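/- **Setting.** A simplicial bifiltration $\mathcal K$ is a finite abstract simplicial complex with subcomplexes $(\mathcal K_s)_{s\in\mathbb N^2}$, $\mathcal K_s\subseteq\mathcal K_t$ for $s\le t$ (componentwise), such that every simplex lies in some $\mathcal K_s$. The support $\mathrm{supp}(\sigma)=\{s:\sigma\in\mathcal K_s\}$ of a simplex is an upset with a unique finite minimal generating set $\mathcal G(\sigma)$, whose elements are the generators of $\sigma$; $\mathcal K$ is $k$-critical if $|\mathcal G(\sigma)|\le k$ for all $\sigma$. For an upset $U\subseteq\mathbb N^2$, the upset module of $U$ is the bipersistence module (functor from $\mathbb N^2$ to $\mathbb Z_2$-vector spaces) that is $\mathbb Z_2$ on $U$ and $0$ elsewhere, with identities as structure maps inside $U$. The chain complex $C_\bullet$ of $\mathcal K$ has $C_i=\bigoplus_{\dim\sigma=i}U_\sigma$, with $U_\sigma$ the upset module of $\mathrm{supp}(\sigma)$, and the simplicial boundary maps. A free resolution of $C_\bullet$ is a chain complex $F_\bullet$ of free modules (direct sums of upset modules generated by a single grade) with a chain map $F_\bullet\to C_\bullet$ inducing isomorphisms on homology. **Data.** A complex is given as the list of its cells, each with its dimension,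 the lexicographically ordered list of the minimal generators of its support, and the list of (positions of) the cells with nonzero coefficient in its boundary. The description size $n$ of $\mathcal K$ is the total number of generators in the list. The size of the output is its number of generators plus its number of nonzero boundary coefficients. Algorithms are programs for a random access machine whose words are natural numbers, with addition, truncated subtraction, comparison and indirect addressing at unit cost. **Log-path complexes.** For a simplex $\sigma$ with $\mathcal G(\sigma)=\{x_0,\dots,x_{m-1}\}$ in lexicographic order, let $L_\sigma$ be the graph on the vertices $0,\dots,m-1$ with an edge from $a$ to $a+2^r$ whenever $2^r\mid a$ and $a+2^r\le m-1$; every edge from $a$ to $a+2^{r+1}$ together with the vertex $a+2^r$ spans a triangle. A log-path complex of $\mathcal K$ has the following basis: for every $i$-simplex $\sigma$, generators $g_\sigma^a$ (the vertices of $L_\sigma$) in degree $i$ at grade $x_a$; relations (the edges) in degree $i+1$; syzygies (the triangles) in degree $i+2$, where edges and triangles have as grade the join of the grades of their smallest and largest vertex. For each $g_\sigma^a$ and each facet $\tau$ of $\sigma$ a generator of $\tau$ of grade $\le x_a$ is chosen. The boundary of $g_\sigma^a$ is the sum of these chosen generators, plus, for each codimension-2 face $\rho$ of $\sigma$, the shortest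 monotone path in $L_\rho$ between the two generators of $\rho$ obtained by applying the choice twice (through the two facets of $\sigma$ that contain $\rho$), plus a sum of syzygies. The boundary of a relation is the sum of its two endpoints, plus, for each facet $\tau$, the shortest monotone path in $L_\tau$ between the generators of $\tau$ chosen for the two endpoints, plus a sum of syzygies. The boundary of a syzygy is the sum of its three edges plus a sum of syzygies. The sums of syzygies are those (uniquely determined) for which the boundary squares to zero. **Theorem.** There is an algorithm (the log-path algorithm) such that for every $d\in\mathbb N$ there is a constant $c=c(d)$ with the following property. Let $k\ge2$ and let $\mathcal K$ be a nonempty $k$-critical simplicial bifiltration of dimension at most $d$ and of description size $n$, with chain complex $C_\bullet$. On the list describing $\mathcal K$, the algorithm halts after at most $c\,n\log_2^2k$ steps, and its output describes a log-path complex of $\mathcal K$ which is a free resolution of $C_\bullet$ and has size (number of generators plus number of nonzero boundary coefficients) at most $c\,n\log_2^2k$. -/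

import Mathlib

open CategoryTheory

universe u

/-! ### Bifiltered chain complexes over the field with two elements -/

/-- A bifiltered chain complex given by cells: each cell has a dimension, a support (an upset of
`ℕ × ℕ`) and a boundary, a finite `ZMod 2`-combination of cells of one dimension less whose
supports contain the support of the cell. -/
structure BifilteredComplex where
  Cell : Type u
  dim : Cell → ℕ
  supp : Cell → Set (ℕ × ℕ)
  isUpperSet_supp : ∀ x, IsUpperSet (supp x)
  boundary : Cell → (Cell →₀ ZMod 2)
  dim_boundary : ∀ x, ∀ y ∈ (boundary x).support, dim y + 1 = dim x
  supp_boundary : ∀ x, ∀ y ∈ (boundary x).support, supp x ⊆ supp y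
  boundary_boundary : ∀ x,
    Finsupp.linearCombination (ZMod 2) boundary (boundary x) = 0

namespace BifilteredComplex

variable (X : BifilteredComplex.{u})

/-- The minimal generating set of the support of a cell. -/
def grades (x : X.Cell) : Set (ℕ × ℕ) := {s | Minimal (· ∈ X.supp x) s}

/-- The chains of dimension `i` at grade `s`: the finite `ZMod 2`-combinations of the `i`-cells
whose support contains `s`. This is the value at `s` of the direct sum, over all `i`-cells, of the
upset modules of their supports. -/
def chains (i : ℕ) (s : ℕ × ℕ) : Submodule (ZMod 2) (X.Cell →₀ ZMod 2) :=
  Finsupp.supported (ZMod 2) (ZMod 2) {x | X.dim x = i ∧ s ∈ X.supp x}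

/-- The boundary operator, extended linearly to all finite combinations of cells. -/
noncomputable def boundaryMap : (X.Cell →₀ ZMod 2) →ₗ[ZMod 2] (X.Cell →₀ ZMod 2) :=
  Finsupp.linearCombination (ZMod 2) X.boundary

theorem boundaryMap_boundaryMap (v : X.Cell →₀ ZMod 2) :
    X.boundaryMap (X.boundaryMap v) = 0 := by
  induction v using Finsupp.induction_linear with
  | zero => simp
  | add f g hf hg => simp [hf, hg]
  | single x a =>
    have h := X.boundary_boundary x
    simp only [boundaryMap, Finsupp.linearCombination_single, map_smul] at h ⊢
    rw [h, smul_zero]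

theorem chains_mono (i : ℕ) {s t : ℕ × ℕ} (h : s ≤ t) : X.chains i s ≤ X.chains i t :=
  Finsupp.supported_mono fun x hx => ⟨hx.1, X.isUpperSet_supp x h hx.2⟩

theorem boundaryMap_mem (i : ℕ) (s : ℕ × ℕ) (v : X.Cell →₀ ZMod 2)
    (hv : v ∈ X.chains (i + 1) s) : X.boundaryMap v ∈ X.chains i s := by
  rw [boundaryMap, Finsupp.linearCombination_apply]
  refine Submodule.sum_mem _ fun x hx => ?_
  refine Submodule.smul_mem _ _ ?_
  have hx' := (Finsupp.mem_supported _ _).1 hv hx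
  refine (Finsupp.mem_supported _ _).2 fun y hy => ⟨?_, X.supp_boundary x y hy hx'.2⟩
  have := X.dim_boundary x y hy
  have := hx'.1
  omega

/-- The bipersistence module of `i`-chains; its structure maps are the inclusions. -/
noncomputable def module (i : ℕ) : (ℕ × ℕ) ⥤ ModuleCat.{u} (ZMod 2) where
  obj s := ModuleCat.of (ZMod 2) (X.chains i s)
  map {_ _} f := ModuleCat.ofHom
    (Submodule.inclusion (X.chains_mono i ⟨leOfHom f.1, leOfHom f.2⟩))
  map_id _ := rfl
  map_comp _ _ := rfl

/-- The boundary map as a morphism of bipersistence modules. -/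
noncomputable def differential (i : ℕ) : X.module (i + 1) ⟶ X.module i where
  app s := ModuleCat.ofHom (X.boundaryMap.restrict (X.boundaryMap_mem i s))
  naturality _ _ _ := rfl

theorem differential_comp (i : ℕ) : X.differential (i + 1) ≫ X.differential i = 0 := by
  ext s v
  exact Subtype.ext (X.boundaryMap_boundaryMap v.1)

/-- The associated chain complex of bipersistence modules. -/
noncomputable def chainComplex : ChainComplex ((ℕ × ℕ) ⥤ ModuleCat.{u} (ZMod 2)) ℕ :=
  ChainComplex.of X.module X.differential X.differential_comp

/-- Every chain module is a direct sum of upset modules generated by a single grade. -/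
def IsFree : Prop := ∀ x, ∃ s, X.supp x = Set.Ici s

end BifilteredComplex

/-- `F` is a free resolution of `C`: a free chain complex admitting a chain map to `C` that
induces isomorphisms on homology. -/
def IsFreeResolution (F C : BifilteredComplex.{u}) : Prop :=
  F.IsFree ∧ ∃ φ : F.chainComplex ⟶ C.chainComplex, QuasiIso φ

/-! ### Simplicial bifiltrations -/

/-- A simplicial bifiltration: an abstract simplicial complex with an increasing family of
subcomplexes indexed by `ℕ × ℕ`, in which every simplex appears at some grade. -/
structure SimplicialBifiltration (V : Type u) where
  complex : PreAbstractSimplicialComplex V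
  level : ℕ × ℕ → PreAbstractSimplicialComplex V
  level_le : ∀ s, level s ≤ complex
  mono : Monotone level
  exhaustive : ∀ σ ∈ complex, ∃ s, σ ∈ level s

namespace SimplicialBifiltration

variable {V : Type u} (B : SimplicialBifiltration V)

/-- The set of grades at which a simplex is present. -/
def supp (σ : Finset V) : Set (ℕ × ℕ) := {s | σ ∈ B.level s}

/-- The minimal generating set of the support of a simplex. -/
def grades (σ : Finset V) : Set (ℕ × ℕ) := {s | Minimal (· ∈ B.supp σ) s}

/-- Every simplex has at most `k` minimal grades. -/
def IsCritical (k : ℕ) : Prop := ∀ σ ∈ B.complex, (B.grades σ).encard ≤ k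

/-- Every simplex has dimension at most `d`. -/
def DimLE (d : ℕ) : Prop := ∀ σ ∈ B.complex, σ.card ≤ d + 1

open Classical in
/-- The basis chain of a simplex; zero if the finite set is not a simplex. -/
noncomputable def basisChain (σ : Finset V) : {σ // σ ∈ B.complex} →₀ ZMod 2 :=
  if h : σ ∈ B.complex then Finsupp.single ⟨σ, h⟩ 1 else 0

open Classical in
/-- The simplicial boundary: the sum of all facets. -/
noncomputable def simplexBoundary (σ : Finset V) : {σ // σ ∈ B.complex} →₀ ZMod 2 :=
  ∑ v ∈ σ, B.basisChain (σ.erase v)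

open Classical in
theorem exists_of_mem_support {σ : Finset V} {y : {σ // σ ∈ B.complex}}
    (hy : y ∈ (B.simplexBoundary σ).support) : ∃ v ∈ σ, y.1 = σ.erase v := by
  obtain ⟨v, hv, hy⟩ := Finset.mem_biUnion.1 (Finsupp.support_finsetSum hy)
  refine ⟨v, hv, ?_⟩
  unfold basisChain at hy
  split_ifs at hy with h
  · have := Finsupp.support_single_subset hy
    rw [Finset.mem_singleton] at this
    rw [this]
  · simp at hy

open Classical in
theorem linearCombination_basisChain {τ : Finset V} (hτ : τ ∈ B.complex ∨ τ = ∅) :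
    Finsupp.linearCombination (ZMod 2) (fun σ : {σ // σ ∈ B.complex} => B.simplexBoundary σ.1)
      (B.basisChain τ) = B.simplexBoundary τ := by
  by_cases h : τ ∈ B.complex
  · simp [basisChain, h, Finsupp.linearCombination_single]
  · have h0 : τ = ∅ := hτ.resolve_left h
    subst h0
    simp [basisChain, h, simplexBoundary]

open Classical in
theorem simplexBoundary_simplexBoundary (σ : Finset V) (hσ : σ ∈ B.complex) :
    Finsupp.linearCombination (ZMod 2) (fun σ : {σ // σ ∈ B.complex} => B.simplexBoundary σ.1)
      (B.simplexBoundary σ) = 0 := by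
  have h1 : ∀ v ∈ σ, σ.erase v ∈ B.complex ∨ σ.erase v = ∅ := fun v _ => by
    rcases (σ.erase v).eq_empty_or_nonempty with h | h
    · exact Or.inr h
    · exact Or.inl ((B.complex.isRelLowerSet_faces hσ).2 (Finset.erase_subset v σ) h)
  rw [simplexBoundary, map_sum, Finset.sum_congr rfl fun v hv =>
    B.linearCombination_basisChain (h1 v hv)]
  simp only [simplexBoundary]
  rw [Finset.sum_sigma']
  refine Finset.sum_involution (fun p _ => ⟨p.2, p.1⟩) ?_ ?_ ?_ ?_
  · intro p _
    rw [Finset.erase_right_comm]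
    ext y
    exact CharTwo.add_self_eq_zero _
  · intro p hp _ he
    simp only [Finset.mem_sigma, Finset.mem_erase] at hp
    exact hp.2.1 (congrArg Sigma.fst he)
  · intro p hp
    simp only [Finset.mem_sigma, Finset.mem_erase] at hp ⊢
    exact ⟨hp.2.2, Ne.symm hp.2.1, hp.1⟩
  · intro p _
    rfl

/-- The bifiltered chain complex of a simplicial bifiltration. -/
noncomputable def toBifilteredComplex : BifilteredComplex.{u} where
  Cell := {σ // σ ∈ B.complex}
  dim σ := σ.1.card - 1
  supp σ := B.supp σ.1
  isUpperSet_supp _ _ _ hst hs := B.mono hst hs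
  boundary σ := B.simplexBoundary σ.1
  dim_boundary σ y hy := by
    classical
    obtain ⟨v, hv, h⟩ := B.exists_of_mem_support hy
    have h1 : 0 < y.1.card := Finset.card_pos.2 (B.complex.isRelLowerSet_faces y.2).1
    have h2 := Finset.card_erase_add_one hv
    rw [h] at h1 ⊢
    omega
  supp_boundary σ y hy s hs := by
    classical
    obtain ⟨v, hv, h⟩ := B.exists_of_mem_support hy
    have h1 : y.1.Nonempty := (B.complex.isRelLowerSet_faces y.2).1
    exact ((B.level s).isRelLowerSet_faces hs).2 (h ▸ Finset.erase_subset v σ.1) h1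
  boundary_boundary σ := B.simplexBoundary_simplexBoundary σ.1 σ.2

end SimplicialBifiltration

/-! ### The data format of inputs and outputs -/

/-- One entry of the list describing a bifiltered chain complex: the dimension of the cell, the
list of the minimal grades of its support, and the positions in the list of the cells that occur in
its boundary. -/
structure CellRecord where
  dim : ℕ
  grades : List (ℕ × ℕ)
  facets : List ℕ

/-- The list `L` describes the bifiltered chain complex `X`. -/
def Represents (L : List CellRecord) (X : BifilteredComplex.{u}) : Prop :=
  ∃ e : Fin L.length ≃ X.Cell, ∀ i : Fin L.length,
    (L.get i).dim = X.dim (e i) ∧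
    (L.get i).grades.Pairwise (fun s t => toLex s < toLex t) ∧
    (∀ s, s ∈ (L.get i).grades ↔ s ∈ X.grades (e i)) ∧
    (L.get i).facets.Nodup ∧
    ∀ j : ℕ, j ∈ (L.get i).facets ↔ ∃ h : j < L.length, X.boundary (e i) (e ⟨j, h⟩) ≠ 0

/-- The total number of generators in the list: the description size of a simplicial input. -/
def generatorCount (L : List CellRecord) : ℕ := (L.map fun r => r.grades.length).sum

/-- The total number of nonzero entries of the boundary matrices. -/
def boundaryCount (L : List CellRecord) : ℕ := (L.map fun r => r.facets.length).sum

/-- The sequence of numbers by which a record is written into memory. -/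
def encodeRecord (r : CellRecord) : List ℕ :=
  r.dim :: r.grades.length :: (r.grades.flatMap (fun s => [s.1, s.2]) ++
    r.facets.length :: r.facets)

/-- The sequence of numbers by which a list of records is written into memory. -/
def encodeList (L : List CellRecord) : List ℕ := L.length :: L.flatMap encodeRecord

/-! ### Random access machine programs

Structured programs for a random access machine at unit cost. The memory consists of variables and
of arrays (a program mentions only finitely many of them), each holding natural numbers. The
arithmetic operations are addition and truncated subtraction; multiplication and division are not
available at unit cost. -/

/-- The contents of the memory. -/
structure Memory where
  var : ℕ → ℕ
  arr : ℕ → ℕ → ℕ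

/-- Arithmetic expressions; `arr a e` reads the array `a` at the address `e`. -/
inductive ArithExpr where
  | const (n : ℕ)
  | var (x : ℕ)
  | arr (a : ℕ) (e : ArithExpr)
  | add (e f : ArithExpr)
  | sub (e f : ArithExpr)

/-- The value of an expression. -/
def ArithExpr.value (m : Memory) : ArithExpr → ℕ
  | const n => n
  | var x => m.var x
  | arr a e => m.arr a (e.value m)
  | add e f => e.value m + f.value m
  | sub e f => e.value m - f.value m

/-- The number of steps needed to evaluate an expression. -/
def ArithExpr.cost : ArithExpr → ℕ
  | const _ => 1
  | var _ => 1
  | arr _ e => e.cost + 1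
  | add e f => e.cost + f.cost + 1
  | sub e f => e.cost + f.cost + 1

/-- Programs; the conditions of `ite` and `while` are comparisons `e < f`. -/
inductive Program where
  | skip
  | assign (x : ℕ) (e : ArithExpr)
  | store (a : ℕ) (e f : ArithExpr)
  | seq (p q : Program)
  | ite (e f : ArithExpr) (p q : Program)
  | while (e f : ArithExpr) (p : Program)

/-- The memory after writing `n` into the variable `x`. -/
def Memory.setVar (m : Memory) (x n : ℕ) : Memory where
  var := Function.update m.var x n
  arr := m.arr

/-- The memory after writing `n` into the array `a` at the address `i`. -/
def Memory.setArr (m : Memory) (a i n : ℕ) : Memory where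
  var := m.var
  arr := Function.update m.arr a (Function.update (m.arr a) i n)

/-- `Runs p m t m'`: started on the memory `m`, the program `p` halts after exactly `t` steps with
the memory `m'`. -/
inductive Runs : Program → Memory → ℕ → Memory → Prop
  | skip (m : Memory) : Runs .skip m 1 m
  | assign (x : ℕ) (e : ArithExpr) (m : Memory) :
      Runs (.assign x e) m (e.cost + 1) (m.setVar x (e.value m))
  | store (a : ℕ) (e f : ArithExpr) (m : Memory) :
      Runs (.store a e f) m (e.cost + f.cost + 1) (m.setArr a (e.value m) (f.value m))
  | seq {p q : Program} {m m' m'' : Memory} {t t' : ℕ} :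
      Runs p m t m' → Runs q m' t' m'' → Runs (.seq p q) m (t + t') m''
  | ite_true {e f : ArithExpr} {p q : Program} {m m' : Memory} {t : ℕ} :
      e.value m < f.value m → Runs p m t m' →
      Runs (.ite e f p q) m (e.cost + f.cost + 1 + t) m'
  | ite_false {e f : ArithExpr} {p q : Program} {m m' : Memory} {t : ℕ} :
      ¬ e.value m < f.value m → Runs q m t m' →
      Runs (.ite e f p q) m (e.cost + f.cost + 1 + t) m'
  | while_true {e f : ArithExpr} {p : Program} {m m' m'' : Memory} {t t' : ℕ} :
      e.value m < f.value m → Runs p m t m' → Runs (.while e f p) m' t' m'' →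
      Runs (.while e f p) m (e.cost + f.cost + 1 + t + t') m''
  | while_false {e f : ArithExpr} {p : Program} {m : Memory} :
      ¬ e.value m < f.value m → Runs (.while e f p) m (e.cost + f.cost + 1) m

/-- The initial memory: the input is in array `0`, its length in variable `0`, and all other
entries are zero. -/
def initialMemory (input : List ℕ) : Memory where
  var x := if x = 0 then input.length else 0
  arr a i := if a = 0 then input.getD i 0 else 0

/-- The program `p` halts on the given input after `t` steps, with the given output in array `1`
and the length of the output in variable `0`. -/
def Computes (p : Program) (input output : List ℕ) (t : ℕ) : Prop :=
  ∃ m, Runs p (initialMemory input) t m ∧ m.var 0 = output.length ∧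
    ∀ (i : ℕ) (h : i < output.length), m.arr 1 i = output[i]

/-! ### The complexes produced by the log-path algorithm

The generators `x_0, …, x_(m-1)` of a simplex are the vertices of the log-path graph; there is an
edge from `a` to `a + 2 ^ r` whenever `2 ^ r` divides `a`, and every edge with `r > 0` is the
longest edge of one triangle, whose third vertex is the midpoint. -/

/-- The edge from `left` to `left + 2 ^ level` of the log-path graph on `m` vertices. -/
structure LogPathEdge (m : ℕ) where
  left : ℕ
  level : ℕ
  dvd : 2 ^ level ∣ left
  lt : left + 2 ^ level < m

/-- The triangle with vertices `left`, `left + 2 ^ level` and `left + 2 ^ (level + 1)`. -/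
structure LogPathTriangle (m : ℕ) where
  left : ℕ
  level : ℕ
  dvd : 2 ^ (level + 1) ∣ left
  lt : left + 2 ^ (level + 1) < m

/-- The smaller endpoint of an edge. -/
def LogPathEdge.src {m : ℕ} (e : LogPathEdge m) : Fin m :=
  ⟨e.left, lt_of_le_of_lt (Nat.le_add_right _ _) e.lt⟩

/-- The larger endpoint of an edge. -/
def LogPathEdge.tgt {m : ℕ} (e : LogPathEdge m) : Fin m := ⟨e.left + 2 ^ e.level, e.lt⟩

/-- The smallest vertex of a triangle. -/
def LogPathTriangle.src {m : ℕ} (t : LogPathTriangle m) : Fin m :=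
  ⟨t.left, lt_of_le_of_lt (Nat.le_add_right _ _) t.lt⟩

/-- The largest vertex of a triangle. -/
def LogPathTriangle.tgt {m : ℕ} (t : LogPathTriangle m) : Fin m :=
  ⟨t.left + 2 ^ (t.level + 1), t.lt⟩

/-- The edge `e` is one of the three edges of the triangle `t`. -/
def LogPathTriangle.HasEdge {m : ℕ} (t : LogPathTriangle m) (e : LogPathEdge m) : Prop :=
  (e.left = t.left ∧ e.level = t.level) ∨
  (e.left = t.left + 2 ^ t.level ∧ e.level = t.level) ∨
  (e.left = t.left ∧ e.level = t.level + 1)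

/-- The shortest monotone path from `a` to `b`, built greedily: take the longest edge from the
current vertex that does not overshoot `b`. An edge is listed as its smaller endpoint and its
level. -/
def shortestPath (a b : ℕ) : List (ℕ × ℕ) :=
  if a < b then
    (a, Nat.findGreatest (fun r => 2 ^ r ∣ a ∧ a + 2 ^ r ≤ b) b) ::
      shortestPath (a + 2 ^ Nat.findGreatest (fun r => 2 ^ r ∣ a ∧ a + 2 ^ r ≤ b) b) b
  else []
termination_by b - a
decreasing_by
  have : 0 < 2 ^ Nat.findGreatest (fun r => 2 ^ r ∣ a ∧ a + 2 ^ r ≤ b) b := by positivity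
  omega

/-- The edge `e` lies on the shortest monotone path connecting the vertices `a` and `b`. -/
def LogPathEdge.OnPath {m : ℕ} (e : LogPathEdge m) (a b : Fin m) : Prop :=
  (e.left, e.level) ∈ shortestPath (min a.1 b.1) (max a.1 b.1)

/-- The basis elements of the output, for an index type `ι` of simplices where the simplex `i` has
`m i` generators: generators, relations and syzygies. -/
inductive LogPathCell {ι : Type} (m : ι → ℕ) where
  | gen (i : ι) (j : Fin (m i))
  | rel (i : ι) (e : LogPathEdge (m i))
  | syz (i : ι) (t : LogPathTriangle (m i))

/-- The number of generators of the cell at position `i`. -/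
def numGrades (L : List CellRecord) (i : Fin L.length) : ℕ := (L.get i).grades.length

/-- The `j`-th generator of the cell at position `i`. -/
def gradeAt (L : List CellRecord) (i : Fin L.length) (j : Fin (numGrades L i)) : ℕ × ℕ :=
  (L.get i).grades.get j

/-- The cell at position `τ` is a facet of the cell at position `σ`. -/
def IsFacet (L : List CellRecord) (τ σ : Fin L.length) : Prop := τ.1 ∈ (L.get σ).facets

/-- `F` is a log-path complex for the input list `L`. For every generator of a simplex `σ` and
every facet `τ` of `σ` a generator `lift σ j τ` of `τ` of smaller or equal grade is chosen. Then
the coefficients of all boundaries at generators and relations are prescribed: the maps `f⁰`, `p¹`,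
`f¹`, `h⁰`, `p²` of the algorithm, in this order below. The remaining coefficients, at the
syzygies, fill the arising cycles by triangles; as `p²` is injective, they are determined by the
requirement that the square of the boundary of `F` is zero. -/
structure LogPathStructure (L : List CellRecord) (F : BifilteredComplex.{u}) where
  cell : LogPathCell (numGrades L) ≃ F.Cell
  lift : ∀ σ : Fin L.length, Fin (numGrades L σ) → ∀ τ : Fin L.length, Fin (numGrades L τ)
  lift_le : ∀ σ j τ, IsFacet L τ σ → gradeAt L τ (lift σ j τ) ≤ gradeAt L σ j
  dim_gen : ∀ σ j, F.dim (cell (.gen σ j)) = (L.get σ).dim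
  dim_rel : ∀ σ e, F.dim (cell (.rel σ e)) = (L.get σ).dim + 1
  dim_syz : ∀ σ t, F.dim (cell (.syz σ t)) = (L.get σ).dim + 2
  supp_gen : ∀ σ j, F.supp (cell (.gen σ j)) = Set.Ici (gradeAt L σ j)
  supp_rel : ∀ σ e, F.supp (cell (.rel σ e)) =
    Set.Ici (gradeAt L σ e.src ⊔ gradeAt L σ e.tgt)
  supp_syz : ∀ σ t, F.supp (cell (.syz σ t)) =
    Set.Ici (gradeAt L σ t.src ⊔ gradeAt L σ t.tgt)
  gen_gen : ∀ σ j τ l, F.boundary (cell (.gen σ j)) (cell (.gen τ l)) ≠ 0 ↔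
    IsFacet L τ σ ∧ l = lift σ j τ
  rel_gen_self : ∀ σ e l, F.boundary (cell (.rel σ e)) (cell (.gen σ l)) ≠ 0 ↔
    l = e.src ∨ l = e.tgt
  rel_gen_of_ne : ∀ σ e τ l, τ ≠ σ → F.boundary (cell (.rel σ e)) (cell (.gen τ l)) = 0
  rel_rel : ∀ σ e τ e', F.boundary (cell (.rel σ e)) (cell (.rel τ e')) ≠ 0 ↔
    IsFacet L τ σ ∧ e'.OnPath (lift σ e.src τ) (lift σ e.tgt τ)
  gen_rel : ∀ σ j ρ e', F.boundary (cell (.gen σ j)) (cell (.rel ρ e')) ≠ 0 ↔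
    ∃ τ τ', τ ≠ τ' ∧ IsFacet L τ σ ∧ IsFacet L τ' σ ∧ IsFacet L ρ τ ∧ IsFacet L ρ τ' ∧
      e'.OnPath (lift τ (lift σ j τ) ρ) (lift τ' (lift σ j τ') ρ)
  syz_gen : ∀ σ t τ l, F.boundary (cell (.syz σ t)) (cell (.gen τ l)) = 0
  syz_rel_self : ∀ σ t e', F.boundary (cell (.syz σ t)) (cell (.rel σ e')) ≠ 0 ↔ t.HasEdge e'
  syz_rel_of_ne : ∀ σ t τ e', τ ≠ σ → F.boundary (cell (.syz σ t)) (cell (.rel τ e')) = 0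

/-! **Resolution of one simplex.** Along the lexicographic order of the generators of a simplex,
first coordinates increase and second coordinates decrease, so the generators present at a grade
form an interval of indices. The log-path graph over an interval consists of the path of unit edges
together with longer dyadic edges, each matched with the one triangle of which it is the longest
edge; hence it is contractible when nonempty. Algebraically this is `p₁_p₂`, `q_p₂` and `p₂_q`: `q`
sends an edge to the sum of all triangles below it, `u` sends a vertex to the unit path from vertex
0, and `p₂ q = 1 + u p₁`.

**Total complex.** The simplicial boundary lifts to generators (`f₀`) and, through paths, to
relations (`f₁`). On generators `f₀ f₀` need not vanish; since a codimension-2 face lies in exactly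
two facets, `f₀ f₀` is the boundary of a sum of paths in those faces (`h₀`). All remaining defects
are `p₁`-cycles, which `q` fills by syzygies, and injectivity of `p₂` then gives a differential
(`FillingData.diff_diff`). Sending a generator to its simplex is a chain map, surjective at every
grade. A cycle `(x, y, z)` in its kernel is the boundary of `(0, u x, q (y + f₁ (u x)))`
(`diff_contraction`), and this chain lives at the same grade (`u_mem`); so the map is a
quasi-isomorphism.

**Size.** Let `2 ^ R` bound the number of generators of each simplex. A geometric series gives at
most `5 n` basis elements. A greedy path first climbs through growing powers of two and then
descends, so it has at most `2 R` edges. Thus a boundary has `O(R)` generators and relations. Its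
syzygy part is `q` of a cycle composed of `O(R)` paths. A single path may lie over linearly many
triangles, but in a cycle one may add to each path from `a` to `b` the paths from 0 to `a` and from
0 to `b`, since these additions cancel. Then `q` yields only the dyadic intervals inside `[0, b]`
with `a` in the interior, at most one of each length (`sum_trianglesAround`). This leaves `O(R ^ 2)`
syzygies per boundary, with constants depending on the dimension only.

**Time.** Linear-time tables provide halves, the largest power of two dividing a number, and the
position of every relation. Lifts are found by binary search, an edge of a greedy path by doubling,
and the syzygies around a path by rounding `a` down to growing powers of two. Syzygies that occur an
even number of times are removed with an array of parities that is cleared after each use. The step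
counts are verified with a precondition calculus (`RAM.wp`) in which everything that a program does
not write is automatically preserved. -/

/-! ### Homological algebra: surjections with acyclic kernel -/

/-- Vector spaces are projective, so pointwise preimages can be chosen linearly. This makes the
refinements in the criteria for mono and epi on homology trivial. -/
theorem LinearMap.exists_comp_eq_of_forall_mem_range {K M N P : Type*} [Field K]
    [AddCommGroup M] [Module K M] [AddCommGroup N] [Module K N] [AddCommGroup P] [Module K P]
    (f : M →ₗ[K] N) (g : P →ₗ[K] N) (h : ∀ p, ∃ m, f m = g p) : ∃ l : P →ₗ[K] M, f ∘ₗ l = g := by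
  obtain ⟨l, hl⟩ := Module.projective_lifting_property f.rangeRestrict
    (g.codRestrict (LinearMap.range f) h) f.surjective_rangeRestrict
  refine ⟨l, LinearMap.ext fun p => ?_⟩
  exact congrArg Subtype.val (LinearMap.congr_fun hl p)

/-- The long exact sequence of the kernel of a surjective chain map, carried out on elements: `he`
says that the kernel complex is acyclic. -/
theorem ChainComplex.quasiIso_of_surjective_of_exact {K : Type*} [Field K]
    {A B : ChainComplex (ModuleCat.{u} K) ℕ} (φ : A ⟶ B)
    (hs : ∀ i (z : B.X i), ∃ x : A.X i, (φ.f i).hom x = z)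
    (he : ∀ i (x : A.X i), (φ.f i).hom x = 0 → (∀ j, (A.d i j).hom x = 0) →
      ∃ y : A.X (i + 1), (φ.f (i + 1)).hom y = 0 ∧ (A.d (i + 1) i).hom y = x) :
    QuasiIso φ := by
  have hc : ∀ i j (x : A.X i), (φ.f j).hom ((A.d i j).hom x) = (B.d i j).hom ((φ.f i).hom x) :=
    fun i j x => (congrArg (fun f => f.hom x) (φ.comm i j)).symm
  have hdd : ∀ i j k (x : A.X i), (A.d j k).hom ((A.d i j).hom x) = 0 :=
    fun i j k x => congrArg (fun f => f.hom x) (A.d_comp_d i j k)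
  -- Being a cycle concerns only the differential to `next i`; all others vanish by the shape of the
  -- complex.
  have hd : ∀ i j k (hk : (ComplexShape.down ℕ).next i = k) (x : A.X i),
      (A.d i k).hom x = 0 → (A.d i j).hom x = 0 := by
    intro i j k hk x hx
    by_cases h : (ComplexShape.down ℕ).Rel i j
    · rw [(ComplexShape.down ℕ).next_eq' h] at hk
      exact hk ▸ hx
    · rw [A.shape _ _ h]; rfl
  refine (quasiIso_iff φ).2 fun i => (quasiIsoAt_iff_isIso_homologyMap φ i).2 ?_
  have hprev : (ComplexShape.down ℕ).prev i = i + 1 := ChainComplex.prev ℕ i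
  have hmono : Mono (HomologicalComplex.homologyMap φ i) := by
    rw [HomologicalComplex.mono_homologyMap_iff_up_to_refinements φ (i + 1) i _ hprev rfl]
    intro P x hx y hy
    -- Injectivity on homology: if `φ x = d y` and `w` lifts `y`, then `x - d w` is a cycle in the
    -- kernel, hence a boundary `d v`, and `x = d (v + w)`.
    obtain ⟨l, hl⟩ := LinearMap.exists_comp_eq_of_forall_mem_range (A.d (i + 1) i).hom x.hom
      (fun p => by
        obtain ⟨w, hw⟩ := hs (i + 1) (y.hom p)
        have hx' : (A.d i ((ComplexShape.down ℕ).next i)).hom (x.hom p) = 0 := by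
          simpa using congrArg (fun f => f.hom p) hx
        have hy' : (φ.f i).hom (x.hom p) = (B.d (i + 1) i).hom (y.hom p) := by
          simpa using congrArg (fun f => f.hom p) hy
        obtain ⟨v, -, hv⟩ := he i (x.hom p - (A.d (i + 1) i).hom w)
          (by rw [map_sub, hc, hw, hy', sub_self])
          (fun j => by rw [map_sub, hdd, hd i j _ rfl _ hx', sub_zero])
        exact ⟨v + w, by rw [map_add, hv]; abel⟩)
    exact ⟨P, 𝟙 P, inferInstance, ModuleCat.ofHom l, by
      ext p; simpa using (LinearMap.congr_fun hl p).symm⟩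
  have hepi : Epi (HomologicalComplex.homologyMap φ i) := by
    rw [HomologicalComplex.epi_homologyMap_iff_up_to_refinements φ (i + 1) i _ hprev rfl]
    intro P y hy
    -- Surjectivity on homology: a cycle in `B` is lifted to an arbitrary `x`, which is then
    -- corrected by an element of the kernel so that it becomes a cycle.
    obtain ⟨l, hl⟩ := LinearMap.exists_comp_eq_of_forall_mem_range
      ((φ.f i).hom ∘ₗ (LinearMap.ker (A.d i ((ComplexShape.down ℕ).next i)).hom).subtype) y.hom
      (fun p => by
        obtain ⟨x, hx⟩ := hs i (y.hom p)
        have hy' : ∀ k, k = (ComplexShape.down ℕ).next i → (B.d i k).hom (y.hom p) = 0 := by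
          rintro k rfl
          simpa using congrArg (fun f => f.hom p) hy
        -- In degree 0 every `x` is a cycle. In positive degree `d x` is a cycle in the kernel, so
        -- it equals `d w` with `w` in the kernel, and `x - w` is the corrected lift.
        rcases i with - | i
        · refine ⟨⟨x, ?_⟩, hx⟩
          rw [LinearMap.mem_ker, A.shape _ _ (by simp)]; rfl
        · have hn : (ComplexShape.down ℕ).next (i + 1) = i := ChainComplex.next_nat_succ i
          obtain ⟨w, hw0, hw⟩ := he i ((A.d (i + 1) i).hom x)
            (by rw [hc, hx, hy' i hn.symm]) (fun j => hdd _ _ _ _)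
          refine ⟨⟨x - w, ?_⟩, ?_⟩
          · rw [LinearMap.mem_ker, hn, map_sub, hw, sub_self]
          · simp [hw0, hx])
    refine ⟨P, 𝟙 P, inferInstance, ModuleCat.ofHom (Submodule.subtype _ ∘ₗ l), ?_, 0, ?_⟩
    · ext p
      exact (l p).2
    · ext p
      simpa using (LinearMap.congr_fun hl p).symm
  exact isIso_of_mono_of_epi _

/-! ### Chain maps and quasi-isomorphisms of bifiltered complexes -/

namespace BifilteredComplex

variable {F C : BifilteredComplex.{u}}

/-- A boundary cell of a 0-cell would have dimension -1. This supplies the cycle condition in degree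
0, where the chain complex has no outgoing differential to test. -/
theorem boundaryMap_eq_zero (F : BifilteredComplex.{u}) (s : ℕ × ℕ) (x : F.Cell →₀ ZMod 2)
    (hx : x ∈ F.chains 0 s) : F.boundaryMap x = 0 := by
  rw [boundaryMap, Finsupp.linearCombination_apply]
  refine Finset.sum_eq_zero fun c hc => ?_
  have hdim := ((Finsupp.mem_supported _ _).1 hx hc).1
  have : F.boundary c = 0 := by
    ext y
    by_contra hy
    have := F.dim_boundary c y (Finsupp.mem_support_iff.2 hy)
    omega
  simp [this]

/-- A chain map given by a linear map that respects dimensions, grades and boundaries. -/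
noncomputable def homOfLinearMap (ψ : (F.Cell →₀ ZMod 2) →ₗ[ZMod 2] (C.Cell →₀ ZMod 2))
    (hψ : ∀ i s, ∀ x ∈ F.chains i s, ψ x ∈ C.chains i s)
    (hc : ∀ x, ψ (F.boundaryMap x) = C.boundaryMap (ψ x)) : F.chainComplex ⟶ C.chainComplex :=
  ChainComplex.ofHom
    (fun i => { app := fun s => ModuleCat.ofHom (ψ.restrict (hψ i s)), naturality := fun _ _ _ => rfl })
    (fun i => by
      ext s x
      simp only [chainComplex, ChainComplex.of_d]
      exact Subtype.ext (hc x.1).symm)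

/-- Homology of functors is computed pointwise, so the criterion for vector spaces can be applied at
each grade. -/
theorem quasiIso_homOfLinearMap (ψ : (F.Cell →₀ ZMod 2) →ₗ[ZMod 2] (C.Cell →₀ ZMod 2))
    (hψ : ∀ i s, ∀ x ∈ F.chains i s, ψ x ∈ C.chains i s)
    (hc : ∀ x, ψ (F.boundaryMap x) = C.boundaryMap (ψ x))
    (hs : ∀ i s, ∀ z ∈ C.chains i s, ∃ x ∈ F.chains i s, ψ x = z)
    (he : ∀ i s, ∀ x ∈ F.chains i s, ψ x = 0 → F.boundaryMap x = 0 →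
      ∃ y ∈ F.chains (i + 1) s, ψ y = 0 ∧ F.boundaryMap y = x) :
    QuasiIso (homOfLinearMap ψ hψ hc) := by
  rw [HomologicalComplex.quasiIso_iff_evaluation]
  intro s
  have hd : ∀ i, F.chainComplex.d (i + 1) i = F.differential i := fun i => by
    simp [chainComplex, ChainComplex.of_d]
  apply ChainComplex.quasiIso_of_surjective_of_exact
  · intro i z
    obtain ⟨x, hx, h⟩ := hs i s z.1 z.2
    exact ⟨⟨x, hx⟩, Subtype.ext h⟩
  · intro i x h0 hx
    have h0' : ψ x.1 = 0 := congrArg Subtype.val h0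
    have hx' : F.boundaryMap x.1 = 0 := by
      rcases i with - | i
      · exact F.boundaryMap_eq_zero s x.1 x.2
      · have h1 := hx i
        change ((F.chainComplex.d (i + 1) i).app s).hom x = 0 at h1
        rw [hd] at h1
        exact congrArg Subtype.val h1
    obtain ⟨y, hy, hy0, hyx⟩ := he i s x.1 x.2 h0' hx'
    refine ⟨⟨y, hy⟩, Subtype.ext hy0, ?_⟩
    change ((F.chainComplex.d (i + 1) i).app s).hom _ = x
    rw [hd]
    exact Subtype.ext hyx

end BifilteredComplex

/-! ### The total differential assembled from contractible pieces -/

namespace LogPath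

section Abstract

/-- The data from which the differential of a log-path complex is built: `p₁`, `p₂` are the
differentials of the contractible pieces, `f₀`, `f₁`, `h₀` lift the given differential, `q` fills
cycles by triangles and `u` is the first part of a contraction. -/
structure FillingData (A₀ A₁ A₂ : Type*) [AddCommGroup A₀] [AddCommGroup A₁] [AddCommGroup A₂]
    [Module (ZMod 2) A₀] [Module (ZMod 2) A₁] [Module (ZMod 2) A₂] where
  p₁ : A₁ →ₗ[ZMod 2] A₀
  p₂ : A₂ →ₗ[ZMod 2] A₁
  q : A₁ →ₗ[ZMod 2] A₂
  u : A₀ →ₗ[ZMod 2] A₁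
  f₀ : A₀ →ₗ[ZMod 2] A₀
  f₁ : A₁ →ₗ[ZMod 2] A₁
  h₀ : A₀ →ₗ[ZMod 2] A₁
  p₁_p₂ : ∀ x, p₁ (p₂ x) = 0
  q_p₂ : ∀ x, q (p₂ x) = x
  p₂_q : ∀ x, p₂ (q x) = x + u (p₁ x)
  p₁_f₁ : ∀ x, p₁ (f₁ x) = f₀ (p₁ x)
  p₁_h₀ : ∀ x, p₁ (h₀ x) = f₀ (f₀ x)

namespace FillingData

variable {A₀ A₁ A₂ : Type*} [AddCommGroup A₀] [AddCommGroup A₁] [AddCommGroup A₂]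
    [Module (ZMod 2) A₀] [Module (ZMod 2) A₁] [Module (ZMod 2) A₂] (X : FillingData A₀ A₁ A₂)

/-- The three components with values in the syzygies fill the `A₁`-part of the defect of `d ^ 2 = 0`
on generators, relations and syzygies respectively. As `p₂` is injective there is no other choice.
-/
def g₂ : A₀ →ₗ[ZMod 2] A₂ := X.q ∘ₗ (X.f₁ ∘ₗ X.h₀ + X.h₀ ∘ₗ X.f₀)

def h₁ : A₁ →ₗ[ZMod 2] A₂ := X.q ∘ₗ (X.f₁ ∘ₗ X.f₁ + X.h₀ ∘ₗ X.p₁)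

def f₂ : A₂ →ₗ[ZMod 2] A₂ := X.q ∘ₗ X.f₁ ∘ₗ X.p₂

theorem add_eq_zero_of_eq {A : Type*} [AddCommGroup A] [Module (ZMod 2) A] {x y : A} (h : x = y) :
    x + y = 0 := by rw [h, ZModModule.add_self]

theorem eq_of_add_eq_zero {A : Type*} [AddCommGroup A] [Module (ZMod 2) A] {x y : A}
    (h : x + y = 0) : x = y := by
  rwa [← ZModModule.sub_eq_add, sub_eq_zero] at h

theorem two_zsmul_eq_zero {A : Type*} [AddCommGroup A] [Module (ZMod 2) A] (x : A) :
    (2 : ℤ) • x = 0 := by rw [two_zsmul, ZModModule.add_self]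

/-- On `p₁`-cycles `p₂ q` is the identity, and the defect is a cycle because `f₁` and `h₀` lift `f₀`
and `f₀ f₀`. The next two lemmas have the same reason. -/
theorem p₂_g₂ (x : A₀) : X.p₂ (X.g₂ x) = X.f₁ (X.h₀ x) + X.h₀ (X.f₀ x) := by
  have : X.p₁ (X.f₁ (X.h₀ x) + X.h₀ (X.f₀ x)) = 0 := by
    rw [map_add, X.p₁_f₁, X.p₁_h₀, X.p₁_h₀, ZModModule.add_self]
  simp [g₂, X.p₂_q, -map_add, this]

theorem p₂_h₁ (x : A₁) : X.p₂ (X.h₁ x) = X.f₁ (X.f₁ x) + X.h₀ (X.p₁ x) := by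
  have : X.p₁ (X.f₁ (X.f₁ x) + X.h₀ (X.p₁ x)) = 0 := by
    rw [map_add, X.p₁_f₁, X.p₁_f₁, X.p₁_h₀, ZModModule.add_self]
  simp [h₁, X.p₂_q, -map_add, this]

theorem p₂_f₂ (x : A₂) : X.p₂ (X.f₂ x) = X.f₁ (X.p₂ x) := by
  have : X.p₁ (X.f₁ (X.p₂ x)) = 0 := by
    rw [X.p₁_f₁, X.p₁_p₂, map_zero]
  simp [f₂, X.p₂_q, this]

theorem p₂_injective : Function.Injective X.p₂ :=
  Function.LeftInverse.injective X.q_p₂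

/-- The differential. -/
def diff : A₀ × A₁ × A₂ →ₗ[ZMod 2] A₀ × A₁ × A₂ where
  toFun x := (X.f₀ x.1 + X.p₁ x.2.1, X.h₀ x.1 + X.f₁ x.2.1 + X.p₂ x.2.2,
    X.g₂ x.1 + X.h₁ x.2.1 + X.f₂ x.2.2)
  map_add' x y := by
    refine Prod.ext ?_ (Prod.ext ?_ ?_) <;> simp <;> abel
  map_smul' c x := by
    refine Prod.ext ?_ (Prod.ext ?_ ?_) <;> simp

theorem diff_apply (x : A₀ × A₁ × A₂) : X.diff x =
    (X.f₀ x.1 + X.p₁ x.2.1, X.h₀ x.1 + X.f₁ x.2.1 + X.p₂ x.2.2,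
      X.g₂ x.1 + X.h₁ x.2.1 + X.f₂ x.2.2) := rfl

/-- The first two components vanish by the choice of the fillings. The third one is tested after
applying the injective map `p₂`, which turns it into a consequence of the same identities. -/
theorem diff_diff (x : A₀ × A₁ × A₂) : X.diff (X.diff x) = 0 := by
  obtain ⟨x, y, z⟩ := x
  simp only [diff_apply, map_add, Prod.mk_eq_zero]
  refine ⟨?_, ?_, X.p₂_injective ?_⟩
  · rw [X.p₁_p₂, X.p₁_h₀, X.p₁_f₁, add_zero]
    exact add_eq_zero_of_eq rfl
  · rw [p₂_g₂, p₂_h₁, p₂_f₂]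
    abel_nf
    simp [two_zsmul_eq_zero]
  · simp only [map_add, map_zero, p₂_g₂, p₂_h₁, p₂_f₂, X.p₁_f₁, X.p₁_h₀, X.p₁_p₂]
    abel_nf
    simp [two_zsmul_eq_zero]

/-- Generators are first bounded by relations through `u`; the error in the relations is then a
`p₁`-cycle and is bounded by syzygies through `q`. Nothing is left to correct in the syzygies, by
injectivity of `p₂`. -/
theorem diff_contraction {x : A₀ × A₁ × A₂} (hx : X.diff x = 0) (h : X.p₁ (X.u x.1) = x.1) :
    X.diff (0, X.u x.1, X.q (x.2.1 + X.f₁ (X.u x.1))) = x := by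
  obtain ⟨x, y, z⟩ := x
  simp only [diff_apply, Prod.mk_eq_zero] at hx
  obtain ⟨h0, h1, h2⟩ := hx
  simp only at h
  -- The first component of the cycle condition reads `p₁ y = f₀ x`, and `f₀ x = p₁ (f₁ (u x))`.
  have e1 : X.p₁ (y + X.f₁ (X.u x)) = 0 := by
    rw [map_add, X.p₁_f₁, h, add_comm, h0]
  have e2 : X.p₂ (X.q (y + X.f₁ (X.u x))) = y + X.f₁ (X.u x) := by rw [X.p₂_q, e1]; simp
  refine Prod.ext (by simp [diff_apply, h]) (Prod.ext ?_ ?_)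
  · simp only [diff_apply, map_zero, zero_add, e2]
    rw [add_comm y, ← add_assoc, ZModModule.add_self, zero_add]
  · simp only [diff_apply, map_zero, zero_add]
    -- After `p₂`, the left side becomes `h₀ x + f₁ y` because `f₁ (f₁ (u x))` occurs twice; this is
    -- `p₂ z` by the second component of the cycle condition.
    apply X.p₂_injective
    rw [map_add, p₂_h₁, p₂_f₂, e2, h, map_add]
    apply eq_of_add_eq_zero
    rw [← h1]
    abel_nf
    simp [two_zsmul_eq_zero]

end FillingData

end Abstract

end LogPath

namespace LogPath

/-! ### Dyadic intervals and shortest paths -/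

/-- The arithmetic reason why two dyadic intervals are either nested or have disjoint interiors. -/
theorem not_dvd_of_lt_of_lt {p b c : ℕ} (hb : p ∣ b) (h1 : b < c) (h2 : c < b + p) : ¬ p ∣ c := by
  rintro ⟨y, rfl⟩
  obtain ⟨x, rfl⟩ := hb
  have h3 : x < y := Nat.lt_of_mul_lt_mul_left h1
  have h4 : y < x + 1 := Nat.lt_of_mul_lt_mul_left (a := p) (by rw [mul_add]; omega)
  omega

/-- The length exponent of the first edge of the shortest path. -/
def firstLevel (a b : ℕ) : ℕ := Nat.findGreatest (fun r => 2 ^ r ∣ a ∧ a + 2 ^ r ≤ b) b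

theorem shortestPath_of_lt {a b : ℕ} (h : a < b) :
    shortestPath a b = (a, firstLevel a b) :: shortestPath (a + 2 ^ firstLevel a b) b := by
  rw [shortestPath, if_pos h, firstLevel]

theorem shortestPath_of_le {a b : ℕ} (h : b ≤ a) : shortestPath a b = [] := by
  rw [shortestPath, if_neg (not_lt.2 h)]

theorem firstLevel_spec {a b : ℕ} (h : a < b) :
    2 ^ firstLevel a b ∣ a ∧ a + 2 ^ firstLevel a b ≤ b :=
  Nat.findGreatest_spec (P := fun r => 2 ^ r ∣ a ∧ a + 2 ^ r ≤ b) (Nat.zero_le b) ⟨by simp, by simpa⟩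

theorem le_firstLevel {a b r : ℕ} (h1 : 2 ^ r ∣ a) (h2 : a + 2 ^ r ≤ b) : r ≤ firstLevel a b :=
  -- The bound `b` on the search for the exponent excludes nothing, as `r < 2 ^ r ≤ b`.
  Nat.le_findGreatest (by have := Nat.lt_two_pow_self (n := r); omega) ⟨h1, h2⟩

/-- Both conditions on the exponent pass to smaller exponents, so failure at `r + 1` excludes all
larger ones. -/
theorem firstLevel_eq {a b r : ℕ} (h1 : 2 ^ r ∣ a) (h2 : a + 2 ^ r ≤ b)
    (h3 : ¬ (2 ^ (r + 1) ∣ a ∧ a + 2 ^ (r + 1) ≤ b)) : firstLevel a b = r := by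
  refine le_antisymm ?_ (le_firstLevel h1 h2)
  by_contra h
  push Not at h
  have := firstLevel_spec (a := a) (b := b) (by have : 0 < 2 ^ r := by positivity
                                                omega)
  refine h3 ⟨(pow_dvd_pow 2 h).trans this.1, ?_⟩
  have : 2 ^ (r + 1) ≤ 2 ^ firstLevel a b := Nat.pow_le_pow_right (by norm_num) h
  omega

/-- Induction along shortest paths. -/
theorem shortestPath_induction {b : ℕ} {motive : ℕ → Prop}
    (base : ∀ a, b ≤ a → motive a)
    (step : ∀ a, a < b → motive (a + 2 ^ firstLevel a b) → motive a) (a : ℕ) : motive a := by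
  induction h : b - a using Nat.strong_induction_on generalizing a with
  | _ n ih =>
    by_cases hab : a < b
    · have : 0 < 2 ^ firstLevel a b := by positivity
      exact step a hab (ih _ (by omega) _ rfl)
    · exact base a (by omega)

theorem mem_shortestPath {a b : ℕ} {e : ℕ × ℕ} (h : e ∈ shortestPath a b) :
    2 ^ e.2 ∣ e.1 ∧ a ≤ e.1 ∧ e.1 + 2 ^ e.2 ≤ b := by
  induction a using shortestPath_induction (b := b) with
  | base a hab => simp [shortestPath_of_le hab] at h
  | step a hab ih =>
    rw [shortestPath_of_lt hab, List.mem_cons] at h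
    have hs := firstLevel_spec hab
    rcases h with rfl | h
    · exact ⟨hs.1, le_rfl, hs.2⟩
    · obtain ⟨h1, h2, h3⟩ := ih h
      exact ⟨h1, by omega, h3⟩

theorem nodup_shortestPath (a b : ℕ) : (shortestPath a b).Nodup := by
  induction a using shortestPath_induction (b := b) with
  | base a hab => simp [shortestPath_of_le hab]
  | step a hab ih =>
    rw [shortestPath_of_lt hab, List.nodup_cons]
    refine ⟨fun h => ?_, ih⟩
    have := (mem_shortestPath h).2.1
    have : 0 < 2 ^ firstLevel a b := by positivity
    simp only at *
    omega

/-- The descending phase: the path reads off the binary digits of `b - a`, from the highest possible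
one downwards, with at most one edge for each digit. -/
theorem length_shortestPath_of_sub_lt {j a b : ℕ} (hj : 2 ^ j ∣ a) (h : b < a + 2 ^ j) :
    (shortestPath a b).length ≤ j := by
  induction j generalizing a with
  | zero => simp [shortestPath_of_le (show b ≤ a by simpa [Nat.lt_succ_iff] using h)]
  | succ j ih =>
    have hj' : 2 ^ j ∣ a := (pow_dvd_pow 2 j.le_succ).trans hj
    by_cases h1 : a + 2 ^ j ≤ b
    · have h2 : 0 < 2 ^ j := by positivity
      rw [shortestPath_of_lt (by omega), firstLevel_eq hj' h1 (fun h' => by omega),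
        List.length_cons]
      have := ih (a := a + 2 ^ j) (hj'.add dvd_rfl) (by rw [pow_succ] at h; omega)
      omega
    · exact (ih hj' (by omega)).trans j.le_succ

/-- The ascending phase: as long as overshooting is not the obstacle, an edge has the length of the
full power of two in `a`, so its end is divisible by a higher power. Here `k` bounds the number of
such edges still possible, and `R` pays for the descending phase. -/
theorem length_shortestPath_of_dvd {R a b : ℕ} (hb : b < 2 ^ R) :
    ∀ k ≤ R, 2 ^ (R - k) ∣ a → (shortestPath a b).length ≤ k + R := by
  intro k hk h
  induction k using Nat.strong_induction_on generalizing a with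
  | _ k ih =>
    by_cases hab : a < b
    · obtain ⟨h1, h2⟩ := firstLevel_spec hab
      -- If a longer edge is blocked only by overshooting, the descent has begun. Otherwise the
      -- first edge raises the divisibility by at least one power of two, and the induction
      -- continues with a smaller `k`.
      by_cases h3 : 2 ^ (firstLevel a b + 1) ∣ a
      · have h4 : ¬ a + 2 ^ (firstLevel a b + 1) ≤ b := fun h5 => by
          have := le_firstLevel h3 h5
          omega
        have := length_shortestPath_of_sub_lt h3 (not_le.1 h4)
        have h5 : firstLevel a b < R := by
          rw [← Nat.pow_lt_pow_iff_right (a := 2) (by norm_num)]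
          omega
        omega
      · have h4 : R - k ≤ firstLevel a b := by
          by_contra h5
          push Not at h5
          exact h3 ((pow_dvd_pow 2 h5).trans h)
        have h5 : firstLevel a b < R := by
          rw [← Nat.pow_lt_pow_iff_right (a := 2) (by norm_num)]
          omega
        have h6 : 2 ^ (firstLevel a b + 1) ∣ a + 2 ^ firstLevel a b := by
          obtain ⟨x, hx⟩ := h1
          generalize firstLevel a b = r at *
          rw [hx, pow_succ] at h3 ⊢
          have hodd : ¬ 2 ∣ x := fun hd => h3 (Nat.mul_dvd_mul_left _ hd)
          have : 2 ^ r * x + 2 ^ r = 2 ^ r * (x + 1) := by ring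
          rw [this]
          exact Nat.mul_dvd_mul_left _ (by omega)
        rw [shortestPath_of_lt hab, List.length_cons]
        have := ih (R - (firstLevel a b + 1)) (by omega) (a := a + 2 ^ firstLevel a b) (by omega)
          (by rwa [Nat.sub_sub_self h5])
        omega
    · simp [shortestPath_of_le (not_lt.1 hab)]

theorem length_shortestPath {R a b : ℕ} (hb : b < 2 ^ R) : (shortestPath a b).length ≤ 2 * R := by
  have := length_shortestPath_of_dvd hb R le_rfl (a := a) (by simp)
  omega

/-! ### The complexes of log-path graphs -/

open Finsupp

/-- Raw generators `(i, a)`, where `i` is the position of a simplex. -/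
abbrev GenChain := ℕ × ℕ →₀ ZMod 2

/-- Raw edges (or triangles) `(i, a, r)`. -/
abbrev EdgeChain := ℕ × ℕ × ℕ →₀ ZMod 2

/-- The boundary of edges. -/
noncomputable def p₁ : EdgeChain →ₗ[ZMod 2] GenChain :=
  linearCombination (ZMod 2) fun e => single (e.1, e.2.1) 1 + single (e.1, e.2.1 + 2 ^ e.2.2) 1

/-- The boundary of triangles. -/
noncomputable def p₂ : EdgeChain →ₗ[ZMod 2] EdgeChain :=
  linearCombination (ZMod 2) fun t => single (t.1, t.2.1, t.2.2 + 1) 1 +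
    single (t.1, t.2.1, t.2.2) 1 + single (t.1, t.2.1 + 2 ^ t.2.2, t.2.2) 1

/-- The sum of all triangles that lie below an edge. -/
noncomputable def trianglesBelow (i : ℕ) : ℕ → ℕ → EdgeChain
  | _, 0 => 0
  | a, r + 1 => single (i, a, r) 1 + trianglesBelow i a r + trianglesBelow i (a + 2 ^ r) r

/-- The filling operator. -/
noncomputable def q : EdgeChain →ₗ[ZMod 2] EdgeChain :=
  linearCombination (ZMod 2) fun e => trianglesBelow e.1 e.2.1 e.2.2

/-- The path of unit edges from `0` to `a`. -/
noncomputable def u : GenChain →ₗ[ZMod 2] EdgeChain :=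
  linearCombination (ZMod 2) fun v => ∑ b ∈ Finset.range v.2, single (v.1, b, 0) 1

/-- All generators of a simplex are sent to the first one. -/
noncomputable def collapse : GenChain →ₗ[ZMod 2] GenChain :=
  linearCombination (ZMod 2) fun v => single (v.1, 0) 1

theorem p₁_single (i a r : ℕ) :
    p₁ (single (i, a, r) 1) = single (i, a) 1 + single (i, a + 2 ^ r) 1 := by simp [p₁]

theorem p₂_single (i a r : ℕ) :
    p₂ (single (i, a, r) 1) =
      single (i, a, r + 1) 1 + single (i, a, r) 1 + single (i, a + 2 ^ r, r) 1 := by simp [p₂]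

theorem q_single (i a r : ℕ) : q (single (i, a, r) 1) = trianglesBelow i a r := by simp [q]

theorem u_single (i a : ℕ) :
    u (single (i, a) 1) = ∑ b ∈ Finset.range a, single (i, b, 0) 1 := by simp [u]

/-- Two linear maps that agree on the basis are equal. -/
theorem apply_eq_of_single {α M : Type*} [AddCommGroup M] [Module (ZMod 2) M]
    {f g : (α →₀ ZMod 2) →ₗ[ZMod 2] M} (h : ∀ x, f (single x 1) = g (single x 1))
    (v : α →₀ ZMod 2) : f v = g v := by
  have : f = g := by
    ext x
    simpa using h x
  rw [this]

/-- This and the following identities hold for arbitrary natural indices, without divisibility or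
range conditions. Those conditions are treated separately, as conditions on supports. -/
theorem p₁_p₂ (x : EdgeChain) : p₁ (p₂ x) = 0 := by
  refine apply_eq_of_single (f := p₁ ∘ₗ p₂) (g := 0) (fun t => ?_) x
  obtain ⟨i, a, r⟩ := t
  have : a + 2 ^ r + 2 ^ r = a + 2 ^ (r + 1) := by rw [pow_succ]; ring
  simp only [LinearMap.comp_apply, p₂_single, map_add, p₁_single, this, LinearMap.zero_apply]
  abel_nf
  simp [CharTwo.two_eq_zero]

/-- The triangles below the longest edge are the triangle itself and those below the two short
edges, and the latter cancel. -/
theorem q_p₂ (x : EdgeChain) : q (p₂ x) = x := by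
  refine apply_eq_of_single (f := q ∘ₗ p₂) (g := LinearMap.id) (fun t => ?_) x
  obtain ⟨i, a, r⟩ := t
  simp only [LinearMap.comp_apply, p₂_single, map_add, q_single, LinearMap.id_apply, trianglesBelow]
  abel_nf
  simp [FillingData.two_zsmul_eq_zero]

/-- The triangles below an edge fill the cycle formed by the edge and its subdivision into unit
edges; the subdivision is the difference of the unit paths from 0 to its two ends. -/
theorem p₂_q (x : EdgeChain) : p₂ (q x) = x + u (p₁ x) := by
  refine apply_eq_of_single (f := p₂ ∘ₗ q) (g := LinearMap.id + u ∘ₗ p₁) (fun t => ?_) x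
  obtain ⟨i, a, r⟩ := t
  simp only [LinearMap.comp_apply, q_single, LinearMap.add_apply, LinearMap.id_apply, p₁_single,
    map_add, u_single]
  induction r generalizing a with
  | zero =>
    rw [pow_zero, Finset.sum_range_succ, trianglesBelow, map_zero]
    abel_nf
    simp [FillingData.two_zsmul_eq_zero, CharTwo.two_eq_zero]
  | succ r ih =>
    have : a + 2 ^ r + 2 ^ r = a + 2 ^ (r + 1) := by rw [pow_succ]; ring
    rw [trianglesBelow, map_add, map_add, ih, ih, p₂_single, this]
    abel_nf
    simp [FillingData.two_zsmul_eq_zero, CharTwo.two_eq_zero]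

theorem p₁_u (x : GenChain) : p₁ (u x) = x + collapse x := by
  refine apply_eq_of_single (f := p₁ ∘ₗ u) (g := LinearMap.id + collapse) (fun t => ?_) x
  obtain ⟨i, a⟩ := t
  simp only [LinearMap.comp_apply, u_single, LinearMap.add_apply, LinearMap.id_apply, collapse,
    linearCombination_single, one_smul]
  induction a with
  | zero => simp [ZModModule.add_self]
  | succ a ih =>
    rw [Finset.sum_range_succ, map_add, ih, p₁_single, pow_zero]
    abel_nf
    simp [CharTwo.two_eq_zero]

/-- The sum of the edges of the shortest path. -/
noncomputable def pathChain (x : ℕ × ℕ × ℕ) : EdgeChain :=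
  ((shortestPath (min x.2.1 x.2.2) (max x.2.1 x.2.2)).map fun e => single (x.1, e) 1).sum

theorem p₁_shortestPath (i : ℕ) {a b : ℕ} (h : a ≤ b) :
    p₁ ((shortestPath a b).map fun e => single (i, e) 1).sum =
      single (i, a) 1 + single (i, b) 1 := by
  induction a using shortestPath_induction (b := b) with
  | base a hab =>
    obtain rfl := le_antisymm h hab
    simp [shortestPath_of_le, ZModModule.add_self]
  | step a hab ih =>
    rw [shortestPath_of_lt hab, List.map_cons, List.sum_cons, map_add, p₁_single,
      ih (firstLevel_spec hab).2]
    abel_nf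
    simp [CharTwo.two_eq_zero]

theorem p₁_pathChain (i a b : ℕ) :
    p₁ (pathChain (i, a, b)) = single (i, a) 1 + single (i, b) 1 := by
  rw [pathChain, p₁_shortestPath i (min_le_max)]
  rcases le_total a b with h | h <;> simp [h, add_comm]

/-- The triangle `t` is dyadic and lies over the interval from `a` to `b`. -/
def Below (a b : ℕ) (t : ℕ × ℕ) : Prop := 2 ^ (t.2 + 1) ∣ t.1 ∧ a ≤ t.1 ∧ t.1 + 2 ^ (t.2 + 1) ≤ b

theorem below_iff {a b c s : ℕ} :
    Below a b (c, s) ↔ 2 ^ (s + 1) ∣ c ∧ a ≤ c ∧ c + 2 ^ (s + 1) ≤ b := ⟨fun h => h, fun h => h⟩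

open Classical in
-- A dyadic interval inside a longer dyadic interval is the whole of it or lies in one of its
-- halves. Hence the recursion meets every such interval exactly once.
theorem trianglesBelow_apply {i a r : ℕ} (h : 2 ^ r ∣ a) (t : ℕ × ℕ) :
    trianglesBelow i a r (i, t) = if Below a (a + 2 ^ r) t then 1 else 0 := by
  obtain ⟨b, s⟩ := t
  induction r generalizing a with
  | zero =>
    rw [if_neg]
    · rfl
    · rintro ⟨-, h1, h2⟩
      simp only at h1 h2
      have : 0 < 2 ^ s := by positivity
      rw [pow_succ] at h2
      omega
  | succ r ih =>
    have hr : 2 ^ r ∣ a := (pow_dvd_pow 2 r.le_succ).trans h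
    have hp : a + 2 ^ r + 2 ^ r = a + 2 ^ (r + 1) := by rw [pow_succ]; ring
    have h0 : 0 < 2 ^ r := by positivity
    have h0' : 0 < 2 ^ (s + 1) := by positivity
    rw [trianglesBelow, Finsupp.add_apply, Finsupp.add_apply, ih hr, ih (hr.add dvd_rfl), hp]
    simp only [below_iff]
    by_cases hb : b = a ∧ s = r
    · obtain ⟨rfl, rfl⟩ := hb
      have h0 : 0 < 2 ^ s := by positivity
      rw [if_neg (by rintro ⟨-, -, h⟩; rw [pow_succ] at h; omega),
        if_neg (by rintro ⟨-, h, -⟩; omega), if_pos ⟨h, le_rfl, le_rfl⟩]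
      simp
    · have hs : (single (i, a, r) (1 : ZMod 2)) (i, b, s) = 0 := by
        refine single_eq_of_ne fun h => hb ?_
        simpa using h
      rw [hs, zero_add]
      by_cases hd : 2 ^ (s + 1) ∣ b
      -- An interval with the midpoint in its interior has length at least `2 ^ (r + 1)`, since
      -- otherwise its length would divide the midpoint. Inside the given interval it could only be
      -- the whole interval, which is already excluded.
      · by_cases h1 : b < a + 2 ^ r ∧ a + 2 ^ r < b + 2 ^ (s + 1)
        · rw [if_neg (by omega), if_neg (by omega), if_neg, add_zero]
          rintro ⟨-, h2, h3⟩
          have h4 : r < s + 1 := by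
            by_contra h4
            exact not_dvd_of_lt_of_lt hd h1.1 h1.2
              ((pow_dvd_pow 2 (not_lt.1 h4)).trans (hr.add dvd_rfl))
          have h5 : 2 ^ (r + 1) ≤ 2 ^ (s + 1) := Nat.pow_le_pow_right (by norm_num) h4
          have h6 : s + 1 = r + 1 := Nat.pow_right_injective (le_refl 2) (by simp only; omega)
          exact hb ⟨by omega, by omega⟩
        · have : ∀ x y z : Prop, [Decidable x] → [Decidable y] → [Decidable z] → (x ↔ y ∨ z) →
              ¬ (y ∧ z) → ((if y then 1 else 0) + (if z then 1 else 0) : ZMod 2) =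
              if x then 1 else 0 := by
            intro x y z _ _ _ hx hyz
            by_cases hy : y <;> by_cases hz : z <;> simp_all
          refine this _ _ _ ?_ ?_ <;> simp only [hd, true_and] <;> omega
      · simp [hd]

theorem trianglesBelow_apply_of_ne {i j a r : ℕ} (h : j ≠ i) (t : ℕ × ℕ) :
    trianglesBelow i a r (j, t) = 0 := by
  induction r generalizing a with
  | zero => rfl
  | succ r ih =>
    rw [trianglesBelow, Finsupp.add_apply, Finsupp.add_apply, ih, ih, add_zero, add_zero]
    exact single_eq_of_ne fun h' => h (congrArg Prod.fst h')

open Classical in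
-- The greedy path from `a` to `b` consists of maximal dyadic pieces, so no dyadic interval inside
-- `[a, b]` has a vertex of the path in its interior. The triangles below the edges of the path are
-- therefore all the dyadic ones over `[a, b]`.
theorem q_shortestPath_apply (i : ℕ) (a b : ℕ) (t : ℕ × ℕ) :
    q ((shortestPath a b).map fun e => single (i, e) 1).sum (i, t) =
      if Below a b t then 1 else 0 := by
  obtain ⟨c, s⟩ := t
  have h0' : 0 < 2 ^ (s + 1) := by positivity
  induction a using shortestPath_induction (b := b) with
  | base a hab =>
    rw [shortestPath_of_le hab, if_neg]
    · simp
    · rintro ⟨-, h1, h2⟩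
      simp only at h1 h2
      omega
  | step a hab ih =>
    obtain ⟨h1, h2⟩ := firstLevel_spec hab
    rw [shortestPath_of_lt hab, List.map_cons, List.sum_cons, map_add, q_single, Finsupp.add_apply, ih,
      trianglesBelow_apply h1]
    simp only [below_iff]
    by_cases hd : 2 ^ (s + 1) ∣ c
    · simp only [hd, true_and]
      have h0 : 0 < 2 ^ firstLevel a b := by positivity
      -- Suppose that an interval inside `[a, b]` crosses the end of the first edge. It is longer
      -- than that edge, so its left end is a multiple of the edge length and hence equal to `a`;
      -- this contradicts the greedy choice.
      by_cases h3 : a ≤ c ∧ c < a + 2 ^ firstLevel a b ∧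
          a + 2 ^ firstLevel a b < c + 2 ^ (s + 1) ∧ c + 2 ^ (s + 1) ≤ b
      · exfalso
        obtain ⟨h3, h4, h5, h6⟩ := h3
        have h7 : firstLevel a b < s + 1 := by
          by_contra h7
          exact not_dvd_of_lt_of_lt hd h4 h5
              ((pow_dvd_pow 2 (not_lt.1 h7)).trans (h1.add dvd_rfl))
        have h8 : c = a := by
          by_contra h8
          exact not_dvd_of_lt_of_lt h1 (by omega) h4 ((pow_dvd_pow 2 h7.le).trans hd)
        subst h8
        have := le_firstLevel hd h6
        omega
      · by_cases h4 : a ≤ c ∧ c + 2 ^ (s + 1) ≤ a + 2 ^ firstLevel a b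
        · rw [if_pos h4, if_neg (by omega), if_pos (by omega), add_zero]
        · rw [if_neg h4, zero_add]
          congr 1
          simp only [eq_iff_iff]
          omega
    · simp [hd]

theorem q_shortestPath_apply_of_ne {i j : ℕ} (h : j ≠ i) (l : List (ℕ × ℕ)) (t : ℕ × ℕ) :
    q (l.map fun e => single (i, e) 1).sum (j, t) = 0 := by
  induction l with
  | nil => simp
  | cons e l ih => rw [List.map_cons, List.sum_cons, map_add, Finsupp.add_apply, ih, q_single,
      trianglesBelow_apply_of_ne h, add_zero]

/-- The triangles over the interval from `0` to `b` in whose interior `a` lies. -/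
def trianglesAround (a b : ℕ) : List (ℕ × ℕ) :=
  ((List.range (b + 1)).filter fun r => a % 2 ^ r ≠ 0 ∧ a - a % 2 ^ r + 2 ^ r ≤ b).map
    fun r => (a - a % 2 ^ r, r - 1)

/-- For each length `2 ^ r` only one dyadic interval can have `a` in its interior: the one that
starts at `a` rounded down. It exists unless `2 ^ r` divides `a`. The level of the triangle is `r -
1`, since levels refer to the short edges. -/
theorem mem_trianglesAround {a b : ℕ} {t : ℕ × ℕ} : t ∈ trianglesAround a b ↔
    2 ^ (t.2 + 1) ∣ t.1 ∧ t.1 < a ∧ a < t.1 + 2 ^ (t.2 + 1) ∧ t.1 + 2 ^ (t.2 + 1) ≤ b := by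
  obtain ⟨c, s⟩ := t
  simp only [trianglesAround, List.mem_map, List.mem_filter, List.mem_range, decide_eq_true_eq,
    Prod.mk.injEq]
  constructor
  · rintro ⟨r, ⟨h1, h2, h3⟩, rfl, rfl⟩
    have hr : r ≠ 0 := by rintro rfl; simp [Nat.mod_one] at h2
    have h4 : a % 2 ^ r < 2 ^ r := Nat.mod_lt _ (by positivity)
    have h5 := Nat.mod_le a (2 ^ r)
    rw [Nat.sub_add_cancel (Nat.pos_of_ne_zero hr)]
    exact ⟨Nat.dvd_sub_mod a, by omega, by omega, h3⟩
  · rintro ⟨⟨x, rfl⟩, h2, h3, h4⟩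
    have h5 : a % 2 ^ (s + 1) = a - 2 ^ (s + 1) * x := by
      have : a = (a - 2 ^ (s + 1) * x) + 2 ^ (s + 1) * x := by omega
      rw [this, Nat.add_mul_mod_self_left, Nat.add_sub_cancel, Nat.mod_eq_of_lt (by omega)]
    refine ⟨s + 1, ⟨?_, ?_, ?_⟩, ?_, ?_⟩
    · have := Nat.lt_two_pow_self (n := s + 1)
      omega
    · omega
    · omega
    · omega
    · omega

theorem nodup_trianglesAround (a b : ℕ) : (trianglesAround a b).Nodup := by
  refine List.Nodup.map_on ?_ ((List.nodup_range).filter _)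
  intro r hr r' hr' h
  simp only [List.mem_filter, decide_eq_true_eq, Prod.mk.injEq] at hr hr' h
  -- The exponent 0 never passes the filter, so the truncated `r - 1` still determines `r`.
  have h1 : r ≠ 0 := by rintro rfl; simp [Nat.mod_one] at hr
  have h2 : r' ≠ 0 := by rintro rfl; simp [Nat.mod_one] at hr'
  omega

open Classical in
theorem sum_map_single_apply {α : Type*} {l : List α} (hl : l.Nodup) (x : α) :
    (l.map fun y => single y (1 : ZMod 2)).sum x = if x ∈ l then 1 else 0 := by
  induction l with
  | nil => simp
  | cons y l ih =>
    rw [List.nodup_cons] at hl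
    rw [List.map_cons, List.sum_cons, Finsupp.add_apply, ih hl.2]
    by_cases h : x = y
    · subst h
      simp [hl.1]
    · rw [single_eq_of_ne h, zero_add]
      simp [h]

/-- The key to the size bound. Each path contributes the indicator function of the dyadic intervals
that it spans. An interval inside `[0, b]` that does not have `a` in its interior lies in exactly
one of `[0, a]` and `[a, b]` and so cancels modulo 2; what survives has at most one interval of each
length. -/
theorem sum_trianglesAround (i : ℕ) {a b : ℕ} (h : a ≤ b) :
    ((trianglesAround a b).map fun t => single (i, t) (1 : ZMod 2)).sum =
      q (pathChain (i, a, b) + (pathChain (i, 0, a) + pathChain (i, 0, b))) := by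
  classical
  ext ⟨j, t⟩
  simp only [pathChain, h, min_eq_left, max_eq_right, Nat.zero_le, map_add, Finsupp.add_apply]
  by_cases hj : j = i
  · subst hj
    rw [q_shortestPath_apply, q_shortestPath_apply, q_shortestPath_apply]
    have h1 := sum_map_single_apply (l := (trianglesAround a b).map (Prod.mk j))
      ((nodup_trianglesAround a b).map (Prod.mk_right_injective j)) (j, t)
    rw [List.map_map] at h1
    have h2 : ((j, t) ∈ (trianglesAround a b).map (Prod.mk j)) ↔ t ∈ trianglesAround a b := by
      simp
    rw [show ((fun y => single y (1 : ZMod 2)) ∘ Prod.mk j) = fun t => single (j, t) 1 from rfl] at h1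
    rw [h1]
    obtain ⟨c, s⟩ := t
    simp only [h2, mem_trianglesAround, below_iff]
    have h0' : 0 < 2 ^ (s + 1) := by positivity
    by_cases hd : 2 ^ (s + 1) ∣ c
    · simp only [hd, true_and, Nat.zero_le]
      generalize 2 ^ (s + 1) = w at *
      by_cases c1 : c + w ≤ b
      · by_cases c2 : c + w ≤ a
        · rw [if_neg (by omega), if_neg (by omega), if_pos c2, if_pos c1]
          decide
        · by_cases c3 : a ≤ c
          · rw [if_neg (by omega), if_pos (by omega), if_neg c2, if_pos c1]
            decide
          · by_cases c4 : a < c + w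
            · rw [if_pos (by omega), if_neg (by omega), if_neg c2, if_pos c1]
              decide
            · omega
      · rw [if_neg (by omega), if_neg (by omega), if_neg (by omega), if_neg (by omega)]
        decide
    · simp [hd]
  · rw [q_shortestPath_apply_of_ne hj, q_shortestPath_apply_of_ne hj, q_shortestPath_apply_of_ne hj]
    simp only [add_zero]
    generalize trianglesAround a b = l
    induction l with
    | nil => simp
    | cons t l ih =>
      rw [List.map_cons, List.sum_cons, Finsupp.add_apply, ih, add_zero]
      exact single_eq_of_ne fun h' => hj (congrArg Prod.fst h')

end LogPath

namespace LogPath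

open Finsupp

/-! ### Lists that describe simplicial bifiltrations -/

section CellLists

variable (L : List CellRecord)

/-- The record at position `i`. -/
def record (i : ℕ) : CellRecord := L.getD i ⟨0, [], []⟩

/-- The positions of the facets of the cell at position `i`. -/
def facets (i : ℕ) : List ℕ := (record L i).facets

/-- The number of generators of the cell at position `i`. -/
def size (i : ℕ) : ℕ := (record L i).grades.length

/-- The grade of the `a`-th generator of the cell at position `i`. -/
def grade (i a : ℕ) : ℕ × ℕ := (record L i).grades.getD a (0, 0)

/-- The last generator of `τ` whose first coordinate is at most that of the generator `a` of `i`. -/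
def lift (i a τ : ℕ) : ℕ :=
  Nat.findGreatest (fun l => l < size L τ ∧ (grade L τ l).1 ≤ (grade L i a).1) (size L τ)

/-- The combinatorial properties of a list that describes a simplicial bifiltration. -/
structure Admissible : Prop where
  facets_lt : ∀ i, ∀ τ ∈ facets L i, τ < L.length
  nodup_facets : ∀ i, (facets L i).Nodup
  dim_facets : ∀ i, ∀ τ ∈ facets L i, (record L τ).dim + 1 = (record L i).dim
  size_pos : ∀ i < L.length, 0 < size L i
  fst_lt : ∀ i a b, a < b → b < size L i → (grade L i a).1 < (grade L i b).1
  snd_lt : ∀ i a b, a < b → b < size L i → (grade L i b).2 < (grade L i a).2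
  exists_le : ∀ i, ∀ τ ∈ facets L i, ∀ a < size L i, ∃ l < size L τ, grade L τ l ≤ grade L i a
  card_between : ∀ i ρ, ((facets L i).toFinset.filter fun τ => ρ ∈ facets L τ).card = 0 ∨
    ((facets L i).toFinset.filter fun τ => ρ ∈ facets L τ).card = 2

/-- The paths in the codimension-2 faces that occur in the boundary of a generator. -/
def genPaths (i a : ℕ) : List (ℕ × ℕ × ℕ) :=
  (facets L i).flatMap fun τ => (facets L i).flatMap fun τ' =>
    (facets L τ).flatMap fun ρ => (facets L τ').flatMap fun ρ' =>
      if τ < τ' ∧ ρ = ρ' then [(ρ, lift L τ (lift L i a τ) ρ, lift L τ' (lift L i a τ') ρ)] else []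

/-- The paths in the facets that occur in the boundary of the relation from `a` to `b`. -/
def relPaths (i a b : ℕ) : List (ℕ × ℕ × ℕ) :=
  (facets L i).map fun τ => (τ, lift L i a τ, lift L i b τ)

/-- The component of the differential from generators to generators. -/
noncomputable def f₀ : GenChain →ₗ[ZMod 2] GenChain :=
  linearCombination (ZMod 2) fun v =>
    ((facets L v.1).map fun τ => single (τ, lift L v.1 v.2 τ) (1 : ZMod 2)).sum

/-- The component of the differential from relations to relations. -/
noncomputable def f₁ : EdgeChain →ₗ[ZMod 2] EdgeChain :=
  linearCombination (ZMod 2) fun e =>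
    ((relPaths L e.1 e.2.1 (e.2.1 + 2 ^ e.2.2)).map pathChain).sum

/-- The component of the differential from generators to relations. -/
noncomputable def h₀ : GenChain →ₗ[ZMod 2] EdgeChain :=
  linearCombination (ZMod 2) fun v => ((genPaths L v.1 v.2).map pathChain).sum

end CellLists

variable {L : List CellRecord}

theorem f₀_single (i a : ℕ) : f₀ L (single (i, a) 1) =
    ((facets L i).map fun τ => single (τ, lift L i a τ) (1 : ZMod 2)).sum := by simp [f₀]

theorem f₁_single (i a r : ℕ) : f₁ L (single (i, a, r) 1) =
    ((relPaths L i a (a + 2 ^ r)).map pathChain).sum := by simp [f₁]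

theorem h₀_single (i a : ℕ) : h₀ L (single (i, a) 1) =
    ((genPaths L i a).map pathChain).sum := by simp [h₀]

theorem p₁_f₁ (x : EdgeChain) : p₁ (f₁ L x) = f₀ L (p₁ x) := by
  refine apply_eq_of_single (f := p₁ ∘ₗ f₁ L) (g := f₀ L ∘ₗ p₁) (fun t => ?_) x
  obtain ⟨i, a, r⟩ := t
  simp only [LinearMap.comp_apply, f₁_single, p₁_single, map_add, f₀_single, relPaths]
  generalize facets L i = l
  induction l with
  | nil => simp
  | cons τ l ih =>
    simp only [List.map_cons, List.sum_cons, map_add, ih, p₁_pathChain]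
    abel

/-- Applied to the set of facets between a simplex and a face: the single ordered pair in a
two-element set counts both of its members once. -/
theorem sum_pairs {M : Type*} [AddCommGroup M] [Module (ZMod 2) M] (S : Finset ℕ)
    (h : S.card = 0 ∨ S.card = 2) (g : ℕ → M) :
    ∑ a ∈ S, ∑ b ∈ S, (if a < b then g a + g b else 0) = ∑ a ∈ S, g a := by
  rcases h with h | h
  · rw [Finset.card_eq_zero] at h
    simp [h]
  · obtain ⟨a, b, hab, rfl⟩ := Finset.card_eq_two.1 h
    simp only [Finset.sum_pair hab]
    rcases lt_or_gt_of_ne hab with h | h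
    · simp [h, h.not_gt]
    · simp [h, h.not_gt, add_comm]

theorem list_sum_flatMap {α M : Type*} [AddCommMonoid M] (l : List α) (F : α → List M) :
    (l.flatMap F).sum = (l.map fun x => (F x).sum).sum := by
  induction l with
  | nil => simp
  | cons a l ih => simp [ih]

theorem list_sum_eq_finset_sum {α M : Type*} [DecidableEq α] [AddCommMonoid M] {l : List α}
    (hl : l.Nodup) (F : α → M) : (l.map F).sum = ∑ x ∈ l.toFinset, F x := by
  rw [List.sum_toFinset _ hl]

/-- Iterated lifts are regrouped by the codimension-2 face `ρ` in which they end. Each `ρ` is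
reached through no facet or through exactly two, and in the latter case the two lifts are the ends
of the path in `ρ`. -/
theorem sum_genPaths (hL : Admissible L) {M : Type*} [AddCommGroup M] [Module (ZMod 2) M]
    (i a : ℕ) (G : ℕ × ℕ → M) :
    ((genPaths L i a).map fun x => G (x.1, x.2.1) + G (x.1, x.2.2)).sum =
      ((facets L i).map fun τ => ((facets L τ).map fun ρ =>
        G (ρ, lift L τ (lift L i a τ) ρ)).sum).sum := by
  set g : ℕ → ℕ → M := fun ρ τ => G (ρ, lift L τ (lift L i a τ) ρ) with hg
  set R := (facets L i).toFinset.biUnion fun τ => (facets L τ).toFinset with hR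
  -- All sums over facets of facets are extended to one common index set, so that they can be
  -- interchanged with the sums over facets.
  have key : ∀ S : Finset ℕ, S ⊆ R → ∀ F : ℕ → M, ∑ ρ ∈ S, F ρ = ∑ ρ ∈ R, if ρ ∈ S then F ρ else 0 := by
    intro S hS F
    rw [← Finset.sum_filter]
    congr 1
    ext x
    simp only [Finset.mem_filter]
    exact ⟨fun h => ⟨hS h, h⟩, fun h => h.2⟩
  have hsub : ∀ τ ∈ (facets L i).toFinset, (facets L τ).toFinset ⊆ R := fun τ hτ =>
    Finset.subset_biUnion_of_mem (fun τ => (facets L τ).toFinset) hτ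
  have hl : ((genPaths L i a).map fun x => G (x.1, x.2.1) + G (x.1, x.2.2)).sum =
      ∑ τ ∈ (facets L i).toFinset, ∑ τ' ∈ (facets L i).toFinset, ∑ ρ ∈ (facets L τ).toFinset,
        ∑ ρ' ∈ (facets L τ').toFinset, if τ < τ' ∧ ρ = ρ' then g ρ τ + g ρ τ' else 0 := by
    simp only [genPaths, List.map_flatMap, list_sum_flatMap,
      list_sum_eq_finset_sum (hL.nodup_facets _)]
    refine Finset.sum_congr rfl fun τ _ => Finset.sum_congr rfl fun τ' _ =>
      Finset.sum_congr rfl fun ρ _ => Finset.sum_congr rfl fun ρ' _ => ?_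
    split_ifs <;> simp [hg]
  rw [hl]
  simp only [list_sum_eq_finset_sum (hL.nodup_facets _)]
  have hr : ∑ τ ∈ (facets L i).toFinset, ∑ ρ ∈ (facets L τ).toFinset, g ρ τ =
      ∑ ρ ∈ R, ∑ τ ∈ (facets L i).toFinset.filter (fun τ => ρ ∈ facets L τ), g ρ τ := by
    rw [Finset.sum_congr rfl fun τ hτ => key _ (hsub τ hτ) _, Finset.sum_comm]
    refine Finset.sum_congr rfl fun ρ _ => ?_
    rw [Finset.sum_filter]
    simp
  rw [hr]
  have hl2 : ∀ τ ∈ (facets L i).toFinset, ∀ τ' ∈ (facets L i).toFinset,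
      (∑ ρ ∈ (facets L τ).toFinset, ∑ ρ' ∈ (facets L τ').toFinset,
        if τ < τ' ∧ ρ = ρ' then g ρ τ + g ρ τ' else 0) = ∑ ρ ∈ R,
        if ρ ∈ facets L τ then if ρ ∈ facets L τ' then if τ < τ' then g ρ τ + g ρ τ' else 0 else 0
          else 0 := by
    intro τ hτ τ' _
    rw [key _ (hsub τ hτ)]
    refine Finset.sum_congr rfl fun ρ _ => ?_
    simp only [List.mem_toFinset]
    congr 1
    by_cases h : τ < τ'
    · simp [h, Finset.sum_ite_eq]
    · simp [h]
  rw [Finset.sum_congr rfl fun τ hτ => Finset.sum_congr rfl fun τ' hτ' => hl2 τ hτ τ' hτ']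
  rw [Finset.sum_congr rfl fun τ hτ => Finset.sum_comm, Finset.sum_comm]
  refine Finset.sum_congr rfl fun ρ _ => ?_
  rw [← sum_pairs _ (hL.card_between i ρ) (g ρ), Finset.sum_filter]
  refine Finset.sum_congr rfl fun τ _ => ?_
  rw [Finset.sum_filter]
  split_ifs
  · rfl
  · simp

theorem map_sum_pathChain (l : List (ℕ × ℕ × ℕ)) : p₁ ((l.map pathChain).sum) =
    (l.map fun x => single (x.1, x.2.1) (1 : ZMod 2) + single (x.1, x.2.2) 1).sum := by
  induction l with
  | nil => simp
  | cons x l ih =>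
    rw [List.map_cons, List.sum_cons, map_add, ih, p₁_pathChain x.1 x.2.1 x.2.2, List.map_cons,
      List.sum_cons]

theorem p₁_h₀ (hL : Admissible L) (x : GenChain) : p₁ (h₀ L x) = f₀ L (f₀ L x) := by
  refine apply_eq_of_single (f := p₁ ∘ₗ h₀ L) (g := f₀ L ∘ₗ f₀ L) (fun t => ?_) x
  obtain ⟨i, a⟩ := t
  simp only [LinearMap.comp_apply, h₀_single, f₀_single, map_sum_pathChain,
    sum_genPaths hL i a fun x => single x (1 : ZMod 2)]
  rw [map_list_sum, List.map_map]
  simp only [Function.comp_def, f₀_single]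

/-- The components of the differential of the log-path complex. -/
noncomputable def filling (hL : Admissible L) : FillingData GenChain EdgeChain EdgeChain where
  p₁ := p₁
  p₂ := p₂
  q := q
  u := u
  f₀ := f₀ L
  f₁ := f₁ L
  h₀ := h₀ L
  p₁_p₂ := p₁_p₂
  q_p₂ := q_p₂
  p₂_q := p₂_q
  p₁_f₁ := p₁_f₁
  p₁_h₀ := p₁_h₀ hL

/-! ### Grades -/

namespace Admissible

variable (hL : Admissible L)

include hL

/-- Some generator of the facet lies below the given one. The last generator with small enough first
coordinate comes no earlier in the list, and second coordinates decrease, so it lies below as well.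
Comparing first coordinates therefore suffices for the choice. -/
theorem lift_spec {i τ a : ℕ} (hτ : τ ∈ facets L i) (ha : a < size L i) :
    lift L i a τ < size L τ ∧ grade L τ (lift L i a τ) ≤ grade L i a := by
  obtain ⟨l, hl, hle⟩ := hL.exists_le i τ hτ a ha
  have h1 := Nat.findGreatest_spec (P := fun l => l < size L τ ∧ (grade L τ l).1 ≤ (grade L i a).1)
    hl.le ⟨hl, hle.1⟩
  have h2 : l ≤ lift L i a τ := Nat.le_findGreatest hl.le ⟨hl, hle.1⟩
  refine ⟨h1.1, h1.2, ?_⟩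
  rcases h2.eq_or_lt with h2 | h2
  · exact h2 ▸ hle.2
  · exact (hL.snd_lt τ l _ h2 h1.1).le.trans hle.2

/-- The larger index controls the first coordinate and the smaller index the second one. This is why
every construction that stays between its end vertices respects grades. -/
theorem grade_le_of_between {i a b c : ℕ} {s : ℕ × ℕ} (h1 : a ≤ b) (h2 : b ≤ c)
    (hc : c < size L i) (ha : grade L i a ≤ s) (hs : grade L i c ≤ s) : grade L i b ≤ s := by
  constructor
  · rcases h2.eq_or_lt with rfl | h2
    · exact hs.1
    · exact (hL.fst_lt i b c h2 hc).le.trans hs.1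
  · rcases h1.eq_or_lt with rfl | h1
    · exact ha.2
    · exact (hL.snd_lt i a b h1 (h2.trans_lt hc)).le.trans ha.2

end Admissible

variable (L) in
/-- The generators of dimension `n` that are present at grade `s`. -/
def genChains (n : ℤ) (s : ℕ × ℕ) : Submodule (ZMod 2) GenChain :=
  supported (ZMod 2) (ZMod 2)
    {v | ((record L v.1).dim : ℤ) = n ∧ v.2 < size L v.1 ∧ grade L v.1 v.2 ≤ s}

variable (L) in
/-- The relations of dimension `n` that are present at grade `s`. -/
def relChains (n : ℤ) (s : ℕ × ℕ) : Submodule (ZMod 2) EdgeChain :=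
  supported (ZMod 2) (ZMod 2)
    {e | ((record L e.1).dim : ℤ) + 1 = n ∧ 2 ^ e.2.2 ∣ e.2.1 ∧ e.2.1 + 2 ^ e.2.2 < size L e.1 ∧
      grade L e.1 e.2.1 ≤ s ∧ grade L e.1 (e.2.1 + 2 ^ e.2.2) ≤ s}

variable (L) in
/-- The syzygies of dimension `n` that are present at grade `s`. -/
def syzChains (n : ℤ) (s : ℕ × ℕ) : Submodule (ZMod 2) EdgeChain :=
  supported (ZMod 2) (ZMod 2)
    {t | ((record L t.1).dim : ℤ) + 2 = n ∧ 2 ^ (t.2.2 + 1) ∣ t.2.1 ∧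
      t.2.1 + 2 ^ (t.2.2 + 1) < size L t.1 ∧
      grade L t.1 t.2.1 ≤ s ∧ grade L t.1 (t.2.1 + 2 ^ (t.2.2 + 1)) ≤ s}

theorem map_mem_of_single {α M : Type*} [AddCommGroup M] [Module (ZMod 2) M]
    {f : (α →₀ ZMod 2) →ₗ[ZMod 2] M} {S : Set α} {W : Submodule (ZMod 2) M}
    (h : ∀ x ∈ S, f (single x 1) ∈ W) {v : α →₀ ZMod 2} (hv : v ∈ supported (ZMod 2) (ZMod 2) S) :
    f v ∈ W := by
  rw [supported_eq_span_single] at hv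
  have : Submodule.span (ZMod 2) ((fun i => single i 1) '' S) ≤ W.comap f := by
    rw [Submodule.span_le]
    rintro _ ⟨x, hx, rfl⟩
    exact h x hx
  exact this hv

/-- Dimensions are integers here, so that lowering them by one needs no special case at zero. -/
theorem p₁_mem {n : ℤ} {s : ℕ × ℕ} {x : EdgeChain} (hx : x ∈ relChains L n s) :
    p₁ x ∈ genChains L (n - 1) s := by
  refine map_mem_of_single (fun e he => ?_) hx
  obtain ⟨i, a, r⟩ := e
  obtain ⟨h1, h2, h3, h4, h5⟩ := he
  simp only at h1 h2 h3 h4 h5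
  rw [p₁_single]
  exact Submodule.add_mem _ (single_mem_supported _ _ ⟨by simp only; omega, by simp only; omega, h4⟩)
    (single_mem_supported _ _ ⟨by simp only; omega, by simp only; omega, h5⟩)

/-- The grade of a triangle takes only its outer vertices into account; the midpoint is present
because it lies between them. -/
theorem p₂_mem (hL : Admissible L) {n : ℤ} {s : ℕ × ℕ} {x : EdgeChain}
    (hx : x ∈ syzChains L n s) : p₂ x ∈ relChains L (n - 1) s := by
  refine map_mem_of_single (fun e he => ?_) hx
  obtain ⟨i, a, r⟩ := e
  obtain ⟨h1, h2, h3, h4, h5⟩ := he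
  simp only at h1 h2 h3 h4 h5
  rw [p₂_single]
  have hp : a + 2 ^ r + 2 ^ r = a + 2 ^ (r + 1) := by rw [pow_succ]; ring
  have h0 : 0 < 2 ^ r := by positivity
  have hr : 2 ^ r ∣ a := (pow_dvd_pow 2 r.le_succ).trans h2
  have hm : grade L i (a + 2 ^ r) ≤ s :=
    hL.grade_le_of_between (by omega) (by omega) h3 h4 h5
  refine Submodule.add_mem _ (Submodule.add_mem _ ?_ ?_) ?_
  · exact single_mem_supported _ _ ⟨by simp only; omega, h2, h3, h4, h5⟩
  · exact single_mem_supported _ _ ⟨by simp only; omega, hr, by simp only; omega, h4, hm⟩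
  · exact single_mem_supported _ _ ⟨by simp only; omega, hr.add dvd_rfl, by simp only; omega, hm,
      by simp only; rwa [hp]⟩

theorem trianglesBelow_mem (i : ℕ) {a r : ℕ} (h : 2 ^ r ∣ a) :
    trianglesBelow i a r ∈ supported (ZMod 2) (ZMod 2)
      {t : ℕ × ℕ × ℕ | t.1 = i ∧ Below a (a + 2 ^ r) t.2} := by
  classical
  intro t ht
  obtain ⟨j, t⟩ := t
  rw [Finset.mem_coe, mem_support_iff] at ht
  by_cases hj : j = i
  · subst hj
    rw [trianglesBelow_apply h] at ht
    exact ⟨rfl, by by_contra hc; exact ht (if_neg hc)⟩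
  · exact absurd (trianglesBelow_apply_of_ne hj t) ht

/-- All triangles below an edge have their vertices between its two ends, so filling does not raise
the grade. -/
theorem q_mem (hL : Admissible L) {n : ℤ} {s : ℕ × ℕ} {x : EdgeChain}
    (hx : x ∈ relChains L n s) : q x ∈ syzChains L (n + 1) s := by
  refine map_mem_of_single (fun e he => ?_) hx
  obtain ⟨i, a, r⟩ := e
  obtain ⟨h1, h2, h3, h4, h5⟩ := he
  simp only at h1 h2 h3 h4 h5
  rw [q_single]
  refine supported_mono ?_ (trianglesBelow_mem i h2)
  rintro ⟨j, b, t⟩ ⟨rfl, h6, h7, h8⟩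
  simp only at h6 h7 h8 h1
  have : 0 < 2 ^ (t + 1) := by positivity
  exact ⟨by simp only; omega, h6, lt_of_le_of_lt h8 h3,
    hL.grade_le_of_between h7 (by simp only; omega) h3 h4 h5,
    hL.grade_le_of_between (by simp only; omega) h8 h3 h4 h5⟩

theorem pathChain_mem (hL : Admissible L) {n : ℤ} {s : ℕ × ℕ} {i a b : ℕ}
    (hn : ((record L i).dim : ℤ) + 1 = n) (ha : a < size L i) (hb : b < size L i)
    (has : grade L i a ≤ s) (hbs : grade L i b ≤ s) : pathChain (i, a, b) ∈ relChains L n s := by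
  refine list_sum_mem fun x hx => ?_
  obtain ⟨e, he, rfl⟩ := List.mem_map.1 hx
  obtain ⟨h1, h2, h3⟩ := mem_shortestPath he
  simp only at h2 h3
  have hmax : max a b < size L i := max_lt ha hb
  have hmins : grade L i (min a b) ≤ s := by rcases min_choice a b with h | h <;> rwa [h]
  have hmaxs : grade L i (max a b) ≤ s := by rcases max_choice a b with h | h <;> rwa [h]
  have : 0 < 2 ^ e.2 := by positivity
  exact single_mem_supported _ _ ⟨hn, h1, by simp only; omega,
    hL.grade_le_of_between h2 (by simp only; omega) hmax hmins hmaxs,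
    hL.grade_le_of_between (by simp only; omega) h3 hmax hmins hmaxs⟩

theorem f₀_mem (hL : Admissible L) {n : ℤ} {s : ℕ × ℕ} {x : GenChain}
    (hx : x ∈ genChains L n s) : f₀ L x ∈ genChains L (n - 1) s := by
  refine map_mem_of_single (fun e he => ?_) hx
  obtain ⟨i, a⟩ := e
  obtain ⟨h1, h2, h3⟩ := he
  simp only at h1 h2 h3
  rw [f₀_single]
  refine list_sum_mem fun x hx => ?_
  obtain ⟨τ, hτ, rfl⟩ := List.mem_map.1 hx
  have h4 := hL.lift_spec hτ h2
  have h5 := hL.dim_facets i τ hτ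
  exact single_mem_supported _ _ ⟨by simp only; omega, h4.1, h4.2.trans h3⟩

theorem f₁_mem (hL : Admissible L) {n : ℤ} {s : ℕ × ℕ} {x : EdgeChain}
    (hx : x ∈ relChains L n s) : f₁ L x ∈ relChains L (n - 1) s := by
  refine map_mem_of_single (fun e he => ?_) hx
  obtain ⟨i, a, r⟩ := e
  obtain ⟨h1, h2, h3, h4, h5⟩ := he
  simp only at h1 h2 h3 h4 h5
  rw [f₁_single]
  refine list_sum_mem fun x hx => ?_
  rw [relPaths, List.map_map] at hx
  obtain ⟨τ, hτ, rfl⟩ := List.mem_map.1 hx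
  have h6 := hL.lift_spec (a := a) hτ (by omega)
  have h7 := hL.lift_spec hτ h3
  have h8 := hL.dim_facets i τ hτ
  exact pathChain_mem hL (by omega) h6.1 h7.1 (h6.2.trans h4) (h7.2.trans h5)

theorem mem_genPaths {i a : ℕ} {x : ℕ × ℕ × ℕ} : x ∈ genPaths L i a ↔
    ∃ τ ∈ facets L i, ∃ τ' ∈ facets L i, τ < τ' ∧ x.1 ∈ facets L τ ∧ x.1 ∈ facets L τ' ∧
      x = (x.1, lift L τ (lift L i a τ) x.1, lift L τ' (lift L i a τ') x.1) := by
  simp only [genPaths, List.mem_flatMap]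
  constructor
  · rintro ⟨τ, hτ, τ', hτ', ρ, hρ, ρ', hρ', h⟩
    split_ifs at h with hc
    · obtain ⟨h1, rfl⟩ := hc
      obtain rfl := List.mem_singleton.1 h
      exact ⟨τ, hτ, τ', hτ', h1, hρ, hρ', rfl⟩
    · simp at h
  · rintro ⟨τ, hτ, τ', hτ', h1, hρ, hρ', h⟩
    exact ⟨τ, hτ, τ', hτ', x.1, hρ, x.1, hρ', by rw [if_pos ⟨h1, rfl⟩, ← h]; simp⟩

theorem h₀_mem (hL : Admissible L) {n : ℤ} {s : ℕ × ℕ} {x : GenChain}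
    (hx : x ∈ genChains L n s) : h₀ L x ∈ relChains L (n - 1) s := by
  refine map_mem_of_single (fun e he => ?_) hx
  obtain ⟨i, a⟩ := e
  obtain ⟨h1, h2, h3⟩ := he
  simp only at h1 h2 h3
  rw [h₀_single]
  refine list_sum_mem fun x hx => ?_
  obtain ⟨y, hy, rfl⟩ := List.mem_map.1 hx
  obtain ⟨τ, hτ, τ', hτ', -, hρ, hρ', h⟩ := mem_genPaths.1 hy
  rw [h]
  have k1 := hL.lift_spec hτ h2
  have k2 := hL.lift_spec hτ' h2
  have k3 := hL.lift_spec hρ k1.1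
  have k4 := hL.lift_spec hρ' k2.1
  have k5 := hL.dim_facets i τ hτ
  have k6 := hL.dim_facets τ _ hρ
  exact pathChain_mem hL (by omega) k3.1 k4.1 (k3.2.trans (k1.2.trans h3))
    (k4.2.trans (k2.2.trans h3))

end LogPath

namespace LogPath

open Finsupp

variable {L : List CellRecord}

/-! ### Supports of the contraction -/

theorem exists_of_map_apply_ne_zero {α β : Type*} {f : (α →₀ ZMod 2) →ₗ[ZMod 2] (β →₀ ZMod 2)}
    {v : α →₀ ZMod 2} {y : β} (h : f v y ≠ 0) : ∃ x, v x ≠ 0 ∧ f (single x 1) y ≠ 0 := by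
  by_contra hc
  push Not at hc
  have : f v ∈ supported (ZMod 2) (ZMod 2) {y}ᶜ := by
    refine map_mem_of_single (S := (v.support : Set α)) (fun x hx => ?_)
      ((mem_supported _ _).2 subset_rfl)
    rw [mem_supported']
    intro z hz
    obtain rfl : z = y := by simpa using hz
    exact hc x (mem_support_iff.1 hx)
  exact h ((mem_supported' _ _).1 this y (by simp))

/-- The unit paths from 0 may run through generators that are absent at `s`. If every simplex
carries an even number of generators of `x`, however, the same chain is obtained from paths that run
from the generators up to a common bound. An edge of the chain thus has a generator of `x` on either
side and lies between present generators. -/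
theorem u_mem (hL : Admissible L) {n : ℤ} {s : ℕ × ℕ} {x : GenChain}
    (hx : x ∈ genChains L n s) (h : collapse x = 0) : u x ∈ relChains L (n + 1) s := by
  classical
  obtain ⟨M, hM⟩ : ∃ M, ∀ v ∈ x.support, v.2 ≤ M :=
    ⟨x.support.sup Prod.snd, fun v hv => Finset.le_sup (f := Prod.snd) hv⟩
  set u' : GenChain →ₗ[ZMod 2] EdgeChain :=
    linearCombination (ZMod 2) fun v => ∑ b ∈ Finset.Ico v.2 M, single (v.1, b, 0) 1 with hu'
  set w : GenChain →ₗ[ZMod 2] EdgeChain :=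
    linearCombination (ZMod 2) fun v => ∑ b ∈ Finset.range M, single (v.1, b, 0) 1 with hw
  -- The path from 0 to a vertex and the path from that vertex to `M` add up to the whole path from
  -- 0 to `M`, which depends on the simplex only.
  have h1 : u x + u' x = w (collapse x) := by
    have : u x + u' x + w (collapse x) ∈ (⊥ : Submodule (ZMod 2) EdgeChain) := by
      refine map_mem_of_single (f := u + u' + w ∘ₗ collapse) (S := (x.support : Set (ℕ × ℕ)))
        (fun v hv => ?_) ((mem_supported _ _).2 subset_rfl)
      rw [Submodule.mem_bot]
      have hv' := hM v hv
      simp only [LinearMap.add_apply, LinearMap.comp_apply, u, hu', hw, collapse,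
        linearCombination_single, one_smul]
      rw [Finset.sum_range_add_sum_Ico _ hv', ZModModule.add_self]
    rw [Submodule.mem_bot] at this
    exact FillingData.eq_of_add_eq_zero this
  rw [h, map_zero] at h1
  have h2 := FillingData.eq_of_add_eq_zero h1
  refine (mem_supported _ _).2 fun e he => ?_
  rw [Finset.mem_coe, mem_support_iff] at he
  have he' := h2 ▸ he
  obtain ⟨⟨i, b⟩, hb1, hb2⟩ := exists_of_map_apply_ne_zero he
  obtain ⟨⟨j, a⟩, ha1, ha2⟩ := exists_of_map_apply_ne_zero he'
  obtain ⟨k, c, r⟩ := e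
  have key : ∀ (S : Finset ℕ) (i : ℕ),
      (∑ b ∈ S, single (i, b, 0) (1 : ZMod 2)) (k, c, r) ≠ 0 → i = k ∧ c ∈ S ∧ r = 0 := by
    intro S i hne
    rw [finsetSum_apply] at hne
    obtain ⟨b, hb, hne⟩ := Finset.exists_ne_zero_of_sum_ne_zero hne
    have : (i, b, 0) = (k, c, r) := by
      by_contra hc
      exact hne (single_eq_of_ne (Ne.symm hc))
    simp only [Prod.mk.injEq] at this
    obtain ⟨rfl, rfl, rfl⟩ := this
    exact ⟨rfl, hb, rfl⟩
  -- Reading the edge in `u x` gives a generator `b` of `x` above it, and reading it in `u' x` gives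
  -- a generator `a` of `x` below it.
  rw [u_single] at hb2
  rw [hu', linearCombination_single, one_smul] at ha2
  obtain ⟨rfl, hb3, rfl⟩ := key _ _ hb2
  obtain ⟨rfl, ha3, -⟩ := key _ _ ha2
  rw [Finset.mem_range] at hb3
  rw [Finset.mem_Ico] at ha3
  simp only at ha3 hb3
  have hbx := (mem_supported _ _).1 hx (mem_support_iff.2 hb1)
  have hax := (mem_supported _ _).1 hx (mem_support_iff.2 ha1)
  obtain ⟨hd, hb4, hb5⟩ := hbx
  obtain ⟨-, ha4, ha5⟩ := hax
  simp only at hd hb4 hb5 ha4 ha5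
  refine ⟨by simp only; omega, by simp, by simp only [pow_zero]; omega, ?_, ?_⟩
  · exact hL.grade_le_of_between ha3.1 (by simp only; omega) hb4 ha5 hb5
  · exact hL.grade_le_of_between (by simp only; omega) (by simp only [pow_zero]; omega) hb4 ha5 hb5

/-! ### The edges in boundaries as lists -/

/-- The edges of the shortest path between two generators. -/
def pathEdges (x : ℕ × ℕ × ℕ) : List (ℕ × ℕ × ℕ) :=
  (shortestPath (min x.2.1 x.2.2) (max x.2.1 x.2.2)).map fun e => (x.1, e)

theorem pathChain_eq (x : ℕ × ℕ × ℕ) :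
    pathChain x = ((pathEdges x).map fun e => single e 1).sum := by
  rw [pathEdges, List.map_map]
  rfl

theorem nodup_pathEdges (x : ℕ × ℕ × ℕ) : (pathEdges x).Nodup :=
  (nodup_shortestPath _ _).map (Prod.mk_right_injective _)

theorem fst_of_mem_pathEdges {x e : ℕ × ℕ × ℕ} (h : e ∈ pathEdges x) : e.1 = x.1 := by
  obtain ⟨y, -, rfl⟩ := List.mem_map.1 h
  rfl

theorem nodup_flatMap_pathEdges {l : List (ℕ × ℕ × ℕ)} (h : (l.map Prod.fst).Nodup) :
    (l.flatMap pathEdges).Nodup := by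
  rw [List.nodup_flatMap]
  refine ⟨fun x _ => nodup_pathEdges x, ?_⟩
  rw [List.Nodup, List.pairwise_map] at h
  refine h.imp fun hab e he he' => hab ?_
  rw [← fst_of_mem_pathEdges he, ← fst_of_mem_pathEdges he']

theorem sum_map_pathChain (l : List (ℕ × ℕ × ℕ)) :
    (l.map pathChain).sum = ((l.flatMap pathEdges).map fun e => single e 1).sum := by
  rw [List.map_flatMap, list_sum_flatMap]
  simp only [← pathChain_eq]

theorem sum_map_pathChain_apply {l : List (ℕ × ℕ × ℕ)} (h : (l.map Prod.fst).Nodup)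
    (e : ℕ × ℕ × ℕ) : (l.map pathChain).sum e ≠ 0 ↔ e ∈ l.flatMap pathEdges := by
  classical
  rw [sum_map_pathChain, sum_map_single_apply (nodup_flatMap_pathEdges h)]
  split_ifs with hc <;> simp [hc]

theorem nodup_relPaths (hL : Admissible L) (i a b : ℕ) : ((relPaths L i a b).map Prod.fst).Nodup := by
  rw [relPaths, List.map_map]
  simpa [Function.comp_def] using hL.nodup_facets i

/-- Only two facets contain the codimension-2 face `ρ`, so the increasing pair of them is unique. -/
theorem Admissible.eq_of_mem (hL : Admissible L) {i ρ a b c d : ℕ} (hab : a < b) (hcd : c < d)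
    (ha : a ∈ facets L i) (hb : b ∈ facets L i) (hc : c ∈ facets L i) (hd : d ∈ facets L i)
    (ha' : ρ ∈ facets L a) (hb' : ρ ∈ facets L b) (hc' : ρ ∈ facets L c) (hd' : ρ ∈ facets L d) :
    a = c ∧ b = d := by
  have h1 : ∀ {x}, x ∈ facets L i → ρ ∈ facets L x →
      x ∈ (facets L i).toFinset.filter fun τ => ρ ∈ facets L τ := fun h h' => by simp [h, h']
  rcases hL.card_between i ρ with h | h
  · rw [Finset.card_eq_zero] at h
    exact absurd (h1 ha ha') (by simp [h])
  · obtain ⟨x, y, -, hxy⟩ := Finset.card_eq_two.1 h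
    have ka := h1 ha ha'
    have kb := h1 hb hb'
    have kc := h1 hc hc'
    have kd := h1 hd hd'
    rw [hxy] at ka kb kc kd
    simp only [Finset.mem_insert, Finset.mem_singleton] at ka kb kc kd
    omega

/-- Each codimension-2 face carries at most one path. Hence nothing cancels in `h₀`, and its nonzero
coefficients are exactly the edges on these paths. -/
theorem nodup_genPaths (hL : Admissible L) (i a : ℕ) : ((genPaths L i a).map Prod.fst).Nodup := by
  simp only [genPaths, List.map_flatMap]
  have inner : ∀ τ τ' ρ ρ' x, x ∈ List.map Prod.fst (if τ < τ' ∧ ρ = ρ' then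
      [(ρ, lift L τ (lift L i a τ) ρ, lift L τ' (lift L i a τ') ρ)] else []) →
      x = ρ ∧ ρ' = ρ ∧ τ < τ' := by
    intro τ τ' ρ ρ' x hx
    split_ifs at hx with h
    · simp at hx
      exact ⟨hx, h.2.symm, h.1⟩
    · simp at hx
  rw [List.nodup_flatMap]
  refine ⟨fun τ hτ => ?_, ?_⟩
  · rw [List.nodup_flatMap]
    refine ⟨fun τ' hτ' => ?_, ?_⟩
    · rw [List.nodup_flatMap]
      refine ⟨fun ρ hρ => ?_, ?_⟩
      · rw [List.nodup_flatMap]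
        refine ⟨fun ρ' _ => by split_ifs <;> simp, ?_⟩
        refine (hL.nodup_facets τ').imp fun hne x hx hx' => hne ?_
        rw [(inner _ _ _ _ _ hx).2.1, (inner _ _ _ _ _ hx').2.1]
      · refine (hL.nodup_facets τ).imp fun hne x hx hx' => hne ?_
        simp only [List.mem_flatMap] at hx hx'
        obtain ⟨_, _, hx⟩ := hx
        obtain ⟨_, _, hx'⟩ := hx'
        rw [← (inner _ _ _ _ _ hx).1, ← (inner _ _ _ _ _ hx').1]
    · refine List.Pairwise.imp_of_mem (fun {b c} hb hc hne x hx hx' => hne ?_) (hL.nodup_facets i)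
      simp only [List.mem_flatMap] at hx hx'
      obtain ⟨ρ, hρ, ρ', hρ', hx⟩ := hx
      obtain ⟨ρ₂, hρ₂, ρ₂', hρ₂', hx'⟩ := hx'
      obtain ⟨rfl, rfl, h1⟩ := inner _ _ _ _ _ hx
      obtain ⟨rfl, rfl, h2⟩ := inner _ _ _ _ _ hx'
      exact (hL.eq_of_mem h1 h2 hτ hb hτ hc hρ hρ' hρ₂ hρ₂').2
  · refine List.Pairwise.imp_of_mem (fun {b c} hb hc hne x hx hx' => hne ?_) (hL.nodup_facets i)
    simp only [List.mem_flatMap] at hx hx'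
    obtain ⟨τ, hτ, ρ, hρ, ρ', hρ', hx⟩ := hx
    obtain ⟨τ₂, hτ₂, ρ₂, hρ₂, ρ₂', hρ₂', hx'⟩ := hx'
    obtain ⟨rfl, rfl, h1⟩ := inner _ _ _ _ _ hx
    obtain ⟨rfl, rfl, h2⟩ := inner _ _ _ _ _ hx'
    exact (hL.eq_of_mem h1 h2 hb hτ hc hτ₂ hρ hρ' hρ₂ hρ₂').1

/-! ### Cells -/

/-- Basis elements of a log-path complex, without the conditions on the indices. -/
inductive RawCell where
  | gen (i a : ℕ)
  | rel (i a r : ℕ)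
  | syz (i a r : ℕ)
deriving DecidableEq

namespace RawCell

/-- The chains of a log-path complex, split into generators, relations and syzygies. -/
abbrev Chains := GenChain × EdgeChain × EdgeChain

/-- The basis element as a chain. -/
noncomputable def toChain : RawCell → Chains
  | gen i a => (single (i, a) 1, 0, 0)
  | rel i a r => (0, single (i, a, r) 1, 0)
  | syz i a r => (0, 0, single (i, a, r) 1)

/-- The coefficient of a basis element. -/
def coeff (x : Chains) : RawCell → ZMod 2
  | gen i a => x.1 (i, a)
  | rel i a r => x.2.1 (i, a, r)
  | syz i a r => x.2.2 (i, a, r)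

variable (L) in
/-- The basis element occurs in the log-path complex of `L`. -/
def Valid : RawCell → Prop
  | gen i a => a < size L i
  | rel i a r => 2 ^ r ∣ a ∧ a + 2 ^ r < size L i
  | syz i a r => 2 ^ (r + 1) ∣ a ∧ a + 2 ^ (r + 1) < size L i

variable (L) in
/-- The dimension of a basis element. -/
def dim : RawCell → ℕ
  | gen i _ => (record L i).dim
  | rel i _ _ => (record L i).dim + 1
  | syz i _ _ => (record L i).dim + 2

variable (L) in
/-- The grade of a basis element. -/
def degree : RawCell → ℕ × ℕ
  | gen i a => grade L i a
  | rel i a r => grade L i a ⊔ grade L i (a + 2 ^ r)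
  | syz i a r => grade L i a ⊔ grade L i (a + 2 ^ (r + 1))

theorem coeff_add (x y : Chains) (c : RawCell) : coeff (x + y) c = coeff x c + coeff y c := by
  cases c <;> rfl

theorem coeff_smul (k : ZMod 2) (x : Chains) (c : RawCell) : coeff (k • x) c = k * coeff x c := by
  cases c <;> rfl

theorem coeff_zero (c : RawCell) : coeff 0 c = 0 := by
  cases c <;> rfl

theorem ext_coeff {x y : Chains} (h : ∀ c, coeff x c = coeff y c) : x = y := by
  refine Prod.ext ?_ (Prod.ext ?_ ?_)
  · ext ⟨i, a⟩; exact h (gen i a)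
  · ext ⟨i, a, r⟩; exact h (rel i a r)
  · ext ⟨i, a, r⟩; exact h (syz i a r)

theorem coeff_toChain (c d : RawCell) : coeff (toChain c) d = if d = c then 1 else 0 := by
  classical
  cases c <;> cases d <;> simp [coeff, toChain, single_apply, eq_comm]

variable (L) in
/-- The chains of dimension `n` that are present at grade `s`. -/
noncomputable def chains (n : ℤ) (s : ℕ × ℕ) : Submodule (ZMod 2) Chains :=
  (genChains L n s).prod ((relChains L n s).prod (syzChains L n s))

theorem mem_chains {n : ℤ} {s : ℕ × ℕ} {x : Chains} : x ∈ chains L n s ↔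
    ∀ c, coeff x c ≠ 0 → c.Valid L ∧ (c.dim L : ℤ) = n ∧ c.degree L ≤ s := by
  simp only [chains, Submodule.mem_prod, genChains, relChains, syzChains, mem_supported]
  constructor
  · rintro ⟨h0, h1, h2⟩ c hc
    cases c with
    | gen i a =>
      obtain ⟨k1, k2, k3⟩ := h0 (mem_support_iff.2 hc)
      exact ⟨k2, k1, k3⟩
    | rel i a r =>
      obtain ⟨k1, k2, k3, k4, k5⟩ := h1 (mem_support_iff.2 hc)
      exact ⟨⟨k2, k3⟩, by simpa [dim] using k1, sup_le k4 k5⟩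
    | syz i a r =>
      obtain ⟨k1, k2, k3, k4, k5⟩ := h2 (mem_support_iff.2 hc)
      exact ⟨⟨k2, k3⟩, by simpa [dim] using k1, sup_le k4 k5⟩
  · intro h
    refine ⟨?_, ?_, ?_⟩
    · rintro ⟨i, a⟩ hc
      obtain ⟨k1, k2, k3⟩ := h (gen i a) (mem_support_iff.1 hc)
      exact ⟨k2, k1, k3⟩
    · rintro ⟨i, a, r⟩ hc
      obtain ⟨k1, k2, k3⟩ := h (rel i a r) (mem_support_iff.1 hc)
      exact ⟨by simpa [dim] using k2, k1.1, k1.2, le_sup_left.trans k3, le_sup_right.trans k3⟩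
    · rintro ⟨i, a, r⟩ hc
      obtain ⟨k1, k2, k3⟩ := h (syz i a r) (mem_support_iff.1 hc)
      exact ⟨by simpa [dim] using k2, k1.1, k1.2, le_sup_left.trans k3, le_sup_right.trans k3⟩

theorem toChain_mem {c : RawCell} (hc : c.Valid L) {n : ℤ} {s : ℕ × ℕ} (hn : (c.dim L : ℤ) = n)
    (hs : c.degree L ≤ s) : c.toChain ∈ chains L n s := by
  rw [mem_chains]
  intro d hd
  rw [coeff_toChain] at hd
  obtain rfl : d = c := by
    by_contra h
    exact hd (if_neg h)
  exact ⟨hc, hn, hs⟩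

/-- Every component of the differential is composed of maps that respect grades. In the syzygy part
two steps lower the dimension and `q` raises it by one. -/
theorem diff_mem (hL : Admissible L) {n : ℤ} {s : ℕ × ℕ} {x : Chains} (hx : x ∈ chains L n s) :
    (filling hL).diff x ∈ chains L (n - 1) s := by
  obtain ⟨h0, h1, h2⟩ := hx
  have e1 : n - 1 - 1 + 1 = n - 1 := by ring
  refine ⟨Submodule.add_mem _ (f₀_mem hL h0) (p₁_mem h1),
    Submodule.add_mem _ (Submodule.add_mem _ (h₀_mem hL h0) (f₁_mem hL h1)) (p₂_mem hL h2),
    Submodule.add_mem _ (Submodule.add_mem _ ?_ ?_) ?_⟩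
  · have := q_mem hL (Submodule.add_mem _ (f₁_mem hL (h₀_mem hL h0)) (h₀_mem hL (f₀_mem hL h0)))
    rwa [e1] at this
  · have := q_mem hL (Submodule.add_mem _ (f₁_mem hL (f₁_mem hL h1)) (h₀_mem hL (p₁_mem h1)))
    rwa [e1] at this
  · have := q_mem hL (f₁_mem hL (p₂_mem hL h2))
    rwa [e1] at this

end RawCell

end LogPath

namespace LogPath

open Finsupp RawCell

variable {L : List CellRecord}

/-! ### The log-path complex -/

section Complex

variable (cs : List RawCell)

/-- The type of cells of the log-path complex whose basis elements are listed in `cs`. -/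
abbrev CellType : Type u := ULift.{u} (Fin cs.length)

/-- The basis element at a position. -/
def rawCell (c : CellType.{u} cs) : RawCell := cs.get c.down

/-- The inclusion of the chains on `cs` into all chains. -/
noncomputable def embed : (CellType.{u} cs →₀ ZMod 2) →ₗ[ZMod 2] Chains :=
  linearCombination (ZMod 2) fun c => (rawCell cs c).toChain

/-- The part of a chain that lives on `cs`. -/
noncomputable def restrict (x : Chains) : CellType.{u} cs →₀ ZMod 2 :=
  equivFunOnFinite.symm fun c => coeff x (rawCell cs c)

variable {cs}

theorem restrict_apply (x : Chains) (c : CellType.{u} cs) :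
    restrict cs x c = coeff x (rawCell cs c) := rfl

variable (hn : cs.Nodup) (hcs : ∀ c, c ∈ cs ↔ c.Valid L)

include hn in
theorem rawCell_injective : Function.Injective (rawCell.{u} cs) := fun _ _ h =>
  ULift.ext _ _ (List.nodup_iff_injective_get.1 hn h)

include hcs in
theorem valid_rawCell (c : CellType.{u} cs) : (rawCell cs c).Valid L :=
  (hcs _).1 (List.get_mem _ _)

include hcs in
theorem exists_rawCell {c : RawCell} (hc : c.Valid L) : ∃ d : CellType.{u} cs, rawCell cs d = c := by
  obtain ⟨n, hn⟩ := List.get_of_mem ((hcs c).2 hc)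
  exact ⟨⟨n⟩, hn⟩

theorem coeff_embed (v : CellType.{u} cs →₀ ZMod 2) (c : RawCell) :
    coeff (embed cs v) c = ∑ d, if c = rawCell cs d then v d else 0 := by
  rw [embed, linearCombination_apply,
    Finsupp.sum_fintype v (fun d k => k • (rawCell cs d).toChain) (fun _ => zero_smul _ _)]
  have : ∀ s : Finset (CellType.{u} cs), coeff (∑ i ∈ s, v i • (rawCell cs i).toChain) c =
      ∑ d ∈ s, if c = rawCell cs d then v d else 0 := by
    intro s
    induction s using Finset.induction_on with
    | empty => simp [coeff_zero]
    | insert d s hd ih =>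
      rw [Finset.sum_insert hd, Finset.sum_insert hd, coeff_add, ih, coeff_smul, coeff_toChain]
      simp
  exact this _

include hn in
theorem coeff_embed_rawCell (v : CellType.{u} cs →₀ ZMod 2) (c : CellType.{u} cs) :
    coeff (embed cs v) (rawCell cs c) = v c := by
  rw [coeff_embed]
  simp only [(rawCell_injective hn).eq_iff]
  simp

include hcs in
theorem coeff_embed_of_not_valid (v : CellType.{u} cs →₀ ZMod 2) {c : RawCell}
    (hc : ¬ c.Valid L) : coeff (embed cs v) c = 0 := by
  rw [coeff_embed]
  refine Finset.sum_eq_zero fun d _ => if_neg ?_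
  rintro rfl
  exact hc (valid_rawCell hcs d)

include hn in
theorem embed_injective : Function.Injective (embed.{u} cs) := fun v w h => by
  ext c
  rw [← coeff_embed_rawCell hn, h, coeff_embed_rawCell hn]

include hn hcs in
-- Restriction forgets the coefficients at invalid indices; membership in `chains` guarantees that
-- these are zero.
theorem embed_restrict {n : ℤ} {s : ℕ × ℕ} {x : Chains} (hx : x ∈ chains L n s) :
    embed.{u} cs (restrict cs x) = x := by
  refine ext_coeff fun c => ?_
  by_cases hc : c.Valid L
  · obtain ⟨d, rfl⟩ := exists_rawCell hcs hc
    rw [coeff_embed_rawCell hn, restrict_apply]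
  · rw [coeff_embed_of_not_valid hcs _ hc]
    by_contra h
    exact hc (mem_chains.1 hx c (Ne.symm h)).1

include hn hcs in
theorem embed_mem_iff {n : ℤ} {s : ℕ × ℕ} {v : CellType.{u} cs →₀ ZMod 2} :
    embed cs v ∈ chains L n s ↔
      ∀ c, v c ≠ 0 → ((rawCell cs c).dim L : ℤ) = n ∧ (rawCell cs c).degree L ≤ s := by
  rw [mem_chains]
  constructor
  · intro h c hc
    exact (h (rawCell cs c) (by rwa [coeff_embed_rawCell hn])).2
  · intro h c hc
    by_cases hv : c.Valid L
    · obtain ⟨d, rfl⟩ := exists_rawCell hcs hv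
      rw [coeff_embed_rawCell hn] at hc
      exact ⟨hv, h d hc⟩
    · exact absurd (coeff_embed_of_not_valid hcs v hv) hc

include hn hcs in
theorem embed_restrict_diff (hL : Admissible L) (c : CellType.{u} cs) :
    embed.{u} cs (restrict cs ((filling hL).diff (rawCell cs c).toChain)) =
      (filling hL).diff (rawCell cs c).toChain :=
  embed_restrict hn hcs (diff_mem hL (toChain_mem (valid_rawCell hcs c) rfl le_rfl))

include hn hcs in
-- The boundary on listed cells is the restriction of the total differential to an invariant
-- subspace. Since the embedding is injective, identities such as `d ^ 2 = 0` can be pulled back.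
theorem embed_linearCombination (hL : Admissible L) (v : CellType.{u} cs →₀ ZMod 2) :
    embed.{u} cs (linearCombination (ZMod 2)
      (fun c => restrict cs ((filling hL).diff (rawCell cs c).toChain)) v) =
      (filling hL).diff (embed cs v) := by
  refine apply_eq_of_single (f := embed cs ∘ₗ linearCombination (ZMod 2)
    (fun c => restrict cs ((filling hL).diff (rawCell cs c).toChain)))
    (g := (filling hL).diff ∘ₗ embed cs) (fun c => ?_) v
  rw [LinearMap.comp_apply, LinearMap.comp_apply, linearCombination_single, one_smul,
    embed_restrict_diff hn hcs, embed, linearCombination_single, one_smul]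

theorem mem_chains_of_boundary (hL : Admissible L) {c d : CellType.{u} cs}
    (hcs : ∀ c, c ∈ cs ↔ c.Valid L)
    (h : d ∈ (restrict cs ((filling hL).diff (rawCell cs c).toChain)).support) :
    ((rawCell cs d).dim L : ℤ) = (rawCell cs c).dim L - 1 ∧
      (rawCell cs d).degree L ≤ (rawCell cs c).degree L :=
  (mem_chains.1 (diff_mem hL (toChain_mem (valid_rawCell hcs c) rfl le_rfl)) _
    (mem_support_iff.1 h)).2

/-- The log-path complex. -/
noncomputable def complex (hL : Admissible L) : BifilteredComplex.{u} where
  Cell := CellType.{u} cs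
  dim c := (rawCell cs c).dim L
  supp c := Set.Ici ((rawCell cs c).degree L)
  isUpperSet_supp _ := isUpperSet_Ici _
  boundary c := restrict cs ((filling hL).diff (rawCell cs c).toChain)
  dim_boundary c d hd := by
    have := (mem_chains_of_boundary hL hcs hd).1
    omega
  supp_boundary c d hd := Set.Ici_subset_Ici.2 (mem_chains_of_boundary hL hcs hd).2
  boundary_boundary c := by
    apply embed_injective hn
    rw [embed_linearCombination hn hcs, embed_restrict_diff hn hcs, FillingData.diff_diff, map_zero]

variable (hL : Admissible L)

theorem isFree_complex : (complex.{u} hn hcs hL).IsFree := fun _ => ⟨_, rfl⟩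

theorem embed_boundaryMap (v : CellType.{u} cs →₀ ZMod 2) :
    embed cs ((complex.{u} hn hcs hL).boundaryMap v) = (filling hL).diff (embed cs v) :=
  embed_linearCombination hn hcs hL v

theorem mem_complex_chains {n : ℕ} {s : ℕ × ℕ} {v : CellType.{u} cs →₀ ZMod 2} :
    v ∈ (complex.{u} hn hcs hL).chains n s ↔ embed cs v ∈ chains L n s := by
  rw [embed_mem_iff hn hcs]
  constructor
  · intro h c hc
    have := (mem_supported _ _).1 h (mem_support_iff.2 hc)
    exact ⟨congrArg Nat.cast this.1, this.2⟩
  · intro h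
    refine (mem_supported _ _).2 fun c hc => ?_
    have := h c (mem_support_iff.1 hc)
    exact ⟨Nat.cast_injective this.1, this.2⟩

/-! ### The coefficients of the boundary -/

theorem numGrades_eq (i : Fin L.length) : numGrades L i = size L i := by
  simp [numGrades, size, record]

theorem gradeAt_eq (i : Fin L.length) (j : Fin (numGrades L i)) : gradeAt L i j = grade L i j := by
  have h := j.2
  simp only [numGrades, List.get_eq_getElem] at h
  simp [gradeAt, grade, record, List.getElem?_eq_getElem h]
  rfl

theorem isFacet_iff (τ σ : Fin L.length) : IsFacet L τ σ ↔ τ.1 ∈ facets L σ := by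
  simp [IsFacet, facets, record]

theorem dim_get (i : Fin L.length) : (L.get i).dim = (record L i).dim := by
  simp [record]

theorem lt_length_of_size_pos {i : ℕ} (h : 0 < size L i) : i < L.length := by
  by_contra hc
  simp [size, record, List.getElem?_eq_none (not_lt.1 hc)] at h

/-- The basis element of an abstract cell. -/
def toRaw : LogPathCell (numGrades L) → RawCell
  | .gen i j => .gen i j
  | .rel i e => .rel i e.left e.level
  | .syz i t => .syz i t.left t.level

theorem toRaw_injective : Function.Injective (toRaw (L := L)) := by
  intro c d h
  cases c <;> cases d <;>
    simp only [toRaw, RawCell.gen.injEq, RawCell.rel.injEq, RawCell.syz.injEq, reduceCtorEq] at h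
  · obtain ⟨h1, h2⟩ := h
    obtain rfl := Fin.ext h1
    obtain rfl := Fin.ext h2
    rfl
  · rename_i e _ e'
    obtain ⟨h1, h2, h3⟩ := h
    obtain rfl := Fin.ext h1
    cases e; cases e'
    simp only at h2 h3
    subst h2 h3
    rfl
  · rename_i e _ e'
    obtain ⟨h1, h2, h3⟩ := h
    obtain rfl := Fin.ext h1
    cases e; cases e'
    simp only at h2 h3
    subst h2 h3
    rfl

theorem valid_toRaw (c : LogPathCell (numGrades L)) : (toRaw c).Valid L := by
  cases c with
  | gen i j => exact lt_of_lt_of_eq j.2 (numGrades_eq i)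
  | rel i e => exact ⟨e.dvd, lt_of_lt_of_eq e.lt (numGrades_eq i)⟩
  | syz i t => exact ⟨t.dvd, lt_of_lt_of_eq t.lt (numGrades_eq i)⟩

theorem exists_toRaw {c : RawCell} (hc : c.Valid L) : ∃ d, toRaw (L := L) d = c := by
  cases c with
  | gen i a =>
    have hi : i < L.length := lt_length_of_size_pos (Nat.zero_lt_of_lt hc)
    exact ⟨.gen ⟨i, hi⟩ ⟨a, by rw [numGrades_eq]; exact hc⟩, rfl⟩
  | rel i a r =>
    have hi : i < L.length := lt_length_of_size_pos (Nat.zero_lt_of_lt hc.2)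
    exact ⟨.rel ⟨i, hi⟩ ⟨a, r, hc.1, by rw [numGrades_eq]; exact hc.2⟩, rfl⟩
  | syz i a r =>
    have hi : i < L.length := lt_length_of_size_pos (Nat.zero_lt_of_lt hc.2)
    exact ⟨.syz ⟨i, hi⟩ ⟨a, r, hc.1, by rw [numGrades_eq]; exact hc.2⟩, rfl⟩

include hcs in
theorem exists_cell (c : LogPathCell (numGrades L)) : ∃ d : CellType.{u} cs, rawCell cs d = toRaw c :=
  exists_rawCell hcs (valid_toRaw c)

/-- The bijection between abstract cells and positions in the list of basis elements. -/
noncomputable def cellEquiv : LogPathCell (numGrades L) ≃ CellType.{u} cs :=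
  Equiv.ofBijective (fun c => (exists_cell hcs c).choose) ⟨fun c d h => by
    apply toRaw_injective
    rw [← (exists_cell hcs c).choose_spec, ← (exists_cell hcs d).choose_spec]
    exact congrArg _ h, fun d => by
    obtain ⟨c, hc⟩ := exists_toRaw (valid_rawCell hcs d)
    exact ⟨c, rawCell_injective hn ((exists_cell hcs c).choose_spec.trans hc)⟩⟩

theorem rawCell_cellEquiv (c : LogPathCell (numGrades L)) :
    rawCell cs (cellEquiv.{u} hn hcs c) = toRaw c := (exists_cell hcs c).choose_spec

/-- The bijection between abstract cells and the cells of the log-path complex. -/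
noncomputable def complexCell : LogPathCell (numGrades L) ≃ (complex.{u} hn hcs hL).Cell :=
  cellEquiv hn hcs

theorem dim_complexCell (c : LogPathCell (numGrades L)) :
    (complex.{u} hn hcs hL).dim (complexCell hn hcs hL c) = (toRaw c).dim L :=
  congrArg (RawCell.dim L) (rawCell_cellEquiv hn hcs c)

theorem supp_complexCell (c : LogPathCell (numGrades L)) :
    (complex.{u} hn hcs hL).supp (complexCell hn hcs hL c) = Set.Ici ((toRaw c).degree L) :=
  congrArg (fun c => Set.Ici (RawCell.degree L c)) (rawCell_cellEquiv hn hcs c)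

theorem boundary_complexCell (c d : LogPathCell (numGrades L)) :
    (complex.{u} hn hcs hL).boundary (complexCell hn hcs hL c) (complexCell hn hcs hL d) =
      coeff ((filling hL).diff (toRaw c).toChain) (toRaw d) :=
  congrArg₂ (fun c d : RawCell => coeff ((filling hL).diff c.toChain) d)
    (rawCell_cellEquiv hn hcs c) (rawCell_cellEquiv hn hcs d)

theorem diff_gen (i a : ℕ) : (filling hL).diff (RawCell.gen i a).toChain =
    (f₀ L (single (i, a) 1), h₀ L (single (i, a) 1), (filling hL).g₂ (single (i, a) 1)) := by
  simp [FillingData.diff_apply, toChain, filling]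

theorem diff_rel (i a r : ℕ) : (filling hL).diff (RawCell.rel i a r).toChain =
    (p₁ (single (i, a, r) 1), f₁ L (single (i, a, r) 1),
      (filling hL).h₁ (single (i, a, r) 1)) := by
  simp [FillingData.diff_apply, toChain, filling]

theorem diff_syz (i a r : ℕ) : (filling hL).diff (RawCell.syz i a r).toChain =
    (0, p₂ (single (i, a, r) 1), (filling hL).f₂ (single (i, a, r) 1)) := by
  simp [FillingData.diff_apply, toChain, filling]

theorem f₀_apply (i a : ℕ) (hn : (facets L i).Nodup) (x : ℕ × ℕ) :
    f₀ L (single (i, a) 1) x ≠ 0 ↔ x.1 ∈ facets L i ∧ x.2 = lift L i a x.1 := by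
  classical
  have h := sum_map_single_apply (l := (facets L i).map fun τ => (τ, lift L i a τ))
    (hn.map fun x y h => congrArg Prod.fst h) x
  rw [List.map_map] at h
  rw [f₀_single]
  simp only [Function.comp_def] at h
  rw [h]
  obtain ⟨τ, l⟩ := x
  simp only [List.mem_map, Prod.mk.injEq, ne_eq, ite_eq_right_iff, one_ne_zero, imp_false, not_not]
  constructor
  · rintro ⟨_, h', rfl, rfl⟩; exact ⟨h', rfl⟩
  · rintro ⟨h', rfl⟩; exact ⟨_, h', rfl, rfl⟩

theorem mem_pathEdges {x e : ℕ × ℕ × ℕ} : e ∈ pathEdges x ↔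
    e.1 = x.1 ∧ e.2 ∈ shortestPath (min x.2.1 x.2.2) (max x.2.1 x.2.2) := by
  obtain ⟨i, e⟩ := e
  simp only [pathEdges, List.mem_map, Prod.mk.injEq]
  constructor
  · rintro ⟨_, h, rfl, rfl⟩; exact ⟨rfl, h⟩
  · rintro ⟨rfl, h⟩; exact ⟨_, h, rfl, rfl⟩

include hL in
theorem f₁_apply (i a r : ℕ) (x : ℕ × ℕ × ℕ) : f₁ L (single (i, a, r) 1) x ≠ 0 ↔
    x.1 ∈ facets L i ∧ x ∈ pathEdges (x.1, lift L i a x.1, lift L i (a + 2 ^ r) x.1) := by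
  rw [f₁_single, sum_map_pathChain_apply (nodup_relPaths hL _ _ _), List.mem_flatMap]
  simp only [relPaths, List.mem_map]
  constructor
  · rintro ⟨_, ⟨τ, hτ, rfl⟩, h⟩
    obtain rfl := fst_of_mem_pathEdges h
    exact ⟨hτ, h⟩
  · rintro ⟨hτ, h⟩
    exact ⟨_, ⟨_, hτ, rfl⟩, h⟩

include hL in
theorem h₀_apply (i a : ℕ) (x : ℕ × ℕ × ℕ) : h₀ L (single (i, a) 1) x ≠ 0 ↔
    ∃ τ ∈ facets L i, ∃ τ' ∈ facets L i, τ < τ' ∧ x.1 ∈ facets L τ ∧ x.1 ∈ facets L τ' ∧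
      x ∈ pathEdges (x.1, lift L τ (lift L i a τ) x.1, lift L τ' (lift L i a τ') x.1) := by
  rw [h₀_single, sum_map_pathChain_apply (nodup_genPaths hL _ _), List.mem_flatMap]
  constructor
  · rintro ⟨y, hy, h⟩
    obtain ⟨τ, h1, τ', h2, h3, h4, h5, h6⟩ := mem_genPaths.1 hy
    rw [← fst_of_mem_pathEdges h] at h4 h5 h6
    exact ⟨τ, h1, τ', h2, h3, h4, h5, h6 ▸ h⟩
  · rintro ⟨τ, h1, τ', h2, h3, h4, h5, h6⟩
    exact ⟨(x.1, lift L τ (lift L i a τ) x.1, lift L τ' (lift L i a τ') x.1),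
      mem_genPaths.2 ⟨τ, h1, τ', h2, h3, h4, h5, rfl⟩, h6⟩

/-- The generator of `τ` chosen for the generator `j` of `σ`. -/
noncomputable def liftFin (σ : Fin L.length) (j : Fin (numGrades L σ)) (τ : Fin L.length) :
    Fin (numGrades L τ) :=
  -- The value 0 only makes the function total: for facets the bound always holds. Index 0 exists
  -- because every cell has a generator.
  ⟨if lift L σ j τ < numGrades L τ then lift L σ j τ else 0, by
    split_ifs with h
    · exact h
    · rw [numGrades_eq]; exact hL.size_pos τ τ.2⟩

theorem liftFin_val {σ τ : Fin L.length} (h : τ.1 ∈ facets L σ) (j : Fin (numGrades L σ)) :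
    (liftFin hL σ j τ : ℕ) = lift L σ j τ := by
  have h1 : (j : ℕ) < size L σ := numGrades_eq σ ▸ j.2
  exact if_pos ((hL.lift_spec h h1).1.trans_eq (numGrades_eq τ).symm)

theorem single_add_single_apply {α : Type*} {x y : α} (hxy : x ≠ y) (z : α) :
    (single x (1 : ZMod 2) + single y 1 : α →₀ ZMod 2) z ≠ 0 ↔ z = x ∨ z = y := by
  classical
  rw [Finsupp.add_apply, single_apply, single_apply]
  by_cases h1 : x = z <;> by_cases h2 : y = z <;> simp_all [eq_comm]

/-- The log-path structure on the log-path complex. -/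
noncomputable def logPathStructure : LogPathStructure L (complex.{u} hn hcs hL) where
  cell := complexCell hn hcs hL
  lift := liftFin hL
  lift_le σ j τ h := by
    rw [isFacet_iff] at h
    rw [gradeAt_eq, gradeAt_eq, liftFin_val hL h]
    exact (hL.lift_spec h (numGrades_eq σ ▸ j.2)).2
  dim_gen σ j := by
    rw [dim_complexCell, dim_get]; rfl
  dim_rel σ e := by
    rw [dim_complexCell, dim_get]; rfl
  dim_syz σ t := by
    rw [dim_complexCell, dim_get]; rfl
  supp_gen σ j := by
    rw [supp_complexCell, gradeAt_eq]; rfl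
  supp_rel σ e := by
    rw [supp_complexCell, gradeAt_eq, gradeAt_eq]; rfl
  supp_syz σ t := by
    rw [supp_complexCell, gradeAt_eq, gradeAt_eq]; rfl
  gen_gen σ j τ l := by
    rw [boundary_complexCell, toRaw, toRaw, diff_gen, coeff, f₀_apply _ _ (hL.nodup_facets _),
      isFacet_iff]
    refine and_congr_right fun h => ?_
    rw [Fin.ext_iff, liftFin_val hL h]
  rel_gen_self σ e l := by
    have h0 : 0 < 2 ^ e.level := by positivity
    rw [boundary_complexCell, toRaw, toRaw, diff_rel, coeff, p₁_single, single_add_single_apply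
      (by simp)]
    simp [LogPathEdge.src, LogPathEdge.tgt, Fin.ext_iff]
  rel_gen_of_ne σ e τ l h := by
    have h' : ¬ (τ : ℕ) = σ := fun hc => h (Fin.ext hc)
    rw [boundary_complexCell, toRaw, toRaw, diff_rel, coeff, p₁_single]
    by_contra hc
    rw [← ne_eq, single_add_single_apply (by simp)] at hc
    simp [h'] at hc
  rel_rel σ e τ e' := by
    rw [boundary_complexCell, toRaw, toRaw, diff_rel, coeff, f₁_apply hL, isFacet_iff]
    refine and_congr_right fun h => ?_
    rw [LogPathEdge.OnPath, liftFin_val hL h, liftFin_val hL h, mem_pathEdges]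
    simp [LogPathEdge.src, LogPathEdge.tgt]
  gen_rel σ j ρ e' := by
    rw [boundary_complexCell, toRaw, toRaw, diff_gen, coeff, h₀_apply hL]
    simp only [mem_pathEdges, isFacet_iff, true_and]
    constructor
    · rintro ⟨τ, h1, τ', h2, h3, h4, h5, h6⟩
      refine ⟨⟨τ, hL.facets_lt _ _ h1⟩, ⟨τ', hL.facets_lt _ _ h2⟩, fun h => ?_, h1, h2, h4, h5, ?_⟩
      · simp only [Fin.mk.injEq] at h
        omega
      · rw [LogPathEdge.OnPath, liftFin_val hL (τ := ρ) h4, liftFin_val hL (τ := ρ) h5,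
          liftFin_val hL h1, liftFin_val hL h2]
        exact h6
    · rintro ⟨τ, τ', hne, h1, h2, h4, h5, h6⟩
      rw [LogPathEdge.OnPath, liftFin_val hL h4, liftFin_val hL h5, liftFin_val hL h1,
          liftFin_val hL h2] at h6
      -- The pair of facets is unordered in the specification and increasing in `h₀`. Exchanging the
      -- two does not change the path between the two lifts.
      rcases lt_or_gt_of_ne (fun h => hne (Fin.ext h) : (τ : ℕ) ≠ τ') with h | h
      · exact ⟨τ, h1, τ', h2, h, h4, h5, h6⟩
      · exact ⟨τ', h2, τ, h1, h, h5, h4, by rwa [min_comm, max_comm]⟩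
  syz_gen σ t τ l := by
    rw [boundary_complexCell, toRaw, toRaw, diff_syz, coeff]; rfl
  syz_rel_self σ t e' := by
    classical
    obtain ⟨a, r, h1, h2⟩ := t
    obtain ⟨b, s, h3, h4⟩ := e'
    have h0 : 0 < 2 ^ r := by positivity
    rw [boundary_complexCell, toRaw, toRaw, diff_syz, coeff, p₂_single]
    simp only [Finsupp.add_apply, single_apply, Prod.mk.injEq, true_and, LogPathTriangle.HasEdge]
    by_cases c1 : b = a ∧ s = r
    · obtain ⟨rfl, rfl⟩ := c1
      simp
    · by_cases c2 : b = a + 2 ^ r ∧ s = r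
      · obtain ⟨rfl, rfl⟩ := c2
        simp
      · by_cases c3 : b = a ∧ s = r + 1
        · obtain ⟨rfl, rfl⟩ := c3
          simp
        · rw [if_neg (by omega), if_neg (by omega), if_neg (by omega)]
          simp only [add_zero, ne_eq, not_true_eq_false, false_iff]
          omega
  syz_rel_of_ne σ t τ e' h := by
    classical
    have h' : ¬ (σ : ℕ) = τ := fun hc => h (Fin.ext hc.symm)
    rw [boundary_complexCell, toRaw, toRaw, diff_syz, coeff, p₂_single]
    simp [h']

end Complex

end LogPath

namespace LogPath

open Finsupp RawCell

variable {L : List CellRecord}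

/-! ### The resolution -/

section Resolution

theorem exists_grade_le (X : BifilteredComplex.{u}) (x : X.Cell) {s : ℕ × ℕ} (hs : s ∈ X.supp x) :
    ∃ t ∈ X.grades x, t ≤ s := by
  obtain ⟨t, h1, h2⟩ := exists_minimal_le_of_wellFoundedLT (· ∈ X.supp x) s hs
  exact ⟨t, h2, h1⟩

/-- The chosen bijection between positions and cells describes `X`. -/
def Describes (L : List CellRecord) (X : BifilteredComplex.{u}) (e : Fin L.length ≃ X.Cell) : Prop :=
  ∀ i : Fin L.length,
    (L.get i).dim = X.dim (e i) ∧
    (L.get i).grades.Pairwise (fun s t => toLex s < toLex t) ∧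
    (∀ s, s ∈ (L.get i).grades ↔ s ∈ X.grades (e i)) ∧
    (L.get i).facets.Nodup ∧
    ∀ j : ℕ, j ∈ (L.get i).facets ↔ ∃ h : j < L.length, X.boundary (e i) (e ⟨j, h⟩) ≠ 0

variable {X : BifilteredComplex.{u}} {e : Fin L.length ≃ X.Cell} (hX : Describes L X e)

theorem record_of_lt {i : ℕ} (h : i < L.length) : record L i = L.get ⟨i, h⟩ := by
  simp [record, List.getElem?_eq_getElem h]

theorem record_of_le {i : ℕ} (h : L.length ≤ i) : record L i = ⟨0, [], []⟩ := by
  simp [record, List.getElem?_eq_none h]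

theorem grade_mem {i a : ℕ} (h : a < size L i) : grade L i a ∈ (record L i).grades := by
  rw [grade, List.getD_eq_getElem _ _ h]
  exact List.getElem_mem _

theorem exists_grade_eq {i : ℕ} {s : ℕ × ℕ} (h : s ∈ (record L i).grades) :
    ∃ a < size L i, grade L i a = s := by
  obtain ⟨a, ha, rfl⟩ := List.getElem_of_mem h
  exact ⟨a, ha, List.getD_eq_getElem _ _ ha⟩

include hX

theorem Describes.mem_facets {i : ℕ} (hi : i < L.length) {j : ℕ} :
    j ∈ facets L i ↔ ∃ h : j < L.length, X.boundary (e ⟨i, hi⟩) (e ⟨j, h⟩) ≠ 0 := by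
  rw [facets, record_of_lt hi]
  exact (hX ⟨i, hi⟩).2.2.2.2 j

theorem Describes.facets_lt {i j : ℕ} (h : j ∈ facets L i) : j < L.length ∧ i < L.length := by
  by_cases hi : i < L.length
  · exact ⟨((hX.mem_facets hi).1 h).1, hi⟩
  · simp [facets, record_of_le (not_lt.1 hi)] at h

theorem Describes.nodup_facets (i : ℕ) : (facets L i).Nodup := by
  by_cases hi : i < L.length
  · rw [facets, record_of_lt hi]
    exact (hX ⟨i, hi⟩).2.2.2.1
  · simp [facets, record_of_le (not_lt.1 hi)]

theorem Describes.mem_grades {i : ℕ} (hi : i < L.length) {s : ℕ × ℕ} :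
    s ∈ X.grades (e ⟨i, hi⟩) ↔ ∃ a < size L i, grade L i a = s := by
  rw [← (hX ⟨i, hi⟩).2.2.1, ← record_of_lt hi]
  exact ⟨exists_grade_eq, by rintro ⟨a, ha, rfl⟩; exact grade_mem ha⟩

theorem Describes.mem_supp {i : ℕ} (hi : i < L.length) {s : ℕ × ℕ} :
    s ∈ X.supp (e ⟨i, hi⟩) ↔ ∃ a < size L i, grade L i a ≤ s := by
  constructor
  · intro h
    obtain ⟨t, ht, hts⟩ := exists_grade_le X _ h
    obtain ⟨a, ha, rfl⟩ := (hX.mem_grades hi).1 ht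
    exact ⟨a, ha, hts⟩
  · rintro ⟨a, ha, h⟩
    exact X.isUpperSet_supp _ h ((hX.mem_grades hi).2 ⟨a, ha, rfl⟩).1

/-- Comparable minimal grades are equal, while the lexicographic order of the list is strict.
Together these give the staircase shape used in the next two lemmas. -/
theorem Describes.not_grade_le {i a b : ℕ} (hab : a < b) (hb : b < size L i) :
    ¬ grade L i a ≤ grade L i b ∧ toLex (grade L i a) < toLex (grade L i b) := by
  have hi : i < L.length := lt_length_of_size_pos (Nat.zero_lt_of_lt hb)
  have h1 : toLex (grade L i a) < toLex (grade L i b) := by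
    have h := (hX ⟨i, hi⟩).2.1
    rw [← record_of_lt hi, List.pairwise_iff_getElem] at h
    have := h a b (hab.trans hb) hb hab
    rwa [grade, grade, List.getD_eq_getElem _ _ hb, List.getD_eq_getElem _ _ (hab.trans hb)]
  refine ⟨fun hle => ?_, h1⟩
  have ha := (hX.mem_grades hi).2 ⟨a, hab.trans hb, rfl⟩
  have hb' := (hX.mem_grades hi).2 ⟨b, hb, rfl⟩
  have := hb'.2 ha.1 hle
  rw [le_antisymm hle this] at h1
  exact lt_irrefl _ h1

theorem Describes.fst_lt {i a b : ℕ} (hab : a < b) (hb : b < size L i) :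
    (grade L i a).1 < (grade L i b).1 := by
  obtain ⟨h1, h2⟩ := hX.not_grade_le hab hb
  rw [Prod.Lex.toLex_lt_toLex] at h2
  rcases h2 with h2 | h2
  · exact h2
  · exact absurd ⟨h2.1.le, h2.2.le⟩ h1

theorem Describes.snd_lt {i a b : ℕ} (hab : a < b) (hb : b < size L i) :
    (grade L i b).2 < (grade L i a).2 := by
  by_contra h
  exact (hX.not_grade_le hab hb).1 ⟨(hX.fst_lt hab hb).le, not_lt.1 h⟩

omit hX in
variable (e) in
/-- The augmentation from the generators to the chains of `X`. -/
noncomputable def augmentation : GenChain →ₗ[ZMod 2] (X.Cell →₀ ZMod 2) :=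
  linearCombination (ZMod 2) fun v => if h : v.1 < L.length then single (e ⟨v.1, h⟩) 1 else 0

omit hX in
theorem augmentation_single {i a : ℕ} (h : i < L.length) :
    augmentation e (single (i, a) 1) = single (e ⟨i, h⟩) 1 := by
  simp [augmentation, h]

omit hX in
theorem augmentation_p₁ (x : EdgeChain) : augmentation e (p₁ x) = 0 := by
  refine apply_eq_of_single (f := augmentation e ∘ₗ p₁) (g := 0) (fun t => ?_) x
  simp [p₁, augmentation, ZModModule.add_self]

/-- The augmentation forgets which generator of a facet was chosen, so only the simplicial boundary
remains. -/
theorem augmentation_f₀ (x : GenChain) :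
    augmentation e (f₀ L x) = X.boundaryMap (augmentation e x) := by
  refine apply_eq_of_single (f := augmentation e ∘ₗ f₀ L) (g := X.boundaryMap ∘ₗ augmentation e)
    (fun t => ?_) x
  obtain ⟨i, a⟩ := t
  rw [LinearMap.comp_apply, LinearMap.comp_apply, f₀_single, map_list_sum, List.map_map]
  by_cases hi : i < L.length
  · rw [augmentation_single hi, BifilteredComplex.boundaryMap, linearCombination_single, one_smul]
    classical
    ext y
    obtain ⟨⟨j, hj⟩, rfl⟩ := e.surjective y
    -- Cells are replaced by their positions, so that the coefficient counts how often `j` occurs in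
    -- the list of facets.
    have h1 : (List.map (augmentation e ∘ fun τ => single (τ, lift L i a τ) 1) (facets L i)).sum
        (e ⟨j, hj⟩) = ((facets L i).map fun τ => single τ (1 : ZMod 2)).sum j := by
      have hlt : ∀ τ ∈ facets L i, τ < L.length := fun τ h => (hX.facets_lt h).1
      revert hlt
      generalize facets L i = l
      intro hlt
      induction l with
      | nil => simp
      | cons τ l ih =>
        have hτ := hlt τ (by simp)
        rw [List.map_cons, List.sum_cons, Finsupp.add_apply, ih fun x h => hlt x (by simp [h]),
          List.map_cons, List.sum_cons, Finsupp.add_apply, Function.comp_apply,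
          augmentation_single hτ, single_apply, single_apply]
        simp
    rw [h1, sum_map_single_apply (hX.nodup_facets i)]
    have h2 := hX.mem_facets hi (j := j)
    -- The description of `X` only says which coefficients are nonzero; over the field with two
    -- elements these are equal to 1.
    split_ifs with h
    · obtain ⟨_, h3⟩ := h2.1 h
      revert h3
      generalize X.boundary (e ⟨i, hi⟩) (e ⟨j, hj⟩) = k
      revert k
      decide
    · by_contra hc
      exact h (h2.2 ⟨hj, Ne.symm hc⟩)
  · simp [facets, record_of_le (not_lt.1 hi), augmentation, hi]

omit hX in
variable (e) in
/-- The map that sends a cell to its first generator. -/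
noncomputable def firstGenerator : (X.Cell →₀ ZMod 2) →ₗ[ZMod 2] GenChain :=
  linearCombination (ZMod 2) fun x => single ((e.symm x : ℕ), 0) 1

omit hX in
-- Both maps record the parity of the number of generators over each simplex. So the kernel of the
-- augmentation satisfies the hypothesis of `u_mem`.
theorem collapse_eq {n : ℤ} {s : ℕ × ℕ} {x : GenChain} (hx : x ∈ genChains L n s) :
    collapse x = firstGenerator e (augmentation e x) := by
  have : collapse x + firstGenerator e (augmentation e x) ∈ (⊥ : Submodule (ZMod 2) GenChain) := by
    refine map_mem_of_single (f := collapse + firstGenerator e ∘ₗ augmentation e) (fun v hv => ?_) hx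
    obtain ⟨i, a⟩ := v
    have hi : i < L.length := lt_length_of_size_pos (Nat.zero_lt_of_lt hv.2.1)
    rw [Submodule.mem_bot, LinearMap.add_apply, LinearMap.comp_apply, augmentation_single hi]
    simp [collapse, firstGenerator, ZModModule.add_self]
  exact FillingData.eq_of_add_eq_zero this

theorem augmentation_mem {n : ℕ} {s : ℕ × ℕ} {x : GenChain} (hx : x ∈ genChains L n s) :
    augmentation e x ∈ X.chains n s := by
  refine map_mem_of_single (fun v hv => ?_) hx
  obtain ⟨i, a⟩ := v
  obtain ⟨h1, h2, h3⟩ := hv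
  have hi : i < L.length := lt_length_of_size_pos (Nat.zero_lt_of_lt h2)
  rw [augmentation_single hi]
  refine single_mem_supported _ _ ⟨?_, (hX.mem_supp hi).2 ⟨a, h2, h3⟩⟩
  have := (hX ⟨i, hi⟩).1
  rw [← record_of_lt hi] at this
  simp only at h1
  omega

variable {cs : List RawCell} (hn : cs.Nodup) (hcs : ∀ c, c ∈ cs ↔ c.Valid L) (hL : Admissible L)

/-- The augmentation is surjective at each grade because a cell is present exactly when one of its
generators is. Its kernel is acyclic by the explicit contraction. -/
theorem isFreeResolution_complex : IsFreeResolution (complex.{u} hn hcs hL) X := by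
  refine ⟨isFree_complex hn hcs hL, ?_⟩
  set F := complex.{u} hn hcs hL with hF
  set E : (F.Cell →₀ ZMod 2) →ₗ[ZMod 2] Chains := embed cs with hE
  have hm : ∀ (n : ℕ) s (x : F.Cell →₀ ZMod 2), x ∈ F.chains n s ↔ E x ∈ RawCell.chains L n s :=
    fun n s x => mem_complex_chains hn hcs hL
  have hr : ∀ (n : ℤ) s (y : Chains), y ∈ RawCell.chains L n s → ∃ x : F.Cell →₀ ZMod 2, E x = y :=
    fun n s y hy => ⟨restrict cs y, embed_restrict hn hcs hy⟩
  have hb : ∀ x : F.Cell →₀ ZMod 2, E (F.boundaryMap x) = (filling hL).diff (E x) :=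
    embed_boundaryMap hn hcs hL
  have hinj : Function.Injective E := embed_injective hn
  clear hE
  clear_value E
  clear hF
  clear_value F
  set ψ : (F.Cell →₀ ZMod 2) →ₗ[ZMod 2] (X.Cell →₀ ZMod 2) :=
    augmentation e ∘ₗ LinearMap.fst _ _ _ ∘ₗ E with hψ
  have hψ' : ∀ v, ψ v = augmentation e (E v).1 := fun v => rfl
  clear_value ψ
  have h1 : ∀ n s, ∀ x ∈ F.chains n s, ψ x ∈ X.chains n s := fun n s x hx => by
    rw [hm] at hx
    rw [hψ']
    exact augmentation_mem hX hx.1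
  have h2 : ∀ x, ψ (F.boundaryMap x) = X.boundaryMap (ψ x) := fun x => by
    rw [hψ', hψ', hb, FillingData.diff_apply, map_add]
    change augmentation e (f₀ L _) + augmentation e (p₁ _) = _
    rw [augmentation_p₁, add_zero, augmentation_f₀ hX]
  refine ⟨BifilteredComplex.homOfLinearMap ψ h1 h2,
    BifilteredComplex.quasiIso_homOfLinearMap ψ h1 h2 ?_ ?_⟩
  · intro n s z hz
    -- Surjectivity need only be checked on cells: a cell present at `s` is the image of one of its
    -- generators present at `s`.
    have : X.chains n s ≤ (F.chains n s).map ψ := by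
      rw [BifilteredComplex.chains, supported_eq_span_single, Submodule.span_le]
      rintro _ ⟨y, ⟨h1, h2⟩, rfl⟩
      obtain ⟨⟨i, hi⟩, rfl⟩ := e.surjective y
      obtain ⟨a, ha, has⟩ := (hX.mem_supp hi).1 h2
      have hd := (hX ⟨i, hi⟩).1
      rw [← record_of_lt hi] at hd
      have hv : RawCell.toChain (.gen i a) ∈ RawCell.chains L n s :=
        toChain_mem (c := .gen i a) ha (congrArg Nat.cast (hd.trans h1)) has
      obtain ⟨x, hx⟩ := hr _ _ _ hv
      refine ⟨x, (hm _ _ _).2 (hx ▸ hv), ?_⟩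
      rw [hψ', hx]
      exact augmentation_single hi
    obtain ⟨x, hx, hxz⟩ := this hz
    exact ⟨x, hx, hxz⟩
  · intro n s x hx hx0 hdx
    rw [hm] at hx
    -- Vanishing of the augmentation removes the correction term in `p₁ u = 1 + collapse`, which is
    -- what the contraction needs.
    have hx1 : collapse (E x).1 = 0 := by
      rw [collapse_eq (e := e) hx.1, ← hψ', hx0, map_zero]
    have hd : (filling hL).diff (E x) = 0 := by
      rw [← hb, hdx, map_zero]
    have hu : (filling hL).p₁ ((filling hL).u (E x).1) = (E x).1 := by
      change p₁ (u _) = _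
      rw [p₁_u, hx1, add_zero]
    have hy := (filling hL).diff_contraction hd hu
    set y : Chains := (0, (filling hL).u (E x).1,
      (filling hL).q ((E x).2.1 + (filling hL).f₁ ((filling hL).u (E x).1))) with hy'
    have hu1 : (filling hL).u (E x).1 ∈ relChains L (n + 1) s := u_mem hL hx.1 hx1
    have hu2 : (filling hL).f₁ ((filling hL).u (E x).1) ∈ relChains L n s := by
      have := f₁_mem hL hu1
      rwa [add_sub_cancel_right] at this
    have hmem : y ∈ RawCell.chains L ((n + 1 : ℕ) : ℤ) s := by
      rw [Nat.cast_add, Nat.cast_one]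
      exact ⟨Submodule.zero_mem _, hu1, q_mem hL (Submodule.add_mem _ hx.2.1 hu2)⟩
    obtain ⟨w, hw⟩ := hr _ _ _ hmem
    refine ⟨w, (hm _ _ _).2 (hw ▸ hmem), ?_, ?_⟩
    · rw [hψ', hw, hy']
      exact map_zero _
    · apply hinj
      rw [hb, hw, hy]

end Resolution

end LogPath

namespace LogPath

open Finsupp

/-! ### Descriptions of simplicial bifiltrations are admissible -/

section Simplicial

variable {V : Type u} {B : SimplicialBifiltration V} {L : List CellRecord}
  {e : Fin L.length ≃ B.toBifilteredComplex.Cell}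

open Classical in
-- Deleting different vertices gives different facets, so no terms of the simplicial boundary
-- cancel.
theorem simplexBoundary_apply (σ τ : {σ // σ ∈ B.complex}) :
    B.simplexBoundary σ.1 τ ≠ 0 ↔ ∃ v ∈ σ.1, σ.1.erase v = τ.1 := by
  constructor
  · intro h
    obtain ⟨v, hv, h⟩ := B.exists_of_mem_support (mem_support_iff.2 h)
    exact ⟨v, hv, h.symm⟩
  · rintro ⟨v, hv, h⟩
    rw [SimplicialBifiltration.simplexBoundary, finsetSum_apply, Finset.sum_eq_single v]
    · have hm : σ.1.erase v ∈ B.complex := h ▸ τ.2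
      rw [SimplicialBifiltration.basisChain, dif_pos hm]
      have : τ = ⟨σ.1.erase v, hm⟩ := Subtype.ext h.symm
      rw [this, single_eq_same]
      exact one_ne_zero
    · intro w hw hwv
      rw [SimplicialBifiltration.basisChain]
      split_ifs with hm
      · refine single_eq_of_ne fun hc => hwv ?_
        have hc' : σ.1.erase v = σ.1.erase w := h.trans (congrArg Subtype.val hc)
        by_contra hne
        have : w ∈ σ.1.erase v := Finset.mem_erase.2 ⟨hne, hw⟩
        rw [hc'] at this
        simp at this
      · rfl
    · intro h'
      exact absurd hv h'

variable (hX : Describes L B.toBifilteredComplex e)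

include hX

open Classical in
theorem Describes.mem_facets_iff {i j : ℕ} (hi : i < L.length) : j ∈ facets L i ↔
    ∃ hj : j < L.length, ∃ v ∈ (e ⟨i, hi⟩).1, (e ⟨i, hi⟩).1.erase v = (e ⟨j, hj⟩).1 := by
  rw [hX.mem_facets hi]
  exact exists_congr fun hj => simplexBoundary_apply _ _

open Classical in
-- If `ρ` arises from `σ` by deleting `v` and then `w`, the facets in between are `σ` without `v`
-- and `σ` without `w`; the latter is a simplex because it still contains `v`.
theorem Describes.card_between (i ρ : ℕ) :
    ((facets L i).toFinset.filter fun τ => ρ ∈ facets L τ).card = 0 ∨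
      ((facets L i).toFinset.filter fun τ => ρ ∈ facets L τ).card = 2 := by
  rw [or_iff_not_imp_left, ← ne_eq, Finset.card_ne_zero]
  rintro ⟨a, ha⟩
  rw [Finset.mem_filter, List.mem_toFinset] at ha
  obtain ⟨ha, hρ⟩ := ha
  obtain ⟨hal, hi⟩ := hX.facets_lt ha
  have hρl := (hX.facets_lt hρ).1
  obtain ⟨_, v, hv, hav⟩ := (hX.mem_facets_iff hi).1 ha
  obtain ⟨_, w, hw, hρw⟩ := (hX.mem_facets_iff hal).1 hρ
  set σ := (e ⟨i, hi⟩).1 with hσ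
  rw [← hav] at hw hρw
  have hwv : w ≠ v := (Finset.mem_erase.1 hw).1
  have hwσ : w ∈ σ := (Finset.mem_erase.1 hw).2
  have hmem : σ.erase w ∈ B.complex :=
    (B.complex.isRelLowerSet_faces (e ⟨i, hi⟩).2).2 (Finset.erase_subset _ _)
      ⟨v, Finset.mem_erase.2 ⟨hwv.symm, hv⟩⟩
  obtain ⟨⟨b, hb⟩, hbe⟩ := e.surjective ⟨σ.erase w, hmem⟩
  have hbe' : (e ⟨b, hb⟩).1 = σ.erase w := congrArg Subtype.val hbe
  have hab : a ≠ b := by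
    rintro rfl
    rw [← hav] at hbe'
    have : w ∈ σ.erase v := hw
    rw [hbe'] at this
    simp at this
  rw [Finset.card_eq_two]
  refine ⟨a, b, hab, ?_⟩
  ext c
  rw [Finset.mem_filter, List.mem_toFinset, Finset.mem_insert, Finset.mem_singleton]
  constructor
  · rintro ⟨hc, hc'⟩
    obtain ⟨hcl, x, hx, hcx⟩ := (hX.mem_facets_iff hi).1 hc
    obtain ⟨_, y, hy, hcy⟩ := (hX.mem_facets_iff hcl).1 hc'
    rw [← hσ] at hx hcx
    -- A facet that contains `ρ` omits a vertex outside `ρ`, and the only vertices of `σ` outside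
    -- `ρ` are `v` and `w`.
    have hxρ : x ∉ (σ.erase v).erase w := by
      rw [hρw, ← hcy, ← hcx]
      simp
    have hxvw : x = v ∨ x = w := by
      by_contra hne
      rw [not_or] at hne
      exact hxρ (by simp [hne.1, hne.2, hx])
    rcases hxvw with rfl | rfl
    · left
      have := e.injective (Subtype.ext (hcx.symm.trans hav))
      exact congrArg Fin.val this
    · right
      have := e.injective (Subtype.ext (hcx.symm.trans hbe'.symm))
      exact congrArg Fin.val this
  · rintro (rfl | rfl)
    · exact ⟨ha, hρ⟩
    · refine ⟨(hX.mem_facets_iff hi).2 ⟨hb, w, hwσ, hbe'.symm⟩,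
        (hX.mem_facets_iff hb).2 ⟨hρl, v, ?_, ?_⟩⟩
      · rw [hbe']
        exact Finset.mem_erase.2 ⟨hwv.symm, hv⟩
      · rw [hbe', ← hρw, Finset.erase_right_comm]

theorem Describes.admissible : Admissible L where
  facets_lt i j h := (hX.facets_lt h).1
  nodup_facets := hX.nodup_facets
  dim_facets i j h := by
    obtain ⟨hj, hi⟩ := hX.facets_lt h
    obtain ⟨_, hne⟩ := (hX.mem_facets hi).1 h
    have h1 := (hX ⟨i, hi⟩).1
    have h2 := (hX ⟨j, hj⟩).1
    have h3 := B.toBifilteredComplex.dim_boundary _ _ (mem_support_iff.2 hne)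
    rw [← record_of_lt] at h1 h2
    rw [h1, h2, h3]
  size_pos i hi := by
    -- Every simplex appears at some grade, so its support is nonempty and has a minimal element.
    obtain ⟨s, hs⟩ := B.exhaustive _ (e ⟨i, hi⟩).2
    obtain ⟨a, ha, -⟩ := (hX.mem_supp hi (s := s)).1 hs
    exact Nat.zero_lt_of_lt ha
  fst_lt i a b hab hb := hX.fst_lt hab hb
  snd_lt i a b hab hb := hX.snd_lt hab hb
  exists_le i j h a ha := by
    obtain ⟨hj, hi⟩ := hX.facets_lt h
    obtain ⟨_, hne⟩ := (hX.mem_facets hi).1 h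
    have h3 := B.toBifilteredComplex.supp_boundary _ _ (mem_support_iff.2 hne)
    exact (hX.mem_supp hj).1 (h3 ((hX.mem_supp hi).2 ⟨a, ha, le_rfl⟩))
  card_between i ρ := by
    have := hX.card_between i ρ
    convert this

/-- Facets correspond to deleted vertices, of which there are at most `d + 1`. This number is the
parameter `D` of all later bounds. -/
theorem Describes.length_facets_le {d : ℕ} (hd : B.DimLE d) (i : ℕ) :
    (facets L i).length ≤ d + 1 := by
  classical
  by_cases hi : i < L.length
  · refine le_trans ?_ (hd _ (e ⟨i, hi⟩).2)
    rw [← List.toFinset_card_of_nodup (hX.nodup_facets i)]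
    refine le_trans ?_ (Finset.card_image_le (s := (e ⟨i, hi⟩).1) (f := (e ⟨i, hi⟩).1.erase))
    refine Finset.card_le_card_of_injOn
      (fun j => if hj : j < L.length then (e ⟨j, hj⟩).1 else ∅) ?_ ?_
    · intro j hj
      rw [Finset.mem_coe, List.mem_toFinset, hX.mem_facets_iff hi] at hj
      obtain ⟨hj, v, hv, h⟩ := hj
      simp only [dif_pos hj]
      exact Finset.mem_coe.2 (Finset.mem_image.2 ⟨v, hv, h⟩)
    · intro j hj k hk h
      rw [Finset.mem_coe, List.mem_toFinset] at hj hk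
      simp only [dif_pos (hX.facets_lt hj).1, dif_pos (hX.facets_lt hk).1] at h
      exact congrArg Fin.val (e.injective (Subtype.ext h))
  · simp [facets, record_of_le (not_lt.1 hi)]

theorem Describes.size_le {k : ℕ} (hk : B.IsCritical k) (i : ℕ) : size L i ≤ k := by
  classical
  by_cases hi : i < L.length
  · have h1 := hk _ (e ⟨i, hi⟩).2
    have h2 : B.grades (e ⟨i, hi⟩).1 = ((record L i).grades.toFinset : Set (ℕ × ℕ)) := by
      ext s
      rw [Finset.mem_coe, List.mem_toFinset, record_of_lt hi, (hX ⟨i, hi⟩).2.2.1]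
      rfl
    have h3 : (record L i).grades.Nodup := by
      have := (hX ⟨i, hi⟩).2.1
      rw [← record_of_lt hi] at this
      exact this.imp fun h => by rintro rfl; exact lt_irrefl _ h
    rw [h2, Set.encard_coe_eq_coe_finsetCard, List.toFinset_card_of_nodup h3] at h1
    exact_mod_cast h1
  · simp [size, record_of_le (not_lt.1 hi)]

end Simplicial

end LogPath

namespace LogPath

open Finsupp

/-! ### The list of basis elements -/

section Enumeration

variable (L : List CellRecord)

/-- The relation from `b * 2 ^ r` to `(b + 1) * 2 ^ r`, followed by the syzygy of which it is the
longest edge. -/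
def edgeCells (i r b : ℕ) : List RawCell :=
  .rel i (b * 2 ^ r) r :: if r = 0 then [] else [.syz i (b * 2 ^ r) (r - 1)]

/-- The relations of level `r` and their syzygies, for a cell with `m` generators. -/
def levelCells (i m r : ℕ) : List RawCell :=
  (List.range ((m - 1) / 2 ^ r)).flatMap (edgeCells i r)

/-- The basis elements that belong to the cell `i`. -/
def block (i : ℕ) : List RawCell :=
  (List.range (size L i)).map (RawCell.gen i) ++
    (List.range (Nat.clog 2 (size L i))).flatMap (levelCells i (size L i))

/-- All basis elements of the log-path complex. -/
def cells : List RawCell := (List.range L.length).flatMap (block L)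

/-- The position of a basis element. -/
def idx (c : RawCell) : ℕ := (cells L).idxOf c

end Enumeration

/-- The cell to which a basis element belongs. -/
def RawCell.index : RawCell → ℕ
  | gen i _ => i
  | rel i _ _ => i
  | syz i _ _ => i

variable {L : List CellRecord}

/-- The largest vertex is `m - 1`, so the quotient counts the dyadic intervals of length `2 ^ r`
that fit. -/
theorem lt_div_iff_edge {m r b : ℕ} : b < (m - 1) / 2 ^ r ↔ b * 2 ^ r + 2 ^ r < m := by
  have : 0 < 2 ^ r := by positivity
  rw [Nat.lt_iff_add_one_le, Nat.le_div_iff_mul_le this, add_one_mul]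
  omega

theorem mem_edgeCells {i r b : ℕ} {c : RawCell} : c ∈ edgeCells i r b ↔
    c = .rel i (b * 2 ^ r) r ∨ (r ≠ 0 ∧ c = .syz i (b * 2 ^ r) (r - 1)) := by
  rw [edgeCells, List.mem_cons]
  split_ifs with h <;> simp [h]

theorem mem_block {i : ℕ} {c : RawCell} : c ∈ block L i ↔ c.index = i ∧ c.Valid L := by
  simp only [block, levelCells, List.mem_append, List.mem_map, List.mem_flatMap, List.mem_range,
    mem_edgeCells, lt_div_iff_edge]
  constructor
  · rintro (⟨a, ha, rfl⟩ | ⟨r, h1, b, h2, rfl | ⟨h3, rfl⟩⟩)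
    · exact ⟨rfl, ha⟩
    · exact ⟨rfl, Dvd.intro_left _ rfl, h2⟩
    · obtain ⟨r, rfl⟩ := Nat.exists_eq_succ_of_ne_zero h3
      exact ⟨rfl, Dvd.intro_left _ rfl, h2⟩
  · rintro ⟨rfl, hc⟩
    cases c with
    | gen i a => exact Or.inl ⟨a, hc, rfl⟩
    | rel i a r =>
      obtain ⟨⟨b, rfl⟩, h⟩ := hc
      -- The levels below the rounded-up logarithm of the number of vertices are those with `2 ^ r`
      -- smaller than that number, and an edge of level `r` forces this.
      refine Or.inr ⟨r, (Nat.lt_clog_iff_pow_lt (by norm_num)).2 ?_, b, ?_,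
        Or.inl (by rw [mul_comm]; rfl)⟩
      · simp only [RawCell.index]; omega
      · rw [mul_comm]; exact h
    | syz i a r =>
      obtain ⟨⟨b, rfl⟩, h⟩ := hc
      refine Or.inr ⟨r + 1, (Nat.lt_clog_iff_pow_lt (by norm_num)).2 ?_, b, ?_,
        Or.inr ⟨by omega, by rw [mul_comm]; rfl⟩⟩
      · simp only [RawCell.index]; omega
      · rw [mul_comm]; exact h

theorem RawCell.Valid.index_lt {c : RawCell} (hc : c.Valid L) : c.index < L.length := by
  cases c with
  | gen i a => exact lt_length_of_size_pos (Nat.zero_lt_of_lt hc)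
  | rel i a r => exact lt_length_of_size_pos (Nat.zero_lt_of_lt hc.2)
  | syz i a r => exact lt_length_of_size_pos (Nat.zero_lt_of_lt hc.2)

theorem mem_cells {c : RawCell} : c ∈ cells L ↔ c.Valid L := by
  simp only [cells, List.mem_flatMap, List.mem_range, mem_block]
  exact ⟨fun ⟨_, _, _, h⟩ => h, fun h => ⟨_, h.index_lt, rfl, h⟩⟩

theorem nodup_block (i : ℕ) : (block L i).Nodup := by
  refine List.Nodup.append (List.nodup_range.map fun a b h => by simpa using h) ?_ ?_
  · rw [List.nodup_flatMap]
    constructor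
    · intro r _
      rw [levelCells, List.nodup_flatMap]
      constructor
      · intro b _
        rw [edgeCells]
        split_ifs <;> simp
      · refine List.nodup_range.imp fun {b b'} h => ?_
        intro c hc hc'
        have : 2 ^ r ≠ 0 := by positivity
        rcases mem_edgeCells.1 hc with rfl | ⟨_, rfl⟩ <;> simp [mem_edgeCells, h] at hc'
    · refine List.nodup_range.imp fun {r r'} h => ?_
      intro c hc hc'
      obtain ⟨b, _, hc⟩ := List.mem_flatMap.1 hc
      obtain ⟨b', _, hc'⟩ := List.mem_flatMap.1 hc'
      rcases mem_edgeCells.1 hc with rfl | ⟨_, rfl⟩ <;> simp [mem_edgeCells] at hc' <;> omega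
  · intro c hc hc'
    obtain ⟨a, _, rfl⟩ := List.mem_map.1 hc
    simp [levelCells, mem_edgeCells] at hc'

theorem nodup_cells : (cells L).Nodup := by
  rw [cells, List.nodup_flatMap]
  refine ⟨fun i _ => nodup_block i, List.nodup_range.imp fun {i j} h => ?_⟩
  intro c hc hc'
  exact h ((mem_block.1 hc).1.symm.trans (mem_block.1 hc').1)

theorem idx_lt {c : RawCell} (hc : c.Valid L) : idx L c < (cells L).length :=
  List.idxOf_lt_length_of_mem (mem_cells.2 hc)

theorem getElem_idx {c : RawCell} (hc : c.Valid L) : (cells L)[idx L c]'(idx_lt hc) = c :=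
  List.getElem_idxOf _

theorem idx_getElem {n : ℕ} (hn : n < (cells L).length) : idx L (cells L)[n] = n :=
  nodup_cells.idxOf_getElem n hn

theorem idx_injOn {c d : RawCell} (hc : c.Valid L) (hd : d.Valid L) (h : idx L c = idx L d) : c = d := by
  rw [← getElem_idx hc, ← getElem_idx hd]
  simp only [h]

theorem idx_eq_of_append {l l' : List RawCell} {c : RawCell} (h : cells L = l ++ c :: l') :
    idx L c = l.length := by
  have h1 : l.length < (cells L).length := by rw [h]; simp
  have h2 : (cells L)[l.length] = c := by simp [h]
  rw [← h2, idx_getElem]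

/-- The position of the first generator of a cell. -/
def blockStart (L : List CellRecord) (i : ℕ) : ℕ := ((List.range i).flatMap (block L)).length

theorem cells_eq {i : ℕ} (hi : i < L.length) : ∃ l, cells L =
    (List.range i).flatMap (block L) ++ (block L i ++ l) := by
  obtain ⟨n, h⟩ := Nat.exists_eq_add_of_le hi
  rw [cells, h, List.range_add, List.range_succ]
  simp only [List.flatMap_append, List.flatMap_cons, List.flatMap_nil, List.append_nil,
    List.append_assoc]
  exact ⟨_, rfl⟩

/-- Generators come first in each block. The programs use this to find their positions without a
table. -/
theorem idx_gen {i a : ℕ} (h : a < size L i) : idx L (.gen i a) = blockStart L i + a := by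
  obtain ⟨l, hl⟩ := cells_eq (lt_length_of_size_pos (Nat.zero_lt_of_lt h))
  have h1 : (cells L)[blockStart L i + a]? = some (.gen i a) := by
    rw [hl, List.getElem?_append_right (by rw [blockStart]; omega), List.getElem?_append_left
      (by rw [block, blockStart]; simp; omega), block, blockStart, List.getElem?_append_left (by simpa),
      Nat.add_sub_cancel_left]
    simp [h]
  obtain ⟨h2, h3⟩ := List.getElem?_eq_some_iff.1 h1
  rw [← h3, idx_getElem]

/-- Each syzygy is listed directly after its longest edge, so the table of positions of relations
also serves for syzygies. -/
theorem idx_syz {i a r : ℕ} (h : RawCell.Valid L (.syz i a r)) :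
    idx L (.syz i a r) = idx L (.rel i a (r + 1)) + 1 := by
  have hi := h.index_lt
  obtain ⟨l, hl⟩ := cells_eq hi
  obtain ⟨⟨b, rfl⟩, h⟩ := h
  have key : [RawCell.rel i (2 ^ (r + 1) * b) (r + 1), RawCell.syz i (2 ^ (r + 1) * b) r] <:+:
      cells L := by
    have h1 : ∀ {α β : Type} (f : α → List β) {l : List α} {x : α}, x ∈ l → f x <:+: l.flatMap f := by
      intro α β f l x hx
      obtain ⟨l₁, l₂, rfl⟩ := List.append_of_mem hx
      exact ⟨l₁.flatMap f, l₂.flatMap f, by simp⟩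
    refine List.IsInfix.trans ?_ (h1 (block L) (List.mem_range.2 hi))
    refine List.IsInfix.trans ?_ (List.suffix_append _ _).isInfix
    refine List.IsInfix.trans ?_ (h1 _ (x := r + 1) (List.mem_range.2
      ((Nat.lt_clog_iff_pow_lt (by norm_num)).2 ?_)))
    · refine List.IsInfix.trans ?_ (h1 _ (x := b) (List.mem_range.2 (lt_div_iff_edge.2 ?_)))
      · rw [edgeCells, if_neg (by omega), mul_comm]
        exact List.infix_rfl
      · rw [mul_comm]; exact h
    · simp only [RawCell.index]; omega
  obtain ⟨l₁, l₂, h⟩ := key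
  have h2 : cells L = (l₁ ++ [RawCell.rel i (2 ^ (r + 1) * b) (r + 1)]) ++
      .syz i (2 ^ (r + 1) * b) r :: l₂ := by simp [← h]
  have h3 : cells L = l₁ ++ RawCell.rel i (2 ^ (r + 1) * b) (r + 1) ::
      .syz i (2 ^ (r + 1) * b) r :: l₂ := by simp [← h]
  rw [idx_eq_of_append h2, idx_eq_of_append h3]
  simp

/-- With `m` generators there are at most `(m - 1) / 2 ^ r` relations of level `r`, hence at most `2
m` in total by a geometric series. Each brings at most one syzygy, and the generators contribute the
fifth `m`. -/
theorem length_block_le (i : ℕ) : (block L i).length ≤ 5 * size L i := by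
  have h1 : ∀ r, (levelCells i (size L i) r).length ≤ 2 * ((size L i - 1) / 2 ^ r) := by
    intro r
    rw [levelCells, List.length_flatMap]
    refine (List.sum_le_card_nsmul _ 2 ?_).trans (by simp [mul_comm])
    intro x hx
    obtain ⟨b, _, rfl⟩ := List.mem_map.1 hx
    rw [edgeCells]
    split_ifs <;> simp
  have h2 : (List.map (fun r => (levelCells i (size L i) r).length)
      (List.range (Nat.clog 2 (size L i)))).sum ≤ 4 * size L i := by
    refine (List.sum_le_sum fun r _ => h1 r).trans ?_
    rw [List.sum_map_mul_left]
    have := Nat.geom_sum_le (b := 2) le_rfl (size L i - 1) (Nat.clog 2 (size L i))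
    rw [← List.toFinset_range, ← list_sum_eq_finset_sum List.nodup_range] at this
    omega
  rw [block, List.length_append, List.length_map, List.length_range, List.length_flatMap]
  omega

theorem generatorCount_eq : generatorCount L = ((List.range L.length).map (size L)).sum := by
  rw [generatorCount]
  congr 1
  refine List.ext_getElem (by simp) fun n h1 h2 => ?_
  simp only [List.length_map] at h1
  simp [size, record, List.getElem?_eq_getElem h1]

theorem length_cells_le : (cells L).length ≤ 5 * generatorCount L := by
  rw [cells, List.length_flatMap, generatorCount_eq, ← List.sum_map_mul_left]
  exact List.sum_le_sum fun i _ => length_block_le i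

end LogPath

namespace LogPath

open Finsupp

/-! ### The boundary of a basis element as a list -/

section BoundaryLists

variable (L : List CellRecord)

/-- The paths that occur in the boundary of a basis element. -/
def paths : RawCell → List (ℕ × ℕ × ℕ)
  | .gen i a => genPaths L i a
  | .rel i a r => relPaths L i a (a + 2 ^ r)
  | .syz _ _ _ => []

/-- The basis elements of the same kind in the facets, or of the next lower kind in the cell. -/
def endpoints : RawCell → List RawCell
  | .gen i a => (facets L i).map fun τ => .gen τ (lift L i a τ)
  | .rel i a r => [.gen i a, .gen i (a + 2 ^ r)]
  | .syz i a r => [.rel i a (r + 1), .rel i a r, .rel i (a + 2 ^ r) r]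

/-- The relation that belongs to an edge. -/
def edgeCell (e : ℕ × ℕ × ℕ) : RawCell := .rel e.1 e.2.1 e.2.2

/-- The syzygy that belongs to a triangle. -/
def triangleCell (ρ : ℕ) (t : ℕ × ℕ) : RawCell := .syz ρ t.1 t.2

/-- The generators and relations in the boundary of a basis element. -/
def lowerBoundary (c : RawCell) : List RawCell :=
  endpoints L c ++ ((paths L c).flatMap pathEdges).map edgeCell

/-- The syzygies around a path. -/
def pathTriangles (x : ℕ × ℕ × ℕ) : List RawCell :=
  (trianglesAround (min x.2.1 x.2.2) (max x.2.1 x.2.2)).map (triangleCell x.1)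

/-- A list of syzygies whose sum is the syzygy part of the boundary. -/
def fillers (c : RawCell) : List RawCell :=
  (lowerBoundary L c).flatMap fun c' => (paths L c').flatMap pathTriangles

end BoundaryLists

/-- The entries of a list at which `M` is positive, each of them once. -/
def oddEntries : (ℕ → ℕ) → List ℕ → List ℕ
  | _, [] => []
  | M, x :: l => if 0 < M x then x :: oddEntries (Function.update M x 0) l else oddEntries M l

/-- The parity of the number of occurrences. -/
def parity (l : List ℕ) (x : ℕ) : ℕ := l.count x % 2

/-- The positions of the basis elements in the boundary of a basis element. -/
def facetIds (L : List CellRecord) (c : RawCell) : List ℕ :=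
  (lowerBoundary L c).map (idx L) ++
    oddEntries (parity ((fillers L c).map (idx L))) ((fillers L c).map (idx L))

theorem mem_oddEntries {l : List ℕ} {M : ℕ → ℕ} {x : ℕ} :
    x ∈ oddEntries M l ↔ x ∈ l ∧ 0 < M x := by
  induction l generalizing M with
  | nil => simp [oddEntries]
  | cons y l ih =>
    rw [oddEntries]
    by_cases hxy : x = y
    · subst hxy
      split_ifs with h <;> simp [ih, h]
    · split_ifs with h <;> simp [ih, hxy]

theorem nodup_oddEntries (l : List ℕ) (M : ℕ → ℕ) : (oddEntries M l).Nodup := by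
  induction l generalizing M with
  | nil => simp [oddEntries]
  | cons y l ih =>
    rw [oddEntries]
    split_ifs with h
    · exact List.nodup_cons.2 ⟨by simp [mem_oddEntries], ih _⟩
    · exact ih M

theorem length_oddEntries_le (l : List ℕ) (M : ℕ → ℕ) : (oddEntries M l).length ≤ l.length := by
  induction l generalizing M with
  | nil => simp [oddEntries]
  | cons y l ih =>
    rw [oddEntries]
    split_ifs with h
    · simpa using ih _
    · exact (ih M).trans (by simp)

variable {L : List CellRecord}

theorem coeff_sum_toChain (l : List RawCell) (c : RawCell) :
    RawCell.coeff (l.map RawCell.toChain).sum c = l.count c := by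
  induction l with
  | nil => simp [RawCell.coeff_zero]
  | cons d l ih =>
    rw [List.map_cons, List.sum_cons, RawCell.coeff_add, ih, RawCell.coeff_toChain, List.count_cons]
    split_ifs with h1 h2 h2 <;> simp_all [add_comm]

theorem sum_edgeCell (l : List (ℕ × ℕ × ℕ)) :
    ((l.map edgeCell).map RawCell.toChain).sum = (0, (l.map fun e => single e 1).sum, 0) := by
  induction l with
  | nil => rfl
  | cons e l ih =>
    rw [List.map_cons, List.map_cons, List.sum_cons, ih, edgeCell, RawCell.toChain]
    simp

theorem sum_gen (l : List (ℕ × ℕ)) :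
    ((l.map fun v => RawCell.gen v.1 v.2).map RawCell.toChain).sum =
      ((l.map fun v => single v 1).sum, 0, 0) := by
  induction l with
  | nil => rfl
  | cons e l ih =>
    rw [List.map_cons, List.map_cons, List.sum_cons, ih, RawCell.toChain]
    simp

/-- The lists that the algorithm writes represent the components of the differential in generators
and relations: endpoints give `f₀`, `p₁`, `p₂`, and paths give `h₀`, `f₁`. -/
theorem sum_lowerBoundary (hL : Admissible L) (c : RawCell) :
    ((lowerBoundary L c).map RawCell.toChain).sum =
      (((filling hL).diff c.toChain).1, ((filling hL).diff c.toChain).2.1, 0) := by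
  rw [lowerBoundary, List.map_append, List.sum_append, sum_edgeCell, ← sum_map_pathChain]
  cases c with
  | gen i a =>
    have := sum_gen ((facets L i).map fun τ => (τ, lift L i a τ))
    simp only [List.map_map, Function.comp_def] at this
    rw [endpoints, List.map_map, Function.comp_def, this, ← f₀_single, paths, ← h₀_single]
    simp [FillingData.diff_apply, RawCell.toChain, filling]
  | rel i a r =>
    have := sum_gen [(i, a), (i, a + 2 ^ r)]
    simp only [List.map_cons, List.map_nil] at this
    rw [endpoints, paths, ← f₁_single]
    simp only [List.map_cons, List.map_nil]
    rw [this]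
    simp [FillingData.diff_apply, RawCell.toChain, filling, p₁_single]
  | syz i a r =>
    simp [endpoints, paths, FillingData.diff_apply, RawCell.toChain, filling, p₂_single, add_assoc]

variable (L) in
/-- The paths in the boundary of a chain, as a chain. -/
noncomputable def pathsMap : RawCell.Chains →ₗ[ZMod 2] EdgeChain :=
  h₀ L ∘ₗ LinearMap.fst _ _ _ + f₁ L ∘ₗ LinearMap.fst _ _ _ ∘ₗ LinearMap.snd _ _ _

theorem pathsMap_apply (x : RawCell.Chains) : pathsMap L x = h₀ L x.1 + f₁ L x.2.1 := rfl

theorem pathsMap_toChain (c : RawCell) :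
    pathsMap L c.toChain = ((paths L c).map pathChain).sum := by
  cases c with
  | gen i a => simp [pathsMap_apply, RawCell.toChain, h₀_single, paths]
  | rel i a r => simp [pathsMap_apply, RawCell.toChain, f₁_single, paths]
  | syz i a r => simp [pathsMap_apply, RawCell.toChain, paths]

/-- The formulas for `g₂`, `h₁` and `f₂` combine into one rule: take the generators and relations in
the boundary, form the paths in their boundaries, and fill. This uniform rule is what the algorithm
carries out. -/
theorem diff_snd_snd (hL : Admissible L) (x : RawCell.Chains) :
    ((filling hL).diff x).2.2 = q (pathsMap L ((filling hL).diff x)) := by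
  simp only [pathsMap_apply, FillingData.diff_apply, FillingData.g₂, FillingData.h₁, FillingData.f₂,
    filling, LinearMap.comp_apply, LinearMap.add_apply, map_add]
  abel

/-- The ends of these paths cancel: this is `f₀` applied to the generator component of `d ^ 2 = 0`.
-/
theorem p₁_pathsMap_diff (hL : Admissible L) (x : RawCell.Chains) :
    p₁ (pathsMap L ((filling hL).diff x)) = 0 := by
  have h := congrArg Prod.fst ((filling hL).diff_diff x)
  rw [FillingData.diff_apply] at h
  rw [pathsMap_apply, map_add, p₁_h₀ hL, p₁_f₁, ← map_add]
  rw [show f₀ L ((filling hL).diff x).1 + p₁ ((filling hL).diff x).2.1 = 0 from h, map_zero]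

/-- The sum of the paths from the first generator. -/
noncomputable def initialPaths : GenChain →ₗ[ZMod 2] EdgeChain :=
  linearCombination (ZMod 2) fun v => pathChain (v.1, 0, v.2)

/-- Each path is closed up through the first generator of its simplex. The added part depends on the
ends of the path only, so it can be written as a linear map applied to `p₁` of the path. -/
theorem sum_pathTriangles (x : ℕ × ℕ × ℕ) :
    ((pathTriangles x).map RawCell.toChain).sum =
      (0, 0, q (pathChain x + initialPaths (p₁ (pathChain x)))) := by
  obtain ⟨ρ, u, v⟩ := x
  have h1 : ∀ l : List (ℕ × ℕ), ((l.map (triangleCell ρ)).map RawCell.toChain).sum =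
      (0, 0, (l.map fun t => single (ρ, t) 1).sum) := by
    intro l
    induction l with
    | nil => rfl
    | cons e l ih =>
      rw [List.map_cons, List.map_cons, List.sum_cons, ih, triangleCell, RawCell.toChain]
      simp
  rw [pathTriangles, h1, sum_trianglesAround ρ min_le_max, p₁_pathChain]
  simp only [initialPaths, map_add, linearCombination_single, one_smul]
  rcases le_total u v with h | h
  · rw [min_eq_left h, max_eq_right h]
  · have : pathChain (ρ, v, u) = pathChain (ρ, u, v) := by
      simp only [pathChain, min_comm, max_comm]
    rw [min_eq_right h, max_eq_left h, this]
    abel_nf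

/-- The closing parts sum to `initialPaths` of the boundary of a cycle, which is zero. So few
triangles for each path suffice, although single paths are not closed. -/
theorem sum_fillers (hL : Admissible L) (c : RawCell) :
    ((fillers L c).map RawCell.toChain).sum = (0, 0, ((filling hL).diff c.toChain).2.2) := by
  have h1 : ∀ l : List (ℕ × ℕ × ℕ), ((l.flatMap pathTriangles).map RawCell.toChain).sum =
      (0, 0, q ((l.map pathChain).sum + initialPaths (p₁ (l.map pathChain).sum))) := by
    intro l
    induction l with
    | nil => simp; rfl
    | cons x l ih =>
      rw [List.flatMap_cons, List.map_append, List.sum_append, ih, sum_pathTriangles, List.map_cons,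
        List.sum_cons]
      simp only [map_add, Prod.mk_add_mk, add_zero]
      rw [add_add_add_comm]
  have h2 : ∀ l : List RawCell,
      ((l.flatMap fun c' => (paths L c').flatMap pathTriangles).map RawCell.toChain).sum =
      (0, 0, q (pathsMap L (l.map RawCell.toChain).sum +
        initialPaths (p₁ (pathsMap L (l.map RawCell.toChain).sum)))) := by
    intro l
    induction l with
    | nil => simp; rfl
    | cons x l ih =>
      rw [List.flatMap_cons, List.map_append, List.sum_append, ih, h1, List.map_cons,
        List.sum_cons, ← pathsMap_toChain]
      simp only [map_add, Prod.mk_add_mk, add_zero]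
      rw [add_add_add_comm]
  have h3 : pathsMap L ((lowerBoundary L c).map RawCell.toChain).sum =
      pathsMap L ((filling hL).diff c.toChain) := by
    rw [sum_lowerBoundary hL]; rfl
  rw [fillers, h2, h3, p₁_pathsMap_diff hL, map_zero, add_zero, ← diff_snd_snd]

theorem nodup_lowerBoundary (hL : Admissible L) (c : RawCell) : (lowerBoundary L c).Nodup := by
  have hinj : Function.Injective edgeCell := fun x y h => by
    simpa [edgeCell, Prod.ext_iff] using h
  have hp : ((paths L c).flatMap pathEdges).Nodup := by
    cases c with
    | gen i a => exact nodup_flatMap_pathEdges (nodup_genPaths hL i a)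
    | rel i a r => exact nodup_flatMap_pathEdges (nodup_relPaths hL i a _)
    | syz i a r => simp [paths]
  refine List.Nodup.append ?_ (hp.map hinj) ?_
  · cases c with
    | gen i a => exact (hL.nodup_facets i).map fun x y h => by simp at h; exact h.1
    | rel i a r => simp [endpoints]
    | syz i a r => simp [endpoints]
  · intro d hd hd'
    obtain ⟨e, he, rfl⟩ := List.mem_map.1 hd'
    cases c with
    | gen i a => simp [endpoints, edgeCell] at hd
    | rel i a r => simp [endpoints, edgeCell] at hd
    | syz i a r => simp [paths] at he

theorem mem_paths (hL : Admissible L) {c : RawCell} (hc : c.Valid L) {x : ℕ × ℕ × ℕ}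
    (hx : x ∈ paths L c) : x.2.1 < size L x.1 ∧ x.2.2 < size L x.1 := by
  cases c with
  | gen i a =>
    obtain ⟨τ, h1, τ', h2, -, h4, h5, h6⟩ := mem_genPaths.1 hx
    rw [h6]
    exact ⟨(hL.lift_spec h4 (hL.lift_spec h1 hc).1).1, (hL.lift_spec h5 (hL.lift_spec h2 hc).1).1⟩
  | rel i a r =>
    obtain ⟨τ, h1, rfl⟩ := List.mem_map.1 hx
    have : a + 2 ^ r < size L i := hc.2
    exact ⟨(hL.lift_spec h1 ((Nat.le_add_right _ _).trans_lt this)).1, (hL.lift_spec h1 hc.2).1⟩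
  | syz i a r => simp [paths] at hx

theorem valid_of_mem_pathEdges {x e : ℕ × ℕ × ℕ} (hx : x.2.1 < size L x.1 ∧ x.2.2 < size L x.1)
    (he : e ∈ pathEdges x) : (edgeCell e).Valid L := by
  obtain ⟨h1, h2⟩ := mem_pathEdges.1 he
  obtain ⟨h3, h4, h5⟩ := mem_shortestPath h2
  refine ⟨h3, ?_⟩
  rw [h1]
  have := max_lt hx.1 hx.2
  omega

theorem valid_of_mem_lowerBoundary (hL : Admissible L) {c d : RawCell} (hc : c.Valid L)
    (hd : d ∈ lowerBoundary L c) : d.Valid L := by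
  rcases List.mem_append.1 hd with hd | hd
  · cases c with
    | gen i a =>
      obtain ⟨τ, h1, rfl⟩ := List.mem_map.1 hd
      exact (hL.lift_spec h1 hc).1
    | rel i a r =>
      simp only [endpoints, List.mem_cons, List.not_mem_nil, or_false] at hd
      have : a + 2 ^ r < size L i := hc.2
      rcases hd with rfl | rfl
      · exact (Nat.le_add_right _ _).trans_lt this
      · exact hc.2
    | syz i a r =>
      simp only [endpoints, List.mem_cons, List.not_mem_nil, or_false] at hd
      obtain ⟨h1, h2⟩ := hc
      have h3 : 2 ^ r ∣ a := (pow_dvd_pow 2 r.le_succ).trans h1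
      have h4 : 2 ^ (r + 1) = 2 ^ r + 2 ^ r := by rw [pow_succ]; ring
      have h5 : 0 < 2 ^ r := by positivity
      rcases hd with rfl | rfl | rfl
      · exact ⟨h1, h2⟩
      · exact ⟨h3, by omega⟩
      · exact ⟨Nat.dvd_add h3 dvd_rfl, by omega⟩
  · obtain ⟨e, he, rfl⟩ := List.mem_map.1 hd
    obtain ⟨x, hx, he⟩ := List.mem_flatMap.1 he
    exact valid_of_mem_pathEdges (mem_paths hL hc hx) he

theorem valid_of_mem_pathTriangles {x : ℕ × ℕ × ℕ} {c : RawCell}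
    (hx : x.2.1 < size L x.1 ∧ x.2.2 < size L x.1) (hc : c ∈ pathTriangles x) : c.Valid L := by
  obtain ⟨t, ht, rfl⟩ := List.mem_map.1 hc
  obtain ⟨h1, h2, h3, h4⟩ := mem_trianglesAround.1 ht
  exact ⟨h1, h4.trans_lt (max_lt hx.1 hx.2)⟩

theorem valid_of_mem_fillers (hL : Admissible L) {c d : RawCell} (hc : c.Valid L)
    (hd : d ∈ fillers L c) : d.Valid L := by
  obtain ⟨c', hc', hd⟩ := List.mem_flatMap.1 hd
  obtain ⟨x, hx, hd⟩ := List.mem_flatMap.1 hd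
  exact valid_of_mem_pathTriangles (mem_paths hL (valid_of_mem_lowerBoundary hL hc hc') hx) hd

theorem count_map_idx {l : List RawCell} (hl : ∀ d ∈ l, d.Valid L) {c : RawCell} (hc : c.Valid L) :
    (l.map (idx L)).count (idx L c) = l.count c := by
  induction l with
  | nil => simp
  | cons d l ih =>
    rw [List.map_cons, List.count_cons, List.count_cons, ih fun d hd => hl d (List.mem_cons_of_mem _ hd)]
    have : idx L d = idx L c ↔ d = c :=
      ⟨idx_injOn (hl d List.mem_cons_self) hc, fun h => h ▸ rfl⟩
    simp [this]

theorem coeff_diff (hL : Admissible L) (c d : RawCell) :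
    RawCell.coeff ((filling hL).diff c.toChain) d =
      (((lowerBoundary L c).count d + (fillers L c).count d : ℕ) : ZMod 2) := by
  rw [Nat.cast_add, ← coeff_sum_toChain, ← coeff_sum_toChain, ← RawCell.coeff_add,
    sum_lowerBoundary hL, sum_fillers hL]
  simp

theorem not_mem_fillers {c d : RawCell} (h : d ∈ lowerBoundary L c) : d ∉ fillers L c := by
  intro h'
  have h4 : ∀ x ∈ lowerBoundary L c, ∀ ρ t, x ≠ triangleCell ρ t := by
    rintro x hx ρ t rfl
    rcases List.mem_append.1 hx with hx | hx
    · cases c <;> simp [endpoints, triangleCell] at hx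
    · simp [edgeCell, triangleCell] at hx
  obtain ⟨c', hc', h'⟩ := List.mem_flatMap.1 h'
  obtain ⟨x, hx, h'⟩ := List.mem_flatMap.1 h'
  obtain ⟨t, ht, rfl⟩ := List.mem_map.1 h'
  exact h4 _ h _ _ rfl

theorem mem_map_idx {l : List RawCell} (hl : ∀ d ∈ l, d.Valid L) {c : RawCell} (hc : c.Valid L) :
    idx L c ∈ l.map (idx L) ↔ c ∈ l := by
  rw [← List.count_pos_iff, count_map_idx hl hc, List.count_pos_iff]

/-- The lower boundary has no repetitions and contains none of the fillers. Hence a coefficient is 1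
on the lower boundary and elsewhere the parity of the multiplicity among the fillers. -/
theorem mem_facetIds (hL : Admissible L) {c d : RawCell} (hc : c.Valid L) (hd : d.Valid L) :
    idx L d ∈ facetIds L c ↔ RawCell.coeff ((filling hL).diff c.toChain) d ≠ 0 := by
  have hf := fun d hd => valid_of_mem_fillers (d := d) hL hc hd
  rw [facetIds, List.mem_append, mem_map_idx (fun d hd => valid_of_mem_lowerBoundary hL hc hd) hd,
    mem_oddEntries, mem_map_idx hf hd, parity, count_map_idx hf hd, coeff_diff]
  by_cases h : d ∈ lowerBoundary L c
  · simp [h, List.count_eq_one_of_mem (nodup_lowerBoundary hL c) h,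
      List.count_eq_zero_of_not_mem (not_mem_fillers h)]
  · rw [List.count_eq_zero_of_not_mem h, zero_add, ne_eq, ZMod.natCast_eq_zero_iff,
      Nat.dvd_iff_mod_eq_zero]
    simp only [h, false_or, Nat.pos_iff_ne_zero, and_iff_right_iff_imp]
    intro h5
    by_contra h6
    rw [List.count_eq_zero_of_not_mem h6] at h5
    exact h5 rfl

theorem lt_of_mem_facetIds (hL : Admissible L) {c : RawCell} (hc : c.Valid L) {j : ℕ}
    (hj : j ∈ facetIds L c) : j < (cells L).length := by
  rcases List.mem_append.1 hj with hj | hj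
  · obtain ⟨d, hd, rfl⟩ := List.mem_map.1 hj
    exact idx_lt (valid_of_mem_lowerBoundary hL hc hd)
  · obtain ⟨d, hd, rfl⟩ := List.mem_map.1 (mem_oddEntries.1 hj).1
    exact idx_lt (valid_of_mem_fillers hL hc hd)

theorem nodup_facetIds (hL : Admissible L) {c : RawCell} (hc : c.Valid L) : (facetIds L c).Nodup := by
  have h1 := fun d hd => valid_of_mem_lowerBoundary (d := d) hL hc hd
  have h2 := fun d hd => valid_of_mem_fillers (d := d) hL hc hd
  refine List.Nodup.append ((nodup_lowerBoundary hL c).map_on fun x hx y hy h =>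
    idx_injOn (h1 x hx) (h1 y hy) h) (nodup_oddEntries _ _) ?_
  intro j hj hj'
  obtain ⟨d, hd, rfl⟩ := List.mem_map.1 hj
  exact not_mem_fillers hd ((mem_map_idx h2 (h1 d hd)).1 (mem_oddEntries.1 hj').1)

/-! ### The output -/

/-- The list that describes the log-path complex. -/
def output (L : List CellRecord) : List CellRecord :=
  (cells L).map fun c => ⟨c.dim L, [c.degree L], facetIds L c⟩

theorem length_output : (output L).length = (cells L).length := by simp [output]

/-- The positions in the output correspond to the cells of the log-path complex. -/
def outputEquiv (hL : Admissible L) :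
    Fin (output L).length ≃ (complex.{u} nodup_cells (fun _ => mem_cells) hL).Cell :=
  (finCongr length_output).trans (Equiv.ulift.symm : _ ≃ CellType.{u} (cells L))

theorem grades_complex (hL : Admissible L)
    (x : (complex.{u} nodup_cells (fun _ => mem_cells (L := L)) hL).Cell) :
    (complex.{u} nodup_cells (fun _ => mem_cells) hL).grades x =
      {(rawCell (cells L) x).degree L} := by
  ext s
  change Minimal (· ∈ Set.Ici ((rawCell (cells L) x).degree L)) s ↔ _
  rw [Set.mem_singleton_iff]
  constructor
  · intro h
    exact le_antisymm (h.2 (Set.mem_Ici.2 le_rfl) h.1) h.1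
  · rintro rfl
    exact ⟨Set.mem_Ici.2 le_rfl, fun y hy _ => hy⟩

theorem represents_output (hL : Admissible L) :
    Represents (output L) (complex.{u} nodup_cells (fun _ => mem_cells) hL) := by
  refine ⟨outputEquiv hL, fun i => ?_⟩
  have hi : i.1 < (cells L).length := length_output ▸ i.2
  have hget : (output L).get i = ⟨(cells L)[i.1].dim L, [(cells L)[i.1].degree L],
    facetIds L (cells L)[i.1]⟩ := by rw [List.get_eq_getElem]; simp [output]
  have hv : (cells L)[i.1].Valid L := mem_cells.1 (List.getElem_mem hi)
  rw [hget]
  refine ⟨rfl, List.pairwise_singleton _ _, fun s => ?_, nodup_facetIds hL hv, fun j => ?_⟩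
  · rw [grades_complex, List.mem_singleton, Set.mem_singleton_iff]
    rfl
  · constructor
    · intro hj
      have h1 := lt_of_mem_facetIds hL hv hj
      refine ⟨length_output.symm ▸ h1, ?_⟩
      rw [← idx_getElem h1, mem_facetIds hL hv (mem_cells.1 (List.getElem_mem h1))] at hj
      exact hj
    · rintro ⟨h1, hj⟩
      have h1' : j < (cells L).length := length_output ▸ h1
      have := (mem_facetIds hL hv (mem_cells.1 (List.getElem_mem h1'))).2 hj
      rwa [idx_getElem] at this

/-! ### Bounds -/

theorem length_flatMap_le {α β : Type*} {l : List α} {f : α → List β} {n k : ℕ} (hl : l.length ≤ n)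
    (hf : ∀ x ∈ l, (f x).length ≤ k) : (l.flatMap f).length ≤ n * k := by
  rw [List.length_flatMap]
  refine (List.sum_le_card_nsmul _ k ?_).trans ?_
  · intro x hx
    obtain ⟨b, hb, rfl⟩ := List.mem_map.1 hx
    exact hf b hb
  · rw [List.length_map, smul_eq_mul]
    exact Nat.mul_le_mul_right k hl

variable {D R : ℕ}

/-- Four nested loops over facets, each of length at most `D`, with at most one path in the
innermost body. -/
theorem length_genPaths_le (hD : ∀ i, (facets L i).length ≤ D) (i a : ℕ) :
    (genPaths L i a).length ≤ D * (D * (D * D)) := by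
  refine length_flatMap_le (hD i) fun τ _ => length_flatMap_le (hD i) fun τ' _ =>
    length_flatMap_le (hD τ) fun ρ _ => ?_
  refine (length_flatMap_le (hD τ') (k := 1) fun ρ' _ => ?_).trans (by simp)
  split_ifs <;> simp

theorem length_paths_le (hD : ∀ i, (facets L i).length ≤ D) (c : RawCell) :
    (paths L c).length ≤ D ^ 4 := by
  have h1 : D * (D * (D * D)) = D ^ 4 := by ring
  cases c with
  | gen i a => exact h1 ▸ length_genPaths_le hD i a
  | rel i a r =>
    rw [paths, relPaths, List.length_map]
    exact (hD i).trans (Nat.le_self_pow (by norm_num) D)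
  | syz i a r => simp [paths]

theorem length_pathEdges_le {x : ℕ × ℕ × ℕ} (h1 : x.2.1 < 2 ^ R) (h2 : x.2.2 < 2 ^ R) :
    (pathEdges x).length ≤ 2 * R := by
  rw [pathEdges, List.length_map]
  exact length_shortestPath (max_lt h1 h2)

/-- There is at most one triangle for each exponent `r`, and an interval of length `2 ^ r` inside
`[0, b]` forces `r < R`. -/
theorem length_trianglesAround_le {a b : ℕ} (hb : b < 2 ^ R) : (trianglesAround a b).length ≤ R := by
  have hn : (((List.range (b + 1)).filter fun r => a % 2 ^ r ≠ 0 ∧ a - a % 2 ^ r + 2 ^ r ≤ b)).Nodup :=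
    List.nodup_range.filter _
  rw [trianglesAround, List.length_map, ← List.toFinset_card_of_nodup hn]
  refine (Finset.card_le_card (t := Finset.range R) fun r hr => ?_).trans (by simp)
  simp only [List.mem_toFinset, List.mem_filter, decide_eq_true_eq] at hr
  rw [Finset.mem_range]
  exact (Nat.pow_lt_pow_iff_right (a := 2) (by norm_num)).1 (by omega)

/-- The summand `D + 3` covers the endpoints: at most `D` for a generator, two for a relation, three
for a syzygy. The rest are at most `D ^ 4` paths with at most `2 R` edges each. -/
theorem length_lowerBoundary_le (hL : Admissible L) (hD : ∀ i, (facets L i).length ≤ D)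
    (hR : ∀ i, size L i ≤ 2 ^ R) {c : RawCell} (hc : c.Valid L) :
    (lowerBoundary L c).length ≤ D + 3 + D ^ 4 * (2 * R) := by
  rw [lowerBoundary, List.length_append, List.length_map]
  refine Nat.add_le_add ?_ (length_flatMap_le (length_paths_le hD c) fun x hx => ?_)
  · cases c with
    | gen i a => simpa [endpoints] using (hD i).trans (by omega)
    | rel i a r => simp [endpoints]
    | syz i a r => simp [endpoints]
  · have := mem_paths hL hc hx
    exact length_pathEdges_le (this.1.trans_le (hR _)) (this.2.trans_le (hR _))

/-- Logarithmically many boundary elements with boundedly many paths each, and logarithmically many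
triangles around each path: this is the origin of the square of the logarithm. -/
theorem length_fillers_le (hL : Admissible L) (hD : ∀ i, (facets L i).length ≤ D)
    (hR : ∀ i, size L i ≤ 2 ^ R) {c : RawCell} (hc : c.Valid L) :
    (fillers L c).length ≤ (D + 3 + D ^ 4 * (2 * R)) * (D ^ 4 * R) := by
  refine length_flatMap_le (length_lowerBoundary_le hL hD hR hc) fun c' hc' =>
    length_flatMap_le (length_paths_le hD c') fun x hx => ?_
  have := mem_paths hL (valid_of_mem_lowerBoundary hL hc hc') hx
  rw [pathTriangles, List.length_map]
  exact length_trianglesAround_le ((max_lt this.1 this.2).trans_le (hR _))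

theorem length_facetIds_le (hL : Admissible L) (hD : ∀ i, (facets L i).length ≤ D)
    (hR : ∀ i, size L i ≤ 2 ^ R) {c : RawCell} (hc : c.Valid L) :
    (facetIds L c).length ≤ (D + 3 + D ^ 4 * (2 * R)) * (D ^ 4 * R + 1) := by
  rw [facetIds, List.length_append, List.length_map]
  have h1 := length_lowerBoundary_le hL hD hR hc
  have h2 := (length_oddEntries_le ((fillers L c).map (idx L))
    (parity ((fillers L c).map (idx L)))).trans_eq (List.length_map _)
  have h3 := length_fillers_le hL hD hR hc
  rw [mul_add, mul_one]
  omega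

theorem size_output_le (hL : Admissible L) (hD : ∀ i, (facets L i).length ≤ D)
    (hR : ∀ i, size L i ≤ 2 ^ R) :
    generatorCount (output L) + boundaryCount (output L) ≤
      (cells L).length * ((D + 3 + D ^ 4 * (2 * R)) * (D ^ 4 * R + 1) + 1) := by
  have h1 : generatorCount (output L) = (cells L).length := by
    simp [generatorCount, output, Function.comp_def]
  have h2 : boundaryCount (output L) ≤
      (cells L).length * ((D + 3 + D ^ 4 * (2 * R)) * (D ^ 4 * R + 1)) := by
    rw [boundaryCount, output, List.map_map, Function.comp_def]
    refine (List.sum_le_card_nsmul _ _ ?_).trans_eq (by rw [List.length_map, smul_eq_mul])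
    intro x hx
    obtain ⟨c, hc, rfl⟩ := List.mem_map.1 hx
    exact length_facetIds_le hL hD hR (mem_cells.1 hc)
  rw [mul_add, mul_one]
  omega

end LogPath

/-! ### Verification of programs -/

namespace RAM

open Program

infix:60 " ≔ " => Program.assign
infixr:50 " ;; " => Program.seq

instance : Add ArithExpr := ⟨.add⟩
instance : Sub ArithExpr := ⟨.sub⟩
instance (n : ℕ) : OfNat ArithExpr n := ⟨.const n⟩

/-- The value of a variable. -/
abbrev v (x : ℕ) : ArithExpr := .var x

infix:80 " # " => ArithExpr.arr

section Values

variable (m : Memory) (e f : ArithExpr) (n x a : ℕ)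

@[simp] theorem value_add : (e + f).value m = e.value m + f.value m := rfl
@[simp] theorem value_sub : (e - f).value m = e.value m - f.value m := rfl
@[simp] theorem value_ofNat : (ofNat(n) : ArithExpr).value m = (OfNat.ofNat n : ℕ) := rfl
@[simp] theorem value_var : (v x).value m = m.var x := rfl
@[simp] theorem value_arr : (a # e).value m = m.arr a (e.value m) := rfl
@[simp] theorem cost_add : (e + f).cost = e.cost + f.cost + 1 := rfl
@[simp] theorem cost_sub : (e - f).cost = e.cost + f.cost + 1 := rfl
@[simp] theorem cost_ofNat : (ofNat(n) : ArithExpr).cost = 1 := rfl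
@[simp] theorem cost_var : (v x).cost = 1 := rfl
@[simp] theorem cost_arr : (a # e).cost = e.cost + 1 := rfl

@[simp] theorem var_setVar (y : ℕ) : (m.setVar x n).var y = if y = x then n else m.var y := by
  simp [Memory.setVar, Function.update_apply]

@[simp] theorem arr_setVar : (m.setVar x n).arr = m.arr := rfl

@[simp] theorem var_setArr (i : ℕ) : (m.setArr a i n).var = m.var := rfl

@[simp] theorem arr_setArr (i b : ℕ) :
    (m.setArr a i n).arr b = if b = a then Function.update (m.arr a) i n else m.arr b := by
  simp only [Memory.setArr, Function.update_apply]

end Values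

/-- The variable is assigned somewhere in the program. -/
def writesVar : Program → ℕ → Bool
  | .skip, _ => false
  | .assign x _, y => decide (x = y)
  | .store _ _ _, _ => false
  | .seq p q, y => writesVar p y || writesVar q y
  | .ite _ _ p q, y => writesVar p y || writesVar q y
  | .while _ _ p, y => writesVar p y

/-- The program writes to the array. -/
def writesArr : Program → ℕ → Bool
  | .skip, _ => false
  | .assign _ _, _ => false
  | .store a _ _, b => decide (a = b)
  | .seq p q, y => writesArr p y || writesArr q y
  | .ite _ _ p q, y => writesArr p y || writesArr q y
  | .while _ _ p, y => writesArr p y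

/-- The memories differ only in places to which the program writes. -/
structure Agree (p : Program) (m m' : Memory) : Prop where
  var : ∀ x, writesVar p x = false → m'.var x = m.var x
  arr : ∀ a, writesArr p a = false → m'.arr a = m.arr a

theorem Agree.refl (p : Program) (m : Memory) : Agree p m m := ⟨fun _ _ => rfl, fun _ _ => rfl⟩

theorem Agree.trans {p : Program} {m₁ m₂ m₃ : Memory} (h : Agree p m₁ m₂) (h' : Agree p m₂ m₃) :
    Agree p m₁ m₃ :=
  ⟨fun x hx => (h'.var x hx).trans (h.var x hx), fun a ha => (h'.arr a ha).trans (h.arr a ha)⟩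

theorem Agree.mono {p q : Program} {m m' : Memory} (h : Agree p m m')
    (hv : ∀ x, writesVar q x = false → writesVar p x = false)
    (ha : ∀ x, writesArr q x = false → writesArr p x = false) : Agree q m m' :=
  ⟨fun x hx => h.var x (hv x hx), fun a h' => h.arr a (ha a h')⟩

theorem agree_setVar {p : Program} {x n : ℕ} {m : Memory} (h : writesVar p x = true) :
    Agree p m (m.setVar x n) := by
  refine ⟨fun y hy => ?_, fun _ _ => rfl⟩
  have : y ≠ x := by rintro rfl; simp [h] at hy
  simp [this]

theorem agree_setArr {p : Program} {a i n : ℕ} {m : Memory} (h : writesArr p a = true) :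
    Agree p m (m.setArr a i n) := by
  refine ⟨fun _ _ => rfl, fun b hb => ?_⟩
  have : b ≠ a := by rintro rfl; simp [h] at hb
  simp [this]

/-- The frame property. Since the written variables and arrays are computed from the program text,
preservation of all other memory holds by `rfl` for concrete programs. -/
theorem Runs.agree {p : Program} {m m' : Memory} {t : ℕ} (h : Runs p m t m') : Agree p m m' := by
  induction h with
  | skip m => exact Agree.refl _ _
  | assign x e m =>
    refine ⟨fun y hy => ?_, fun _ _ => rfl⟩
    have : y ≠ x := by rintro rfl; simp [writesVar] at hy
    simp [this]
  | store a e f m =>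
    refine ⟨fun _ _ => rfl, fun b hb => ?_⟩
    have : b ≠ a := by rintro rfl; simp [writesArr] at hb
    simp [this]
  | seq _ _ h h' =>
    refine Agree.trans (h.mono ?_ ?_) (h'.mono ?_ ?_) <;> intro x hx <;>
      simp only [writesVar, writesArr, Bool.or_eq_false_iff] at hx
    exacts [hx.1, hx.1, hx.2, hx.2]
  | ite_true _ _ h =>
    refine h.mono ?_ ?_ <;> intro x hx <;> simp only [writesVar, writesArr, Bool.or_eq_false_iff] at hx
    exacts [hx.1, hx.1]
  | ite_false _ _ h =>
    refine h.mono ?_ ?_ <;> intro x hx <;> simp only [writesVar, writesArr, Bool.or_eq_false_iff] at hx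
    exacts [hx.2, hx.2]
  | while_true _ _ _ h h' => exact Agree.trans (h.mono (fun _ h => h) fun _ h => h) h'
  | while_false _ => exact Agree.refl _ _

/-- The program halts, with a number of steps and a memory that satisfy `Q`. -/
def wp (p : Program) (m : Memory) (Q : ℕ → Memory → Prop) : Prop := ∃ t m', Runs p m t m' ∧ Q t m'

variable {p q : Program} {m : Memory} {Q Q' : ℕ → Memory → Prop} {e f : ArithExpr}

/-- The frame property is handed to the continuation, so specifications need to mention only what a
program changes on purpose. -/
theorem wp.mono (h : wp p m Q) (hQ : ∀ t m', Agree p m m' → Q t m' → Q' t m') : wp p m Q' := by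
  obtain ⟨t, m', h1, h2⟩ := h
  exact ⟨t, m', h1, hQ t m' (Runs.agree h1) h2⟩

theorem wp_seq : wp (p ;; q) m Q ↔ wp p m fun t m' => wp q m' fun t' m'' => Q (t + t') m'' := by
  constructor
  · rintro ⟨_, _, h, hQ⟩
    cases h with
    | seq h h' => exact ⟨_, _, h, _, _, h', hQ⟩
  · rintro ⟨t, m', h, t', m'', h', hQ⟩
    exact ⟨_, _, .seq h h', hQ⟩

theorem wp_skip : wp .skip m Q ↔ Q 1 m := by
  constructor
  · rintro ⟨_, _, h, hQ⟩
    cases h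
    exact hQ
  · exact fun h => ⟨_, _, .skip m, h⟩

theorem wp_assign {x : ℕ} : wp (x ≔ e) m Q ↔ Q (e.cost + 1) (m.setVar x (e.value m)) := by
  constructor
  · rintro ⟨_, _, h, hQ⟩
    cases h
    exact hQ
  · exact fun h => ⟨_, _, .assign x e m, h⟩

theorem wp_store {a : ℕ} :
    wp (.store a e f) m Q ↔ Q (e.cost + f.cost + 1) (m.setArr a (e.value m) (f.value m)) := by
  constructor
  · rintro ⟨_, _, h, hQ⟩
    cases h
    exact hQ
  · exact fun h => ⟨_, _, .store a e f m, h⟩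

theorem wp_ite : wp (.ite e f p q) m Q ↔
    (e.value m < f.value m → wp p m fun t m' => Q (e.cost + f.cost + 1 + t) m') ∧
      (¬ e.value m < f.value m → wp q m fun t m' => Q (e.cost + f.cost + 1 + t) m') := by
  constructor
  · rintro ⟨_, _, h, hQ⟩
    cases h with
    | ite_true hc h => exact ⟨fun _ => ⟨_, _, h, hQ⟩, fun h => absurd hc h⟩
    | ite_false hc h => exact ⟨fun h => absurd h hc, fun _ => ⟨_, _, h, hQ⟩⟩
  · rintro ⟨h1, h2⟩
    by_cases hc : e.value m < f.value m
    · obtain ⟨t, m', h, hQ⟩ := h1 hc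
      exact ⟨_, _, .ite_true hc h, hQ⟩
    · obtain ⟨t, m', h, hQ⟩ := h2 hc
      exact ⟨_, _, .ite_false hc h, hQ⟩

/-- A loop with a variant `r` whose body needs at most `T` steps. -/
theorem wp_while_variant (I : ℕ → Memory → Prop) (T n : ℕ) (h0 : I n m)
    (step : ∀ r m', Agree p m m' → I r m' → e.value m' < f.value m' →
      ∃ r', r = r' + 1 ∧ wp p m' fun t m'' => t ≤ T ∧ I r' m'')
    (hQ : ∀ t r m', Agree p m m' → I r m' → ¬ e.value m' < f.value m' →
      t ≤ n * (T + (e.cost + f.cost + 1)) + (e.cost + f.cost + 1) → Q t m') :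
    wp (.while e f p) m Q := by
  suffices h : ∀ r m', Agree p m m' → I r m' → ∃ t m'' r', Runs (.while e f p) m' t m'' ∧
      Agree p m m'' ∧ I r' m'' ∧ ¬ e.value m'' < f.value m'' ∧
      t ≤ r * (T + (e.cost + f.cost + 1)) + (e.cost + f.cost + 1) by
    obtain ⟨t, m', r, h1, h2, h3, h4, h5⟩ := h n m (Agree.refl _ _) h0
    exact ⟨t, m', h1, hQ t r m' h2 h3 h4 h5⟩
  intro r
  induction r with
  | zero =>
    intro m' hA hI
    by_cases hc : e.value m' < f.value m'
    · obtain ⟨r', h, _⟩ := step _ _ hA hI hc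
      omega
    · exact ⟨_, m', 0, .while_false hc, hA, hI, hc, by omega⟩
  | succ r ih =>
    intro m' hA hI
    by_cases hc : e.value m' < f.value m'
    · obtain ⟨r', h, t, m₁, h1, h2, h3⟩ := step _ _ hA hI hc
      obtain rfl : r = r' := by omega
      obtain ⟨t', m₂, r', h4, h5, h6, h7, h8⟩ := ih m₁ (hA.trans (Runs.agree h1)) h3
      exact ⟨_, m₂, r', .while_true hc h1 h4, h5, h6, h7, by rw [add_mul]; omega⟩
    · exact ⟨_, m', r + 1, .while_false hc, hA, hI, hc, by omega⟩

/-- A loop with `n` iterations, the `i`-th of which needs at most `T i` steps. -/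
theorem wp_while_count (I : ℕ → Memory → Prop) (T : ℕ → ℕ) (n : ℕ) (h0 : I 0 m)
    (cond : ∀ i m', Agree p m m' → I i m' → (e.value m' < f.value m' ↔ i < n))
    (step : ∀ i m', i < n → Agree p m m' → I i m' → wp p m' fun t m'' => t ≤ T i ∧ I (i + 1) m'')
    (hQ : ∀ t m', Agree p m m' → I n m' →
      t ≤ ∑ i ∈ Finset.range n, (T i + (e.cost + f.cost + 1)) + (e.cost + f.cost + 1) → Q t m') :
    wp (.while e f p) m Q := by
  suffices h : ∀ k ≤ n, ∀ m', Agree p m m' → I (n - k) m' → ∃ t m'', Runs (.while e f p) m' t m'' ∧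
      Agree p m m'' ∧ I n m'' ∧
      t ≤ ∑ i ∈ Finset.Ico (n - k) n, (T i + (e.cost + f.cost + 1)) + (e.cost + f.cost + 1) by
    obtain ⟨t, m', h1, h2, h3, h4⟩ := h n le_rfl m (Agree.refl _ _) (by rwa [Nat.sub_self])
    exact ⟨t, m', h1, hQ t m' h2 h3 (by rwa [Nat.sub_self, ← Finset.range_eq_Ico] at h4)⟩
  intro k
  induction k with
  | zero =>
    intro _ m' hA hI
    exact ⟨_, m', .while_false (by rw [cond _ _ hA hI]; omega), hA, hI, by simp⟩
  | succ k ih =>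
    intro hk m' hA hI
    obtain ⟨t, m₁, h1, h2, h3⟩ := step _ _ (by omega) hA hI
    rw [show n - (k + 1) + 1 = n - k by omega] at h3
    obtain ⟨t', m₂, h4, h5, h6, h7⟩ := ih (by omega) m₁ (hA.trans (Runs.agree h1)) h3
    refine ⟨_, m₂, .while_true (by rw [cond _ _ hA hI]; omega) h1 h4, h5, h6, ?_⟩
    rw [Finset.sum_eq_sum_Ico_succ_bot (by omega), show n - (k + 1) + 1 = n - k by omega]
    omega

/-- A loop with `n` iterations, each of which needs at most `T` steps. -/
theorem wp_while_uniform (I : ℕ → Memory → Prop) (T n : ℕ) (h0 : I 0 m)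
    (cond : ∀ i m', Agree p m m' → I i m' → (e.value m' < f.value m' ↔ i < n))
    (step : ∀ i m', i < n → Agree p m m' → I i m' → wp p m' fun t m'' => t ≤ T ∧ I (i + 1) m'')
    (hQ : ∀ t m', Agree p m m' → I n m' →
      t ≤ n * (T + (e.cost + f.cost + 1)) + (e.cost + f.cost + 1) → Q t m') :
    wp (.while e f p) m Q :=
  wp_while_count I (fun _ => T) n h0 cond step fun t m' hA hI ht => hQ t m' hA hI (by simpa using ht)

/-! ### Lists in memory -/

/-- The list `l` stands in `g` from the address `s` on. -/
def Seg (g : ℕ → ℕ) (s : ℕ) (l : List ℕ) : Prop := ∀ (j : ℕ) (h : j < l.length), g (s + j) = l[j]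

theorem Seg.nil (g : ℕ → ℕ) (s : ℕ) : Seg g s [] := fun j h => by simp at h

theorem seg_append {g : ℕ → ℕ} {s : ℕ} {l l' : List ℕ} :
    Seg g s (l ++ l') ↔ Seg g s l ∧ Seg g (s + l.length) l' := by
  constructor
  · intro h
    refine ⟨fun j hj => ?_, fun j hj => ?_⟩
    · rw [h j (by rw [List.length_append]; omega), List.getElem_append_left]
    · rw [add_assoc, h (l.length + j) (by rw [List.length_append]; omega),
        List.getElem_append_right (by omega)]
      simp
  · rintro ⟨h1, h2⟩ j hj
    by_cases h : j < l.length
    · rw [h1 j h, List.getElem_append_left]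
    · rw [List.getElem_append_right (by omega), ← h2 (j - l.length)]
      congr 1
      omega

theorem seg_cons {g : ℕ → ℕ} {s x : ℕ} {l : List ℕ} :
    Seg g s (x :: l) ↔ g s = x ∧ Seg g (s + 1) l := by
  rw [← List.singleton_append, seg_append]
  refine and_congr ⟨fun h => h 0 (by simp), fun h j hj => ?_⟩ Iff.rfl
  obtain rfl : j = 0 := by simpa using hj
  exact h

theorem Seg.congr {g g' : ℕ → ℕ} {s : ℕ} {l : List ℕ} (h : Seg g s l)
    (hg : ∀ j, s ≤ j → j < s + l.length → g' j = g j) : Seg g' s l := fun j hj => by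
  rw [hg _ (by omega) (by omega), h j hj]

/-- Between the two memories, `l` was written to the array `A` at the address in variable `2`, which
was moved behind `l`. -/
structure Appends (A : ℕ) (m m' : Memory) (l : List ℕ) : Prop where
  ptr : m'.var 2 = m.var 2 + l.length
  seg : Seg (m'.arr A) (m.var 2) l
  keep : ∀ j < m.var 2, m'.arr A j = m.arr A j

theorem Appends.trans {A : ℕ} {m₁ m₂ m₃ : Memory} {l l' : List ℕ} (h : Appends A m₁ m₂ l)
    (h' : Appends A m₂ m₃ l') : Appends A m₁ m₃ (l ++ l') := by
  have h2 := h.ptr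
  refine ⟨by rw [h'.ptr, h2, List.length_append, add_assoc], seg_append.2 ⟨?_, h2 ▸ h'.seg⟩, ?_⟩
  · exact h.seg.congr fun j _ hj => h'.keep j (by omega)
  · intro j hj
    rw [h'.keep j (by omega), h.keep j hj]

theorem Appends.nil {A : ℕ} {m m' : Memory} (h : m'.var 2 = m.var 2) (h' : m'.arr A = m.arr A) :
    Appends A m m' [] := ⟨h, Seg.nil _ _, fun _ _ => by rw [h']⟩

theorem Appends.congr {A : ℕ} {m₁ m₂ m₃ m₄ : Memory} {l : List ℕ} (h : Appends A m₂ m₃ l)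
    (h1 : m₂.var 2 = m₁.var 2) (h2 : m₂.arr A = m₁.arr A) (h3 : m₄.var 2 = m₃.var 2)
    (h4 : m₄.arr A = m₃.arr A) : Appends A m₁ m₄ l :=
  ⟨by rw [h3, h.ptr, h1], by rw [h4, ← h1]; exact h.seg, fun j hj => by
    rw [h4, ← h2]; exact h.keep j (by rwa [h1])⟩

/-- A loop that runs through the places from `s` to `s + k * l.length` in steps of `k`, and whose
body appends `g x` for the entry `x` of `l`. -/
theorem wp_each {α : Type*} {A P E k s T : ℕ} {l : List α} {g : α → List ℕ} (hk : 0 < k)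
    (hs : m.var P = s) (he : m.var E = s + k * l.length)
    (hP : writesVar p P = false) (hE : writesVar p E = false) (hPE : P ≠ E) (hP2 : P ≠ 2)
    (body : ∀ (i : ℕ) (h : i < l.length) (m' : Memory),
      Agree (p ;; P ≔ v P + .const k) m m' → m'.var P = s + k * i →
      wp p m' fun t m'' => t ≤ T ∧ Appends A m' m'' (g l[i])) :
    wp (.while (v P) (v E) (p ;; P ≔ v P + .const k)) m fun t m' =>
      t ≤ l.length * (T + 7) + 3 ∧ Appends A m m' (l.flatMap g) := by
  have hE' : writesVar (p ;; P ≔ v P + .const k) E = false := by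
    simp only [writesVar, hE, Bool.false_or]
    exact decide_eq_false hPE
  refine wp_while_uniform (T := T + 4) (n := l.length)
    (fun i m' => m'.var P = s + k * i ∧ Appends A m m' ((l.take i).flatMap g)) ?_ ?_ ?_ ?_
  · exact ⟨by simpa using hs, by simpa using Appends.nil rfl rfl⟩
  · rintro i m' hA ⟨h1, -⟩
    simp only [value_var]
    rw [h1, hA.var E hE', he, Nat.add_lt_add_iff_left, Nat.mul_lt_mul_left hk]
  · rintro i m' hi hA ⟨h1, h2⟩
    rw [wp_seq]
    refine (body i hi m' hA h1).mono fun t m'' hA' ⟨h3, h4⟩ => ?_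
    rw [wp_assign]
    refine ⟨?_, ?_, ?_⟩
    · change t + (1 + 1 + 1 + 1) ≤ _
      omega
    · change (m''.setVar P (m''.var P + k)).var P = _
      rw [var_setVar, if_pos rfl, hA'.var P hP, h1, mul_add, mul_one, add_assoc]
    · rw [List.take_add_one, List.getElem?_eq_getElem hi]
      simp only [Option.toList_some, List.flatMap_append, List.flatMap_cons, List.flatMap_nil,
        List.append_nil]
      exact (h2.trans h4).congr rfl rfl (by simp [hP2.symm]) rfl
  · rintro t m' hA ⟨-, h2⟩ ht
    refine ⟨ht, by rwa [List.take_length] at h2⟩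

/-- The lists `f 0, …, f (n - 1)` stand one after the other in the array `A`, and `S` is the array
of their addresses. -/
def Stream (S A : ℕ) (f : ℕ → List ℕ) (n : ℕ) (m : Memory) : Prop :=
  ∀ i < n, m.arr S (i + 1) = m.arr S i + (f i).length ∧ Seg (m.arr A) (m.arr S i) (f i)

/-- Run `body` for all numbers in variable `3` below variable `4`. -/
def pass (S : ℕ) (body : Program) : Program :=
  2 ≔ 0 ;; 3 ≔ 0 ;; .store S 0 0 ;; .while (v 3) (v 4) (body ;; 3 ≔ v 3 + 1 ;; .store S (v 3) (v 2))

/-- The lists are written consecutively. The invariant records that all stored addresses are at most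
the current pointer, so that later lists do not overwrite earlier ones. -/
theorem wp_pass {S A n T : ℕ} {f : ℕ → List ℕ} (hn : m.var 4 = n) (hSA : S ≠ A)
    (hS : writesArr p S = false) (h3 : writesVar p 3 = false) (h4 : writesVar p 4 = false)
    (body : ∀ i < n, ∀ m', Agree (pass S p) m m' → m'.var 3 = i →
      wp p m' fun t m'' => t ≤ T ∧ Appends A m' m'' (f i)) :
    wp (pass S p) m fun t m' => t ≤ n * (T + 10) + 10 ∧ Stream S A f n m' := by
  rw [pass, wp_seq, wp_assign, wp_seq, wp_assign, wp_seq, wp_store]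
  set m₀ := ((m.setVar 2 0).setVar 3 0).setArr S 0 0 with hm₀
  have hA₀ : Agree (pass S p) m m₀ := by
    refine ⟨fun x hx => ?_, fun a ha => ?_⟩
    · simp only [pass, writesVar, Bool.or_eq_false_iff, decide_eq_false_iff_not] at hx
      simp [hm₀, Ne.symm hx.1, Ne.symm hx.2.1]
    · simp only [pass, writesArr, Bool.or_eq_false_iff, decide_eq_false_iff_not] at ha
      simp [hm₀, Ne.symm ha.2.2.1]
  refine wp_while_uniform (T := T + 7) (n := n) (fun i m' => m'.var 3 = i ∧ m'.arr S i = m'.var 2 ∧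
    (∀ j < i, m'.arr S (j + 1) ≤ m'.var 2) ∧ Stream S A f i m') ?_ ?_ ?_ ?_
  · exact ⟨by simp, by simp, by simp, fun i hi => by simp at hi⟩
  · rintro i m' hA ⟨h, -⟩
    have := hA.var 4 (by simp only [writesVar, h4, Bool.false_or]; rfl)
    simp only [value_var, h, this]
    simp [hn]
  · rintro i m' hi hA ⟨h5, h6, h7, h8⟩
    rw [wp_seq]
    have hA' : Agree (pass S p) m m' := by
      refine hA₀.trans (hA.mono (fun x hx => ?_) (fun x hx => ?_))
      · simp only [pass, writesVar, Bool.or_eq_false_iff] at hx ⊢; tauto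
      · simp only [pass, writesArr, Bool.or_eq_false_iff] at hx ⊢; tauto
    refine (body i hi m' hA' h5).mono fun t m'' hB ⟨h9, h10⟩ => ?_
    rw [wp_seq, wp_assign, wp_store]
    have e3 := hB.var 3 h3
    have eS := hB.arr S hS
    refine ⟨by simp; omega, by simp [e3, h5], by simp [e3, h5], fun j hj => ?_, fun j hj => ?_⟩
    · simp only [arr_setArr, if_true, var_setArr, var_setVar, value_add, value_var, value_ofNat, e3,
        h5, h10.ptr, eS, arr_setVar, Function.update_apply]
      norm_num
      split_ifs with h
      · exact le_rfl
      · have := h7 j (by omega)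
        omega
    · have hp := h10.ptr
      -- The invariant bounds the addresses after each list, that is, the entries at `j + 1`; the
      -- entry at 0 has to be treated separately.
      have h11 : m'.arr S j ≤ m'.var 2 := by
        rcases Nat.eq_zero_or_pos j with rfl | hj0
        · rcases Nat.eq_zero_or_pos i with rfl | hi0
          · exact h6.le
          · have := (h8 0 hi0).1
            have := h7 0 hi0
            omega
        · obtain ⟨j, rfl⟩ := Nat.exists_eq_succ_of_ne_zero hj0.ne'
          exact h7 j (by omega)
      simp only [arr_setArr, if_true, var_setVar, value_add, value_var, value_ofNat, e3,
        h5, eS, arr_setVar, Function.update_apply, if_neg hSA.symm]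
      norm_num
      rw [if_neg (by omega : ¬ j = i + 1)]
      rcases Nat.lt_succ_iff_lt_or_eq.1 hj with hj | rfl
      · obtain ⟨h12, h13⟩ := h8 j hj
        have := h7 j hj
        rw [if_neg (by omega)]
        exact ⟨h12, h13.congr fun x _ hx => h10.keep x (by omega)⟩
      · rw [if_pos rfl, h6]
        exact ⟨hp, h10.seg⟩
  · rintro t m' hA ⟨-, -, -, h8⟩ ht
    refine ⟨?_, h8⟩
    simp only [cost_var, cost_ofNat] at ht ⊢
    have : n * (T + 7 + (1 + 1 + 1)) = n * (T + 10) := rfl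
    omega

end RAM

namespace LogPath

open RAM

variable {L : List CellRecord}

/-! ### Tables -/

namespace RawCell

/-- The number that encodes the constructor. -/
def kind : RawCell → ℕ
  | gen _ _ => 0
  | rel _ _ _ => 1
  | syz _ _ _ => 2

/-- The smallest vertex. -/
def left : RawCell → ℕ
  | gen _ a => a
  | rel _ a _ => a
  | syz _ a _ => a

/-- The distance of the first two vertices. -/
def step : RawCell → ℕ
  | gen _ _ => 0
  | rel _ _ r => 2 ^ r
  | syz _ _ r => 2 ^ r

end RawCell

/-- The entries of the arrays `20` to `25` at `n` describe the basis element `c`. -/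
structure Entry (L : List CellRecord) (m : Memory) (n : ℕ) (c : RawCell) : Prop where
  kind : m.arr 20 n = c.kind
  index : m.arr 21 n = c.index
  left : m.arr 22 n = c.left
  step : m.arr 23 n = c.step
  fst : m.arr 24 n = (c.degree L).1
  snd : m.arr 25 n = (c.degree L).2

/-- The address at which the position of a relation is stored in the array `26`. -/
def edgeKey (L : List CellRecord) (i a r : ℕ) : ℕ :=
  blockStart L i + blockStart L i + a + a + 2 ^ r

/-- The array `10` halves numbers, and the array `11` computes the largest power of two that
divides a number, up to the bound `n`. -/
structure Arithmetic (n : ℕ) (m : Memory) : Prop where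
  half : ∀ s < n + n, m.arr 10 s = s / 2
  low : ∀ a < n, ∀ r, 2 ^ r ≤ n → (2 ^ r ≤ m.arr 11 a ↔ 2 ^ r ∣ a)

/-- The arrays `0` and `10` to `26` contain the input and the tables that are computed first. -/
structure Tables (L : List CellRecord) (m : Memory) : Prop where
  arith : ∃ n, (∀ i, size L i + size L i ≤ n) ∧ Arithmetic n m
  size : ∀ i < L.length, m.arr 12 i = size L i
  start : ∀ i < L.length, m.arr 13 i = blockStart L i
  facets : ∀ i < L.length, Seg (m.arr 0) (m.arr 14 i) (facets L i)
  facets_end : ∀ i < L.length, m.arr 15 i = m.arr 14 i + (LogPath.facets L i).length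
  dim : ∀ i < L.length, m.arr 16 i = (record L i).dim
  entry : ∀ c, c.Valid L → Entry L m (idx L c) c
  edge : ∀ i a r, RawCell.Valid L (.rel i a r) → m.arr 26 (edgeKey L i a r) = idx L (.rel i a r)

/-- The program does not write to the arrays with the input and the tables. -/
def keepsTables (p : Program) : Bool :=
  [0, 10, 11, 12, 13, 14, 15, 16, 20, 21, 22, 23, 24, 25, 26].all fun a => !writesArr p a

theorem Tables.of_agree {p : Program} {m m' : Memory} (hT : Tables L m) (hA : Agree p m m')
    (hp : keepsTables p = true) : Tables L m' := by
  have h : ∀ a ∈ [0, 10, 11, 12, 13, 14, 15, 16, 20, 21, 22, 23, 24, 25, 26],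
      m'.arr a = m.arr a := fun a ha =>
    hA.arr a (by simpa using List.all_eq_true.1 hp a ha)
  simp only [List.forall_mem_cons] at h
  obtain ⟨h0, h10, h11, h12, h13, h14, h15, h16, h20, h21, h22, h23, h24, h25, h26, -⟩ := h
  obtain ⟨⟨n, hn, hn1, hn2⟩, h2, h3, h4, h5, h6, h7, h8⟩ := hT
  exact ⟨⟨n, hn, by rwa [h10], by rwa [h11]⟩, by rwa [h12], by rwa [h13], by rwa [h0, h14],
    by rwa [h15, h14], by rwa [h16],
    fun c hc => ⟨by rw [h20]; exact (h7 c hc).kind, by rw [h21]; exact (h7 c hc).index,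
      by rw [h22]; exact (h7 c hc).left, by rw [h23]; exact (h7 c hc).step,
      by rw [h24]; exact (h7 c hc).fst, by rw [h25]; exact (h7 c hc).snd⟩, by rwa [h26]⟩

theorem Tables.of_arr {m m' : Memory} (hT : Tables L m) (h : m'.arr = m.arr) : Tables L m' :=
  ⟨let ⟨n, hn, h1, h2⟩ := hT.arith; ⟨n, hn, by rwa [h], by rwa [h]⟩, by rw [h]; exact hT.size,
    by rw [h]; exact hT.start, by rw [h]; exact hT.facets, by rw [h]; exact hT.facets_end,
    by rw [h]; exact hT.dim, fun c hc => let ⟨h1, h2, h3, h4, h5, h6⟩ := hT.entry c hc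
      ⟨by rwa [h], by rwa [h], by rwa [h], by rwa [h], by rwa [h], by rwa [h]⟩,
    by rw [h]; exact hT.edge⟩

theorem Tables.gen {m : Memory} (hT : Tables L m) {i a : ℕ} (ha : a < LogPath.size L i) :
    m.arr 24 (blockStart L i + a) = (grade L i a).1 := by
  rw [← idx_gen ha]
  exact (hT.entry (.gen i a) ha).fst

theorem Tables.half {m : Memory} (hT : Tables L m) {i s : ℕ}
    (hs : s < LogPath.size L i + LogPath.size L i) : m.arr 10 s = s / 2 := by
  obtain ⟨n, hn, h⟩ := hT.arith
  exact h.half s (by have := hn i; omega)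

theorem Tables.low {m : Memory} (hT : Tables L m) {i a r : ℕ} (ha : a < LogPath.size L i)
    (hr : 2 ^ r ≤ LogPath.size L i + LogPath.size L i) : 2 ^ r ≤ m.arr 11 a ↔ 2 ^ r ∣ a := by
  obtain ⟨n, hn, h⟩ := hT.arith
  have := hn i
  exact h.low a (by omega) r (by omega)

/-! ### Choosing generators of facets -/

/-- Binary search for the last generator of the cell in variable `t` whose first coordinate is at
most that of the generator with the position in variable `g`. -/
def liftTo (g t : ℕ) : Program :=
  50 ≔ 13 # v t ;; 51 ≔ 12 # v t ;; 52 ≔ 24 # v g ;; 53 ≔ 0 ;; 54 ≔ v 51 ;;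
  .while (v 53 + 1) (v 54)
    (55 ≔ 10 # (v 53 + v 54) ;; .ite (v 52) (24 # (v 50 + v 55)) (54 ≔ v 55) (53 ≔ v 55))

theorem lift_eq {i a τ l : ℕ} (hl : l < size L τ)
    (h1 : (grade L τ l).1 ≤ (grade L i a).1)
    (h2 : ∀ l', l < l' → l' < size L τ → (grade L i a).1 < (grade L τ l').1) : lift L i a τ = l := by
  have h3 := Nat.findGreatest_spec
    (P := fun l => l < size L τ ∧ (grade L τ l).1 ≤ (grade L i a).1) hl.le ⟨hl, h1⟩
  have h4 : l ≤ lift L i a τ := Nat.le_findGreatest hl.le ⟨hl, h1⟩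
  refine le_antisymm (not_lt.1 fun h => ?_) h4
  exact absurd (h2 _ h h3.1) (not_lt.2 h3.2)

/-- Binary search with the invariant that the generator at the lower end qualifies, that none from
the upper end on does, and that the distance of the two is at most `2 ^ r`. First coordinates
increase, so one comparison at the middle decides for a whole half. -/
theorem wp_liftTo (hL : Admissible L) {m : Memory} (hT : Tables L m) {R : ℕ}
    (hR : ∀ i, size L i ≤ 2 ^ R) {g t i a τ : ℕ} (hτ : τ ∈ facets L i) (ha : a < size L i)
    (hg : m.var g = idx L (.gen i a)) (ht : m.var t = τ) (h : t ≠ 50 ∧ g ≠ 50 ∧ g ≠ 51) :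
    wp (liftTo g t) m fun k m' => k ≤ 18 * R + 20 ∧ m'.var 53 = lift L i a τ := by
  have hi := hL.facets_lt i τ hτ
  have hτ0 := hL.lift_spec hτ ha
  simp only [liftTo, wp_seq, wp_assign]
  set m₀ := Memory.setVar _ 54 _ with hm₀
  have e50 : m₀.var 50 = blockStart L τ := by simp [hm₀, ht, hT.start _ hi]
  have e51 : m₀.var 51 = size L τ := by simp [hm₀, ht, h.1, hT.size _ hi]
  have e52 : m₀.var 52 = (grade L i a).1 := by
    simp [hm₀, hg, h, (hT.entry (.gen i a) ha).fst, RawCell.degree]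
  have e53 : m₀.var 53 = 0 := by simp [hm₀]
  have e54 : m₀.var 54 = size L τ := by simp [hm₀, ht, h.1, hT.size _ hi]
  have ea : m₀.arr = m.arr := by simp [hm₀]
  clear_value m₀
  refine wp_while_variant (fun r m' => ∃ lo hi, m'.var 53 = lo ∧ m'.var 54 = hi ∧ lo < hi ∧
    hi ≤ size L τ ∧ hi - lo ≤ 2 ^ r ∧ (grade L τ lo).1 ≤ (grade L i a).1 ∧
    ∀ l, hi ≤ l → l < size L τ → (grade L i a).1 < (grade L τ l).1) 13 R ?_ ?_ ?_
  · refine ⟨0, size L τ, e53, e54, by omega, le_rfl, by have := hR τ; omega, ?_, fun l h1 h2 => by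
      omega⟩
    -- Generator 0 qualifies because it has the smallest first coordinate and the chosen generator
    -- qualifies.
    rcases Nat.eq_zero_or_pos (lift L i a τ) with h0 | h0
    · rw [← h0]; exact hτ0.2.1
    · exact (hL.fst_lt τ _ _ h0 hτ0.1).le.trans hτ0.2.1
  · rintro r m' hA ⟨lo, hi', h1, h2, h3, h4, h5, h6, h7⟩ hc
    simp only [value_add, value_var, value_ofNat, h1, h2] at hc
    obtain ⟨r, rfl⟩ : ∃ r', r = r' + 1 := Nat.exists_eq_succ_of_ne_zero (by
      rintro rfl
      simp only [pow_zero] at h5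
      omega)
    refine ⟨r, rfl, ?_⟩
    rw [pow_succ] at h5
    have a10 := hA.arr 10 rfl
    have a24 := hA.arr 24 rfl
    have v50 := hA.var 50 rfl
    have v52 := hA.var 52 rfl
    have hmid : m.arr 10 (lo + hi') = (lo + hi') / 2 := hT.half (i := τ) (by omega)
    have hX : m.arr 24 (blockStart L τ + (lo + hi') / 2) = (grade L τ ((lo + hi') / 2)).1 :=
      hT.gen (by omega)
    simp only [wp_seq, wp_assign, wp_ite]
    simp only [value_add, value_var, value_arr, var_setVar, arr_setVar, a10, a24, v50, v52, h1, h2,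
      ea, e50, e52, hmid, if_true, cost_add, cost_var, cost_arr]
    norm_num [hX]
    refine ⟨fun hlt => ⟨by omega, by omega, by omega, h6, fun l hl hl' => ?_⟩,
      fun hle => ⟨by omega, h4, by omega, hle, h7⟩⟩
    rcases hl.eq_or_lt with rfl | hl
    · exact hlt
    · exact hlt.trans (hL.fst_lt τ _ _ hl hl')
  · rintro k r m' hA ⟨lo, hi', h1, h2, h3, h4, h5, h6, h7⟩ hc ht
    simp only [value_add, value_var, value_ofNat, h1, h2] at hc
    refine ⟨?_, ?_⟩
    · simp only [cost_add, cost_var, cost_arr, cost_ofNat] at ht ⊢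
      omega
    · rw [h1, lift_eq (by omega) h6 fun l hl => h7 l (by omega)]

end LogPath

namespace LogPath

open RAM

variable {L : List CellRecord}

/-! ### Tracing paths -/

/-- Load the ends of the path described by the variables `60` to `62`, in increasing order. -/
def orderEnds : Program :=
  .ite (v 61) (v 62) (63 ≔ v 61 ;; 64 ≔ v 62) (63 ≔ v 62 ;; 64 ≔ v 61) ;;
  65 ≔ 13 # v 60 ;; 65 ≔ v 65 + v 65

/-- The length of the longest edge from `63` that does not overshoot `64`. -/
def longestEdge : Program :=
  66 ≔ 1 ;; 67 ≔ 1 ;;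
  .while (v 63 + v 67) (v 64 + 1)
    (.ite (v 67) (11 # v 63 + 1) (66 ≔ v 67) .skip ;; 67 ≔ v 67 + v 67)

/-- Append the positions of the relations on the path described by the variables `60` to `62`. -/
def tracePath : Program :=
  orderEnds ;;
  .while (v 63) (v 64)
    (longestEdge ;; .store 34 (v 2) (26 # (v 65 + v 63 + v 63 + v 66)) ;; 2 ≔ v 2 + 1 ;;
      63 ≔ v 63 + v 66)

theorem wp_orderEnds {m : Memory} (hT : Tables L m) {x : ℕ × ℕ × ℕ} (h0 : m.var 60 = x.1)
    (h1 : m.var 61 = x.2.1) (h2 : m.var 62 = x.2.2) (hx : x.1 < L.length) :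
    wp orderEnds m fun k m' => k ≤ 20 ∧ m'.var 63 = min x.2.1 x.2.2 ∧
      m'.var 64 = max x.2.1 x.2.2 ∧ m'.var 65 = blockStart L x.1 + blockStart L x.1 ∧
      m'.arr = m.arr := by
  simp only [orderEnds, wp_seq, wp_assign, wp_ite]
  constructor
  · intro h
    simp only [value_var, h1, h2] at h
    simp [h0, h1, h2, hT.start _ hx, h.le]
  · intro h
    simp only [value_var, h1, h2, not_lt] at h
    simp [h0, h1, h2, hT.start _ hx, h]

/-- All powers of two that do not overshoot are tried in increasing order and the last one dividing
`a` is kept. Divisibility is a comparison with the table of largest dividing powers. There are at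
most `R` trials since `b < 2 ^ R`. -/
theorem wp_longestEdge {m : Memory} (hT : Tables L m) {R i a b : ℕ} (hR : size L i ≤ 2 ^ R)
    (ha : m.var 63 = a) (hb : m.var 64 = b) (hab : a < b) (hbi : b < size L i) :
    wp longestEdge m fun k m' => k ≤ 20 * R + 20 ∧ m'.var 66 = 2 ^ firstLevel a b := by
  simp only [longestEdge, wp_seq, wp_assign]
  set m₀ := Memory.setVar _ 67 _ with hm₀
  have e63 : m₀.var 63 = a := by simp [hm₀, ha]
  have e64 : m₀.var 64 = b := by simp [hm₀, hb]
  have e66 : m₀.var 66 = 1 := by simp [hm₀]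
  have e67 : m₀.var 67 = 1 := by simp [hm₀]
  have ea : m₀.arr = m.arr := by simp [hm₀]
  clear_value m₀
  refine wp_while_variant (fun r m' => ∃ j s, j + r = R ∧ m'.var 67 = 2 ^ j ∧ m'.var 66 = 2 ^ s ∧
    2 ^ s ∣ a ∧ a + 2 ^ s ≤ b ∧ ∀ r < j, 2 ^ r ∣ a → r ≤ s) 13 R ?_ ?_ ?_
  · exact ⟨0, 0, by omega, by simpa, by simpa, by simp, by simpa, by simp⟩
  · rintro r m' hA ⟨j, s, h1, h2, h3, h4, h5, h6⟩ hc
    have v63 := hA.var 63 rfl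
    have v64 := hA.var 64 rfl
    have a11 := hA.arr 11 rfl
    simp only [value_add, value_var, value_ofNat, h2, v63, v64, e63, e64] at hc
    obtain ⟨r, rfl⟩ : ∃ r', r = r' + 1 := Nat.exists_eq_succ_of_ne_zero (by
      rintro rfl
      rw [add_zero] at h1
      rw [← h1] at hR
      omega)
    refine ⟨r, rfl, ?_⟩
    have hlow := hT.low (i := i) (a := a) (r := j) (by omega) (by omega)
    simp only [wp_seq, wp_assign, wp_ite, wp_skip]
    simp only [value_add, value_var, value_arr, value_ofNat, var_setVar, h2, v63, a11, ea, e63,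
      Nat.lt_add_one_iff, hlow, cost_add, cost_var, cost_arr, cost_ofNat]
    refine ⟨fun hd => ⟨by omega, j + 1, j, by omega, ?_, ?_, hd, by omega, fun r hr _ => by omega⟩,
      fun hd => ⟨by omega, j + 1, s, by omega, ?_, ?_, h4, h5, fun r hr hr' => ?_⟩⟩
    · simp [pow_succ, mul_two]
    · simp
    · simp [pow_succ, mul_two]
    · simp [h3]
    · rcases Nat.lt_succ_iff_lt_or_eq.1 hr with hr | rfl
      · exact h6 r hr hr'
      · exact absurd hr' hd
  · rintro k r m' hA ⟨j, s, h1, h2, h3, h4, h5, h6⟩ hc ht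
    have v63 := hA.var 63 rfl
    have v64 := hA.var 64 rfl
    simp only [value_add, value_var, value_ofNat, h2, v63, v64, e63, e64] at hc
    refine ⟨?_, ?_⟩
    · simp only [cost_add, cost_var, cost_ofNat] at ht ⊢
      omega
    · rw [h3]
      congr 1
      refine le_antisymm (le_firstLevel h4 h5) ?_
      obtain ⟨h7, h8⟩ := firstLevel_spec hab
      refine h6 _ ?_ h7
      exact (Nat.pow_lt_pow_iff_right (a := 2) (by norm_num)).1 (by omega)

/-- At most `2 R` edges, each found in `O(R)` steps. -/
theorem wp_tracePath {m : Memory} (hT : Tables L m) {R : ℕ} {x : ℕ × ℕ × ℕ}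
    (hR : size L x.1 ≤ 2 ^ R) (h0 : m.var 60 = x.1) (h1 : m.var 61 = x.2.1) (h2 : m.var 62 = x.2.2)
    (hx : x.2.1 < size L x.1 ∧ x.2.2 < size L x.1) :
    wp tracePath m fun k m' => k ≤ 2 * R * (20 * R + 50) + 30 ∧
      Appends 34 m m' (((pathEdges x).map edgeCell).map (idx L)) := by
  have hi : x.1 < L.length := lt_length_of_size_pos (Nat.zero_lt_of_lt hx.1)
  rw [tracePath, wp_seq]
  refine (wp_orderEnds hT h0 h1 h2 hi).mono fun k m₀ hA₀ ⟨hk, e63, e64, e65, ea⟩ => ?_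
  have hT₀ : Tables L m₀ := hT.of_agree hA₀ rfl
  have e2 := hA₀.var 2 rfl
  set a := min x.2.1 x.2.2 with ha
  set b := max x.2.1 x.2.2 with hb
  have hbi : b < size L x.1 := max_lt hx.1 hx.2
  have hval : ∀ e ∈ shortestPath a b, (edgeCell (x.1, e)).Valid L := fun e he =>
    valid_of_mem_pathEdges hx (mem_pathEdges.2 ⟨rfl, he⟩)
  have hpath : ((pathEdges x).map edgeCell).map (idx L) =
      (shortestPath a b).map fun e => idx L (edgeCell (x.1, e)) := by
    rw [pathEdges, List.map_map, List.map_map]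
    rfl
  rw [hpath]
  -- The variant is the length of the remaining path; what has been written followed by the
  -- positions on the remaining path is always the complete list.
  refine wp_while_variant (fun r m' => ∃ c l, m'.var 63 = c ∧ r = (shortestPath c b).length ∧
    (∀ e ∈ shortestPath c b, (edgeCell (x.1, e)).Valid L) ∧ Appends 34 m₀ m' l ∧
    l ++ (shortestPath c b).map (fun e => idx L (edgeCell (x.1, e))) =
      (shortestPath a b).map fun e => idx L (edgeCell (x.1, e))) (20 * R + 40)
    (shortestPath a b).length ?_ ?_ ?_
  · exact ⟨a, [], e63, rfl, hval, Appends.nil rfl rfl, rfl⟩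
  · rintro r m' hA ⟨c, l, h3, h4, h5, h6, h7⟩ hc
    have v64 := hA.var 64 rfl
    have v65 := hA.var 65 rfl
    simp only [value_var, h3, v64, e64] at hc
    rw [shortestPath_of_lt hc] at h4 h5 h7
    refine ⟨_, h4, ?_⟩
    rw [wp_seq]
    refine (wp_longestEdge (hT₀.of_agree hA rfl) hR h3 (v64.trans e64) hc hbi).mono
      fun k m'' hA' ⟨hk, h8⟩ => ?_
    have v63 := hA'.var 63 rfl
    have v65' := hA'.var 65 rfl
    have v2 := hA'.var 2 rfl
    have a26 := (hA.arr 26 rfl).symm ▸ (hA'.arr 26 rfl)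
    have a34 := hA'.arr 34 rfl
    have hE : m''.arr 26 (blockStart L x.1 + blockStart L x.1 + c + c + 2 ^ firstLevel c b) =
        idx L (edgeCell (x.1, c, firstLevel c b)) := by
      rw [a26]
      exact hT₀.edge x.1 c _ (h5 _ List.mem_cons_self)
    simp only [wp_seq, wp_assign, wp_store]
    simp only [value_add, value_var, value_arr, value_ofNat, var_setVar, var_setArr, h8, v63, v65',
      v65, e65, h3, hE, v2, cost_add, cost_var, cost_arr, cost_ofNat]
    refine ⟨by omega, c + 2 ^ firstLevel c b, l ++ [idx L (edgeCell (x.1, c, firstLevel c b))], ?_,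
      rfl, fun e he => h5 e (List.mem_cons_of_mem _ he), ?_, ?_⟩
    · simp
    · refine h6.trans ⟨by simp, ?_, fun j hj => ?_⟩
      · simp [seg_cons, Seg.nil]
      · simp [a34, hj.ne]
    · rw [← h7]
      simp
  · rintro t r m' hA ⟨c, l, h3, h4, h5, h6, h7⟩ hc ht
    have v64 := hA.var 64 rfl
    simp only [value_var, h3, v64, e64, not_lt] at hc
    rw [shortestPath_of_le hc, List.map_nil, List.append_nil] at h7
    refine ⟨?_, h7 ▸ h6.congr e2 (by rw [ea]) rfl rfl⟩
    have h8 : (shortestPath a b).length ≤ 2 * R := length_shortestPath (hbi.trans_le hR)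
    have h9 : (shortestPath a b).length * (20 * R + 40 + 3) ≤ 2 * R * (20 * R + 50) :=
      Nat.mul_le_mul h8 (by omega)
    have ht' : t ≤ (shortestPath a b).length * (20 * R + 40 + 3) + 3 := ht
    omega

/-! ### Collecting triangles -/

/-- Append the positions of the syzygies around the path described by the variables `60` to `62`. -/
def collectTriangles : Program :=
  orderEnds ;; 66 ≔ v 63 ;; 67 ≔ 1 ;;
  .while (v 66 + v 67) (v 64 + 1)
    (.ite (v 66) (v 63)
        (.store 36 (v 2) (26 # (v 65 + v 66 + v 66 + v 67) + 1) ;; 2 ≔ v 2 + 1) .skip ;;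
      .ite (v 67 + v 67) (11 # v 66 + 1) .skip (66 ≔ v 66 - v 67) ;; 67 ≔ v 67 + v 67)

/-- Rounding down to the next power of two clears at most one more binary digit. This allows an
update by one divisibility test and one subtraction, without division. -/
theorem sub_mod_two_pow_succ (a j : ℕ) : a - a % 2 ^ (j + 1) =
    if 2 ^ (j + 1) ∣ a - a % 2 ^ j then a - a % 2 ^ j else a - a % 2 ^ j - 2 ^ j := by
  have h0 : 0 < 2 ^ j := by positivity
  have h1 : a % 2 ^ (j + 1) = a % 2 ^ j + 2 ^ j * (a / 2 ^ j % 2) := by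
    rw [pow_succ, Nat.mod_mul]
  have h2 : a - a % 2 ^ j = 2 ^ j * (a / 2 ^ j) := by
    have := Nat.div_add_mod a (2 ^ j)
    omega
  have h3 : 2 ^ (j + 1) ∣ a - a % 2 ^ j ↔ 2 ∣ a / 2 ^ j := by
    rw [h2, pow_succ]
    exact Nat.mul_dvd_mul_iff_left h0
  simp only [h3]
  rw [h1]
  rcases Nat.mod_two_eq_zero_or_one (a / 2 ^ j) with h | h
  · rw [if_pos (Nat.dvd_of_mod_eq_zero h), h]
    omega
  · rw [if_neg (by omega), h]
    omega

/-- The right ends of the dyadic intervals that start at `a` rounded down do not decrease with the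
level. So a loop may stop at the first interval that leaves `[0, b]`. -/
theorem trianglesAround_eq {a b n : ℕ} (h1 : ∀ r < n, a - a % 2 ^ r + 2 ^ r ≤ b)
    (h2 : b < a - a % 2 ^ n + 2 ^ n) : trianglesAround a b =
      ((List.range n).filter fun r => a % 2 ^ r ≠ 0).map fun r => (a - a % 2 ^ r, r - 1) := by
  have hmono : ∀ r, n ≤ r → b < a - a % 2 ^ r + 2 ^ r := by
    intro r hr
    -- This is the monotonicity of the right ends, written without subtraction.
    have e1 : a % 2 ^ n + 2 ^ r ≥ a % 2 ^ r + 2 ^ n := by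
      obtain ⟨k, rfl⟩ := Nat.exists_eq_add_of_le hr
      have h3 : a % 2 ^ (n + k) = a % 2 ^ n + 2 ^ n * (a / 2 ^ n % 2 ^ k) := by
        rw [pow_add, Nat.mod_mul]
      have h4 : a / 2 ^ n % 2 ^ k + 1 ≤ 2 ^ k := Nat.mod_lt _ (by positivity)
      have h5 := Nat.mul_le_mul_left (2 ^ n) h4
      rw [h3, pow_add]
      rw [mul_add, mul_one] at h5
      omega
    have e2 := Nat.mod_le a (2 ^ n)
    have e3 := Nat.mod_le a (2 ^ r)
    omega
  have hnb : n ≤ b + 1 := by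
    by_contra hc
    have := h1 (b + 1) (by omega)
    have := Nat.lt_two_pow_self (n := b + 1)
    omega
  rw [trianglesAround]
  congr 1
  obtain ⟨k, hk⟩ := Nat.exists_eq_add_of_le hnb
  rw [hk, List.range_add, List.filter_append]
  have : List.filter (fun r => decide (a % 2 ^ r ≠ 0 ∧ a - a % 2 ^ r + 2 ^ r ≤ b))
      (List.map (fun x => n + x) (List.range k)) = [] := by
    rw [List.filter_eq_nil_iff]
    intro r hr
    obtain ⟨y, -, rfl⟩ := List.mem_map.1 hr
    have := hmono (n + y) (by omega)
    simp only [decide_eq_true_eq]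
    omega
  rw [this, List.append_nil]
  refine List.filter_congr fun r hr => ?_
  simp [h1 r (List.mem_range.1 hr)]

/-- Variable `66` holds `a` rounded down to a multiple of the power in variable `67`. The test `66 <
63` says that this power does not divide `a`, so that `a` is in the interior of the interval. -/
theorem wp_collectTriangles {m : Memory} (hT : Tables L m) {R : ℕ} {x : ℕ × ℕ × ℕ}
    (hR : size L x.1 ≤ 2 ^ R) (h0 : m.var 60 = x.1) (h1 : m.var 61 = x.2.1) (h2 : m.var 62 = x.2.2)
    (hx : x.2.1 < size L x.1 ∧ x.2.2 < size L x.1) :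
    wp collectTriangles m fun k m' => k ≤ 50 * R + 50 ∧
      Appends 36 m m' ((pathTriangles x).map (idx L)) := by
  have hi : x.1 < L.length := lt_length_of_size_pos (Nat.zero_lt_of_lt hx.1)
  rw [collectTriangles, wp_seq]
  refine (wp_orderEnds hT h0 h1 h2 hi).mono fun k m₁ hA₁ ⟨hk, e63, e64, e65, ea⟩ => ?_
  have hT₁ : Tables L m₁ := hT.of_agree hA₁ rfl
  have e2 := hA₁.var 2 rfl
  simp only [wp_seq (p := 66 ≔ _), wp_seq (p := 67 ≔ _), wp_assign]
  set m₀ := Memory.setVar _ 67 _ with hm₀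
  have hT₀ : Tables L m₀ := hT₁.of_arr rfl
  set a := min x.2.1 x.2.2 with ha
  set b := max x.2.1 x.2.2 with hb
  have f63 : m₀.var 63 = a := by simp [hm₀, e63]
  have f64 : m₀.var 64 = b := by simp [hm₀, e64]
  have f65 : m₀.var 65 = blockStart L x.1 + blockStart L x.1 := by simp [hm₀, e65]
  have f66 : m₀.var 66 = a := by simp [hm₀, e63]
  have f67 : m₀.var 67 = 1 := by simp [hm₀]
  have f2 : m₀.var 2 = m₁.var 2 := by simp [hm₀]
  have fa : m₀.arr = m₁.arr := by simp [hm₀]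
  clear_value m₀
  have hbi : b < size L x.1 := max_lt hx.1 hx.2
  have hab : a ≤ b := min_le_max
  set F : ℕ → ℕ := fun r => idx L (triangleCell x.1 (a - a % 2 ^ r, r - 1)) with hF
  refine wp_while_variant (fun r m' => ∃ j, j + r = R ∧ m'.var 67 = 2 ^ j ∧
    m'.var 66 = a - a % 2 ^ j ∧ (∀ r < j, a - a % 2 ^ r + 2 ^ r ≤ b) ∧
    Appends 36 m₀ m' (((List.range j).filter fun r => a % 2 ^ r ≠ 0).map F)) 43 R ?_ ?_ ?_
  · exact ⟨0, by omega, by simpa, by simp [f66, Nat.mod_one], by simp,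
      by simpa using Appends.nil rfl rfl⟩
  · rintro r m' hA ⟨j, h3, h4, h5, h6, h7⟩ hc
    have v63 := hA.var 63 rfl
    have v64 := hA.var 64 rfl
    have v65 := hA.var 65 rfl
    simp only [value_add, value_var, value_ofNat, h4, h5, v64, f64] at hc
    obtain ⟨r, rfl⟩ : ∃ r', r = r' + 1 := Nat.exists_eq_succ_of_ne_zero (by
      rintro rfl
      rw [add_zero] at h3
      rw [← h3] at hR
      omega)
    refine ⟨r, rfl, ?_⟩
    have h6' : ∀ r < j + 1, a - a % 2 ^ r + 2 ^ r ≤ b := by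
      intro r hr
      rcases Nat.lt_succ_iff_lt_or_eq.1 hr with hr | rfl
      · exact h6 r hr
      · omega
    -- The test concerns the power `2 ^ (j + 1)`, which may exceed the number of generators but not
    -- its double; therefore the tables extend to twice the sizes.
    have hlow := hT₀.low (i := x.1) (a := a - a % 2 ^ j) (r := j + 1) (by omega)
      (by rw [pow_succ]; omega)
    rw [pow_succ, mul_two] at hlow
    have a11 := hA.arr 11 rfl
    have a26 := hA.arr 26 rfl
    have hmod := sub_mod_two_pow_succ a j
    rw [pow_succ, mul_two] at hmod
    have hmodle := Nat.mod_le a (2 ^ j)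
    rw [wp_seq]
    have step₁ : wp (.ite (v 66) (v 63)
        (.store 36 (v 2) (26 # (v 65 + v 66 + v 66 + v 67) + 1) ;; 2 ≔ v 2 + 1) .skip) m'
        fun t m'' => t ≤ 20 ∧
          Appends 36 m₀ m'' (((List.range (j + 1)).filter fun r => a % 2 ^ r ≠ 0).map F) := by
      rw [List.range_succ, List.filter_append, List.map_append]
      rw [wp_ite]
      simp only [wp_seq, wp_assign, wp_store, wp_skip]
      simp only [value_add, value_var, value_arr, value_ofNat, h4, h5, v63, v65, f63,
        f65, a26, cost_add, cost_var, cost_arr, cost_ofNat]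
      refine ⟨fun h => ⟨by omega, ?_⟩, fun h => ⟨by omega, ?_⟩⟩
      · have hne : a % 2 ^ j ≠ 0 := by omega
        have hj : j - 1 + 1 = j := Nat.sub_add_cancel (Nat.pos_of_ne_zero (by
          rintro rfl; simp [Nat.mod_one] at hne))
        have hvalid : RawCell.Valid L (.syz x.1 (a - a % 2 ^ j) (j - 1)) := by
          simp only [RawCell.Valid, hj]
          exact ⟨Nat.dvd_sub_mod a, by omega⟩
        have hvalid' : RawCell.Valid L (.rel x.1 (a - a % 2 ^ j) j) :=
          ⟨Nat.dvd_sub_mod a, by omega⟩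
        -- The table yields the longest edge of the triangle, of level `j`; the syzygy, of level `j
        -- - 1`, is at the next position.
        have hE : m₀.arr 26 (blockStart L x.1 + blockStart L x.1 + (a - a % 2 ^ j) +
            (a - a % 2 ^ j) + 2 ^ j) + 1 = F j := by
          rw [hF]
          simp only [triangleCell]
          rw [idx_syz hvalid, hj, ← hT₀.edge _ _ _ hvalid', edgeKey]
        rw [hE]
        refine h7.trans ⟨by simp [hne], ?_, fun i hi => ?_⟩
        · simp [hne, seg_cons, Seg.nil]
        · simp [hi.ne]
      · have hne : a % 2 ^ j = 0 := by omega
        simpa [hne] using h7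
    refine step₁.mono fun t m'' hA' ⟨ht, h8⟩ => ?_
    have w66 := hA'.var 66 rfl
    have w67 := hA'.var 67 rfl
    have w11 := hA'.arr 11 rfl
    simp only [wp_seq, wp_assign, wp_ite, wp_skip]
    simp only [value_add, value_sub, value_var, value_arr, value_ofNat, w66, w67, h4, h5, w11, a11,
      Nat.lt_add_one_iff, hlow, cost_add, cost_sub, cost_var, cost_arr, cost_ofNat]
    refine ⟨fun hd => ⟨by omega, j + 1, by omega, ?_, ?_, h6', h8.congr rfl rfl ?_ rfl⟩,
      fun hd => ⟨by omega, j + 1, by omega, ?_, ?_, h6', h8.congr rfl rfl ?_ rfl⟩⟩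
    · simp [pow_succ, mul_two]
    · simp [w66, h5, pow_succ, mul_two, hmod, hd]
    · simp
    · simp [pow_succ, mul_two, w67, h4]
    · simp [pow_succ, mul_two, hmod, hd]
    · simp
  · rintro t r m' hA ⟨j, h3, h4, h5, h6, h7⟩ hc ht
    have v64 := hA.var 64 rfl
    simp only [value_add, value_var, value_ofNat, h4, h5, v64, f64] at hc
    have hp : (pathTriangles x).map (idx L) =
        ((List.range j).filter fun r => a % 2 ^ r ≠ 0).map F := by
      rw [pathTriangles, ← ha, ← hb, trianglesAround_eq h6 (by omega), List.map_map, List.map_map]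
      rfl
    refine ⟨?_, ?_⟩
    · simp only [cost_add, cost_var, cost_ofNat] at ht ⊢
      omega
    · rw [hp]
      exact h7.congr (f2.trans e2) (by rw [fa, ea]) rfl rfl

end LogPath

namespace LogPath

open RAM

variable {L : List CellRecord}

/-! ### Loops over facets -/

/-- Run `p` for all facets of the cell in variable `c`; the facet is in variable `x`. -/
def eachFacet (P E c x : ℕ) (p : Program) : Program :=
  P ≔ 14 # v c ;; E ≔ 15 # v c ;; .while (v P) (v E) ((x ≔ 0 # v P ;; p) ;; P ≔ v P + .const 1)

/-- The factor in the cost of a loop. -/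
def loopCost (D K : ℕ) : ℕ := (D + 1) * (K + 30)

theorem le_loopCost {D K S n : ℕ} (hn : n ≤ D) (hS : 1 ≤ S) :
    n * (K * S + 20) + 20 ≤ loopCost D K * S := by
  have h1 : n * (K * S + 20) ≤ D * ((K + 30) * S) :=
    Nat.mul_le_mul hn (by rw [add_mul]; omega)
  have h2 : loopCost D K * S = D * ((K + 30) * S) + (K * S + 30 * S) := by
    rw [loopCost]; ring
  omega

theorem le_loopCost_self (D K : ℕ) : K ≤ loopCost D K := by
  rw [loopCost, add_mul, one_mul]
  omega

/-- The bound is split into a factor `K` that depends on the dimension and a factor `S` for the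
logarithms. Nesting loops changes only the first factor. -/
theorem wp_eachFacet {m : Memory} (hT : Tables L m) {A P E c x i K S D : ℕ} {p : Program}
    {g : ℕ → List ℕ} (hi : i < L.length) (hc : m.var c = i)
    (hne : P ≠ E ∧ P ≠ 2 ∧ E ≠ 2 ∧ x ≠ 2 ∧ c ≠ P ∧ x ≠ P ∧ x ≠ E)
    (hPE : writesVar p P = false ∧ writesVar p E = false ∧ writesArr p 0 = false)
    (hD : (facets L i).length ≤ D) (hS : 1 ≤ S)
    (body : ∀ τ ∈ facets L i, ∀ m', Agree (eachFacet P E c x p) m m' → m'.var x = τ →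
      wp p m' fun t m'' => t ≤ K * S ∧ Appends A m' m'' (g τ)) :
    wp (eachFacet P E c x p) m fun t m' =>
      t ≤ loopCost D K * S ∧ Appends A m m' ((facets L i).flatMap g) := by
  obtain ⟨hPE', hP2, hE2, hx2, hcP, hxP, hxE⟩ := hne
  have hx : ∀ y : ℕ, y ≠ x → decide (x = y) = false := fun y h => decide_eq_false h.symm
  simp only [eachFacet, wp_seq (p := P ≔ _), wp_seq (p := E ≔ _), wp_assign]
  set m₀ := Memory.setVar _ E _ with hm₀
  have hA₀ : Agree (eachFacet P E c x p) m m₀ :=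
    (agree_setVar (by simp [eachFacet, writesVar])).trans
      (agree_setVar (by simp [eachFacet, writesVar]))
  refine (wp_each (A := A) (k := 1) (T := K * S + 3) (l := facets L i) (g := g)
    (s := m.arr 14 i) (by norm_num) ?_ ?_ ?_ ?_ hPE' hP2 ?_).mono fun t m' hA ⟨ht, h⟩ => ⟨?_, ?_⟩
  · simp [hm₀, hPE', hc]
  · simp [hm₀, hcP, hc, hT.facets_end i hi]
  · simp [writesVar, hPE.1, hxP]
  · simp [writesVar, hPE.2.1, hxE]
  · intro j hj m' hA hj'
    rw [wp_seq, wp_assign]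
    have ha : m'.arr 0 = m.arr 0 := by
      rw [hA.arr 0 (by simp [writesArr, hPE.2.2])]
      rfl
    refine (body (facets L i)[j] (List.getElem_mem hj) _ ?_ ?_).mono fun t m'' _ ⟨ht, h⟩ => ⟨?_, ?_⟩
    · refine hA₀.trans ((hA.trans (agree_setVar (by simp [writesVar]))).mono (fun y hy => ?_)
        fun a ha => ?_)
      · simp only [eachFacet, writesVar, Bool.or_eq_false_iff] at hy ⊢; tauto
      · simp only [eachFacet, writesArr, Bool.or_eq_false_iff] at ha ⊢; tauto
    · simp only [value_var, value_arr, var_setVar, if_true, hj', ha]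
      rw [one_mul, hT.facets i hi j hj]
    · simp only [cost_arr, cost_var]; omega
    · exact h.congr (by simp [hx2.symm]) rfl rfl rfl
  · refine le_trans ?_ (le_loopCost hD hS)
    simp only [cost_arr, cost_var]
    have : (facets L i).length * (K * S + 3 + 7) ≤ (facets L i).length * (K * S + 20) :=
      Nat.mul_le_mul_left _ (by omega)
    omega
  · exact h.congr (by simp [hm₀, hP2.symm, hE2.symm]) rfl rfl rfl

/-! ### The paths in the boundaries -/

/-- The basis element at a position. -/
def cellAt (L : List CellRecord) (n : ℕ) : RawCell := (cells L).getD n (.gen 0 0)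

theorem cellAt_idx {c : RawCell} (hc : c.Valid L) : cellAt L (idx L c) = c := by
  rw [cellAt, List.getD_eq_getElem _ _ (idx_lt hc), getElem_idx hc]

theorem valid_cellAt {n : ℕ} (hn : n < (cells L).length) : (cellAt L n).Valid L := by
  rw [cellAt, List.getD_eq_getElem _ _ hn]
  exact mem_cells.1 (List.getElem_mem hn)

theorem idx_cellAt {n : ℕ} (hn : n < (cells L).length) : idx L (cellAt L n) = n := by
  rw [cellAt, List.getD_eq_getElem _ _ hn, idx_getElem]

theorem Tables.entry_cellAt {m : Memory} (hT : Tables L m) {n : ℕ} (hn : n < (cells L).length) :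
    Entry L m n (cellAt L n) := by
  have := hT.entry _ (valid_cellAt hn)
  rwa [idx_cellAt hn] at this

/-- A path as three numbers in memory. -/
def flatten (x : ℕ × ℕ × ℕ) : List ℕ := [x.1, x.2.1, x.2.2]

/-- Append the facet in variable `r` and the generators of it chosen for the generators at the
positions in the variables `24` and `28`. -/
def emitPath (r : ℕ) : Program :=
  .store 33 (v 2) (v r) ;; liftTo 24 r ;; .store 33 (v 2 + 1) (v 53) ;; liftTo 28 r ;;
  .store 33 (v 2 + 2) (v 53) ;; 2 ≔ v 2 + 3

/-- Append the paths in the boundary of the basis element in variable `3`. -/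
def emitPaths : Program :=
  .ite (20 # v 3) 1
    (20 ≔ 21 # v 3 ;; eachFacet 21 22 20 23 (liftTo 3 23 ;; 24 ≔ 13 # v 23 + v 53 ;;
      eachFacet 25 26 20 27 (liftTo 3 27 ;; 28 ≔ 13 # v 27 + v 53 ;;
        eachFacet 29 30 23 31 (eachFacet 32 33 27 34
          (.ite (v 23) (v 27)
            (.ite (v 31) (v 34) .skip (.ite (v 34) (v 31) .skip (emitPath 31))) .skip)))))
    (.ite (20 # v 3) 2
      (20 ≔ 21 # v 3 ;; 24 ≔ 13 # v 20 + 22 # v 3 ;; 28 ≔ v 24 + 23 # v 3 ;;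
        eachFacet 21 22 20 23 (emitPath 23))
      .skip)

section

variable (hL : Admissible L) {R D : ℕ} (hR : ∀ i, size L i ≤ 2 ^ R)
  (hD : ∀ i, (facets L i).length ≤ D)

include hL hR

theorem wp_emitPath {m : Memory} (hT : Tables L m) {r τ a τ' a' ρ : ℕ} (hr : r = 23 ∨ r = 31)
    (hρ : m.var r = ρ) (h24 : m.var 24 = idx L (.gen τ a)) (h28 : m.var 28 = idx L (.gen τ' a'))
    (hτ : ρ ∈ facets L τ) (hτ' : ρ ∈ facets L τ') (ha : a < size L τ) (ha' : a' < size L τ') :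
    wp (emitPath r) m fun k m' => k ≤ 80 * (R + 1) ∧
      Appends 33 m m' (flatten (ρ, lift L τ a ρ, lift L τ' a' ρ)) := by
  rw [emitPath, wp_seq, wp_store, wp_seq]
  set m₁ := m.setArr 33 ((v 2).value m) ((v r).value m) with hm₁
  have hT₁ : Tables L m₁ := hT.of_agree (p := .store 33 (v 2) (v r))
    (agree_setArr rfl) rfl
  have b33 : m₁.arr 33 = Function.update (m.arr 33) (m.var 2) ρ := by simp [hm₁, hρ]
  refine (wp_liftTo hL hT₁ hR hτ ha (g := 24) (t := r) h24 hρ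
    (by rcases hr with rfl | rfl <;> decide)).mono fun k₁ m₂ hA ⟨hk₁, e₁⟩ => ?_
  have a2 : m₂.var 2 = m.var 2 := hA.var 2 rfl
  have a33 := (hA.arr 33 rfl).trans b33
  have a28 : m₂.var 28 = m.var 28 := hA.var 28 rfl
  have ar : m₂.var r = ρ := (hA.var r (by rcases hr with rfl | rfl <;> rfl)).trans hρ
  have hT₂ : Tables L m₂ := hT₁.of_agree hA rfl
  rw [wp_seq, wp_store, wp_seq]
  set m₃ := m₂.setArr 33 ((v 2 + 1).value m₂) ((v 53).value m₂) with hm₃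
  have hT₃ : Tables L m₃ := hT₂.of_agree (p := .store 33 (v 2) (v r))
    (agree_setArr rfl) rfl
  have c33 : m₃.arr 33 = Function.update (m₂.arr 33) (m.var 2 + 1) (lift L τ a ρ) := by
    simp [hm₃, e₁, a2]
  refine (wp_liftTo hL hT₃ hR hτ' ha' (g := 28) (t := r) (a28.trans h28) ar
    (by rcases hr with rfl | rfl <;> decide)).mono fun k₂ m₄ hB ⟨hk₂, e₂⟩ => ?_
  have d2 : m₄.var 2 = m.var 2 := (hB.var 2 rfl).trans a2
  have d33 := (hB.arr 33 rfl).trans c33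
  simp only [wp_seq, wp_assign, wp_store]
  simp only [value_add, value_var, value_ofNat, d2, e₂, cost_add, cost_var, cost_ofNat]
  refine ⟨by omega, by simp [flatten, d2], ?_, fun j hj => ?_⟩
  · simp [flatten, seg_cons, Seg.nil, d33, a33, add_assoc]
  · simp only [arr_setVar, arr_setArr, if_true, d33, a33, Function.update_apply]
    rw [if_neg (by omega), if_neg (by omega), if_neg (by omega)]

include hD

/-- The factor in the cost of finding the paths of a basis element. -/
def pathsCost (D : ℕ) : ℕ :=
  loopCost D (loopCost D (loopCost D (loopCost D 100) + 50) + 50) + 100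

/-- The nested loops mirror the nested `flatMap` in `genPaths`. The number of iterations depends on
`D` only, and each uses a bounded number of binary searches. -/
theorem wp_emitPaths {m : Memory} (hT : Tables L m) {n : ℕ} (hn : n < (cells L).length)
    (h3 : m.var 3 = n) :
    wp emitPaths m fun k m' => k ≤ pathsCost D * (R + 1) ∧
      Appends 33 m m' ((paths L (cellAt L n)).flatMap flatten) := by
  have hE := hT.entry_cellAt hn
  have hv := valid_cellAt hn
  have hidx := idx_cellAt hn
  have hi := hv.index_lt
  have hS : 1 ≤ R + 1 := by omega
  rw [emitPaths]
  generalize cellAt L n = c at *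
  cases c with
  | gen i a =>
    have ek : m.arr 20 n = 0 := hE.kind
    replace hi : i < L.length := hi
    have ei : m.arr 21 n = i := hE.index
    rw [wp_ite]
    refine ⟨fun _ => ?_, fun h => absurd h (by simp [h3, ek])⟩
    rw [wp_seq, wp_assign]
    set m₀ := m.setVar 20 _ with hm₀
    have hT₀ : Tables L m₀ := hT.of_arr rfl
    have e20 : m₀.var 20 = i := by simp [hm₀, h3, ei]
    have e3 : m₀.var 3 = n := by simp [hm₀, h3]
    have e2 : m₀.var 2 = m.var 2 := by simp [hm₀]
    have ea : m₀.arr = m.arr := rfl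
    clear_value m₀
    simp only [paths, genPaths, List.flatMap_assoc]
    refine (wp_eachFacet hT₀ (K := loopCost D (loopCost D (loopCost D 100) + 50) + 50) (S := R + 1)
      (D := D) (A := 33) hi e20 (by decide) ⟨rfl, rfl, rfl⟩ (hD i) hS
      fun τ hτ m₁ hA₁ e23 => ?_).mono fun k m' _ ⟨hk, h⟩ => ⟨?_, h.congr e2 (by rw [ea]) rfl rfl⟩
    · have hT₁ : Tables L m₁ := hT₀.of_agree hA₁ rfl
      rw [wp_seq]
      refine (wp_liftTo hL hT₁ hR hτ hv (g := 3) (t := 23)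
        ((hA₁.var 3 rfl).trans (e3.trans hidx.symm)) e23 (by decide)).mono fun k₁ m₂ hA₂ ⟨hk₁, e53⟩ => ?_
      have hT₂ : Tables L m₂ := hT₁.of_agree hA₂ rfl
      have f23 : m₂.var 23 = τ := (hA₂.var 23 rfl).trans e23
      have hτl := hL.facets_lt _ _ hτ
      have hτa := (hL.lift_spec hτ hv).1
      rw [wp_seq, wp_assign]
      set m₃ := m₂.setVar 24 _ with hm₃
      have hT₃ : Tables L m₃ := hT₂.of_arr rfl
      have g23 : m₃.var 23 = τ := by simp [hm₃, f23]
      have g24 : m₃.var 24 = idx L (.gen τ (lift L i a τ)) := by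
        simp [hm₃, f23, hT₂.start _ hτl, e53, idx_gen hτa]
      have g20 : m₃.var 20 = i := by
        simp [hm₃, hA₂.var 20 rfl, hA₁.var 20 rfl, e20]
      have g3 : m₃.var 3 = n := by simp [hm₃, hA₂.var 3 rfl, hA₁.var 3 rfl, e3]
      have g2 : m₃.var 2 = m₁.var 2 := by simp [hm₃, hA₂.var 2 rfl]
      have ga : m₃.arr 33 = m₁.arr 33 := by simp [hm₃, hA₂.arr 33 rfl]
      clear_value m₃
      refine (wp_eachFacet hT₃ (K := loopCost D (loopCost D 100) + 50) (S := R + 1)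
        (D := D) (A := 33) hi g20 (by decide) ⟨rfl, rfl, rfl⟩ (hD i) hS
        fun τ' hτ' m₄ hA₄ e27 => ?_).mono fun k m' _ ⟨hk, h⟩ => ⟨?_, h.congr g2 ga rfl rfl⟩
      · have hT₄ : Tables L m₄ := hT₃.of_agree hA₄ rfl
        rw [wp_seq]
        refine (wp_liftTo hL hT₄ hR hτ' hv (g := 3) (t := 27)
          ((hA₄.var 3 rfl).trans (g3.trans hidx.symm)) e27 (by decide)).mono
          fun k₁ m₅ hA₅ ⟨hk₁, e53⟩ => ?_
        have hT₅ : Tables L m₅ := hT₄.of_agree hA₅ rfl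
        have f27 : m₅.var 27 = τ' := (hA₅.var 27 rfl).trans e27
        have hτl' := hL.facets_lt _ _ hτ'
        have hτa' := (hL.lift_spec hτ' hv).1
        rw [wp_seq, wp_assign]
        set m₆ := m₅.setVar 28 _ with hm₆
        have hT₆ : Tables L m₆ := hT₅.of_arr rfl
        have i27 : m₆.var 27 = τ' := by simp [hm₆, f27]
        have i28 : m₆.var 28 = idx L (.gen τ' (lift L i a τ')) := by
          simp [hm₆, f27, hT₅.start _ hτl', e53, idx_gen hτa']
        have i24 : m₆.var 24 = idx L (.gen τ (lift L i a τ)) := by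
          simp [hm₆, hA₅.var 24 rfl, hA₄.var 24 rfl, g24]
        have i23 : m₆.var 23 = τ := by simp [hm₆, hA₅.var 23 rfl, hA₄.var 23 rfl, g23]
        have i2 : m₆.var 2 = m₄.var 2 := by simp [hm₆, hA₅.var 2 rfl]
        have ia : m₆.arr 33 = m₄.arr 33 := by simp [hm₆, hA₅.arr 33 rfl]
        clear_value m₆
        refine (wp_eachFacet hT₆ (K := loopCost D 100) (S := R + 1)
          (D := D) (A := 33) hτl i23 (by decide) ⟨rfl, rfl, rfl⟩ (hD τ) hS
          fun ρ hρ m₇ hA₇ e31 => ?_).mono fun k m' _ ⟨hk, h⟩ => ⟨?_, h.congr i2 ia rfl rfl⟩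
        · refine wp_eachFacet (hT₆.of_agree hA₇ rfl) (K := 100) (S := R + 1)
            (D := D) (A := 33) hτl' ((hA₇.var 27 rfl).trans i27) (by decide) ⟨rfl, rfl, rfl⟩ (hD τ') hS
            fun ρ' hρ' m₈ hA₈ e34 => ?_
          have hT₈ : Tables L m₈ := (hT₆.of_agree hA₇ rfl).of_agree hA₈ rfl
          have j31 : m₈.var 31 = ρ := (hA₈.var 31 rfl).trans e31
          have j23 : m₈.var 23 = τ := ((hA₈.var 23 rfl).trans (hA₇.var 23 rfl)).trans i23
          have j27 : m₈.var 27 = τ' := ((hA₈.var 27 rfl).trans (hA₇.var 27 rfl)).trans i27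
          have j24 := ((hA₈.var 24 rfl).trans (hA₇.var 24 rfl)).trans i24
          have j28 := ((hA₈.var 28 rfl).trans (hA₇.var 28 rfl)).trans i28
          simp only [wp_ite, wp_skip, value_var, j31, j23, j27, e34, cost_var]
          -- Equality of `ρ` and `ρ'` is tested by two strict comparisons. In all branches but one
          -- the body appends the empty list.
          refine ⟨fun h1 => ⟨fun h2 => ⟨by omega, ?_⟩, fun h2 => ⟨fun h3 => ⟨by omega, ?_⟩,
            fun h3 => ?_⟩⟩, fun h1 => ⟨by omega, ?_⟩⟩
          · rw [if_neg (by omega)]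
            exact Appends.nil rfl rfl
          · rw [if_neg (by omega)]
            exact Appends.nil rfl rfl
          · obtain rfl : ρ = ρ' := by omega
            rw [if_pos ⟨h1, rfl⟩]
            refine (wp_emitPath hL hR hT₈ (Or.inr rfl) j31 j24 j28 hρ hρ' hτa hτa').mono
              fun k m' _ ⟨hk, h⟩ => ⟨by omega, by simpa using h⟩
          · rw [if_neg (by omega)]
            exact Appends.nil rfl rfl
        · simp only [add_mul, cost_add, cost_var, cost_arr] at hk ⊢
          omega
      · simp only [add_mul, cost_add, cost_var, cost_arr] at hk ⊢
        omega
    · simp only [pathsCost, add_mul, cost_var, cost_arr, cost_ofNat] at hk ⊢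
      omega
  | rel i a r =>
    have ek : m.arr 20 n = 1 := hE.kind
    replace hi : i < L.length := hi
    have ei : m.arr 21 n = i := hE.index
    have el : m.arr 22 n = a := hE.left
    have es : m.arr 23 n = 2 ^ r := hE.step
    have hv' : a + 2 ^ r < size L i := hv.2
    have ha : a < size L i := (Nat.le_add_right _ _).trans_lt hv'
    rw [wp_ite]
    refine ⟨fun h => absurd h (by simp [h3, ek]), fun _ => ?_⟩
    rw [wp_ite]
    refine ⟨fun _ => ?_, fun h => absurd h (by simp [h3, ek])⟩
    simp only [wp_seq, wp_assign]
    set m₀ := Memory.setVar _ 28 _ with hm₀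
    have hT₀ : Tables L m₀ := hT.of_arr rfl
    have e20 : m₀.var 20 = i := by simp [hm₀, h3, ei]
    have e24 : m₀.var 24 = idx L (.gen i a) := by
      simp [hm₀, h3, ei, hT.start _ hi, el, idx_gen ha]
    have e28 : m₀.var 28 = idx L (.gen i (a + 2 ^ r)) := by
      simp [hm₀, h3, ei, hT.start _ hi, el, es, idx_gen hv', add_assoc]
    have e2 : m₀.var 2 = m.var 2 := by simp [hm₀]
    have ea : m₀.arr = m.arr := rfl
    clear_value m₀
    have hp : (paths L (.rel i a r)).flatMap flatten = (facets L i).flatMap fun τ =>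
        flatten (τ, lift L i a τ, lift L i (a + 2 ^ r) τ) := by
      rw [paths, relPaths, List.flatMap_map]
    rw [hp]
    refine (wp_eachFacet hT₀ (K := 100) (S := R + 1)
      (D := D) (A := 33) hi e20 (by decide) ⟨rfl, rfl, rfl⟩ (hD i) hS
      fun τ hτ m₁ hA₁ e23 => ?_).mono fun k m' _ ⟨hk, h⟩ => ⟨?_, h.congr e2 (by rw [ea]) rfl rfl⟩
    · refine (wp_emitPath hL hR (hT₀.of_agree hA₁ rfl) (Or.inl rfl) e23
        ((hA₁.var 24 rfl).trans e24) ((hA₁.var 28 rfl).trans e28) hτ hτ ha hv').mono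
        fun k m' _ ⟨hk, h⟩ => ⟨by omega, h⟩
    · have h1 : loopCost D 100 ≤ loopCost D (loopCost D (loopCost D (loopCost D 100) + 50) + 50) := by
        have h2 := fun K => le_loopCost_self D K
        have := h2 (loopCost D 100)
        have := h2 (loopCost D (loopCost D 100) + 50)
        have := h2 (loopCost D (loopCost D (loopCost D 100) + 50) + 50)
        omega
      have h2 := Nat.mul_le_mul_right (R + 1) h1
      simp only [pathsCost, add_mul, cost_add, cost_var, cost_arr, cost_ofNat] at hk ⊢
      omega
  | syz i a r =>
    have ek : m.arr 20 n = 2 := hE.kind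
    rw [wp_ite]
    refine ⟨fun h => absurd h (by simp [h3, ek]), fun _ => ?_⟩
    rw [wp_ite]
    refine ⟨fun h => absurd h (by simp [h3, ek]), fun _ => ?_⟩
    rw [wp_skip]
    refine ⟨?_, Appends.nil rfl rfl⟩
    simp only [pathsCost, add_mul, cost_var, cost_arr, cost_ofNat]
    omega

end

end LogPath

/-! ### Loops over lists stored in memory -/

namespace RAM

/-- Run `p` with variable `P` running from `e` to `f` in steps of `k`. -/
def eachStep (e f : ArithExpr) (P E k : ℕ) (p : Program) : Program :=
  P ≔ e ;; E ≔ f ;; .while (v P) (v E) (p ;; P ≔ v P + .const k)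

theorem wp_eachStep {α : Type*} {A P E k s T : ℕ} {m : Memory} {p : Program} {e f : ArithExpr}
    {l : List α} {g : α → List ℕ} (hk : 0 < k) (he : e.value m = s)
    (hf : f.value (m.setVar P s) = s + k * l.length) (hne : P ≠ E ∧ P ≠ 2 ∧ E ≠ 2)
    (hP : writesVar p P = false) (hE : writesVar p E = false)
    (body : ∀ (i : ℕ) (h : i < l.length) (m' : Memory), Agree (eachStep e f P E k p) m m' →
      m'.var P = s + k * i → wp p m' fun t m'' => t ≤ T ∧ Appends A m' m'' (g l[i])) :
    wp (eachStep e f P E k p) m fun t m' =>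
      t ≤ l.length * (T + 7) + (e.cost + f.cost + 5) ∧ Appends A m m' (l.flatMap g) := by
  simp only [eachStep, wp_seq (p := P ≔ _), wp_seq (p := E ≔ _), wp_assign]
  rw [he, hf]
  have hA₀ : Agree (eachStep e f P E k p) m ((m.setVar P s).setVar E (s + k * l.length)) :=
    (agree_setVar (by simp [eachStep, writesVar])).trans
      (agree_setVar (by simp [eachStep, writesVar]))
  refine (wp_each (A := A) (k := k) (T := T) (l := l) (g := g) (s := s) hk ?_ ?_ hP hE hne.1 hne.2.1
    ?_).mono fun t m' hA ⟨ht, h⟩ => ⟨?_, ?_⟩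
  · simp [hne.1]
  · simp
  · intro i hi m' hA hm
    refine body i hi m' (hA₀.trans (hA.mono (fun y hy => ?_) fun a ha => ?_)) hm
    · simp only [eachStep, writesVar, Bool.or_eq_false_iff] at hy ⊢; tauto
    · simp only [eachStep, writesArr, Bool.or_eq_false_iff] at ha ⊢; tauto
  · omega
  · exact h.congr (by simp [hne.2.1.symm, hne.2.2.symm]) rfl rfl rfl

theorem Stream.of_agree {S A n : ℕ} {f : ℕ → List ℕ} {m m' : Memory} {p : Program}
    (h : Stream S A f n m) (hA : Agree p m m') (hS : writesArr p S = false)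
    (hp : writesArr p A = false) : Stream S A f n m' := by
  rw [Stream, hA.arr S hS, hA.arr A hp]
  exact h

/-- Run `p` with variable `x` running through the list with the number in variable `c`. -/
def eachEntry (S a P E c x : ℕ) (p : Program) : Program :=
  eachStep (S # v c) (S # (v c + 1)) P E 1 (x ≔ a # v P ;; p)

theorem wp_eachEntry {S a A P E c x T N n : ℕ} {m : Memory} {p : Program} {F : ℕ → List ℕ}
    {g : ℕ → List ℕ} (hF : Stream S a F N m) (hn : n < N) (hc : m.var c = n)
    (hne : P ≠ E ∧ P ≠ 2 ∧ E ≠ 2 ∧ x ≠ 2 ∧ c ≠ P ∧ x ≠ P ∧ x ≠ E)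
    (hp : writesVar p P = false ∧ writesVar p E = false ∧ writesArr p a = false)
    (body : ∀ (i : ℕ) (h : i < (F n).length) (m' : Memory), Agree (eachEntry S a P E c x p) m m' →
      m'.var x = (F n)[i] → wp p m' fun t m'' => t ≤ T ∧ Appends A m' m'' (g (F n)[i])) :
    wp (eachEntry S a P E c x p) m fun t m' =>
      t ≤ (F n).length * (T + 10) + 11 ∧ Appends A m m' ((F n).flatMap g) := by
  obtain ⟨hPE, hP2, hE2, hx2, hcP, hxP, hxE⟩ := hne
  obtain ⟨h1, h2⟩ := hF n hn
  refine (wp_eachStep (A := A) (T := T + 3) (l := F n) (g := g) (s := m.arr S n) (by norm_num)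
    (by simp [hc]) ?_ ⟨hPE, hP2, hE2⟩ ?_ ?_ ?_).mono fun t m' hA ⟨ht, h⟩ => ⟨?_, h⟩
  · simp [hcP, hc, h1]
  · simp [writesVar, hp.1, hxP]
  · simp [writesVar, hp.2.1, hxE]
  · intro i hi m' hA hi'
    rw [wp_seq, wp_assign]
    have ha : m'.arr a = m.arr a := hA.arr a (by simp [writesArr, eachStep, hp.2.2])
    refine (body i hi _ (hA.trans (agree_setVar (by simp [eachStep, writesVar]))) ?_).mono
      fun t m'' _ ⟨ht, h⟩ => ⟨?_, ?_⟩
    · simp only [value_var, value_arr, var_setVar, if_true, hi', ha]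
      rw [one_mul, h2 i hi]
    · simp only [cost_arr, cost_var]; omega
    · exact h.congr (by simp [hx2.symm]) rfl rfl rfl
  · simp only [cost_arr, cost_add, cost_var, cost_ofNat] at ht ⊢
    have : (F n).length * (T + 3 + 7) = (F n).length * (T + 10) := rfl
    omega

end RAM

namespace LogPath

open RAM

variable {L : List CellRecord}

/-! ### Loops over paths -/

/-- Run `p` for all paths of the basis element in variable `c`. -/
def eachPath (P E c : ℕ) (p : Program) : Program :=
  eachStep (32 # v c) (32 # (v c + 1)) P E 3
    (60 ≔ 33 # v P ;; 61 ≔ 33 # (v P + 1) ;; 62 ≔ 33 # (v P + 2) ;; p)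

theorem length_flatMap_flatten (l : List (ℕ × ℕ × ℕ)) : (l.flatMap flatten).length = 3 * l.length := by
  induction l with
  | nil => rfl
  | cons x l ih =>
    rw [List.flatMap_cons, List.length_append, ih, flatten, List.length_cons]
    simp
    omega

theorem seg_flatten {f : ℕ → ℕ} {s : ℕ} {l : List (ℕ × ℕ × ℕ)} (h : Seg f s (l.flatMap flatten))
    {j : ℕ} (hj : j < l.length) : f (s + 3 * j) = l[j].1 ∧ f (s + 3 * j + 1) = l[j].2.1 ∧
      f (s + 3 * j + 2) = l[j].2.2 := by
  induction l generalizing s j with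
  | nil => simp at hj
  | cons x l ih =>
    rw [List.flatMap_cons, seg_append] at h
    cases j with
    | zero =>
      simp only [flatten, seg_cons] at h
      exact ⟨h.1.1, h.1.2.1, h.1.2.2.1⟩
    | succ j =>
      have := ih h.2 (j := j) (by simpa using hj)
      rw [show s + 3 * (j + 1) = s + (flatten x).length + 3 * j by simp [flatten]; omega]
      exact this

/-- The paths of the basis elements, as lists of numbers. -/
def pathList (L : List CellRecord) (n : ℕ) : List ℕ := (paths L (cellAt L n)).flatMap flatten

/-- The positions of the generators and relations in the boundaries of the basis elements. -/
def lowerList (L : List CellRecord) (n : ℕ) : List ℕ := (lowerBoundary L (cellAt L n)).map (idx L)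

/-- The positions of the syzygies whose sums are the syzygy parts of the boundaries. -/
def fillerList (L : List CellRecord) (n : ℕ) : List ℕ := (fillers L (cellAt L n)).map (idx L)

theorem wp_eachPath {m : Memory} {A P E c n N K S D : ℕ} {p : Program} {g : ℕ × ℕ × ℕ → List ℕ}
    (hF : Stream 32 33 (pathList L) N m) (hn : n < N) (hc : m.var c = n)
    (hne : P ≠ E ∧ P ≠ 2 ∧ E ≠ 2 ∧ c ≠ P ∧ P ≠ 60 ∧ P ≠ 61 ∧ P ≠ 62 ∧ E ≠ 60 ∧ E ≠ 61 ∧ E ≠ 62)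
    (hp : writesVar p P = false ∧ writesVar p E = false ∧ writesArr p 33 = false)
    (hD : (paths L (cellAt L n)).length ≤ D) (hS : 1 ≤ S)
    (body : ∀ x ∈ paths L (cellAt L n), ∀ m', Agree (eachPath P E c p) m m' → m'.var 60 = x.1 →
      m'.var 61 = x.2.1 → m'.var 62 = x.2.2 →
      wp p m' fun t m'' => t ≤ K * S ∧ Appends A m' m'' (g x)) :
    wp (eachPath P E c p) m fun t m' =>
      t ≤ loopCost D K * S ∧ Appends A m m' ((paths L (cellAt L n)).flatMap g) := by
  obtain ⟨hPE, hP2, hE2, hcP, h1, h2, h3, h4, h5, h6⟩ := hne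
  obtain ⟨f1, f2⟩ := hF n hn
  rw [pathList, length_flatMap_flatten] at f1
  refine (wp_eachStep (A := A) (T := K * S + 13) (l := paths L (cellAt L n)) (g := g)
    (s := m.arr 32 n) (by norm_num) (by simp [hc]) ?_ ⟨hPE, hP2, hE2⟩ ?_ ?_ ?_).mono
    fun t m' hA ⟨ht, h⟩ => ⟨?_, h⟩
  · simp [hcP, hc, f1]
  · simp [writesVar, hp.1, h1.symm, h2.symm, h3.symm]
  · simp [writesVar, hp.2.1, h4.symm, h5.symm, h6.symm]
  · intro i hi m' hA hi'
    have ha : m'.arr 33 = m.arr 33 := hA.arr 33 (by simp [writesArr, eachStep, hp.2.2])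
    obtain ⟨e1, e2, e3⟩ := seg_flatten f2 hi
    simp only [wp_seq, wp_assign]
    refine (body _ (List.getElem_mem hi) _ (hA.trans ((agree_setVar (by simp [eachStep, writesVar])).trans
      ((agree_setVar (by simp [eachStep, writesVar])).trans
        (agree_setVar (by simp [eachStep, writesVar]))))) ?_ ?_ ?_).mono
      fun t m'' _ ⟨ht, h⟩ => ⟨?_, h.congr (by simp) rfl rfl rfl⟩
    · simp [hi', ha, e1]
    · simp [hi', ha, e2, h1]
    · simp [hi', ha, e3, h1, h2]
    · simp only [cost_arr, cost_var, cost_add, cost_ofNat]; omega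
  · refine le_trans ?_ (le_loopCost hD hS)
    simp only [cost_arr, cost_add, cost_var, cost_ofNat] at ht
    have : (paths L (cellAt L n)).length * (K * S + 13 + 7) =
      (paths L (cellAt L n)).length * (K * S + 20) := rfl
    omega

/-! ### Generators and relations in the boundaries -/

/-- Append the positions of the endpoints of the basis element in variable `3`. -/
def emitEndpoints : Program :=
  .ite (20 # v 3) 1
    (20 ≔ 21 # v 3 ;; eachFacet 21 22 20 23
      (liftTo 3 23 ;; .store 34 (v 2) (13 # v 23 + v 53) ;; 2 ≔ v 2 + 1))
    (.ite (20 # v 3) 2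
      (20 ≔ 13 # (21 # v 3) + 22 # v 3 ;; .store 34 (v 2) (v 20) ;;
        .store 34 (v 2 + 1) (v 20 + 23 # v 3) ;; 2 ≔ v 2 + 2)
      (65 ≔ 13 # (21 # v 3) ;; 66 ≔ 22 # v 3 ;; 67 ≔ 23 # v 3 ;; 65 ≔ v 65 + v 65 ;;
        .store 34 (v 2) (26 # (v 65 + v 66 + v 66 + (v 67 + v 67))) ;;
        .store 34 (v 2 + 1) (26 # (v 65 + v 66 + v 66 + v 67)) ;; 66 ≔ v 66 + v 67 ;;
        .store 34 (v 2 + 2) (26 # (v 65 + v 66 + v 66 + v 67)) ;; 2 ≔ v 2 + 3))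

/-- Append the positions of the generators and relations in the boundary of the basis element in
variable `3`. -/
def emitLower : Program := emitEndpoints ;; eachPath 21 22 3 tracePath

/-- Append the positions of the syzygies whose sum is the syzygy part of the boundary of the basis
element in variable `3`. -/
def emitFillers : Program := eachEntry 35 34 21 22 3 23 (eachPath 24 25 23 collectTriangles)

/-- The factor in the cost of finding the lower part of a boundary. -/
def lowerCost (D : ℕ) : ℕ := loopCost D 100 + 200 + loopCost (D ^ 4) 100

/-- The factor in the cost of finding the syzygies in a boundary. -/
def fillersCost (D : ℕ) : ℕ := loopCost (D + 3 + D ^ 4 * 2) (loopCost (D ^ 4) 100)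

section

variable (hL : Admissible L) {R D : ℕ} (hR : ∀ i, size L i ≤ 2 ^ R)
  (hD : ∀ i, (facets L i).length ≤ D)

include hL hR hD

/-- Positions of generators are computed from the start of the block, and positions of relations are
looked up under their keys. Only generators need binary searches, one for each facet. -/
theorem wp_emitEndpoints {m : Memory} (hT : Tables L m) {n : ℕ} (hn : n < (cells L).length)
    (h3 : m.var 3 = n) :
    wp emitEndpoints m fun k m' => k ≤ (loopCost D 100 + 150) * (R + 1) ∧
      Appends 34 m m' ((endpoints L (cellAt L n)).map (idx L)) := by
  have hE := hT.entry_cellAt hn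
  have hv := valid_cellAt hn
  have hidx := idx_cellAt hn
  have hi := hv.index_lt
  have hS : 1 ≤ R + 1 := by omega
  rw [emitEndpoints]
  generalize cellAt L n = c at *
  cases c with
  | gen i a =>
    have ek : m.arr 20 n = 0 := hE.kind
    replace hi : i < L.length := hi
    have ei : m.arr 21 n = i := hE.index
    rw [wp_ite]
    refine ⟨fun _ => ?_, fun h => absurd h (by simp [h3, ek])⟩
    rw [wp_seq, wp_assign]
    set m₀ := m.setVar 20 _ with hm₀
    have hT₀ : Tables L m₀ := hT.of_arr rfl
    have e20 : m₀.var 20 = i := by simp [hm₀, h3, ei]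
    have e3 : m₀.var 3 = n := by simp [hm₀, h3]
    have e2 : m₀.var 2 = m.var 2 := by simp [hm₀]
    have ea : m₀.arr = m.arr := rfl
    clear_value m₀
    have hp : (endpoints L (.gen i a)).map (idx L) =
        (facets L i).flatMap fun τ => [idx L (.gen τ (lift L i a τ))] := by
      rw [endpoints, List.map_map, ← List.map_eq_flatMap]
      rfl
    rw [hp]
    refine (wp_eachFacet hT₀ (K := 100) (S := R + 1)
      (D := D) (A := 34) hi e20 (by decide) ⟨rfl, rfl, rfl⟩ (hD i) hS
      fun τ hτ m₁ hA₁ e23 => ?_).mono fun k m' _ ⟨hk, h⟩ => ⟨?_, h.congr e2 (by rw [ea]) rfl rfl⟩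
    · have hT₁ : Tables L m₁ := hT₀.of_agree hA₁ rfl
      rw [wp_seq]
      refine (wp_liftTo hL hT₁ hR hτ hv (g := 3) (t := 23)
        ((hA₁.var 3 rfl).trans (e3.trans hidx.symm)) e23 (by decide)).mono fun k₁ m₂ hA₂ ⟨hk₁, e53⟩ => ?_
      have hT₂ : Tables L m₂ := hT₁.of_agree hA₂ rfl
      have f23 : m₂.var 23 = τ := (hA₂.var 23 rfl).trans e23
      have f2 : m₂.var 2 = m₁.var 2 := hA₂.var 2 rfl
      have fa : m₂.arr 34 = m₁.arr 34 := hA₂.arr 34 rfl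
      have hτl := hL.facets_lt _ _ hτ
      have hτa := (hL.lift_spec hτ hv).1
      simp only [wp_seq, wp_assign, wp_store]
      simp only [value_add, value_var, value_arr, value_ofNat, f23, hT₂.start _ hτl, e53, f2, ← idx_gen hτa,
        cost_add, cost_var, cost_arr, cost_ofNat]
      refine ⟨by omega, by simp [f2], by simp [seg_cons, Seg.nil], fun j hj => ?_⟩
      simp [fa, hj.ne]
    · simp only [add_mul, cost_var, cost_arr, cost_ofNat] at hk ⊢
      omega
  | rel i a r =>
    have ek : m.arr 20 n = 1 := hE.kind
    replace hi : i < L.length := hi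
    have ei : m.arr 21 n = i := hE.index
    have el : m.arr 22 n = a := hE.left
    have es : m.arr 23 n = 2 ^ r := hE.step
    have hv' : a + 2 ^ r < size L i := hv.2
    have ha : a < size L i := (Nat.le_add_right _ _).trans_lt hv'
    rw [wp_ite]
    refine ⟨fun h => absurd h (by simp [h3, ek]), fun _ => ?_⟩
    rw [wp_ite]
    refine ⟨fun _ => ?_, fun h => absurd h (by simp [h3, ek])⟩
    simp only [wp_seq, wp_assign, wp_store]
    refine ⟨?_, by simp [endpoints], ?_, fun j hj => ?_⟩
    · simp only [add_mul, cost_add, cost_var, cost_arr, cost_ofNat]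
      omega
    · simp [endpoints, seg_cons, Seg.nil, h3, ei, el, es, hT.start _ hi, idx_gen ha, idx_gen hv',
        add_assoc]
    · simp [Function.update_apply]
      rw [if_neg (by omega), if_neg (by omega)]
  | syz i a r =>
    have ek : m.arr 20 n = 2 := hE.kind
    replace hi : i < L.length := hi
    have ei : m.arr 21 n = i := hE.index
    have el : m.arr 22 n = a := hE.left
    have es : m.arr 23 n = 2 ^ r := hE.step
    have hb : ∀ d ∈ endpoints L (.syz i a r), d.Valid L := fun d hd =>
      valid_of_mem_lowerBoundary hL hv (List.mem_append_left _ hd)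
    have h1 := hT.edge i a (r + 1) (hb _ (by simp [endpoints]))
    have h2 := hT.edge i a r (hb _ (by simp [endpoints]))
    have h4 := hT.edge i (a + 2 ^ r) r (hb _ (by simp [endpoints]))
    rw [edgeKey] at h1 h2 h4
    rw [pow_succ, mul_two] at h1
    rw [wp_ite]
    refine ⟨fun h => absurd h (by simp [h3, ek]), fun _ => ?_⟩
    rw [wp_ite]
    refine ⟨fun h => absurd h (by simp [h3, ek]), fun _ => ?_⟩
    simp only [wp_seq, wp_assign, wp_store]
    refine ⟨?_, by simp [endpoints], ?_, fun j hj => ?_⟩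
    · simp only [add_mul, cost_add, cost_var, cost_arr, cost_ofNat]
      omega
    · simp [endpoints, seg_cons, Seg.nil, h3, ei, el, es, hT.start _ hi, h1, h2, h4]
    · simp [Function.update_apply]
      rw [if_neg (by omega), if_neg (by omega), if_neg (by omega)]

theorem wp_emitLower {m : Memory} (hT : Tables L m) {n : ℕ} (hn : n < (cells L).length)
    (h3 : m.var 3 = n) (hP : Stream 32 33 (pathList L) (cells L).length m) :
    wp emitLower m fun k m' => k ≤ lowerCost D * (R + 1) ^ 2 ∧ Appends 34 m m' (lowerList L n) := by
  have hS : 1 ≤ (R + 1) ^ 2 := Nat.one_le_pow _ _ (by omega)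
  rw [emitLower, wp_seq]
  refine (wp_emitEndpoints hL hR hD hT hn h3).mono fun k₁ m₁ hA₁ ⟨hk₁, h₁⟩ => ?_
  have hT₁ : Tables L m₁ := hT.of_agree hA₁ rfl
  refine (wp_eachPath (L := L) (A := 34) (K := 100) (S := (R + 1) ^ 2) (D := D ^ 4)
    (g := fun x => ((pathEdges x).map edgeCell).map (idx L))
    (hP.of_agree hA₁ rfl rfl) hn ((hA₁.var 3 rfl).trans h3) (by decide) ⟨rfl, rfl, rfl⟩
    (length_paths_le hD _) hS fun x hx m₂ hA₂ e60 e61 e62 => ?_).mono fun k₂ m₂ hA₂ ⟨hk₂, h₂⟩ => ⟨?_, ?_⟩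
  · refine (wp_tracePath (hT₁.of_agree hA₂ rfl) (hR x.1) e60 e61 e62
      (mem_paths hL (valid_cellAt hn) hx)).mono fun k m' _ ⟨hk, h⟩ => ⟨hk.trans ?_, h⟩
    -- The bound `2 R (20 R + 50) + 30` is at most `100 (R + 1) ^ 2`.
    nlinarith
  · have h4 : (loopCost D 100 + 150) * (R + 1) ≤ (loopCost D 100 + 150) * (R + 1) ^ 2 :=
      Nat.mul_le_mul_left _ (Nat.le_self_pow (by norm_num) _)
    simp only [lowerCost, add_mul] at hk₁ h4 ⊢
    omega
  · have : lowerList L n = (endpoints L (cellAt L n)).map (idx L) ++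
        (paths L (cellAt L n)).flatMap fun x => ((pathEdges x).map edgeCell).map (idx L) := by
      simp only [lowerList, lowerBoundary, List.map_append, List.map_flatMap]
    rw [this]
    exact h₁.trans h₂

/-- The loop runs over the lower boundary already stored and reuses the stored paths of each of its
members. Both the number of members and the work for each are `O(R)`. -/
theorem wp_emitFillers {m : Memory} (hT : Tables L m) {n : ℕ} (hn : n < (cells L).length)
    (h3 : m.var 3 = n) (hP : Stream 32 33 (pathList L) (cells L).length m)
    (hl : Stream 35 34 (lowerList L) (cells L).length m) :
    wp emitFillers m fun k m' => k ≤ fillersCost D * (R + 1) ^ 2 ∧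
      Appends 36 m m' (fillerList L n) := by
  have hS : 1 ≤ R + 1 := by omega
  refine (wp_eachEntry (A := 36) (T := loopCost (D ^ 4) 100 * (R + 1))
    (g := fun y => (paths L (cellAt L y)).flatMap fun x => (pathTriangles x).map (idx L))
    hl hn h3 (by decide) ⟨rfl, rfl, rfl⟩ fun i hi m₁ hA₁ e23 => ?_).mono fun k m' _ ⟨hk, h⟩ => ⟨?_, ?_⟩
  · have hmem : (lowerList L n)[i] ∈ lowerList L n := List.getElem_mem hi
    obtain ⟨c, hc, hc'⟩ := List.mem_map.1 hmem
    have hcv := valid_of_mem_lowerBoundary hL (valid_cellAt hn) hc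
    have hlt : (lowerList L n)[i] < (cells L).length := by rw [← hc']; exact idx_lt hcv
    refine wp_eachPath (L := L) (A := 36) (K := 100) (S := R + 1) (D := D ^ 4)
      (hP.of_agree hA₁ rfl rfl) hlt e23 (by decide) ⟨rfl, rfl, rfl⟩
      (length_paths_le hD _) hS fun x hx m₂ hA₂ e60 e61 e62 => ?_
    refine (wp_collectTriangles ((hT.of_agree hA₁ rfl).of_agree hA₂ rfl) (hR x.1) e60 e61 e62
      (mem_paths hL (valid_cellAt hlt) hx)).mono fun k m' _ ⟨hk, h⟩ => ⟨by omega, h⟩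
  · refine hk.trans ?_
    have h1 : (lowerList L n).length ≤ (D + 3 + D ^ 4 * 2) * (R + 1) := by
      rw [lowerList, List.length_map]
      refine (length_lowerBoundary_le hL hD hR (valid_cellAt hn)).trans ?_
      nlinarith [Nat.zero_le (D ^ 4), Nat.zero_le (D * R)]
    rw [fillersCost, loopCost]
    set N := D + 3 + D ^ 4 * 2
    set K := loopCost (D ^ 4) 100
    have h2 : K * (R + 1) + 10 ≤ (K + 10) * (R + 1) := by rw [add_mul]; omega
    calc _ ≤ (N * (R + 1)) * ((K + 10) * (R + 1)) + 11 :=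
          Nat.add_le_add_right (Nat.mul_le_mul h1 h2) 11
      _ ≤ (N * (R + 1)) * ((K + 10) * (R + 1)) + 11 * (R + 1) ^ 2 := by
        have := Nat.one_le_pow 2 (R + 1) hS
        omega
      _ ≤ (N + 1) * (K + 30) * (R + 1) ^ 2 := by
        have : (N + 1) * (K + 30) = N * (K + 10) + 11 + (20 * N + K + 19) := by ring
        rw [this, add_mul _ (20 * N + K + 19)]
        refine le_trans (le_of_eq (by ring)) (Nat.le_add_right _ _)
  · have : fillerList L n = (lowerList L n).flatMap fun y =>
        (paths L (cellAt L y)).flatMap fun x => (pathTriangles x).map (idx L) := by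
      simp only [fillerList, fillers, lowerList, List.map_flatMap, List.flatMap_map]
      refine List.flatMap_congr fun c hc => ?_
      rw [cellAt_idx (valid_of_mem_lowerBoundary hL (valid_cellAt hn) hc)]
    rw [this]
    exact h

end

end LogPath

/-! ### Reduction of lists modulo 2 -/

namespace RAM

/-- A loop rule for bodies whose effect depends on marks left by earlier iterations, so that it is
not a function of the current entry alone. -/
theorem wp_eachEntry_invariant {S a P E c x T N n : ℕ} {m : Memory} {p : Program} {F : ℕ → List ℕ}
    (I : ℕ → Memory → Prop)
    (hI : ∀ i m₁ m₂, m₂.var 2 = m₁.var 2 → m₂.arr = m₁.arr → I i m₁ → I i m₂)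
    (hF : Stream S a F N m) (hn : n < N) (hc : m.var c = n)
    (hne : P ≠ E ∧ P ≠ 2 ∧ E ≠ 2 ∧ x ≠ 2 ∧ c ≠ P ∧ x ≠ P ∧ x ≠ E)
    (hp : writesVar p P = false ∧ writesVar p E = false ∧ writesArr p a = false) (h0 : I 0 m)
    (body : ∀ (i : ℕ) (h : i < (F n).length) (m' : Memory), m'.var x = (F n)[i] → I i m' →
      wp p m' fun t m'' => t ≤ T ∧ I (i + 1) m'') :
    wp (eachEntry S a P E c x p) m fun t m' =>
      t ≤ (F n).length * (T + 10) + 11 ∧ I (F n).length m' := by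
  obtain ⟨hPE, hP2, hE2, hx2, hcP, hxP, hxE⟩ := hne
  obtain ⟨h1, h2⟩ := hF n hn
  simp only [eachEntry, eachStep, wp_seq (p := P ≔ _), wp_seq (p := E ≔ _), wp_assign]
  have hP : writesVar ((x ≔ a # v P ;; p) ;; P ≔ v P + .const 1) E = false := by
    simp [writesVar, hp, hxE, hPE]
  have hP' : writesVar (x ≔ a # v P ;; p) P = false := by
    simp [writesVar, hp, hxP]
  have ha : writesArr ((x ≔ a # v P ;; p) ;; P ≔ v P + .const 1) a = false := by
    simp [writesArr, hp]
  set m₀ := (Memory.setVar _ E _) with hm₀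
  have e1 : m₀.var P = m.arr S n := by simp [hm₀, hc, hPE]
  have e2 : m₀.var E = m.arr S n + (F n).length := by simp [hm₀, hc, hcP, h1]
  have e3 : m₀.arr = m.arr := rfl
  have e4 : m₀.var 2 = m.var 2 := by simp [hm₀, hP2.symm, hE2.symm]
  clear_value m₀
  refine wp_while_uniform (T := T + 7) (n := (F n).length)
    (fun i m' => m'.var P = m.arr S n + i ∧ I i m') ?_ ?_ ?_ ?_
  · exact ⟨by simpa using e1, hI 0 _ _ e4 e3 h0⟩
  · rintro i m' hA ⟨h3, -⟩
    simp only [value_var]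
    rw [h3, hA.var E hP, e2, Nat.add_lt_add_iff_left]
  · rintro i m' hi hA ⟨h3, h4⟩
    simp only [wp_seq (p := x ≔ _ ;; p), wp_seq (p := x ≔ _), wp_assign]
    refine (body i hi (m'.setVar x _) ?_ (hI i m' _ (by simp [hx2.symm]) rfl h4)).mono
      fun t m'' hA' ⟨h5, h6⟩ => ⟨?_, ?_, ?_⟩
    · simp [h3, hA.arr a ha, e3, h2 i hi]
    · simp only [cost_var, cost_arr]
      change _ + (1 + 1 + 1 + 1) ≤ _
      omega
    · change (m''.setVar P (m''.var P + 1)).var P = _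
      rw [var_setVar, if_pos rfl, hA'.var P hp.1, var_setVar, if_neg (Ne.symm hxP), h3, add_assoc]
    · exact hI _ m'' _ (by simp [hP2.symm]) rfl h6
  · rintro t m' hA ⟨-, h3⟩ ht
    refine ⟨?_, h3⟩
    simp only [cost_var, cost_arr, cost_add, cost_ofNat] at ht ⊢
    have : (F n).length * (T + 7 + (1 + 1 + 1)) = (F n).length * (T + 10) := rfl
    omega

/-! ### Entries that occur an odd number of times -/

/-- Store the parities of the multiplicities of the list with the number in variable `3`. -/
def markParity : Program := eachEntry 37 36 21 22 3 23 (.store 38 (v 23) (1 - 38 # v 23))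

/-- Append the marked entries of the list with the number in variable `3`, and unmark them. -/
def emitMarked : Program :=
  eachEntry 37 36 21 22 3 23
    (.ite 0 (38 # v 23) (.store 1 (v 2) (v 23) ;; .store 38 (v 23) 0 ;; 2 ≔ v 2 + 1) .skip)

variable {N n : ℕ} {m : Memory} {F : ℕ → List ℕ}

open LogPath in
theorem wp_markParity (hF : Stream 37 36 F N m) (hn : n < N) (hc : m.var 3 = n)
    (h0 : ∀ x, m.arr 38 x = 0) :
    wp markParity m fun t m' => t ≤ (F n).length * 20 + 11 ∧ m'.arr 38 = parity (F n) := by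
  refine (wp_eachEntry_invariant (T := 10) (fun i m' => m'.arr 38 = parity ((F n).take i))
    (fun i m₁ m₂ _ h h' => by rw [h]; exact h') hF hn hc (by decide) ⟨rfl, rfl, rfl⟩ ?_ ?_).mono
    fun t m' _ ⟨ht, h⟩ => ⟨ht, by rwa [List.take_length] at h⟩
  · funext x
    simp [h0, parity]
  · intro i hi m' hx h
    rw [wp_store]
    refine ⟨by simp, ?_⟩
    funext y
    simp only [value_var, value_sub, value_arr, value_ofNat, arr_setArr, if_true, hx, h,
      List.take_add_one, List.getElem?_eq_getElem hi, Option.toList_some, parity, List.count_append,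
      List.count_singleton, Function.update_apply, beq_iff_eq]
    by_cases hy : y = (F n)[i]
    · subst hy
      rw [if_pos rfl, if_pos rfl]
      omega
    · rw [if_neg hy, if_neg (Ne.symm hy), add_zero]

open LogPath in
-- An entry is unmarked when it is emitted, so it is emitted only once. At the end no mark is left,
-- and the array of marks need not be cleared separately.
theorem wp_emitMarked (hF : Stream 37 36 F N m) (hn : n < N) (hc : m.var 3 = n)
    (h0 : m.arr 38 = parity (F n)) :
    wp emitMarked m fun t m' => t ≤ (F n).length * 30 + 11 ∧ (∀ x, m'.arr 38 x = 0) ∧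
      Appends 1 m m' (oddEntries (parity (F n)) (F n)) := by
  -- The invariant states that marks remain only at entries still to come and that the emitted list
  -- completes to the desired result.
  refine (wp_eachEntry_invariant (T := 20) (fun i m' => ∃ l,
    l ++ oddEntries (m'.arr 38) ((F n).drop i) = oddEntries (parity (F n)) (F n) ∧
    (∀ x, 0 < m'.arr 38 x → x ∈ (F n).drop i) ∧ Appends 1 m m' l)
    (fun i m₁ m₂ h1 h2 ⟨l, h3, h4, h5⟩ => ⟨l, by rwa [h2], by rwa [h2],
      h5.congr rfl rfl h1 (by rw [h2])⟩) hF hn hc (by decide) ⟨rfl, rfl, rfl⟩ ?_ ?_).mono ?_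
  · refine ⟨[], by simp [h0], fun x hx => ?_, Appends.nil rfl rfl⟩
    rw [h0, parity] at hx
    rw [List.drop_zero]
    refine List.count_pos_iff.1 ?_
    omega
  · rintro i hi m' hx ⟨l, h1, h2, h3⟩
    rw [List.drop_eq_getElem_cons hi, oddEntries] at h1
    simp only [wp_ite, wp_seq, wp_store, wp_assign, wp_skip, value_ofNat, value_arr, value_var, hx]
    refine ⟨fun h => ⟨by simp, l ++ [(F n)[i]], ?_, ?_, ?_⟩, fun h => ⟨by simp, l, ?_, ?_, h3⟩⟩
    · rw [if_pos h] at h1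
      rw [← h1]
      simp [hx]
    · intro y hy
      simp only [arr_setVar, arr_setArr, if_true, Function.update_apply, hx, var_setArr] at hy
      norm_num [Function.update_apply] at hy
      split_ifs at hy with h4
      · exact absurd hy (lt_irrefl _)
      · have := h2 y hy
        rw [List.drop_eq_getElem_cons hi, List.mem_cons] at this
        exact this.resolve_left h4
    · refine h3.trans ⟨by simp, ?_, fun j hj => ?_⟩
      · simp [seg_cons, Seg.nil]
      · simp [hj.ne]
    · rwa [if_neg h] at h1
    · intro y hy
      have := h2 y hy
      rw [List.drop_eq_getElem_cons hi, List.mem_cons] at this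
      refine this.resolve_left ?_
      rintro rfl
      exact h hy
  · rintro t m' - ⟨ht, l, h1, h2, h3⟩
    rw [List.drop_length, oddEntries, List.append_nil] at h1
    rw [← h1]
    refine ⟨ht, fun x => Nat.eq_zero_of_not_pos fun hx => ?_, h3⟩
    simpa using h2 x hx

end RAM

namespace LogPath

open RAM

variable {L : List CellRecord}

/-! ### Writing the output -/

/-- Append the record of the basis element in variable `3` to the output. -/
def writeRecord : Program :=
  .store 1 (v 2) (16 # (21 # v 3) + 20 # v 3) ;; .store 1 (v 2 + 1) 1 ;;
    .store 1 (v 2 + 2) (24 # v 3) ;; .store 1 (v 2 + 3) (25 # v 3) ;; 20 ≔ v 2 + 4 ;;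
    2 ≔ v 2 + 5 ;;
    eachEntry 35 34 21 22 3 23 (.store 1 (v 2) (v 23) ;; 2 ≔ v 2 + 1) ;;
    markParity ;; emitMarked ;; .store 1 (v 20) (v 2 - (v 20 + 1))

/-- Write the output. -/
def writeOutput : Program :=
  .store 1 0 (v 4) ;; 2 ≔ 1 ;; 3 ≔ 0 ;; .while (v 3) (v 4) (writeRecord ;; 3 ≔ v 3 + 1) ;; 0 ≔ v 2

variable (L) in
/-- The record of the basis element at position `n`. -/
def outputRecord (n : ℕ) : CellRecord :=
  ⟨(cellAt L n).dim L, [(cellAt L n).degree L], facetIds L (cellAt L n)⟩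

theorem output_eq : output L = (List.range (cells L).length).map (outputRecord L) := by
  refine List.ext_getElem (by simp [output]) fun i h1 h2 => ?_
  have hi : i < (cells L).length := by simpa [output] using h1
  simp [output, outputRecord, cellAt, hi]

/-- The number of boundary elements is known only after the reduction modulo 2. Its place is
reserved in variable `20` and filled at the end from the distance of the pointers. -/
theorem wp_writeRecord {m : Memory} (hT : Tables L m) {n : ℕ} (hn : n < (cells L).length)
    (h3 : m.var 3 = n) (hl : Stream 35 34 (lowerList L) (cells L).length m)
    (hf : Stream 37 36 (fillerList L) (cells L).length m) (h0 : ∀ x, m.arr 38 x = 0) :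
    wp writeRecord m fun t m' => t ≤ (lowerList L n).length * 30 + (fillerList L n).length * 50 + 100 ∧
      (∀ x, m'.arr 38 x = 0) ∧ Appends 1 m m' (encodeRecord (outputRecord L n)) := by
  have hE := hT.entry_cellAt hn
  have hi := (valid_cellAt hn).index_lt
  -- The codes 0, 1, 2 of the three kinds are also the shifts of the dimension over that of the
  -- simplex.
  have hdim : m.arr 16 (m.arr 21 n) + m.arr 20 n = (cellAt L n).dim L := by
    rw [hE.index, hT.dim _ hi, hE.kind]
    cases cellAt L n <;> rfl
  have h24 := hE.fst
  have h25 := hE.snd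
  simp only [writeRecord, wp_seq (p := .store _ _ _), wp_seq (p := _ ≔ _), wp_assign, wp_store]
  set m₁ := Memory.setVar _ 2 _ with hm₁
  have e20 : m₁.var 20 = m.var 2 + 4 := by simp [hm₁]
  have e3 : m₁.var 3 = n := by simp [hm₁, h3]
  have e38 : m₁.arr 38 = m.arr 38 := by simp [hm₁]
  have hA₁ : Agree writeRecord m m₁ :=
    (agree_setArr rfl).trans ((agree_setArr rfl).trans ((agree_setArr rfl).trans
      ((agree_setArr rfl).trans ((agree_setVar rfl).trans (agree_setVar rfl)))))
  have hp₁ : m₁.var 2 = m.var 2 + 5 := by simp [hm₁]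
  have hs₁ : Seg (m₁.arr 1) (m.var 2) [(cellAt L n).dim L, 1, ((cellAt L n).degree L).1,
      ((cellAt L n).degree L).2] := by
    simp [hm₁, seg_cons, Seg.nil, h3, hdim, h24, h25, add_assoc]
  have hk₁ : ∀ j < m.var 2, m₁.arr 1 j = m.arr 1 j := by
    intro j hj
    simp [hm₁, Function.update_apply]
    rw [if_neg (by omega), if_neg (by omega), if_neg (by omega), if_neg (by omega)]
  clear_value m₁
  rw [wp_seq]
  refine (wp_eachEntry (A := 1) (T := 20) (g := fun y => [y]) (hl.of_agree hA₁ rfl rfl) hn e3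
    (by decide) ⟨rfl, rfl, rfl⟩ fun i hi m' _ h => ?_).mono fun t₂ m₂ hA₂ ⟨ht₂, h₂⟩ => ?_
  · simp only [wp_seq, wp_store, wp_assign]
    refine ⟨by simp, by simp, ?_, fun j hj => ?_⟩
    · simp [seg_cons, Seg.nil, h]
    · simp [hj.ne]
  · rw [List.flatMap_singleton'] at h₂
    have hF₂ := (hf.of_agree hA₁ rfl rfl).of_agree hA₂ rfl rfl
    rw [wp_seq]
    refine (wp_markParity hF₂ hn ((hA₂.var 3 rfl).trans e3)
      (by rwa [hA₂.arr 38 rfl, e38])).mono fun t₃ m₃ hA₃ ⟨ht₃, h₃⟩ => ?_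
    rw [wp_seq]
    refine (wp_emitMarked (hF₂.of_agree hA₃ rfl rfl) hn
      ((hA₃.var 3 rfl).trans ((hA₂.var 3 rfl).trans e3)) h₃).mono fun t₄ m₄ hA₄ ⟨ht₄, h38, h₄⟩ => ?_
    rw [wp_store]
    have f20 : m₄.var 20 = m.var 2 + 4 :=
      (hA₄.var 20 rfl).trans ((hA₃.var 20 rfl).trans ((hA₂.var 20 rfl).trans e20))
    have h₅ := (h₂.congr rfl rfl (hA₃.var 2 rfl) (hA₃.arr 1 rfl)).trans h₄
    have hfac : lowerList L n ++ oddEntries (parity (fillerList L n)) (fillerList L n) =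
        facetIds L (cellAt L n) := rfl
    rw [hfac] at h₅
    obtain ⟨h6, h7, h8⟩ := h₅
    refine ⟨?_, ?_, ?_, ?_, fun j hj => ?_⟩
    · simp only [cost_add, cost_sub, cost_var, cost_arr, cost_ofNat]
      omega
    · simpa using h38
    · rw [var_setArr, h6, hp₁]
      simp [encodeRecord, outputRecord]
      omega
    · have : encodeRecord (outputRecord L n) = [(cellAt L n).dim L, 1, ((cellAt L n).degree L).1,
          ((cellAt L n).degree L).2] ++ ([(facetIds L (cellAt L n)).length] ++
            facetIds L (cellAt L n)) := by
        simp [encodeRecord, outputRecord]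
      rw [this, seg_append, seg_append]
      simp only [arr_setArr, if_true, value_var, value_sub, value_add, value_ofNat, f20, h6, hp₁]
      refine ⟨hs₁.congr fun j _ hj => ?_, ?_, ?_⟩
      · simp only [List.length_cons, List.length_nil] at hj
        rw [Function.update_apply, if_neg (by omega), h8 j (by omega)]
      · rw [seg_cons]
        refine ⟨?_, Seg.nil _ _⟩
        simp
      · rw [hp₁] at h7
        refine h7.congr fun j hj hj' => ?_
        rw [Function.update_apply, if_neg (by omega)]
    · simp only [arr_setArr, if_true, value_var, f20]
      rw [Function.update_apply, if_neg (by omega), h8 j (by omega), hk₁ j hj]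

/-- The factor in the cost of writing a record of the output. -/
def recordCost (D : ℕ) : ℕ := (D + 3 + D ^ 4 * 2) * 30 + (D + 3 + D ^ 4 * 2) * D ^ 4 * 50 + 120

theorem wp_writeOutput (hL : Admissible L) {R D : ℕ} (hR : ∀ i, size L i ≤ 2 ^ R)
    (hD : ∀ i, (facets L i).length ≤ D) {m : Memory} (hT : Tables L m)
    (h4 : m.var 4 = (cells L).length) (hl : Stream 35 34 (lowerList L) (cells L).length m)
    (hf : Stream 37 36 (fillerList L) (cells L).length m) (h0 : ∀ x, m.arr 38 x = 0) :
    wp writeOutput m fun t m' => t ≤ (cells L).length * (recordCost D * (R + 1) ^ 2) + 20 ∧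
      m'.var 0 = (encodeList (output L)).length ∧ Seg (m'.arr 1) 0 (encodeList (output L)) := by
  simp only [writeOutput, wp_seq (p := .store _ _ _), wp_seq (p := _ ≔ _), wp_assign, wp_store,
    wp_seq (p := .while _ _ _)]
  set m₁ := Memory.setVar _ 3 _ with hm₁
  have hA₁ : Agree writeOutput m m₁ :=
    (agree_setArr rfl).trans ((agree_setVar rfl).trans (agree_setVar rfl))
  have hT₁ : Tables L m₁ := hT.of_agree hA₁ rfl
  have hl₁ := hl.of_agree hA₁ rfl rfl
  have hf₁ := hf.of_agree hA₁ rfl rfl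
  have e4 : m₁.var 4 = (cells L).length := by simp [hm₁, h4]
  have e3 : m₁.var 3 = 0 := by simp [hm₁]
  have e38 : m₁.arr 38 = m.arr 38 := by simp [hm₁]
  have ha₁ : Appends 1 (m.setVar 2 0) m₁ [(cells L).length] := by
    refine ⟨by simp [hm₁], by simp [hm₁, seg_cons, Seg.nil, h4], fun j hj => by simp at hj⟩
  clear_value m₁
  -- The loop test costs 3 steps; subtracting them here makes the total cost per record `recordCost
  -- D * (R + 1) ^ 2`.
  refine wp_while_uniform (T := recordCost D * (R + 1) ^ 2 - 3) (n := (cells L).length)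
    (fun i m' => m'.var 3 = i ∧ (∀ x, m'.arr 38 x = 0) ∧ Appends 1 (m.setVar 2 0) m'
      ([(cells L).length] ++ (List.range i).flatMap fun j => encodeRecord (outputRecord L j)))
    ?_ ?_ ?_ ?_
  · exact ⟨e3, by rwa [e38], by simpa using ha₁⟩
  · rintro i m' hA ⟨h, -⟩
    simp only [value_var, h, hA.var 4 rfl, e4]
  · rintro i m' hi hA ⟨h1, h2, h3⟩
    rw [wp_seq]
    refine (wp_writeRecord (hT₁.of_agree hA rfl) hi h1 (hl₁.of_agree hA rfl rfl)
      (hf₁.of_agree hA rfl rfl) h2).mono fun t m'' hA' ⟨ht, h5, h6⟩ => ?_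
    rw [wp_assign]
    refine ⟨?_, ?_, h5, ?_⟩
    · have hv := valid_cellAt hi
      have b1 : (lowerList L i).length ≤ (D + 3 + D ^ 4 * 2) * (R + 1) := by
        rw [lowerList, List.length_map]
        refine (length_lowerBoundary_le hL hD hR hv).trans ?_
        nlinarith [Nat.zero_le (D ^ 4), Nat.zero_le (D * R)]
      have b2 : (fillerList L i).length ≤ (D + 3 + D ^ 4 * 2) * D ^ 4 * (R + 1) ^ 2 := by
        rw [fillerList, List.length_map]
        refine (length_fillers_le hL hD hR hv).trans ?_
        calc _ ≤ ((D + 3 + D ^ 4 * 2) * (R + 1)) * (D ^ 4 * (R + 1)) := by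
              refine Nat.mul_le_mul ?_ (Nat.mul_le_mul_left _ (by omega))
              nlinarith [Nat.zero_le (D ^ 4), Nat.zero_le (D * R)]
          _ = _ := by ring
      have b3 : 1 ≤ (R + 1) ^ 2 := Nat.one_le_pow _ _ (by omega)
      have b4 : (D + 3 + D ^ 4 * 2) * (R + 1) ≤ (D + 3 + D ^ 4 * 2) * (R + 1) ^ 2 :=
        Nat.mul_le_mul_left _ (Nat.le_self_pow (by norm_num) _)
      have b5 : recordCost D * (R + 1) ^ 2 = (D + 3 + D ^ 4 * 2) * (R + 1) ^ 2 * 30 +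
          (D + 3 + D ^ 4 * 2) * D ^ 4 * (R + 1) ^ 2 * 50 + 120 * (R + 1) ^ 2 := by
        rw [recordCost]; ring
      rw [b5]
      simp only [cost_add, cost_var, cost_ofNat]
      generalize (D + 3 + D ^ 4 * 2) * D ^ 4 * (R + 1) ^ 2 = X at *
      generalize (D + 3 + D ^ 4 * 2) * (R + 1) ^ 2 = Y at *
      generalize (D + 3 + D ^ 4 * 2) * (R + 1) = Z at *
      generalize (R + 1) ^ 2 = W at *
      omega
    · simp [hA'.var 3 rfl, h1]
    · rw [List.range_succ, List.flatMap_append, ← List.append_assoc]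
      rw [List.flatMap_singleton]
      exact (h3.trans h6).congr rfl rfl (by simp) rfl
  · rintro t m' hA ⟨h1, -, h3⟩ ht
    have h5 : encodeList (output L) = [(cells L).length] ++
        (List.range (cells L).length).flatMap fun j => encodeRecord (outputRecord L j) := by
      rw [encodeList, length_output, output_eq, List.flatMap_map, List.singleton_append]
    rw [← h5] at h3
    refine ⟨?_, ?_, ?_⟩
    · have b3 : 1 ≤ (R + 1) ^ 2 := Nat.one_le_pow _ _ (by omega)
      have : recordCost D * (R + 1) ^ 2 - 3 + (1 + 1 + 1) = recordCost D * (R + 1) ^ 2 := by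
        have : 120 * 1 ≤ recordCost D * (R + 1) ^ 2 :=
          Nat.mul_le_mul (by rw [recordCost]; omega) b3
        omega
      simp only [cost_var, cost_ofNat] at ht ⊢
      rw [this] at ht
      omega
    · simpa using h3.ptr
    · simpa using h3.seg

end LogPath

namespace LogPath

open RAM

variable {L : List CellRecord}

/-! ### Arithmetical tables -/

/-- Fill the arrays `10` and `11` with the halves and the largest dividing powers of two of the
numbers below the double of variable `0`. -/
def fillArithmetic : Program :=
  .store 11 0 (v 0) ;; 1 ≔ 0 ;; .while (v 1) (v 0)
    (.store 11 (v 1 + v 1) (11 # v 1 + 11 # v 1) ;; .store 11 (v 1 + v 1 + 1) 1 ;;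
      .store 10 (v 1 + v 1) (v 1) ;; .store 10 (v 1 + v 1 + 1) (v 1) ;; 1 ≔ v 1 + 1)

/-- The table fills itself: the largest power of two dividing `2 a` is twice that of `a`, and for `2
a + 1` it is 1. Every power divides 0, so the entry at 0 only has to be at least `n`. -/
theorem wp_fillArithmetic {m : Memory} {n : ℕ} (hn : m.var 0 = n) :
    wp fillArithmetic m fun t m' => t ≤ n * 50 + 20 ∧ Arithmetic n m' := by
  simp only [fillArithmetic, wp_seq (p := .store _ _ _), wp_seq (p := _ ≔ _), wp_assign, wp_store]
  refine wp_while_uniform (T := 40) (n := n) (fun a m' => m'.var 1 = a ∧ n ≤ m'.arr 11 0 ∧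
    (∀ s < a + a, m'.arr 10 s = s / 2) ∧
    ∀ x < a + a, 0 < x → ∀ r, 2 ^ r ≤ m'.arr 11 x ↔ 2 ^ r ∣ x) ?_ ?_ ?_ ?_
  · exact ⟨by simp, by simp [hn], by simp, by simp⟩
  · rintro i m' hA ⟨h, -⟩
    simp only [value_var, h, hA.var 0 rfl]
    simp [hn]
  · rintro a m' ha - ⟨h1, h2, h3, h4⟩
    simp only [wp_seq, wp_store, wp_assign, cost_add, cost_var, cost_arr, cost_ofNat]
    refine ⟨by omega, ?_⟩
    simp only [value_add, value_var, value_arr, value_ofNat, var_setVar, arr_setVar, var_setArr,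
      arr_setArr, h1, if_true, Function.update_apply]
    norm_num
    simp only [Function.update_apply]
    refine ⟨?_, fun s hs => ?_, fun x hx hx0 r => ?_⟩
    · rw [if_neg (by omega)]
      -- The first iteration overwrites the entry at 0 by its double, which is still at least `n`.
      split_ifs with h
      · obtain rfl : a = 0 := by omega
        omega
      · exact h2
    · split_ifs with h h'
      · omega
      · omega
      · exact h3 s (by omega)
    · split_ifs with h h'
      · subst h
        cases r with
        | zero => simp
        | succ r =>
          have h5 : ¬ 2 ^ (r + 1) ≤ 1 := not_le.2 (Nat.one_lt_two_pow (by omega))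
          have h6 : ¬ 2 ^ (r + 1) ∣ a + a + 1 := fun h => by
            have := (Dvd.intro_left (2 ^ r) (pow_succ 2 r).symm).trans h
            omega
          exact iff_of_false h5 h6
      · subst h'
        have h5 := h4 a (by omega) (by omega)
        cases r with
        | zero =>
          have := (h5 0).2 (by simp)
          simp only [pow_zero, isUnit_iff_eq_one, IsUnit.dvd, iff_true] at this ⊢
          omega
        | succ r =>
          have h6 := h5 r
          rw [pow_succ, ← mul_two a, Nat.mul_dvd_mul_iff_right (by norm_num), ← h6]
          omega
      · exact h4 x (by omega) hx0 r
  · rintro t m' - ⟨-, h2, h3, h4⟩ ht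
    refine ⟨?_, h3, fun a ha r hr => ?_⟩
    · simp only [cost_var, cost_ofNat] at ht ⊢
      omega
    · rcases Nat.eq_zero_or_pos a with rfl | ha0
      · exact iff_of_true (hr.trans h2) (dvd_zero _)
      · exact h4 a (by omega) ha0 r

/-! ### The table of basis elements -/

/-- Within a simplex, `2 a + 2 ^ r` is twice the midpoint of the edge and equals `2 ^ r` times an
odd number, so it determines `r` and then `a`. Between simplices the doubled block starts separate
the keys, as each block has at least as many positions as generators. -/
theorem edgeKey_injective {i a r i' a' r' : ℕ} (h : RawCell.Valid L (.rel i a r))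
    (h' : RawCell.Valid L (.rel i' a' r')) (hk : edgeKey L i a r = edgeKey L i' a' r') :
    RawCell.rel i a r = .rel i' a' r' := by
  have key : ∀ {i a r i' a' r' : ℕ}, RawCell.Valid L (.rel i a r) → i < i' →
      edgeKey L i a r < edgeKey L i' a' r' := by
    intro i a r i' a' r' h hi
    have h2 : blockStart L i + size L i ≤ blockStart L i' := by
      obtain ⟨n, rfl⟩ := Nat.exists_eq_add_of_lt hi
      rw [blockStart, blockStart, add_assoc, List.range_add, List.flatMap_append, List.length_append,
        Nat.add_comm n, List.range_add, List.range_one]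
      simp [block]
    have h3 : a + 2 ^ r < size L i := h.2
    have : 0 < 2 ^ r := by positivity
    have : 0 < 2 ^ r' := by positivity
    simp only [edgeKey]
    omega
  have key' : ∀ {a r a' r' : ℕ}, 2 ^ r ∣ a → 2 ^ r' ∣ a' → r < r' →
      a + a + 2 ^ r ≠ a' + a' + 2 ^ r' := by
    rintro a r a' r' ⟨b, rfl⟩ ⟨b', rfl⟩ hr h
    obtain ⟨n, rfl⟩ := Nat.exists_eq_add_of_lt hr
    -- After cancelling `2 ^ r`, an odd number would equal an even one.
    have h1 : 2 ^ r * (2 * b + 1) = 2 ^ r * (2 * (2 ^ n * (2 * b' + 1))) := by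
      rw [pow_succ, pow_add] at h
      linarith
    have := Nat.eq_of_mul_eq_mul_left (by positivity) h1
    omega
  rcases lt_trichotomy i i' with hi | rfl | hi
  · exact absurd hk (key h hi).ne
  · have h1 : a + a + 2 ^ r = a' + a' + 2 ^ r' := by
      simp only [edgeKey] at hk
      omega
    rcases lt_trichotomy r r' with hr | rfl | hr
    · exact absurd h1 (key' h.1 h'.1 hr)
    · obtain rfl : a = a' := by omega
      rfl
    · exact absurd h1.symm (key' h'.1 h.1 hr)
  · exact absurd hk.symm (key h' hi).ne

/-- The first basis elements are those in `l`, and the tables describe them. -/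
structure Pushed (L : List CellRecord) (l : List RawCell) (m : Memory) : Prop where
  isPrefix : l <+: cells L
  count : m.var 4 = l.length
  entry : ∀ (j : ℕ) (h : j < l.length), Entry L m j l[j]
  edge : ∀ (j : ℕ) (h : j < l.length) (i a r : ℕ), l[j] = .rel i a r → m.arr 26 (edgeKey L i a r) = j

theorem Pushed.congr {l : List RawCell} {m m' : Memory} (h : Pushed L l m)
    (h4 : m'.var 4 = m.var 4) (ha : ∀ a, 20 ≤ a → m'.arr a = m.arr a) : Pushed L l m' := by
  obtain ⟨h1, h2, h3, h5⟩ := h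
  refine ⟨h1, by rw [h4, h2], fun j hj => ?_, by rwa [ha 26 (by norm_num)]⟩
  obtain ⟨a1, a2, a3, a4, a5, a6⟩ := h3 j hj
  rw [← ha _ (by norm_num)] at a1 a2 a3 a4 a5 a6
  exact ⟨a1, a2, a3, a4, a5, a6⟩

/-- Since `l` is a prefix of the final list, positions in `l` are already the final positions. -/
theorem Pushed.entry_of_mem {l : List RawCell} {m : Memory} (h : Pushed L l m) {c : RawCell}
    (hc : c ∈ l) : Entry L m (idx L c) c := by
  obtain ⟨j, hj, rfl⟩ := List.getElem_of_mem hc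
  obtain ⟨l', hl'⟩ := h.isPrefix
  have h1 := h.entry j hj
  have : idx L l[j] = j := by
    rw [idx_eq_of_append (l := l.take j) (l' := l.drop (j + 1) ++ l')]
    · simp [hj.le]
    · rw [← List.cons_append, ← List.append_assoc, List.getElem_cons_drop, List.take_append_drop, hl']
  rwa [this]

/-- Append a basis element to the tables: its cell is in variable `3`, its smallest vertex in
variable `6`, its step in variable `s` and its grade in the variables `40` and `41`. -/
def push (k s : ℕ) : Program :=
  .store 20 (v 4) (.const k) ;; .store 21 (v 4) (v 3) ;; .store 22 (v 4) (v 6) ;;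
    .store 23 (v 4) (v s) ;; .store 24 (v 4) (v 40) ;; .store 25 (v 4) (v 41) ;; 4 ≔ v 4 + 1

theorem wp_push {m : Memory} {l : List RawCell} {c : RawCell} {s : ℕ} (h : Pushed L l m)
    (hc : l ++ [c] <+: cells L) (h3 : m.var 3 = c.index) (h6 : m.var 6 = c.left)
    (hs : m.var s = c.step) (h40 : m.var 40 = (c.degree L).1) (h41 : m.var 41 = (c.degree L).2)
    (hkey : ∀ i a r, c = .rel i a r → m.arr 26 (edgeKey L i a r) = l.length) :
    wp (push c.kind s) m fun t m' => t ≤ 30 ∧ Pushed L (l ++ [c]) m' := by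
  have h4 := h.count
  simp only [push, wp_seq, wp_store, wp_assign, cost_var, cost_add, cost_ofNat]
  refine ⟨by simp [ArithExpr.cost], hc, by simp [h4], fun j hj => ?_, fun j hj i a r hj' => ?_⟩
  · rcases Nat.lt_succ_iff_lt_or_eq.1 (by simpa using hj : j < l.length + 1) with hj' | rfl
    · obtain ⟨a1, a2, a3, a4, a5, a6⟩ := h.entry j hj'
      rw [List.getElem_append_left hj']
      constructor <;> simp [hj'.ne, *]
    · rw [List.getElem_concat_length rfl]
      constructor <;> simp [h4, h3, h6, hs, h40, h41, ArithExpr.value]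
  · rcases Nat.lt_succ_iff_lt_or_eq.1 (by simpa using hj : j < l.length + 1) with hj'' | rfl
    · rw [List.getElem_append_left hj''] at hj'
      simpa using h.edge j hj'' i a r hj'
    · rw [List.getElem_concat_length rfl] at hj'
      simpa using hkey i a r hj'

/-- A new relation has a new key by injectivity of the keys and the absence of repetitions, so no
earlier entry is overwritten. -/
theorem Pushed.setEdge {m : Memory} {l : List RawCell} {i a r n : ℕ} (h : Pushed L l m)
    (hc : l ++ [.rel i a r] <+: cells L) : Pushed L l (m.setArr 26 (edgeKey L i a r) n) := by
  refine ⟨h.isPrefix, h.count, fun j hj => ?_, fun j hj i' a' r' hj' => ?_⟩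
  · obtain ⟨a1, a2, a3, a4, a5, a6⟩ := h.entry j hj
    constructor <;> simpa
  · have hnd := hc.sublist.nodup nodup_cells
    have hv : ∀ c ∈ l ++ [RawCell.rel i a r], c.Valid L := fun c h => mem_cells.1 (hc.subset h)
    have hmem : RawCell.rel i' a' r' ∈ l := hj' ▸ List.getElem_mem hj
    have hne : edgeKey L i' a' r' ≠ edgeKey L i a r := fun he => by
      have := edgeKey_injective (hv _ (List.mem_append_left _ hmem)) (hv _ (by simp)) he
      rw [List.nodup_append] at hnd
      exact hnd.2.2 _ hmem _ (List.mem_singleton_self _) this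
    simp only [arr_setArr, if_true, Function.update_apply, if_neg hne]
    exact h.edge j hj i' a' r' hj'

/-! ### Generators -/

/-- Append the generators of the cell in variable `3` to the tables. -/
def parseGenerators : Program :=
  .while (v 6) (v 5) (40 ≔ 0 # v 2 ;; 41 ≔ 0 # (v 2 + 1) ;; push 0 9 ;; 2 ≔ v 2 + 2 ;; 6 ≔ v 6 + 1)

theorem length_flatMap_pair (l : List (ℕ × ℕ)) : (l.flatMap fun s => [s.1, s.2]).length = 2 * l.length := by
  induction l with
  | nil => rfl
  | cons x l ih => simp [ih]; omega

theorem seg_flatMap_pair {f : ℕ → ℕ} {s : ℕ} {l : List (ℕ × ℕ)}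
    (h : Seg f s (l.flatMap fun s => [s.1, s.2])) {j : ℕ} (hj : j < l.length) :
    f (s + 2 * j) = l[j].1 ∧ f (s + 2 * j + 1) = l[j].2 := by
  induction l generalizing s j with
  | nil => simp at hj
  | cons x l ih =>
    rw [List.flatMap_cons, seg_append] at h
    cases j with
    | zero =>
      simp only [seg_cons] at h
      exact ⟨h.1.1, h.1.2.1⟩
    | succ j =>
      have := ih h.2 (j := j) (by simpa using hj)
      rw [show s + 2 * (j + 1) = s + [x.1, x.2].length + 2 * j by simp; omega]
      exact this

theorem flatMap_range_prefix {α : Type*} (f : ℕ → List α) {b n : ℕ} (h : b ≤ n) :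
    (List.range b).flatMap f <+: (List.range n).flatMap f := by
  obtain ⟨k, rfl⟩ := Nat.exists_eq_add_of_le h
  rw [List.range_add, List.flatMap_append]
  exact List.prefix_append _ _

theorem flatMap_block_prefix {i : ℕ} (hi : i < L.length) :
    (List.range i).flatMap (block L) ++ block L i <+: cells L := by
  have := flatMap_range_prefix (block L) (Nat.succ_le_of_lt hi)
  rwa [List.range_succ, List.flatMap_append, List.flatMap_singleton] at this

theorem wp_parseGenerators {m : Memory} {i s : ℕ} (hi : i < L.length) (h2 : m.var 2 = s)
    (hs : Seg (m.arr 0) s ((record L i).grades.flatMap fun s => [s.1, s.2])) (h3 : m.var 3 = i)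
    (h5 : m.var 5 = size L i) (h6 : m.var 6 = 0) (h9 : m.var 9 = 0)
    (hP : Pushed L ((List.range i).flatMap (block L)) m) :
    wp parseGenerators m fun t m' => t ≤ size L i * 60 + 3 ∧ m'.var 2 = s + 2 * size L i ∧
      Pushed L ((List.range i).flatMap (block L) ++ (List.range (size L i)).map (.gen i)) m' := by
  refine wp_while_uniform (T := 50) (n := size L i) (fun a m' => m'.var 6 = a ∧ m'.var 2 = s + 2 * a ∧
    Pushed L ((List.range i).flatMap (block L) ++ (List.range a).map (.gen i)) m') ?_ ?_ ?_ ?_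
  · exact ⟨h6, h2, by simpa using hP⟩
  · rintro a m' hA ⟨h, -⟩
    simp only [value_var, h, hA.var 5 rfl, h5]
  · rintro a m' ha hA ⟨g6, g2, gP⟩
    have hg : grade L i a = (record L i).grades[a]'ha := List.getD_eq_getElem _ _ ha
    obtain ⟨e1, e2⟩ := seg_flatMap_pair hs (j := a) ha
    have a0 := hA.arr 0 rfl
    simp only [wp_seq (p := _ ≔ _), wp_assign]
    rw [wp_seq]
    refine (wp_push (L := L) (c := .gen i a) (s := 9) (m := Memory.setVar (Memory.setVar m' 40 _) 41 _) (gP.congr (by simp) fun _ _ => rfl) ?_ ?_ ?_ ?_ ?_ ?_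
      fun _ _ _ h => by cases h).mono fun t m'' hA' ⟨ht, gP'⟩ => ?_
    · refine List.IsPrefix.trans ?_ (flatMap_block_prefix hi)
      rw [List.append_assoc, List.prefix_append_right_inj, block]
      refine List.IsPrefix.trans ?_ (List.prefix_append _ _)
      have := flatMap_range_prefix (fun a => [RawCell.gen i a]) (Nat.succ_le_of_lt ha)
      rwa [← List.map_eq_flatMap, ← List.map_eq_flatMap, List.range_succ, List.map_append] at this
    · simpa [hA.var 3 rfl, RawCell.index] using h3
    · simpa [RawCell.left] using g6
    -- Variable `9` is still 0 while generators are read, and 0 is the step of a generator.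
    · simpa [hA.var 9 rfl, RawCell.step] using h9
    · simp [a0, g2, e1, RawCell.degree, hg]
    · simp [a0, g2, e2, RawCell.degree, hg]
    · rw [wp_seq, wp_assign, wp_assign]
      simp only [cost_add, cost_var, cost_arr, cost_ofNat]
      refine ⟨by omega, ?_, ?_, ?_⟩
      · simp [hA'.var 6 rfl, g6]
      · simp [hA'.var 2 rfl, g2]
        omega
      · refine Pushed.congr (m := m'') ?_ (by simp) fun _ _ => rfl
        rw [List.range_succ, List.map_append, ← List.append_assoc]
        exact gP'
  · rintro t m' - ⟨-, g2, gP⟩ ht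
    refine ⟨?_, g2, gP⟩
    simp only [cost_var] at ht
    omega

/-! ### Relations and syzygies -/

/-- Append the relation from variable `6` with step variable `8` to the tables, and the syzygy of
which it is the longest edge. -/
def parseEdge : Program :=
  40 ≔ 24 # (v 7 + v 6 + v 8) ;; 41 ≔ 25 # (v 7 + v 6) ;;
    .store 26 (v 7 + v 7 + v 6 + v 6 + v 8) (v 4) ;; push 1 8 ;; .ite 0 (v 9) (push 2 9) .skip

/-- Append the relations and syzygies of the cell in variable `3` to the tables. -/
def parseEdges : Program :=
  .while (v 8) (v 5)
    (6 ≔ 0 ;; .while (v 6 + v 8) (v 5) (parseEdge ;; 6 ≔ v 6 + v 8) ;; 9 ≔ v 8 ;; 8 ≔ v 8 + v 8)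

/-- Variable `8` holds the step of the relation and variable `9` half of it. The latter is the step
of the accompanying syzygy, and its value 0 at level 0 signals that there is none. -/
theorem wp_parseEdge (hL : Admissible L) {m : Memory} {i b r : ℕ} {l : List RawCell}
    (hP : Pushed L l m) (hc : l ++ edgeCells i r b <+: cells L)
    (hg : ∀ a < size L i, RawCell.gen i a ∈ l) (hb : b * 2 ^ r + 2 ^ r < size L i)
    (h3 : m.var 3 = i) (h6 : m.var 6 = b * 2 ^ r) (h7 : m.var 7 = blockStart L i)
    (h8 : m.var 8 = 2 ^ r) (h9 : m.var 9 = if r = 0 then 0 else 2 ^ (r - 1)) :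
    wp parseEdge m fun t m' => t ≤ 100 ∧ Pushed L (l ++ edgeCells i r b) m' := by
  have hb' : b * 2 ^ r < size L i := (Nat.le_add_right _ _).trans_lt hb
  have hX := (hP.entry_of_mem (hg _ hb)).fst
  have hY := (hP.entry_of_mem (hg _ hb')).snd
  rw [idx_gen hb] at hX
  rw [idx_gen hb'] at hY
  have h0 : 0 < 2 ^ r := by positivity
  -- By the staircase shape the join needs no comparison: its first coordinate comes from the right
  -- end and its second from the left end.
  have hdeg : grade L i (b * 2 ^ r) ⊔ grade L i (b * 2 ^ r + 2 ^ r) =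
      ((grade L i (b * 2 ^ r + 2 ^ r)).1, (grade L i (b * 2 ^ r)).2) :=
    Prod.ext (sup_eq_right.2 (hL.fst_lt i _ _ (by omega) hb).le)
      (sup_eq_left.2 (hL.snd_lt i _ _ (by omega) hb).le)
  have hc1 : l ++ [.rel i (b * 2 ^ r) r] <+: cells L := by
    refine List.IsPrefix.trans ?_ hc
    rw [List.prefix_append_right_inj, edgeCells]
    exact List.prefix_append [_] _
  simp only [parseEdge, wp_seq (p := _ ≔ _), wp_assign, wp_seq (p := .store _ _ _), wp_store]
  set m₁ := Memory.setArr _ 26 _ _ with hm₁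
  have e40 : m₁.var 40 = (grade L i (b * 2 ^ r + 2 ^ r)).1 := by
    simp [hm₁, h7, h6, h8, add_assoc, hX, RawCell.degree]
  have e41 : m₁.var 41 = (grade L i (b * 2 ^ r)).2 := by
    simp [hm₁, h7, h6, hY, RawCell.degree]
  have e3 : m₁.var 3 = i := by simp [hm₁, h3]
  have e6 : m₁.var 6 = b * 2 ^ r := by simp [hm₁, h6]
  have e8 : m₁.var 8 = 2 ^ r := by simp [hm₁, h8]
  have e9 : m₁.var 9 = if r = 0 then 0 else 2 ^ (r - 1) := by simp [hm₁, h9]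
  have ek : m₁.arr 26 (edgeKey L i (b * 2 ^ r) r) = l.length := by
    simp [hm₁, h7, h6, h8, edgeKey, hP.count]
  have P₁ : Pushed L l m₁ := by
    have hk : blockStart L i + blockStart L i + b * 2 ^ r + b * 2 ^ r + 2 ^ r =
      edgeKey L i (b * 2 ^ r) r := rfl
    rw [hm₁]
    simp only [value_add, value_var, var_setVar, h7, h6, h8]
    norm_num
    rw [hk]
    exact Pushed.setEdge (hP.congr (by simp) fun _ _ => rfl) hc1
  clear_value m₁
  rw [wp_seq]
  refine (wp_push (L := L) (c := .rel i (b * 2 ^ r) r) (s := 8) P₁ hc1 e3 e6 e8 ?_ ?_ ?_).mono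
    fun t m₂ hA₂ ⟨ht, P₂⟩ => ?_
  · rw [e40, RawCell.degree, hdeg]
  · rw [e41, RawCell.degree, hdeg]
  · rintro _ _ _ ⟨⟩
    exact ek
  have f9 := (hA₂.var 9 rfl).trans e9
  rw [wp_ite]
  simp only [value_ofNat, value_var, f9, cost_add, cost_var, cost_arr, cost_ofNat]
  by_cases hr : r = 0
  · rw [if_pos hr]
    refine ⟨fun h => absurd h (lt_irrefl _), fun _ => ?_⟩
    rw [wp_skip]
    refine ⟨by omega, ?_⟩
    rw [edgeCells, if_pos hr]
    exact P₂
  · rw [if_neg hr] at f9 ⊢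
    refine ⟨fun _ => ?_, fun h => absurd (by positivity) h⟩
    obtain ⟨r, rfl⟩ := Nat.exists_eq_succ_of_ne_zero hr
    refine (wp_push (L := L) (c := .syz i (b * 2 ^ (r + 1)) r) (s := 9) P₂ ?_
      ((hA₂.var 3 rfl).trans e3) ((hA₂.var 6 rfl).trans e6) f9
      ?_ ?_ ?_).mono fun t m₃ _ ⟨ht, P₃⟩ => ⟨by omega, ?_⟩
    · rw [edgeCells, if_neg hr] at hc
      rw [List.append_assoc]
      exact hc
    · rw [hA₂.var 40 rfl, e40, RawCell.degree, hdeg]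
    · rw [hA₂.var 41 rfl, e41, RawCell.degree, hdeg]
    · rintro _ _ _ ⟨⟩
    · rw [edgeCells, if_neg hr]
      rw [List.append_assoc] at P₃
      exact P₃

end LogPath

namespace LogPath

open RAM

variable {L : List CellRecord}

/-- Level `r` takes time proportional to `(m - 1) / 2 ^ r` plus a constant. The geometric series and
the logarithmic number of levels are both linear in the number `m` of generators. -/
theorem wp_parseEdges (hL : Admissible L) {m : Memory} {i : ℕ} (hi : i < L.length)
    (hP : Pushed L ((List.range i).flatMap (block L) ++ (List.range (size L i)).map (.gen i)) m)
    (h3 : m.var 3 = i) (h5 : m.var 5 = size L i) (h7 : m.var 7 = blockStart L i)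
    (h8 : m.var 8 = 1) (h9 : m.var 9 = 0) :
    wp parseEdges m fun t m' => t ≤ size L i * 300 + 3 ∧
      Pushed L ((List.range i).flatMap (block L) ++ block L i) m' := by
  set B := (List.range i).flatMap (block L) with hB
  set S := (List.range (size L i)).map (RawCell.gen i) with hS
  have hblock : B ++ S ++ (List.range (Nat.clog 2 (size L i))).flatMap (levelCells i (size L i)) =
      B ++ block L i := by rw [block, ← List.append_assoc]
  have hpre : B ++ S ++ (List.range (Nat.clog 2 (size L i))).flatMap (levelCells i (size L i)) <+:
      cells L := hblock ▸ flatMap_block_prefix hi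
  refine wp_while_count (T := fun r => (size L i - 1) / 2 ^ r * 120 + 20) (n := Nat.clog 2 (size L i))
    (fun r m' => m'.var 8 = 2 ^ r ∧ (m'.var 9 = if r = 0 then 0 else 2 ^ (r - 1)) ∧
      Pushed L (B ++ S ++ (List.range r).flatMap (levelCells i (size L i))) m') ?_ ?_ ?_ ?_
  · exact ⟨h8, h9, by simpa using hP⟩
  · rintro r m' hA ⟨g8, -⟩
    rw [value_var, value_var, g8, hA.var 5 rfl, h5, Nat.lt_clog_iff_pow_lt (by norm_num)]
  · rintro r m₁ hr hA ⟨g8, g9, gP⟩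
    have g3 := (hA.var 3 rfl).trans h3
    have g5 := (hA.var 5 rfl).trans h5
    have g7 := (hA.var 7 rfl).trans h7
    simp only [wp_seq (p := _ ≔ _), wp_assign, wp_seq (p := .while _ _ _)]
    have hpre' : B ++ S ++ (List.range r).flatMap (levelCells i (size L i)) ++
        levelCells i (size L i) r <+: cells L := by
      refine List.IsPrefix.trans ?_ hpre
      have := flatMap_range_prefix (levelCells i (size L i)) (Nat.succ_le_of_lt hr)
      rw [List.range_succ, List.flatMap_append, List.flatMap_singleton] at this
      rwa [List.append_assoc _ _ (levelCells _ _ _), List.prefix_append_right_inj]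
    refine wp_while_uniform (T := 110) (n := (size L i - 1) / 2 ^ r)
      (fun b m' => m'.var 6 = b * 2 ^ r ∧ Pushed L (B ++ S ++
        (List.range r).flatMap (levelCells i (size L i)) ++ (List.range b).flatMap (edgeCells i r)) m')
      ?_ ?_ ?_ ?_
    · refine ⟨by simp, ?_⟩
      rw [List.range_zero, List.flatMap_nil, List.append_nil]
      exact gP.congr (by simp) fun _ _ => rfl
    · rintro b m' hA' ⟨f6, -⟩
      simp only [value_add, value_var, f6, hA'.var 8 rfl, hA'.var 5 rfl]
      simp only [value_ofNat, var_setVar, lt_div_iff_edge]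
      norm_num [g8, g5]
    · rintro b m' hb hA' ⟨f6, fP⟩
      have f8 : m'.var 8 = 2 ^ r := by rw [hA'.var 8 rfl]; simpa using g8
      have f9 : m'.var 9 = if r = 0 then 0 else 2 ^ (r - 1) := by rw [hA'.var 9 rfl]; simpa using g9
      have f3 : m'.var 3 = i := by rw [hA'.var 3 rfl]; simpa using g3
      have f7 : m'.var 7 = blockStart L i := by rw [hA'.var 7 rfl]; simpa using g7
      rw [wp_seq]
      refine (wp_parseEdge hL fP ?_ (fun a ha => ?_) (lt_div_iff_edge.1 hb) f3 f6 f7 f8 f9).mono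
        fun t m'' hA'' ⟨ht, fP'⟩ => ?_
      · refine List.IsPrefix.trans ?_ hpre'
        have := flatMap_range_prefix (edgeCells i r) (Nat.succ_le_of_lt hb)
        rw [List.range_succ, List.flatMap_append, List.flatMap_singleton] at this
        rwa [List.append_assoc _ _ (edgeCells _ _ _), List.prefix_append_right_inj]
      · simp [hS, ha]
      · rw [wp_assign]
        refine ⟨?_, ?_, ?_⟩
        · simp only [cost_add, cost_var]; omega
        · simp [hA''.var 6 rfl, hA''.var 8 rfl, f6, f8, add_mul]
        · rw [List.range_succ, List.flatMap_append, List.flatMap_singleton, ← List.append_assoc]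
          exact fP'.congr (by simp) fun _ _ => rfl
    · rintro t m' hA' ⟨-, fP⟩ ht
      have f8 : m'.var 8 = 2 ^ r := by rw [hA'.var 8 rfl]; simpa using g8
      refine ⟨?_, ?_, ?_, ?_⟩
      · simp only [cost_add, cost_var, cost_ofNat] at ht ⊢
        omega
      · simp [f8, pow_succ, mul_two]
      · simp [f8]
      · rw [List.range_succ, List.flatMap_append, List.flatMap_singleton, ← List.append_assoc]
        exact fP.congr (by simp) fun _ _ => rfl
  · rintro t m' - ⟨-, -, gP⟩ ht
    rw [hblock] at gP
    refine ⟨ht.trans ?_, gP⟩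
    have h1 := Nat.geom_sum_le (b := 2) le_rfl (size L i - 1) (Nat.clog 2 (size L i))
    have h2 : Nat.clog 2 (size L i) ≤ size L i := Nat.clog_le_of_le_pow Nat.lt_two_pow_self.le
    simp only [cost_var, Finset.sum_add_distrib, ← Finset.sum_mul, Finset.sum_const,
      Finset.card_range, smul_eq_mul]
    omega

/-! ### Reading the input -/

/-- Read the record of the cell in variable `3`. -/
def parseRecord : Program :=
  .store 16 (v 3) (0 # v 2) ;; .store 12 (v 3) (0 # (v 2 + 1)) ;; .store 13 (v 3) (v 4) ;;
    5 ≔ 0 # (v 2 + 1) ;; 2 ≔ v 2 + 2 ;; 7 ≔ v 4 ;; 6 ≔ 0 ;; 8 ≔ 1 ;; 9 ≔ 0 ;;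
    parseGenerators ;; parseEdges ;;
    .store 14 (v 3) (v 2 + 1) ;; .store 15 (v 3) (v 2 + 1 + 0 # v 2) ;; 2 ≔ 15 # v 3

/-- Read the input. -/
def parse : Program :=
  1 ≔ 0 # 0 ;; 2 ≔ 1 ;; 3 ≔ 0 ;; 4 ≔ 0 ;; .while (v 3) (v 1) (parseRecord ;; 3 ≔ v 3 + 1)

/-- The address of the record of the cell `i` in the input. -/
def inputStart (L : List CellRecord) (i : ℕ) : ℕ := 1 + ((L.take i).flatMap encodeRecord).length

theorem inputStart_succ {i : ℕ} (hi : i < L.length) : inputStart L (i + 1) =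
    inputStart L i + 2 + 2 * size L i + 1 + (facets L i).length := by
  rw [inputStart, List.take_add_one, List.getElem?_eq_getElem hi, Option.toList_some,
    List.flatMap_append, List.flatMap_singleton, List.length_append, inputStart, size, facets,
    record_of_lt hi, List.get_eq_getElem]
  simp only [encodeRecord, List.length_cons, List.length_append, length_flatMap_pair]
  omega

theorem seg_inputStart {g : ℕ → ℕ} (h : Seg g 0 (encodeList L)) {i : ℕ} (hi : i < L.length) :
    g (inputStart L i) = (record L i).dim ∧ g (inputStart L i + 1) = size L i ∧
    Seg g (inputStart L i + 2) ((record L i).grades.flatMap fun s => [s.1, s.2]) ∧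
    g (inputStart L i + 2 + 2 * size L i) = (facets L i).length ∧
    Seg g (inputStart L i + 2 + 2 * size L i + 1) (facets L i) := by
  have hL' : L = L.take i ++ record L i :: L.drop (i + 1) := by
    rw [record_of_lt hi, List.get_eq_getElem, List.getElem_cons_drop, List.take_append_drop]
  rw [encodeList, seg_cons, hL', List.flatMap_append, List.flatMap_cons, seg_append, seg_append,
    ← hL', Nat.zero_add] at h
  have h1 := h.2.2.1
  rw [encodeRecord, seg_cons, seg_cons, seg_append, seg_cons, length_flatMap_pair] at h1
  exact h1

/-- The records of the first `i` cells have been read. -/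
structure Parsed (L : List CellRecord) (i : ℕ) (m : Memory) : Prop where
  ptr : m.var 2 = inputStart L i
  pushed : Pushed L ((List.range i).flatMap (block L)) m
  size : ∀ j < i, m.arr 12 j = size L j
  start : ∀ j < i, m.arr 13 j = blockStart L j
  facets : ∀ j < i, m.arr 14 j = inputStart L j + 2 + 2 * LogPath.size L j + 1
  facets_end : ∀ j < i, m.arr 15 j = m.arr 14 j + (LogPath.facets L j).length
  dim : ∀ j < i, m.arr 16 j = (record L j).dim

theorem wp_parseRecord (hL : Admissible L) {m : Memory} {i : ℕ} (hi : i < L.length)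
    (hin : Seg (m.arr 0) 0 (encodeList L)) (h3 : m.var 3 = i) (hP : Parsed L i m) :
    wp parseRecord m fun t m' => t ≤ size L i * 360 + 60 ∧ Parsed L (i + 1) m' := by
  obtain ⟨i1, i2, i3, i4, i5⟩ := seg_inputStart hin hi
  have h2 := hP.ptr
  have h4 := hP.pushed.count
  simp only [parseRecord, wp_seq (p := _ ≔ _), wp_assign, wp_seq (p := .store _ _ _), wp_store]
  set m₁ := Memory.setVar _ 9 _ with hm₁
  have e2 : m₁.var 2 = inputStart L i + 2 := by simp [hm₁, h2]
  have e3 : m₁.var 3 = i := by simp [hm₁, h3]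
  have e5 : m₁.var 5 = size L i := by simp [hm₁, h2, i2]
  have e6 : m₁.var 6 = 0 := by simp [hm₁]
  have e7 : m₁.var 7 = blockStart L i := by simp [hm₁, h4, blockStart]
  have e8 : m₁.var 8 = 1 := by simp [hm₁]
  have e9 : m₁.var 9 = 0 := by simp [hm₁]
  have e0 : m₁.arr 0 = m.arr 0 := by simp [hm₁]
  have e12 : m₁.arr 12 = Function.update (m.arr 12) i (size L i) := by simp [hm₁, h2, h3, i2]
  have e13 : m₁.arr 13 = Function.update (m.arr 13) i (blockStart L i) := by
    simp [hm₁, h3, h4, blockStart]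
  have e14 : m₁.arr 14 = m.arr 14 := by simp [hm₁]
  have e15 : m₁.arr 15 = m.arr 15 := by simp [hm₁]
  have e16 : m₁.arr 16 = Function.update (m.arr 16) i (record L i).dim := by simp [hm₁, h2, h3, i1]
  have P₁ : Pushed L ((List.range i).flatMap (block L)) m₁ := by
    refine hP.pushed.congr (by simp [hm₁]) fun a ha => ?_
    simp only [hm₁, arr_setVar, arr_setArr]
    rw [if_neg (by omega), if_neg (by omega), if_neg (by omega)]
  clear_value m₁
  rw [wp_seq]
  refine (wp_parseGenerators hi e2 (by rwa [e0]) e3 e5 e6 e9 P₁).mono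
    fun t₂ m₂ hA₂ ⟨ht₂, f2, P₂⟩ => ?_
  rw [wp_seq]
  refine (wp_parseEdges hL hi P₂ ((hA₂.var 3 rfl).trans e3) ((hA₂.var 5 rfl).trans e5)
    ((hA₂.var 7 rfl).trans e7) ((hA₂.var 8 rfl).trans e8) ((hA₂.var 9 rfl).trans e9)).mono
    fun t₃ m₃ hA₃ ⟨ht₃, P₃⟩ => ?_
  have g2 : m₃.var 2 = inputStart L i + 2 + 2 * size L i := (hA₃.var 2 rfl).trans f2
  have g3 : m₃.var 3 = i := (hA₃.var 3 rfl).trans ((hA₂.var 3 rfl).trans e3)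
  have g0 := (hA₃.arr 0 rfl).trans ((hA₂.arr 0 rfl).trans e0)
  have g12 := (hA₃.arr 12 rfl).trans ((hA₂.arr 12 rfl).trans e12)
  have g13 := (hA₃.arr 13 rfl).trans ((hA₂.arr 13 rfl).trans e13)
  have g14 := (hA₃.arr 14 rfl).trans ((hA₂.arr 14 rfl).trans e14)
  have g15 := (hA₃.arr 15 rfl).trans ((hA₂.arr 15 rfl).trans e15)
  have g16 := (hA₃.arr 16 rfl).trans ((hA₂.arr 16 rfl).trans e16)
  simp only [wp_seq, wp_store, wp_assign]
  refine ⟨?_, ?_, ?_, fun j hj => ?_, fun j hj => ?_, fun j hj => ?_, fun j hj => ?_, fun j hj => ?_⟩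
  · simp only [cost_add, cost_var, cost_arr, cost_ofNat]
    omega
  · rw [inputStart_succ hi]
    simp [g2, g3, g0, i4]
  · rw [List.range_succ, List.flatMap_append, List.flatMap_singleton]
    refine P₃.congr (by simp) fun a ha => ?_
    simp only [arr_setVar, arr_setArr]
    rw [if_neg (by omega), if_neg (by omega)]
  all_goals rcases Nat.lt_succ_iff_lt_or_eq.1 hj with hj | rfl
  · simpa [g12, hj.ne] using hP.size j hj
  · simp [g12]
  · simpa [g13, hj.ne] using hP.start j hj
  · simp [g13]
  · simpa [g14, g3, hj.ne] using hP.facets j hj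
  · simp [g3, g2]
  · simpa [g14, g15, g3, hj.ne] using hP.facets_end j hj
  · simp [g3, g2, g0, i4]
  · simpa [g16, hj.ne] using hP.dim j hj
  · simp [g16]

theorem wp_parse (hL : Admissible L) {m : Memory} {n : ℕ} (hin : Seg (m.arr 0) 0 (encodeList L))
    (hA : Arithmetic n m) (hn : ∀ i, size L i + size L i ≤ n) :
    wp parse m fun t m' => t ≤ generatorCount L * 430 + 20 ∧ Tables L m' ∧
      m'.var 4 = (cells L).length := by
  simp only [parse, wp_seq (p := _ ≔ _), wp_assign]
  refine wp_while_count (T := fun i => size L i * 360 + 64) (n := L.length)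
    (fun i m' => m'.var 3 = i ∧ Parsed L i m') ?_ ?_ ?_ ?_
  · refine ⟨by simp, by simp [inputStart], ⟨by simp, by simp, by simp, by simp⟩, ?_, ?_, ?_, ?_, ?_⟩ <;>
      simp
  · rintro i m' hA' ⟨h3, -⟩
    have : m.arr 0 0 = L.length := (seg_cons.1 hin).1
    simp only [value_var, h3, hA'.var 1 rfl]
    simp [this]
  · rintro i m' hi hA' ⟨h3, hP⟩
    rw [wp_seq]
    refine (wp_parseRecord hL hi (by rw [hA'.arr 0 rfl]; exact hin) h3 hP).mono
      fun t m'' hA'' ⟨ht, hP'⟩ => ?_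
    rw [wp_assign]
    refine ⟨?_, ?_, ?_, ?_, ?_, ?_, ?_, ?_, ?_⟩
    · simp only [cost_add, cost_var, cost_ofNat]
      omega
    · simp [hA''.var 3 rfl, h3]
    · simpa using hP'.ptr
    · exact hP'.pushed.congr (by simp) fun _ _ => rfl
    exacts [hP'.size, hP'.start, hP'.facets, hP'.facets_end, hP'.dim]
  · rintro t m' hA' ⟨-, hP⟩ ht
    -- Every cell has at least one generator, so the constant cost per cell is absorbed into the
    -- number of generators.
    have h1 : ∑ i ∈ Finset.range L.length, (size L i * 360 + 64 + 3) ≤ generatorCount L * 430 := by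
      rw [generatorCount_eq, ← List.sum_toFinset _ List.nodup_range, List.toFinset_range,
        Finset.sum_mul]
      refine Finset.sum_le_sum fun i hi => ?_
      have := hL.size_pos i (Finset.mem_range.1 hi)
      omega
    refine ⟨?_, ?_, ?_⟩
    · have h2 : t ≤ generatorCount L * 430 + 3 := ht.trans (Nat.add_le_add_right h1 3)
      simp only [cost_arr, cost_ofNat]
      omega
    · refine ⟨⟨n, hn, ?_, ?_⟩, hP.size, hP.start, fun i hi => ?_, hP.facets_end, hP.dim,
        fun c hc => ?_, fun i a r hv => ?_⟩
      · rw [hA'.arr 10 rfl]; exact hA.half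
      · rw [hA'.arr 11 rfl]; exact hA.low
      · rw [hP.facets i hi, hA'.arr 0 rfl]
        exact (seg_inputStart hin hi).2.2.2.2
      · exact hP.pushed.entry_of_mem (mem_cells.2 hc)
      · have := hP.pushed.edge (idx L (.rel i a r)) (idx_lt hv) i a r (getElem_idx hv)
        exact this
    · exact hP.pushed.count

end LogPath

namespace LogPath

open RAM

variable {L : List CellRecord}

/-! ### The log-path algorithm -/

/-- The log-path algorithm. -/
def logPathAlgorithm : Program :=
  fillArithmetic ;; parse ;; pass 32 emitPaths ;; pass 35 emitLower ;; pass 37 emitFillers ;; writeOutput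

/-- The factor in the cost of the log-path algorithm. -/
def algorithmCost (D : ℕ) : ℕ :=
  (6 + D) * 50 + 5 * (pathsCost D + lowerCost D + fillersCost D + recordCost D + 30) + 600

/-- The factor in the size of the output. -/
def outputCost (D : ℕ) : ℕ := 5 * ((D + 3 + D ^ 4 * 2) * (D ^ 4 + 1) + 1)

theorem length_encodeList : (encodeList L).length = inputStart L L.length := by
  rw [encodeList, inputStart, List.take_length, List.length_cons, add_comm]

theorem inputStart_mono : Monotone (inputStart L) := fun i j h => by
  obtain ⟨l, hl⟩ := List.take_prefix_take_left (l := L) h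
  rw [inputStart, inputStart, ← hl, List.flatMap_append, List.length_append]
  omega

theorem size_add_size_le (i : ℕ) : size L i + size L i ≤ (encodeList L).length := by
  by_cases hi : i < L.length
  · have h1 := inputStart_succ hi
    have h2 := inputStart_mono (L := L) (Nat.succ_le_of_lt hi)
    rw [Nat.succ_eq_add_one] at h2
    rw [length_encodeList]
    omega
  · have : ¬ 0 < size L i := fun h => hi (lt_length_of_size_pos h)
    omega

/-- A record with `m` generators takes at most `3 + 2 m + D` cells of memory, which is at most `(5 +
D) m` because `m` is positive. So the initial tables, whose size is the input length, cost only
linear time in the number of generators. -/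
theorem length_encodeList_le (hL : Admissible L) {D : ℕ} (hD : ∀ i, (facets L i).length ≤ D) :
    (encodeList L).length ≤ 1 + generatorCount L * (5 + D) := by
  rw [length_encodeList, generatorCount_eq]
  have key : ∀ i ≤ L.length, inputStart L i ≤ 1 + ((List.range i).map (size L)).sum * (5 + D) := by
    intro i
    induction i with
    | zero => simp [inputStart]
    | succ i ih =>
      intro hi
      have h1 := ih (by omega)
      have h2 : 1 * (3 + D) ≤ size L i * (3 + D) := Nat.mul_le_mul_right _ (hL.size_pos i hi)
      have h3 := hD i
      rw [inputStart_succ hi, List.range_succ, List.map_append, List.sum_append]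
      simp only [List.map_cons, List.map_nil, List.sum_cons, List.sum_nil, add_zero]
      nlinarith
  exact key _ le_rfl

theorem generatorCount_pos (hL : Admissible L) (h0 : 0 < L.length) : 1 ≤ generatorCount L := by
  rw [generatorCount_eq]
  refine (hL.size_pos 0 h0).trans_le (List.single_le_sum (by simp) _ ?_)
  exact List.mem_map_of_mem (List.mem_range.2 h0)

/-- Reading is linear. Each of the three passes and the final writing handle at most five basis
elements for each generator of the input, at cost `O((R + 1) ^ 2)` each. -/
theorem computes_output (hL : Admissible L) (h0 : 0 < L.length) {R D : ℕ}
    (hR : ∀ i, size L i ≤ 2 ^ R) (hD : ∀ i, (facets L i).length ≤ D) :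
    ∃ t ≤ algorithmCost D * (generatorCount L * (R + 1) ^ 2),
      Computes logPathAlgorithm (encodeList L) (encodeList (output L)) t := by
  suffices h : wp logPathAlgorithm (initialMemory (encodeList L)) fun t m' =>
      t ≤ algorithmCost D * (generatorCount L * (R + 1) ^ 2) ∧
        m'.var 0 = (encodeList (output L)).length ∧ Seg (m'.arr 1) 0 (encodeList (output L)) by
    obtain ⟨t, m', h1, h2, h3, h4⟩ := h
    exact ⟨t, h2, m', h1, h3, fun i hi => by rw [← h4 i hi, Nat.zero_add]⟩
  set m := initialMemory (encodeList L) with hm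
  have hin : Seg (m.arr 0) 0 (encodeList L) := fun j hj => by simp [hm, initialMemory, hj]
  have h38 : ∀ x, m.arr 38 x = 0 := fun x => rfl
  have hv : m.var 0 = (encodeList L).length := rfl
  clear_value m
  rw [logPathAlgorithm, wp_seq]
  refine (wp_fillArithmetic hv).mono fun t₁ m₁ hA₁ ⟨ht₁, hT₁⟩ => ?_
  rw [wp_seq]
  refine (wp_parse hL (by rwa [hA₁.arr 0 rfl]) hT₁ size_add_size_le).mono
    fun t₂ m₂ hA₂ ⟨ht₂, hT₂, h4⟩ => ?_
  rw [wp_seq]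
  refine (wp_pass (A := 33) (f := pathList L) h4 (by norm_num) rfl rfl rfl fun i hi m' hA' h3 =>
    wp_emitPaths hL hR hD (hT₂.of_agree hA' rfl) hi h3).mono fun t₃ m₃ hA₃ ⟨ht₃, hS₃⟩ => ?_
  have hT₃ := hT₂.of_agree hA₃ rfl
  have h4₃ := (hA₃.var 4 rfl).trans h4
  rw [wp_seq]
  refine (wp_pass (A := 34) (f := lowerList L) h4₃ (by norm_num) rfl rfl rfl fun i hi m' hA' h3 =>
    wp_emitLower hL hR hD (hT₃.of_agree hA' rfl) hi h3 (hS₃.of_agree hA' rfl rfl)).mono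
    fun t₄ m₄ hA₄ ⟨ht₄, hS₄⟩ => ?_
  have hT₄ := hT₃.of_agree hA₄ rfl
  have h4₄ := (hA₄.var 4 rfl).trans h4₃
  rw [wp_seq]
  refine (wp_pass (A := 36) (f := fillerList L) h4₄ (by norm_num) rfl rfl rfl fun i hi m' hA' h3 =>
    wp_emitFillers hL hR hD (hT₄.of_agree hA' rfl) hi h3
      ((hS₃.of_agree hA₄ rfl rfl).of_agree hA' rfl rfl) (hS₄.of_agree hA' rfl rfl)).mono
    fun t₅ m₅ hA₅ ⟨ht₅, hS₅⟩ => ?_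
  refine (wp_writeOutput hL hR hD (hT₄.of_agree hA₅ rfl) ((hA₅.var 4 rfl).trans h4₄)
    (hS₄.of_agree hA₅ rfl rfl) hS₅ ?_).mono fun t₆ m₆ _ ⟨ht₆, h₆⟩ => ⟨?_, h₆⟩
  · rwa [hA₅.arr 38 rfl, hA₄.arr 38 rfl, hA₃.arr 38 rfl, hA₂.arr 38 rfl, hA₁.arr 38 rfl]
  · have hG := generatorCount_pos hL h0
    have hn := length_encodeList_le hL hD
    have hN := length_cells_le (L := L)
    have hW : 1 ≤ (R + 1) ^ 2 := Nat.one_le_pow _ _ (by omega)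
    have hRW : R + 1 ≤ (R + 1) ^ 2 := Nat.le_self_pow (by norm_num) _
    generalize generatorCount L = G at *
    generalize (encodeList L).length = n at *
    generalize (cells L).length = N at *
    set W := (R + 1) ^ 2 with hW'
    clear_value W
    have hGW : G ≤ G * W := Nat.le_mul_of_pos_right _ hW
    -- The common estimate for the three passes: `N ≤ 5 G`, and the additive constants are absorbed
    -- because `G` and `W` are positive.
    have b : ∀ {t T C : ℕ}, t ≤ N * (T + 10) + 10 → T ≤ C * W → t ≤ (5 * C + 60) * (G * W) := by
      intro t T C h h'
      calc t ≤ 5 * G * ((C + 10) * W) + 10 * (G * W) := by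
            refine h.trans (Nat.add_le_add (Nat.mul_le_mul hN ?_) (by omega))
            rw [add_mul]; omega
        _ = _ := by ring
    have b₃ := b ht₃ (Nat.mul_le_mul_left _ hRW)
    have b₄ := b ht₄ le_rfl
    have b₅ := b ht₅ le_rfl
    have b₆ : t₆ ≤ (5 * recordCost D + 60) * (G * W) := by
      calc t₆ ≤ 5 * G * (recordCost D * W) + 60 * (G * W) :=
            ht₆.trans (Nat.add_le_add (Nat.mul_le_mul_right _ hN) (by omega))
        _ = _ := by ring
    have b₁ : t₁ ≤ ((6 + D) * 50 + 20) * (G * W) := by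
      calc t₁ ≤ (1 + G * (5 + D)) * 50 + 20 := by omega
        _ ≤ (G * W + G * W * (5 + D)) * 50 + 20 * (G * W) := by
          have := Nat.mul_le_mul_right (5 + D) hGW
          omega
        _ = _ := by ring
    have hc : algorithmCost D * (G * W) = ((6 + D) * 50 + 20) * (G * W) +
        (5 * pathsCost D + 60) * (G * W) + (5 * lowerCost D + 60) * (G * W) +
        (5 * fillersCost D + 60) * (G * W) + (5 * recordCost D + 60) * (G * W) + 490 * (G * W) := by
      rw [algorithmCost]; ring
    rw [hc]
    omega

theorem size_output_le_outputCost (hL : Admissible L) {R D : ℕ} (hR : ∀ i, size L i ≤ 2 ^ R)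
    (hD : ∀ i, (facets L i).length ≤ D) :
    generatorCount (output L) + boundaryCount (output L) ≤
      outputCost D * (generatorCount L * (R + 1) ^ 2) := by
  refine (size_output_le hL hD hR).trans ?_
  calc _ ≤ 5 * generatorCount L *
        (((D + 3 + D ^ 4 * 2) * (R + 1)) * ((D ^ 4 + 1) * (R + 1)) + 1 * (R + 1) ^ 2) := by
        refine Nat.mul_le_mul length_cells_le (Nat.add_le_add (Nat.mul_le_mul ?_ ?_) ?_)
        · nlinarith [Nat.zero_le (D ^ 4), Nat.zero_le (D * R)]
        · nlinarith [Nat.zero_le (D ^ 4)]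
        · rw [one_mul]
          exact Nat.one_le_pow _ _ (by omega)
    _ = _ := by rw [outputCost]; ring

/-- Rounding up costs less than 1, and for `k ≥ 2` the logarithm is at least 1, so the two
additional units amount to at most twice the logarithm. -/
theorem clog_add_one_le {k : ℕ} (hk : 2 ≤ k) : (Nat.clog 2 k + 1 : ℝ) ≤ 3 * Real.logb 2 k := by
  have h1 : (1 : ℝ) ≤ Real.logb 2 k := by
    rw [Real.le_logb_iff_rpow_le (by norm_num) (by positivity), Real.rpow_one]
    exact_mod_cast hk
  have h2 := Nat.ceil_lt_add_one (zero_le_one.trans h1)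
  have h3 : ⌈Real.logb 2 k⌉₊ = Nat.clog 2 k := by exact_mod_cast Real.natCeil_logb_natCast 2 k
  rw [h3] at h2
  linarith

end LogPath

/-! ### The main theorem -/

theorem mainTheorem3 :
    ∃ P : Program, ∀ d : ℕ, ∃ c : ℝ,
      ∀ (V : Type u) (B : SimplicialBifiltration V) (k : ℕ) (L : List CellRecord),
        2 ≤ k → B.complex.faces.Nonempty → B.DimLE d → B.IsCritical k →
        Represents L B.toBifilteredComplex →
        ∃ (F : BifilteredComplex.{u}) (O : List CellRecord) (t : ℕ),
          Computes P (encodeList L) (encodeList O) t ∧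
          Represents O F ∧
          Nonempty (LogPathStructure L F) ∧
          IsFreeResolution F B.toBifilteredComplex ∧
          (t : ℝ) ≤ c * ((generatorCount L : ℝ) * Real.logb 2 k ^ 2) ∧
          ((generatorCount O + boundaryCount O : ℕ) : ℝ) ≤
            c * ((generatorCount L : ℝ) * Real.logb 2 k ^ 2) := by
  -- The factor 9 is the square of the 3 in `clog_add_one_le`. The sum of the two cost factors
  -- serves for the running time and for the size at once.
  refine ⟨LogPath.logPathAlgorithm, fun d =>
    ⟨((LogPath.algorithmCost (d + 1) + LogPath.outputCost (d + 1) : ℕ) : ℝ) * 9, ?_⟩⟩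
  rintro V B k L hk ⟨σ, hσ⟩ hd hc ⟨e, he⟩
  have hX : LogPath.Describes L B.toBifilteredComplex e := he
  have hL := hX.admissible
  have hD := hX.length_facets_le hd
  -- The parameter `R` of all bounds is the rounded-up logarithm of `k`; the algorithm itself does
  -- not know `k`.
  have hR : ∀ i, LogPath.size L i ≤ 2 ^ Nat.clog 2 k := fun i =>
    (hX.size_le hc i).trans (Nat.le_pow_clog (by norm_num) k)
  -- A nonempty complex is needed because reading an empty list still takes a positive number of
  -- steps, while the bound would be zero.
  have h0 : 0 < L.length := (Nat.zero_le _).trans_lt (e.symm ⟨σ, hσ⟩).2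
  obtain ⟨t, ht, hP⟩ := LogPath.computes_output hL h0 hR hD
  have bound : ∀ {s : ℕ}, s ≤ (LogPath.algorithmCost (d + 1) + LogPath.outputCost (d + 1)) *
      (generatorCount L * (Nat.clog 2 k + 1) ^ 2) →
      (s : ℝ) ≤ ((LogPath.algorithmCost (d + 1) + LogPath.outputCost (d + 1) : ℕ) : ℝ) * 9 *
        ((generatorCount L : ℝ) * Real.logb 2 k ^ 2) := by
    intro s hs
    have h1 : (s : ℝ) ≤ ((LogPath.algorithmCost (d + 1) + LogPath.outputCost (d + 1) : ℕ) : ℝ) *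
        ((generatorCount L : ℝ) * (Nat.clog 2 k + 1) ^ 2) := by exact_mod_cast hs
    refine h1.trans ?_
    rw [mul_assoc, ← mul_assoc 9, mul_comm 9, mul_assoc (generatorCount L : ℝ)]
    gcongr
    refine (pow_le_pow_left₀ (by positivity) (LogPath.clog_add_one_le hk) 2).trans_eq ?_
    ring
  refine ⟨LogPath.complex LogPath.nodup_cells (fun _ => LogPath.mem_cells) hL, LogPath.output L, t, hP,
    LogPath.represents_output hL, ⟨LogPath.logPathStructure _ _ _⟩,
    LogPath.isFreeResolution_complex hX _ _ _, bound (ht.trans ?_),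
    bound ((LogPath.size_output_le_outputCost hL hR hD).trans ?_)⟩
  · exact Nat.mul_le_mul_right _ (Nat.le_add_right _ _)
  · exact Nat.mul_le_mul_right _ (Nat.le_add_left _ _)
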